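/- Let $\mathbb D\subset\mathbb C$ be the open unit disk, $\mathbb D_\rho$ the open disk of radius $\rho$ about $0$, $r=|z|$, $\partial_z=\frac12(\partial_x-i\partial_y)$, and for $\varepsilon>0$ let $\chi=\sqrt{\varepsilon^2+r^2}$. Let $a\in\mathbb R$, $2\le p\le\infty$ and $\varepsilon_0>0$ (with the convention $2/\infty=0$). There are constants $C_\upsilon$ ($\upsilon>0$) and $C_{p',\rho}$ ($0<p'<p$, $0<\rho<1$), depending otherwise only on $a,p,\varepsilon_0$, such that the following holds for every $\varepsilon\in(0,\varepsilon_0]$. Let $f^\varepsilon\in L^p(\mathbb D)$ and let $u^\varepsilon$ be a complex-valued function in $C^2(\mathbb D\setminus\{0\})$, of class $C^1$ up to the boundary on $\overline{\mathbb D}\setminus\{0\}$, which is locally integrable in $\mathbb D$ and solves $$\Delta u^\varepsilon=\chi^a f^\varepsilon\quad\text{in }\mathbb D$$ in the sense of distributions (on all of $\mathbb D$, including the origin). Put $$N^\varepsilon=\|f^\varepsilon\|_{L^p(\mathbb D)}+\|u^\varepsilon\|_{C^1(\partial\mathbb D)},\qquad \|u\|_{C^1(\partial\mathbb D)}=\sup_{\partial\mathbb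 D}|u|+\sup_{\partial\mathbb D}|\nabla u|,$$ where $\nabla u$ is the full gradient. Then there are a complex polynomial $P^\varepsilon$ of degree at most $\lceil a\rceil$ (with $P^\varepsilon=0$ if $\lceil a\rceil<0$) and functions $T^\varepsilon,Q^\varepsilon$ such that on $\mathbb D\setminus\{0\}$ $$u^\varepsilon_z=P^\varepsilon+\chi^aT^\varepsilon,\qquad u^\varepsilon_{zz}=P^\varepsilon_z+\chi^aQ^\varepsilon,\qquad Q^\varepsilon=\frac{(\chi^aT^\varepsilon)_z}{\chi^a},$$ and, with the same $P^\varepsilon,T^\varepsilon,Q^\varepsilon$ for all $\upsilon,p',\rho$: 1. if $p>2$, then for every $\upsilon>0$ $$\left\|\frac{T^\varepsilon}{\chi^{1-\frac2p-\upsilon}}\right\|_{L^\infty(\mathbb D)}\le C_\upsilon N^\varepsilon;$$ 2. for every $0<p'<p$ and every $0<\rho<1$, $Q^\varepsilon\in L^{p'}(\mathbb D_\rho)$ and $$\|Q^\varepsilon\|_{L^{p'}(\mathbb D_\rho)}\le C_{p',\rho}N^\varepsilon.$$ -/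

import Mathlib

open MeasureTheory Set
open scoped ENNReal ContDiff

noncomputable section

/-- The weight `χ = √(ε² + r²)`, where `r = |z|`. -/
def chi (ε : ℝ) (z : ℂ) : ℝ := Real.sqrt (ε ^ 2 + ‖z‖ ^ 2)

/-- The Wirtinger derivative `u_z = (∂ₓ u - i ∂_y u) / 2` of a complex-valued function. -/
def dz (u : ℂ → ℂ) (z : ℂ) : ℂ :=
  (fderiv ℝ u z 1 - Complex.I * fderiv ℝ u z Complex.I) / 2

/-- `u` is a solution of `Δ u = g` in the open unit disk in the sense of distributions. -/
def IsDistribSolution (u g : ℂ → ℂ) : Prop :=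
  LocallyIntegrableOn u (Metric.ball 0 1) ∧
  LocallyIntegrableOn g (Metric.ball 0 1) ∧
  ∀ φ : ℂ → ℂ, ContDiff ℝ ∞ φ → HasCompactSupport φ → tsupport φ ⊆ Metric.ball 0 1 →
    ∫ z in Metric.ball (0 : ℂ) 1, u z * Laplacian.laplacian φ z =
      ∫ z in Metric.ball (0 : ℂ) 1, g z * φ z

/-- The norm `‖u‖_{C¹(∂D)} = sup_{∂D} |u| + sup_{∂D} |∇u|`, with the full gradient; it is meant
for functions that are `C¹` up to the boundary of the unit disk. -/
def boundaryC1Norm (u : ℂ → ℂ) : ℝ :=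
  (⨆ z : Metric.sphere (0 : ℂ) 1, ‖u z‖) +
    ⨆ z : Metric.sphere (0 : ℂ) 1, ‖fderivWithin ℝ u (Metric.closedBall 0 1) z‖

/-- The norm of `L^p(D_R)`, where `D_R` is the open disk of radius `R` about `0`
(meaningful for functions in `L^p(D_R)`). -/
def diskLpNorm (R : ℝ) (p : ℝ≥0∞) (f : ℂ → ℂ) : ℝ :=
  (eLpNorm f p (volume.restrict (Metric.ball 0 R))).toReal

end

/-!
Write `v = u_z` and `F = χ ^ a f`. As `Δ = 4 ∂_z ∂_{z̄}`, the equation says `∂_{z̄} v = F / 4`, and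
`v` is continuous off the origin. The proof has three parts.

*The polynomial.* Testing the equation with cutoffs times `ζ ^ m / (z - ζ)` gives the
Cauchy–Pompeiu formula for `z ^ m v` across the origin (`integral_representation`). Letting the
cutoff exhaust the disk, `z ^ m v = H_m + G_m` with the Cauchy potential `G_m = (4π)⁻¹ ∫ ζ ^ m F(ζ)
/ (z - ζ)` and a holomorphic `H_m` that is bounded by the data (`exists_holomorphic_part_bounds`):
near the circle `v` is bounded by the boundary norm of `u`. Put `n = ⌈a - 2 / p⌉`. If `n ≥ 0`, take
for `P` the Taylor polynomial of degree `n` of `H_0` plus that of the part of `G_0` that comes from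
`|ζ| > ε`; the kernel `1 / (z - ζ)` turns into `(z / ζ) ^ (n + 1) / (z - ζ)` there. If `n < 0`,
take `P = 0`, and use `m = -n - 1` for `|z| ≥ ε` and `m = 0` for `|z| < ε`. In all cases, with `β =
a - n - 1`, `|v - P| ≤ C χ(z) ^ (n + 1) (∫ χ ^ β |f| / |z - ζ| + N / (1 - |z|))`
(`exists_polynomial`). Moreover `β` is such that `χ ^ β` is integrable against `L ^ p`, and, as `β
≤ 2 / p - 1`, no polynomial need be subtracted from the potential on the right-hand side, `cpot`.

*The pointwise estimate.* If `p > 2`, Hölder's inequality near `z`, and the bound `|z - ζ| ≥ c max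
(χ(z)) (χ(ζ))` far from `z`, estimate `cpot` by `χ ^ (β + 1 - 2 / p - υ)` (`exists_cpot_le`), which
is the estimate of `T = χ ^ (-a) (v - P)` (`exists_norm_sub_le`). Only the behaviour at the circle
needs the maximum principle for `H_m`.

*The second derivative.* `Q = χ ^ (-a) ∂_z(v - P)` is estimated on the rings `{s ≤ χ ≤ 2 s}`, `s =
ε 2 ^ k`. With a cutoff `ψ` to a slightly larger ring, `∂_z(ψ (v - P))` is the Beurling transform
of `ψ F / 4 + (∂_{z̄} ψ)(v - P)`. On the first term the weight is comparable with a constant, and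
the transform is bounded from `L ^ p₁` to `L ^ q` for `q < p₁`; the second vanishes near the
smaller ring, so that there its transform is bounded by the `L¹` norm of `v - P` on the larger one,
which again comes from `cpot`. The bounds carry positive powers of `s` and can be summed over the
rings (`exists_ring_estimate`, `exists_disk_estimate`).

The boundedness of the Beurling transform is proved for the regularized kernels `-(x̄ / (|x|² +
δ²))²`, uniformly in `δ`. Integration by parts gives the `L²` bound (`lintegral_bt_sq_le`); bounded
functions are mapped to functions of bounded mean oscillation, hence into every `L ^ q` of the disk
by the John–Nirenberg inequality (`integral_sq_sub_avg_pow_le`); and truncation at a power of the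
height interpolates between these two bounds with a small loss in the exponent
(`exists_lintegral_bt_rpow_le`), which the theorem allows since `p' < p`.
-/

namespace Dbar

open Topology Filter

/-! ### Wirtinger calculus -/

/-- The Wirtinger derivative `u_{z̄} = (∂ₓ u + i ∂_y u) / 2`. -/
noncomputable def dzb (u : ℂ → ℂ) (z : ℂ) : ℂ :=
  (fderiv ℝ u z 1 + Complex.I * fderiv ℝ u z Complex.I) / 2

lemma _root_.HasFDerivAt.dz_eq {u : ℂ → ℂ} {u' : ℂ →L[ℝ] ℂ} {z : ℂ} (h : HasFDerivAt u u' z) :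
    dz u z = (u' 1 - Complex.I * u' Complex.I) / 2 := by
  rw [dz, h.fderiv]

lemma _root_.HasFDerivAt.dzb_eq {u : ℂ → ℂ} {u' : ℂ →L[ℝ] ℂ} {z : ℂ} (h : HasFDerivAt u u' z) :
    dzb u z = (u' 1 + Complex.I * u' Complex.I) / 2 := by
  rw [dzb, h.fderiv]

lemma dz_congr {u w : ℂ → ℂ} {z : ℂ} (h : u =ᶠ[𝓝 z] w) : dz u z = dz w z := by
  rw [dz, dz, h.fderiv_eq]

lemma dzb_congr {u w : ℂ → ℂ} {z : ℂ} (h : u =ᶠ[𝓝 z] w) : dzb u z = dzb w z := by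
  rw [dzb, dzb, h.fderiv_eq]

lemma dz_mul {u w : ℂ → ℂ} {z : ℂ} (hu : DifferentiableAt ℝ u z) (hw : DifferentiableAt ℝ w z) :
    dz (fun x => u x * w x) z = dz u z * w z + u z * dz w z := by
  rw [(show HasFDerivAt (fun x => u x * w x) _ z from
    hu.hasFDerivAt.mul hw.hasFDerivAt).dz_eq, dz, dz]
  simp only [add_apply, smul_apply, smul_eq_mul]
  ring

lemma dzb_mul {u w : ℂ → ℂ} {z : ℂ} (hu : DifferentiableAt ℝ u z) (hw : DifferentiableAt ℝ w z) :
    dzb (fun x => u x * w x) z = dzb u z * w z + u z * dzb w z := by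
  rw [(show HasFDerivAt (fun x => u x * w x) _ z from
    hu.hasFDerivAt.mul hw.hasFDerivAt).dzb_eq, dzb, dzb]
  simp only [add_apply, smul_apply, smul_eq_mul]
  ring

lemma dz_sub {u w : ℂ → ℂ} {z : ℂ} (hu : DifferentiableAt ℝ u z) (hw : DifferentiableAt ℝ w z) :
    dz (fun x => u x - w x) z = dz u z - dz w z := by
  rw [(show HasFDerivAt (fun x => u x - w x) _ z from
    hu.hasFDerivAt.sub hw.hasFDerivAt).dz_eq, dz, dz]
  simp only [sub_apply]
  ring

lemma dzb_sub {u w : ℂ → ℂ} {z : ℂ} (hu : DifferentiableAt ℝ u z) (hw : DifferentiableAt ℝ w z) :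
    dzb (fun x => u x - w x) z = dzb u z - dzb w z := by
  rw [(show HasFDerivAt (fun x => u x - w x) _ z from
    hu.hasFDerivAt.sub hw.hasFDerivAt).dzb_eq, dzb, dzb]
  simp only [sub_apply]
  ring

lemma _root_.HasDerivAt.dz_eq {f : ℂ → ℂ} {f' z : ℂ} (h : HasDerivAt f f' z) : dz f z = f' := by
  rw [(h.hasFDerivAt.restrictScalars ℝ).dz_eq]
  simp only [ContinuousLinearMap.coe_restrictScalars', ContinuousLinearMap.toSpanSingleton_apply,
    smul_eq_mul]
  linear_combination (-f' / 2) * Complex.I_mul_I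

lemma _root_.HasDerivAt.dzb_eq {f : ℂ → ℂ} {f' z : ℂ} (h : HasDerivAt f f' z) : dzb f z = 0 := by
  rw [(h.hasFDerivAt.restrictScalars ℝ).dzb_eq]
  simp only [ContinuousLinearMap.coe_restrictScalars', ContinuousLinearMap.toSpanSingleton_apply,
    smul_eq_mul]
  linear_combination (f' / 2) * Complex.I_mul_I

lemma norm_dz_le {u : ℂ → ℂ} {z : ℂ} : ‖dz u z‖ ≤ ‖fderiv ℝ u z‖ := by
  have h1 := (fderiv ℝ u z).le_opNorm 1
  have h2 := (fderiv ℝ u z).le_opNorm Complex.I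
  rw [norm_one, mul_one] at h1
  rw [Complex.norm_I, mul_one] at h2
  rw [dz, norm_div, RCLike.norm_ofNat]
  have h3 : ‖fderiv ℝ u z 1 - Complex.I * fderiv ℝ u z Complex.I‖ ≤ _ := norm_sub_le _ _
  rw [norm_mul, Complex.norm_I, one_mul] at h3
  linarith

lemma dzb_eq_zero_of_notMem_tsupport {u : ℂ → ℂ} {z : ℂ} (h : z ∉ tsupport u) : dzb u z = 0 := by
  have : u =ᶠ[𝓝 z] fun _ => 0 := notMem_tsupport_iff_eventuallyEq.1 h
  rw [dzb_congr this]
  simp [dzb]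

lemma tsupport_dzb_subset (u : ℂ → ℂ) : tsupport (dzb u) ⊆ tsupport u := by
  refine closure_minimal (fun z hz => ?_) (isClosed_tsupport u)
  by_contra h
  exact hz (dzb_eq_zero_of_notMem_tsupport h)

lemma _root_.ContDiffOn.dz {u : ℂ → ℂ} {U : Set ℂ} {m n : WithTop ℕ∞} (hu : ContDiffOn ℝ n u U)
    (hU : IsOpen U) (hmn : m + 1 ≤ n) : ContDiffOn ℝ m (dz u) U := by
  have h := hu.fderiv_of_isOpen hU hmn
  unfold _root_.dz
  exact ((h.clm_apply contDiffOn_const).sub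
    (contDiffOn_const.mul (h.clm_apply contDiffOn_const))).div_const _

lemma _root_.ContDiffOn.dzb {u : ℂ → ℂ} {U : Set ℂ} {m n : WithTop ℕ∞} (hu : ContDiffOn ℝ n u U)
    (hU : IsOpen U) (hmn : m + 1 ≤ n) : ContDiffOn ℝ m (dzb u) U := by
  have h := hu.fderiv_of_isOpen hU hmn
  unfold Dbar.dzb
  exact ((h.clm_apply contDiffOn_const).add
    (contDiffOn_const.mul (h.clm_apply contDiffOn_const))).div_const _

lemma _root_.ContDiff.dz {u : ℂ → ℂ} {m n : WithTop ℕ∞} (hu : ContDiff ℝ n u)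
    (hmn : m + 1 ≤ n) : ContDiff ℝ m (dz u) :=
  contDiffOn_univ.1 (hu.contDiffOn.dz isOpen_univ hmn)

lemma _root_.ContDiff.dzb {u : ℂ → ℂ} {m n : WithTop ℕ∞} (hu : ContDiff ℝ n u)
    (hmn : m + 1 ≤ n) : ContDiff ℝ m (dzb u) :=
  contDiffOn_univ.1 (hu.contDiffOn.dzb isOpen_univ hmn)

lemma laplacian_eq_four_mul_dz_dzb {φ : ℂ → ℂ} (hφ : ContDiff ℝ 2 φ) (z : ℂ) :
    Laplacian.laplacian φ z = 4 * dz (dzb φ) z := by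
  have h1 : ContDiff ℝ 1 (fderiv ℝ φ) := hφ.fderiv_right (by norm_num)
  have hd : DifferentiableAt ℝ (fderiv ℝ φ) z := h1.differentiable one_ne_zero z
  have hs : IsSymmSndFDerivAt ℝ φ z := hφ.contDiffAt.isSymmSndFDerivAt (by simp)
  have key : HasFDerivAt (dzb φ) _ z :=
    ((hd.hasFDerivAt.clm_apply (hasFDerivAt_const (1 : ℂ) z)).add
    ((hd.hasFDerivAt.clm_apply (hasFDerivAt_const Complex.I z)).const_mul Complex.I)).mul_const
      (2⁻¹ : ℂ)
  rw [key.dz_eq]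
  rw [InnerProductSpace.laplacian_eq_iteratedFDeriv_complexPlane]
  simp only [iteratedFDeriv_two_apply]
  have := hs.eq 1 Complex.I
  simp [this]
  generalize (fderiv ℝ (fderiv ℝ φ) z) 1 1 = A
  generalize (fderiv ℝ (fderiv ℝ φ) z) Complex.I 1 = B
  generalize (fderiv ℝ (fderiv ℝ φ) z) Complex.I Complex.I = D
  linear_combination D * Complex.I_mul_I

/-! ### Integration by parts -/

lemma integral_mul_dz {f g : ℂ → ℂ}
    (hf'g : ∀ v, Integrable fun x => fderiv ℝ f x v * g x)
    (hfg' : ∀ v, Integrable fun x => f x * fderiv ℝ g x v)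
    (hfg : Integrable fun x => f x * g x)
    (hf : ∀ x ∈ tsupport g, DifferentiableAt ℝ f x)
    (hg : ∀ x ∈ tsupport f, DifferentiableAt ℝ g x) :
    ∫ x, f x * dz g x = - ∫ x, dz f x * g x := by
  have h1 := integral_mul_fderiv_eq_neg_fderiv_mul_of_integrable (hf'g 1) (hfg' 1) hfg hf hg
  have h2 := integral_mul_fderiv_eq_neg_fderiv_mul_of_integrable (hf'g Complex.I)
    (hfg' Complex.I) hfg hf hg
  have e1 : ∀ x, f x * dz g x = (1 / 2 : ℂ) * (f x * fderiv ℝ g x 1)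
      - (Complex.I / 2) * (f x * fderiv ℝ g x Complex.I) := fun x => by rw [dz]; ring
  have e2 : ∀ x, dz f x * g x = (1 / 2 : ℂ) * (fderiv ℝ f x 1 * g x)
      - (Complex.I / 2) * (fderiv ℝ f x Complex.I * g x) := fun x => by rw [dz]; ring
  simp only [e1, e2]
  rw [integral_sub ((hfg' 1).const_mul _) ((hfg' _).const_mul _),
    integral_sub ((hf'g 1).const_mul _) ((hf'g _).const_mul _)]
  simp only [integral_const_mul]
  rw [h1, h2]
  ring

lemma integral_mul_dzb {f g : ℂ → ℂ}
    (hf'g : ∀ v, Integrable fun x => fderiv ℝ f x v * g x)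
    (hfg' : ∀ v, Integrable fun x => f x * fderiv ℝ g x v)
    (hfg : Integrable fun x => f x * g x)
    (hf : ∀ x ∈ tsupport g, DifferentiableAt ℝ f x)
    (hg : ∀ x ∈ tsupport f, DifferentiableAt ℝ g x) :
    ∫ x, f x * dzb g x = - ∫ x, dzb f x * g x := by
  have h1 := integral_mul_fderiv_eq_neg_fderiv_mul_of_integrable (hf'g 1) (hfg' 1) hfg hf hg
  have h2 := integral_mul_fderiv_eq_neg_fderiv_mul_of_integrable (hf'g Complex.I)
    (hfg' Complex.I) hfg hf hg
  have e1 : ∀ x, f x * dzb g x = (1 / 2 : ℂ) * (f x * fderiv ℝ g x 1)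
      + (Complex.I / 2) * (f x * fderiv ℝ g x Complex.I) := fun x => by rw [dzb]; ring
  have e2 : ∀ x, dzb f x * g x = (1 / 2 : ℂ) * (fderiv ℝ f x 1 * g x)
      + (Complex.I / 2) * (fderiv ℝ f x Complex.I * g x) := fun x => by rw [dzb]; ring
  simp only [e1, e2]
  rw [integral_add ((hfg' 1).const_mul _) ((hfg' _).const_mul _),
    integral_add ((hf'g 1).const_mul _) ((hf'g _).const_mul _)]
  simp only [integral_const_mul]
  rw [h1, h2]
  ring

/-- A product `f * g` is continuous on the whole plane if `f` is only continuous near the support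
of `g`. -/
lemma continuous_mul_of_tsupport_subset {f g : ℂ → ℂ} {U : Set ℂ} (hU : IsOpen U)
    (hf : ContinuousOn f U) (hg : Continuous g) (hgU : tsupport g ⊆ U) :
    Continuous fun x => f x * g x := by
  rw [continuous_iff_continuousAt]
  intro x
  by_cases hx : x ∈ tsupport g
  · exact (hf.continuousAt (hU.mem_nhds (hgU hx))).mul hg.continuousAt
  · have h : (fun x => f x * g x) =ᶠ[𝓝 x] fun _ => 0 := by
      filter_upwards [notMem_tsupport_iff_eventuallyEq.1 hx] with y hy
      simp [hy]
    exact continuousAt_const.congr h.symm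

lemma integrable_mul_of_tsupport_subset {f g : ℂ → ℂ} {U : Set ℂ} (hU : IsOpen U)
    (hf : ContinuousOn f U) (hg : Continuous g) (hgc : HasCompactSupport g)
    (hgU : tsupport g ⊆ U) : Integrable fun x => f x * g x :=
  (continuous_mul_of_tsupport_subset hU hf hg hgU).integrable_of_hasCompactSupport hgc.mul_left

lemma contDiff_mul_of_tsupport_subset {f g : ℂ → ℂ} {U : Set ℂ} {n : WithTop ℕ∞} (hU : IsOpen U)
    (hf : ContDiffOn ℝ n f U) (hg : ContDiff ℝ n g) (hgU : tsupport g ⊆ U) :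
    ContDiff ℝ n fun x => f x * g x := by
  rw [contDiff_iff_contDiffAt]
  intro x
  by_cases hx : x ∈ tsupport g
  · exact (hf.contDiffAt (hU.mem_nhds (hgU hx))).mul hg.contDiffAt
  · have h : (fun x => f x * g x) =ᶠ[𝓝 x] fun _ => 0 := by
      filter_upwards [notMem_tsupport_iff_eventuallyEq.1 hx] with y hy
      simp [hy]
    exact contDiffAt_const.congr_of_eventuallyEq h

/-- The conditions for integrating by parts in `∫ f ∂g`, for `g` supported in a set where `f` is
`C¹`. -/
lemma integrable_parts_and_differentiableAt {f g : ℂ → ℂ} {U : Set ℂ} (hU : IsOpen U)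
    (hf : ContDiffOn ℝ 1 f U) (hg : ContDiff ℝ 1 g) (hgc : HasCompactSupport g)
    (hgU : tsupport g ⊆ U) :
    (∀ v, Integrable fun x => fderiv ℝ f x v * g x) ∧
    (∀ v, Integrable fun x => f x * fderiv ℝ g x v) ∧ (Integrable fun x => f x * g x) ∧
    (∀ x ∈ tsupport g, DifferentiableAt ℝ f x) ∧ (∀ x ∈ tsupport f, DifferentiableAt ℝ g x) := by
  refine ⟨fun v => ?_, fun v => ?_, ?_, fun x hx => ?_, fun x _ => hg.differentiable one_ne_zero x⟩
  · exact integrable_mul_of_tsupport_subset hU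
      ((hf.continuousOn_fderiv_of_isOpen hU le_rfl).clm_apply continuousOn_const)
      hg.continuous hgc hgU
  · refine integrable_mul_of_tsupport_subset hU hf.continuousOn
      ((hg.continuous_fderiv one_ne_zero).clm_apply continuous_const) (hgc.fderiv_apply ℝ v)
      ((tsupport_fderiv_apply_subset ℝ v).trans hgU)
  · exact integrable_mul_of_tsupport_subset hU hf.continuousOn hg.continuous hgc hgU
  · exact (hf.contDiffAt (hU.mem_nhds (hgU hx))).differentiableAt one_ne_zero

/-- Integration by parts against a compactly supported `C¹` function `g`; the other factor need
only be `C¹` near the support of `g`. -/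
lemma integral_mul_dz_of_tsupport_subset {f g : ℂ → ℂ} {U : Set ℂ} (hU : IsOpen U)
    (hf : ContDiffOn ℝ 1 f U) (hg : ContDiff ℝ 1 g) (hgc : HasCompactSupport g)
    (hgU : tsupport g ⊆ U) : ∫ x, f x * dz g x = - ∫ x, dz f x * g x := by
  obtain ⟨h1, h2, h3, h4, h5⟩ := integrable_parts_and_differentiableAt hU hf hg hgc hgU
  exact integral_mul_dz h1 h2 h3 h4 h5

lemma integral_mul_dzb_of_tsupport_subset {f g : ℂ → ℂ} {U : Set ℂ} (hU : IsOpen U)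
    (hf : ContDiffOn ℝ 1 f U) (hg : ContDiff ℝ 1 g) (hgc : HasCompactSupport g)
    (hgU : tsupport g ⊆ U) : ∫ x, f x * dzb g x = - ∫ x, dzb f x * g x := by
  obtain ⟨h1, h2, h3, h4, h5⟩ := integrable_parts_and_differentiableAt hU hf hg hgc hgU
  exact integral_mul_dzb h1 h2 h3 h4 h5

/-! ### Radial integrals in the plane -/

lemma integral_radial (f : ℝ → ℝ) :
    ∫ x : ℂ, f ‖x‖ = 2 * Real.pi * ∫ y in Ioi (0 : ℝ), y * f y := by
  rw [integral_fun_norm_addHaar volume f]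
  simp [measureReal_def, Complex.finrank_real_complex]
  ring

lemma integrable_radial {f : ℝ → ℝ} (h : IntegrableOn (fun y => y * f y) (Ioi 0)) :
    Integrable fun x : ℂ => f ‖x‖ := by
  rw [integrable_fun_norm_addHaar volume]
  simpa [Complex.finrank_real_complex] using h

lemma lintegral_radial {f : ℝ → ℝ} (h : IntegrableOn (fun y => y * f y) (Ioi 0))
    (hf : ∀ y, 0 ≤ y → 0 ≤ f y) :
    ∫⁻ x : ℂ, ENNReal.ofReal (f ‖x‖) =
      ENNReal.ofReal (2 * Real.pi * ∫ y in Ioi (0 : ℝ), y * f y) := by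
  rw [← ofReal_integral_eq_lintegral_ofReal (integrable_radial h)
    (ae_of_all _ fun x => hf _ (norm_nonneg x)), integral_radial]

lemma mul_indicator_rpow_eq {s : ℝ} {t : Set ℝ} : EqOn (fun y => y * t.indicator (fun y => y ^ s) y)
    (t.indicator fun y => y ^ (s + 1)) (Ioi 0) := by
  intro y hy
  by_cases h : y ∈ t
  · simp only [indicator_of_mem h]
    rw [Real.rpow_add_one (ne_of_gt hy), mul_comm]
  · simp [indicator_of_notMem h]

lemma lintegral_ball_rpow {s R : ℝ} (hs : -2 < s) (hR : 0 ≤ R) :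
    ∫⁻ x in Metric.ball (0 : ℂ) R, ENNReal.ofReal (‖x‖ ^ s) =
      ENNReal.ofReal (2 * Real.pi * (R ^ (s + 2) / (s + 2))) := by
  have hi : IntegrableOn (fun y : ℝ => y ^ (s + 1)) (Ioi 0 ∩ Iio R) := by
    rw [Ioi_inter_Iio, ← integrableOn_Ioc_iff_integrableOn_Ioo,
      ← intervalIntegrable_iff_integrableOn_Ioc_of_le hR]
    exact intervalIntegral.intervalIntegrable_rpow' (by linarith)
  have h1 : IntegrableOn (fun y => y * (Iio R).indicator (fun y => y ^ s) y) (Ioi 0) := by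
    rw [integrableOn_congr_fun mul_indicator_rpow_eq measurableSet_Ioi, IntegrableOn,
      integrable_indicator_iff measurableSet_Iio, IntegrableOn, Measure.restrict_restrict
      measurableSet_Iio, inter_comm]
    exact hi
  have h2 := lintegral_radial h1 (fun y hy => indicator_apply_nonneg fun _ => Real.rpow_nonneg hy _)
  rw [setIntegral_congr_fun measurableSet_Ioi mul_indicator_rpow_eq,
    setIntegral_indicator measurableSet_Iio, Ioi_inter_Iio, ← integral_Ioc_eq_integral_Ioo,
    ← intervalIntegral.integral_of_le hR, integral_rpow (Or.inl (by linarith)),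
    Real.zero_rpow (by linarith), show s + 1 + 1 = s + 2 by ring, sub_zero] at h2
  rw [← h2, ← lintegral_indicator Metric.isOpen_ball.measurableSet]
  congr 1
  ext x
  by_cases h : ‖x‖ < R
  · rw [indicator_of_mem (by simpa using h), indicator_of_mem (by simpa using h)]
  · rw [indicator_of_notMem (by simpa using h), indicator_of_notMem (by simpa using h),
      ENNReal.ofReal_zero]

lemma lintegral_compl_ball_rpow {s R : ℝ} (hs : s < -2) (hR : 0 < R) :
    ∫⁻ x in (Metric.closedBall (0 : ℂ) R)ᶜ, ENNReal.ofReal (‖x‖ ^ s) =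
      ENNReal.ofReal (2 * Real.pi * (-R ^ (s + 2) / (s + 2))) := by
  have hi : IntegrableOn (fun y : ℝ => y ^ (s + 1)) (Ioi 0 ∩ Ioi R) := by
    rw [Ioi_inter_Ioi, max_eq_right hR.le]
    exact integrableOn_Ioi_rpow_of_lt (by linarith) hR
  have h1 : IntegrableOn (fun y => y * (Ioi R).indicator (fun y => y ^ s) y) (Ioi 0) := by
    rw [integrableOn_congr_fun mul_indicator_rpow_eq measurableSet_Ioi, IntegrableOn,
      integrable_indicator_iff measurableSet_Ioi, IntegrableOn, Measure.restrict_restrict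
      measurableSet_Ioi, inter_comm]
    exact hi
  have h2 := lintegral_radial h1 (fun y hy => indicator_apply_nonneg fun _ => Real.rpow_nonneg hy _)
  rw [setIntegral_congr_fun measurableSet_Ioi mul_indicator_rpow_eq,
    setIntegral_indicator measurableSet_Ioi, Ioi_inter_Ioi, max_eq_right hR.le,
    integral_Ioi_rpow_of_lt (by linarith) hR, show s + 1 + 1 = s + 2 by ring] at h2
  rw [← h2, ← lintegral_indicator Metric.isClosed_closedBall.measurableSet.compl]
  congr 1
  ext x
  by_cases h : R < ‖x‖
  · rw [indicator_of_mem (by simpa using h), indicator_of_mem (by simpa using h)]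
  · rw [indicator_of_notMem (by simpa using h), indicator_of_notMem (by simpa using h),
      ENNReal.ofReal_zero]

lemma lintegral_ball_inv_norm {R : ℝ} (hR : 0 ≤ R) (z : ℂ) :
    ∫⁻ x in Metric.ball z R, ENNReal.ofReal (‖x - z‖⁻¹) = ENNReal.ofReal (2 * Real.pi * R) := by
  have h := lintegral_ball_rpow (s := -1) (by norm_num) hR
  norm_num [Real.rpow_neg_one] at h
  rw [← h, ← lintegral_indicator Metric.isOpen_ball.measurableSet,
    ← lintegral_indicator Metric.isOpen_ball.measurableSet,
    ← lintegral_sub_right_eq_self ((Metric.ball (0 : ℂ) R).indicator _) z]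
  congr 1
  ext x
  simp [indicator, dist_eq_norm]

/-! ### Regularized Cauchy kernels -/

/-- The regularized Cauchy kernel `x̄ / (|x|² + δ²)`, which tends to `1 / x` as `δ → 0`. -/
noncomputable def ck (δ : ℝ) (x : ℂ) : ℂ := starRingEnd ℂ x * (x * starRingEnd ℂ x + δ ^ 2)⁻¹

/-- The derivative `∂_{z̄}` of the regularized Cauchy kernel, namely `δ² / (|x|² + δ²)²`. It is `π`
times an approximate identity. -/
noncomputable def pk (δ : ℝ) (x : ℂ) : ℂ := δ ^ 2 * (x * starRingEnd ℂ x + δ ^ 2)⁻¹ ^ 2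

/-- The derivative `∂_z` of the regularized Cauchy kernel: a regularization of the
Beurling kernel `-1 / x²`. -/
noncomputable def bk (δ : ℝ) (x : ℂ) : ℂ := -(ck δ x) ^ 2

lemma mul_conj_add_eq (δ : ℝ) (x : ℂ) :
    x * starRingEnd ℂ x + (δ : ℂ) ^ 2 = ((‖x‖ ^ 2 + δ ^ 2 : ℝ) : ℂ) := by
  rw [Complex.mul_conj, Complex.normSq_eq_norm_sq]; push_cast; rfl

lemma pk_eq (δ : ℝ) (x : ℂ) : pk δ x = ((δ ^ 2 * (‖x‖ ^ 2 + δ ^ 2)⁻¹ ^ 2 : ℝ) : ℂ) := by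
  rw [pk, mul_conj_add_eq]; push_cast; rfl

lemma norm_mul_conj_add (δ : ℝ) (x : ℂ) :
    ‖x * starRingEnd ℂ x + (δ : ℂ) ^ 2‖ = ‖x‖ ^ 2 + δ ^ 2 := by
  rw [mul_conj_add_eq, Complex.norm_real, Real.norm_of_nonneg (by positivity)]

section

variable {δ : ℝ}

lemma mul_conj_add_ne (hδ : 0 < δ) (x : ℂ) : x * starRingEnd ℂ x + (δ : ℂ) ^ 2 ≠ 0 := by
  rw [mul_conj_add_eq]
  exact_mod_cast (by positivity : ‖x‖ ^ 2 + δ ^ 2 ≠ 0)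

lemma contDiff_conj {n : WithTop ℕ∞} : ContDiff ℝ n (starRingEnd ℂ : ℂ → ℂ) :=
  Complex.conjCLE.contDiff

lemma contDiff_ck (hδ : 0 < δ) {n : WithTop ℕ∞} : ContDiff ℝ n (ck δ) := by
  unfold ck
  exact contDiff_conj.mul (((contDiff_id.mul contDiff_conj).add contDiff_const).inv
    (mul_conj_add_ne hδ))

lemma contDiff_pk (hδ : 0 < δ) {n : WithTop ℕ∞} : ContDiff ℝ n (pk δ) := by
  unfold pk
  exact contDiff_const.mul ((((contDiff_id.mul contDiff_conj).add contDiff_const).inv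
    (mul_conj_add_ne hδ)).pow 2)

lemma contDiff_bk (hδ : 0 < δ) {n : WithTop ℕ∞} : ContDiff ℝ n (bk δ) := by
  unfold bk
  exact ((contDiff_ck hδ).pow 2).neg

lemma dz_comp {f : ℂ → ℂ} {f' : ℂ} {u : ℂ → ℂ} {z : ℂ} (hf : HasDerivAt f f' (u z))
    (hu : DifferentiableAt ℝ u z) : dz (fun x => f (u x)) z = f' * dz u z := by
  rw [(show HasFDerivAt (fun x => f (u x)) _ z from
    (hf.hasFDerivAt.restrictScalars ℝ).comp z hu.hasFDerivAt).dz_eq, dz]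
  simp
  ring

lemma dzb_comp {f : ℂ → ℂ} {f' : ℂ} {u : ℂ → ℂ} {z : ℂ} (hf : HasDerivAt f f' (u z))
    (hu : DifferentiableAt ℝ u z) : dzb (fun x => f (u x)) z = f' * dzb u z := by
  rw [(show HasFDerivAt (fun x => f (u x)) _ z from
    (hf.hasFDerivAt.restrictScalars ℝ).comp z hu.hasFDerivAt).dzb_eq, dzb]
  simp
  ring

lemma dz_conj (z : ℂ) : dz (starRingEnd ℂ) z = 0 := by
  rw [(show HasFDerivAt (starRingEnd ℂ) _ z from Complex.conjCLE.hasFDerivAt).dz_eq]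
  simp

lemma dzb_conj (z : ℂ) : dzb (starRingEnd ℂ) z = 1 := by
  rw [(show HasFDerivAt (starRingEnd ℂ) _ z from Complex.conjCLE.hasFDerivAt).dzb_eq]
  simp

lemma differentiableAt_conj (z : ℂ) : DifferentiableAt ℝ (starRingEnd ℂ) z :=
  Complex.conjCLE.differentiableAt

lemma dz_mul_conj_add (z c : ℂ) : dz (fun x => x * starRingEnd ℂ x + c) z = starRingEnd ℂ z := by
  have h := dz_comp (f := fun y => y + c) (u := fun x => x * starRingEnd ℂ x) (z := z)
    ((hasDerivAt_id _).add_const c) (differentiableAt_id.mul (differentiableAt_conj z))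
  rw [h, dz_mul differentiableAt_fun_id (differentiableAt_conj z), (hasDerivAt_id' z).dz_eq,
    dz_conj]
  ring

lemma dzb_mul_conj_add (z c : ℂ) : dzb (fun x => x * starRingEnd ℂ x + c) z = z := by
  have h := dzb_comp (f := fun y => y + c) (u := fun x => x * starRingEnd ℂ x) (z := z)
    ((hasDerivAt_id _).add_const c) (differentiableAt_id.mul (differentiableAt_conj z))
  rw [h, dzb_mul differentiableAt_fun_id (differentiableAt_conj z), (hasDerivAt_id' z).dzb_eq,
    dzb_conj]
  ring

lemma differentiableAt_mul_conj_add (z c : ℂ) :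
    DifferentiableAt ℝ (fun x => x * starRingEnd ℂ x + c) z :=
  (differentiableAt_fun_id.mul (differentiableAt_conj z)).add_const c

lemma differentiableAt_inv_mul_conj_add (hδ : 0 < δ) (z : ℂ) :
    DifferentiableAt ℝ (fun x => (x * starRingEnd ℂ x + (δ : ℂ) ^ 2)⁻¹) z :=
  (differentiableAt_mul_conj_add z _).inv (mul_conj_add_ne hδ z)

lemma dz_ck (hδ : 0 < δ) (z : ℂ) : dz (ck δ) z = bk δ z := by
  unfold bk ck
  rw [dz_mul (differentiableAt_conj z) (differentiableAt_inv_mul_conj_add hδ z), dz_conj,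
    dz_comp (u := fun x => x * starRingEnd ℂ x + (δ : ℂ) ^ 2)
      (hasDerivAt_inv (mul_conj_add_ne hδ z)) (differentiableAt_mul_conj_add z _),
    dz_mul_conj_add, ← inv_pow]
  ring

lemma dzb_ck (hδ : 0 < δ) (z : ℂ) : dzb (ck δ) z = pk δ z := by
  have := mul_conj_add_ne hδ z
  unfold pk ck
  rw [dzb_mul (differentiableAt_conj z) (differentiableAt_inv_mul_conj_add hδ z), dzb_conj,
    dzb_comp (u := fun x => x * starRingEnd ℂ x + (δ : ℂ) ^ 2)
      (hasDerivAt_inv (mul_conj_add_ne hδ z)) (differentiableAt_mul_conj_add z _),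
    dzb_mul_conj_add]
  field_simp
  ring

lemma dzb_bk (hδ : 0 < δ) (z : ℂ) : dzb (bk δ) z = -2 * ck δ z * pk δ z := by
  unfold bk
  rw [dzb_comp (f := fun y => -y ^ 2) (hasDerivAt_pow 2 _).neg
    ((contDiff_ck hδ (n := 1)).differentiable one_ne_zero z), dzb_ck hδ]
  norm_num

lemma dz_pk (hδ : 0 < δ) (z : ℂ) : dz (pk δ) z = -2 * ck δ z * pk δ z := by
  unfold pk ck
  rw [dz_comp (f := fun y => (δ : ℂ) ^ 2 * y ^ 2) ((hasDerivAt_pow 2 _).const_mul _)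
    (differentiableAt_inv_mul_conj_add hδ z),
    dz_comp (u := fun x => x * starRingEnd ℂ x + (δ : ℂ) ^ 2)
      (hasDerivAt_inv (mul_conj_add_ne hδ z)) (differentiableAt_mul_conj_add z _),
    dz_mul_conj_add, ← inv_pow]
  push_cast
  ring

lemma dz_sub_left {g : ℂ → ℂ} (z ζ : ℂ) (hg : DifferentiableAt ℝ g (z - ζ)) :
    dz (fun w => g (z - w)) ζ = -dz g (z - ζ) := by
  rw [(show HasFDerivAt (fun w => g (z - w)) _ ζ from
    hg.hasFDerivAt.comp ζ ((hasFDerivAt_id ζ).const_sub z)).dz_eq, dz]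
  simp
  ring

lemma dzb_sub_left {g : ℂ → ℂ} (z ζ : ℂ) (hg : DifferentiableAt ℝ g (z - ζ)) :
    dzb (fun w => g (z - w)) ζ = -dzb g (z - ζ) := by
  rw [(show HasFDerivAt (fun w => g (z - w)) _ ζ from
    hg.hasFDerivAt.comp ζ ((hasFDerivAt_id ζ).const_sub z)).dzb_eq, dzb]
  simp
  ring

lemma norm_ck (δ : ℝ) (x : ℂ) : ‖ck δ x‖ = ‖x‖ * (‖x‖ ^ 2 + δ ^ 2)⁻¹ := by
  rw [ck, norm_mul, norm_inv, norm_mul_conj_add, Complex.norm_conj]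

lemma norm_ck_le_inv (δ : ℝ) (x : ℂ) : ‖ck δ x‖ ≤ ‖x‖⁻¹ := by
  rw [norm_ck]
  rcases eq_or_ne x 0 with rfl | hx
  · simp
  have := norm_pos_iff.2 hx
  rw [← div_eq_mul_inv, div_le_iff₀ (by positivity)]
  field_simp
  nlinarith [sq_nonneg δ]

lemma norm_ck_le (hδ : 0 < δ) (x : ℂ) : ‖ck δ x‖ ≤ δ⁻¹ := by
  rw [norm_ck, ← div_eq_mul_inv, div_le_iff₀ (by positivity)]
  field_simp
  nlinarith [sq_nonneg (‖x‖ - δ), norm_nonneg x]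

lemma norm_pk (δ : ℝ) (x : ℂ) : ‖pk δ x‖ = δ ^ 2 * (‖x‖ ^ 2 + δ ^ 2)⁻¹ ^ 2 := by
  rw [pk_eq, Complex.norm_real, Real.norm_of_nonneg (by positivity)]

lemma norm_bk (δ : ℝ) (x : ℂ) : ‖bk δ x‖ = ‖ck δ x‖ ^ 2 := by
  rw [bk, norm_neg, norm_pow]

lemma ck_sub_ck (hδ : 0 < δ) (x y : ℂ) : ck δ x - ck δ y =
    (starRingEnd ℂ x * starRingEnd ℂ y * (y - x) + δ ^ 2 * starRingEnd ℂ (x - y)) *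
      ((x * starRingEnd ℂ x + δ ^ 2)⁻¹ * (y * starRingEnd ℂ y + δ ^ 2)⁻¹) := by
  have h1 := mul_inv_cancel₀ (mul_conj_add_ne hδ x)
  have h2 := mul_inv_cancel₀ (mul_conj_add_ne hδ y)
  rw [ck, ck, map_sub]
  linear_combination (-(starRingEnd ℂ x * (x * starRingEnd ℂ x + (δ : ℂ) ^ 2)⁻¹)) * h2 +
    (starRingEnd ℂ y * (y * starRingEnd ℂ y + (δ : ℂ) ^ 2)⁻¹) * h1

lemma norm_ck_sub_ck_le (hδ : 0 < δ) (x y : ℂ) : ‖ck δ x - ck δ y‖ ≤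
    ‖x - y‖ * ((‖x‖ * ‖y‖ + δ ^ 2) * ((‖x‖ ^ 2 + δ ^ 2)⁻¹ * (‖y‖ ^ 2 + δ ^ 2)⁻¹)) := by
  rw [ck_sub_ck hδ, norm_mul, norm_mul, norm_inv, norm_inv, norm_mul_conj_add, norm_mul_conj_add,
    ← mul_assoc ‖x - y‖]
  gcongr
  refine (norm_add_le (starRingEnd ℂ x * starRingEnd ℂ y * (y - x))
    ((δ : ℂ) ^ 2 * starRingEnd ℂ (x - y))).trans (le_of_eq ?_)
  rw [norm_mul, norm_mul, norm_mul, Complex.norm_conj, Complex.norm_conj, Complex.norm_conj,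
    norm_sub_rev y x, norm_pow, Complex.norm_real, Real.norm_of_nonneg hδ.le]
  ring

lemma norm_ck_sub_ck_le_div (hδ : 0 < δ) {x y : ℂ} (hx : x ≠ 0) (hy : y ≠ 0) :
    ‖ck δ x - ck δ y‖ ≤ ‖x - y‖ * (‖x‖⁻¹ * ‖y‖⁻¹) := by
  refine (norm_ck_sub_ck_le hδ x y).trans ?_
  have hx' := norm_pos_iff.2 hx
  have hy' := norm_pos_iff.2 hy
  refine mul_le_mul_of_nonneg_left ?_ (norm_nonneg _)
  rw [← mul_inv, ← mul_inv, ← div_eq_mul_inv, div_le_iff₀ (by positivity)]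
  field_simp
  nlinarith [sq_nonneg (‖x‖ - ‖y‖), sq_nonneg δ, mul_pos hx' hy',
    mul_nonneg (sq_nonneg δ) (sq_nonneg (‖x‖ - ‖y‖)), mul_nonneg (sq_nonneg δ) (mul_pos hx' hy').le,
    sq_nonneg (δ ^ 2)]

lemma norm_ck_sub_ck_le_const (hδ : 0 < δ) (x y : ℂ) :
    ‖ck δ x - ck δ y‖ ≤ ‖x - y‖ * (δ ^ 2)⁻¹ := by
  refine (norm_ck_sub_ck_le hδ x y).trans ?_
  gcongr
  rw [← mul_inv, ← div_eq_mul_inv, div_le_iff₀ (by positivity)]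
  field_simp
  nlinarith [sq_nonneg (‖x‖ - ‖y‖), sq_nonneg δ, mul_nonneg (sq_nonneg δ) (sq_nonneg (‖x‖ - ‖y‖)),
    mul_nonneg (norm_nonneg x) (norm_nonneg y), sq_nonneg (‖x‖ * ‖y‖),
    mul_nonneg (sq_nonneg δ) (mul_nonneg (norm_nonneg x) (norm_nonneg y))]

lemma bk_sub_bk (δ : ℝ) (x y : ℂ) :
    bk δ x - bk δ y = -((ck δ x - ck δ y) * (ck δ x + ck δ y)) := by
  rw [bk, bk]; ring

lemma norm_bk_sub_bk_le_div (hδ : 0 < δ) {x y : ℂ} (hx : x ≠ 0) (hy : y ≠ 0) :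
    ‖bk δ x - bk δ y‖ ≤ ‖x - y‖ * (‖x‖⁻¹ * ‖y‖⁻¹) * (‖x‖⁻¹ + ‖y‖⁻¹) := by
  rw [bk_sub_bk, norm_neg, norm_mul]
  gcongr
  · exact norm_ck_sub_ck_le_div hδ hx hy
  · exact (norm_add_le _ _).trans (add_le_add (norm_ck_le_inv _ _) (norm_ck_le_inv _ _))

lemma norm_bk_sub_bk_le_const (hδ : 0 < δ) (x y : ℂ) :
    ‖bk δ x - bk δ y‖ ≤ ‖x - y‖ * (δ ^ 2)⁻¹ * (2 * δ⁻¹) := by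
  rw [bk_sub_bk, norm_neg, norm_mul]
  gcongr
  · exact norm_ck_sub_ck_le_const hδ x y
  · refine (norm_add_le _ _).trans ?_
    linarith [norm_ck_le hδ x, norm_ck_le hδ y]

lemma norm_bk_le (hδ : 0 < δ) (x : ℂ) : ‖bk δ x‖ ≤ δ⁻¹ ^ 2 := by
  rw [norm_bk]
  gcongr
  exact norm_ck_le hδ x

lemma norm_bk_le_inv (δ : ℝ) (x : ℂ) : ‖bk δ x‖ ≤ ‖x‖⁻¹ ^ 2 := by
  rw [norm_bk]
  gcongr
  exact norm_ck_le_inv δ x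

lemma tendsto_ck {x : ℂ} (hx : x ≠ 0) : Tendsto (fun δ : ℝ => ck δ x) (𝓝[>] 0) (𝓝 x⁻¹) := by
  have h : ContinuousAt (fun δ : ℝ => ck δ x) 0 := by
    unfold ck
    refine continuousAt_const.mul (ContinuousAt.inv₀ (by fun_prop) ?_)
    simpa using hx
  have h2 : ck 0 x = x⁻¹ := by
    have : starRingEnd ℂ x ≠ 0 := by simpa using hx
    rw [ck]
    simp
    field_simp
  rw [← h2]
  exact h.mono_left nhdsWithin_le_nhds

lemma hasDerivAt_pk_antideriv {c : ℝ} (hc : 0 < c) (y : ℝ) :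
    HasDerivAt (fun y : ℝ => -(c ^ 2 / 2) * (y ^ 2 + c ^ 2)⁻¹)
      (y * (c ^ 2 * (y ^ 2 + c ^ 2)⁻¹ ^ 2)) y := by
  have h0 : y ^ 2 + c ^ 2 ≠ 0 := by positivity
  have h := (((hasDerivAt_pow 2 y).add_const (c ^ 2)).inv h0).const_mul (-(c ^ 2 / 2))
  refine h.congr_deriv ?_
  push_cast
  field_simp

lemma tendsto_pk_antideriv (c : ℝ) :
    Tendsto (fun y : ℝ => -(c ^ 2 / 2) * (y ^ 2 + c ^ 2)⁻¹) atTop (𝓝 0) := by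
  have : Tendsto (fun y : ℝ => y ^ 2 + c ^ 2) atTop atTop :=
    tendsto_atTop_add_const_right _ _ (tendsto_pow_atTop two_ne_zero)
  simpa using this.inv_tendsto_atTop.const_mul (-(c ^ 2 / 2))

lemma integrable_norm_pk (hδ : 0 < δ) :
    Integrable fun x : ℂ => δ ^ 2 * (‖x‖ ^ 2 + δ ^ 2)⁻¹ ^ 2 := by
  refine integrable_radial (f := fun y => δ ^ 2 * (y ^ 2 + δ ^ 2)⁻¹ ^ 2) ?_
  exact integrableOn_Ioi_deriv_of_nonneg (hasDerivAt_pk_antideriv hδ 0).continuousAt.continuousWithinAt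
    (fun y _ => hasDerivAt_pk_antideriv hδ y) (fun y (hy : 0 < y) => by positivity)
    (tendsto_pk_antideriv δ)

lemma integral_norm_pk (hδ : 0 < δ) :
    ∫ x : ℂ, δ ^ 2 * (‖x‖ ^ 2 + δ ^ 2)⁻¹ ^ 2 = Real.pi := by
  rw [integral_radial (fun y => δ ^ 2 * (y ^ 2 + δ ^ 2)⁻¹ ^ 2),
    integral_Ioi_of_hasDerivAt_of_nonneg (hasDerivAt_pk_antideriv hδ 0).continuousAt.continuousWithinAt
    (fun y _ => hasDerivAt_pk_antideriv hδ y) (fun y (hy : 0 < y) => by positivity)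
    (tendsto_pk_antideriv δ)]
  field_simp
  norm_num

/-- `π⁻¹ pk δ` is an approximate identity as `δ → 0`. -/
lemma tendsto_integral_mul_pk {g : ℂ → ℂ} {z : ℂ} (hg : Integrable g) (hgz : ContinuousAt g z) :
    Tendsto (fun δ : ℝ => ∫ ζ, g ζ * pk δ (z - ζ)) (𝓝[>] 0) (𝓝 (Real.pi * g z)) := by
  have hpi := Real.pi_pos
  have h := tendsto_integral_comp_smul_smul_of_integrable' (μ := (volume : Measure ℂ))
    (φ := fun x : ℂ => Real.pi⁻¹ * (1 ^ 2 * (‖x‖ ^ 2 + 1 ^ 2)⁻¹ ^ 2)) (fun x => by positivity)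
    (by rw [integral_const_mul, integral_norm_pk one_pos]; field_simp) ?_ hg hgz
  · have h2 := (h.comp tendsto_inv_nhdsGT_zero).const_mul (Real.pi : ℂ)
    refine h2.congr' ?_
    filter_upwards [self_mem_nhdsWithin] with δ (hδ : 0 < δ)
    simp only [Function.comp]
    rw [← integral_const_mul]
    congr 1
    ext ζ
    rw [pk_eq, Complex.finrank_real_complex, norm_smul, Real.norm_of_nonneg (by positivity),
      Complex.real_smul]
    have : (δ⁻¹ ^ 2 * (Real.pi⁻¹ * (1 ^ 2 * ((δ⁻¹ * ‖z - ζ‖) ^ 2 + 1 ^ 2)⁻¹ ^ 2)) : ℝ) =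
        Real.pi⁻¹ * (δ ^ 2 * (‖z - ζ‖ ^ 2 + δ ^ 2)⁻¹ ^ 2) := by
      field_simp
    rw [this]
    push_cast
    have : (Real.pi : ℂ) ≠ 0 := by exact_mod_cast hpi.ne'
    field_simp
  · have h1 : Tendsto (fun x : ℂ => Real.pi⁻¹ * ‖x‖⁻¹ ^ 2) (Bornology.cobounded ℂ) (𝓝 0) := by
      simpa using ((tendsto_norm_cobounded_atTop (E := ℂ)).inv_tendsto_atTop.pow 2).const_mul
        Real.pi⁻¹
    refine squeeze_zero' (Eventually.of_forall fun x => by positivity) ?_ h1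
    filter_upwards [(tendsto_norm_cobounded_atTop (E := ℂ)).eventually_gt_atTop 0] with x hx
    rw [Complex.finrank_real_complex]
    field_simp
    nlinarith [sq_nonneg (‖x‖ ^ 2)]

lemma integrable_inv_mul {g : ℂ → ℂ} (hg : Continuous g) (hgc : HasCompactSupport g) (z : ℂ) :
    Integrable fun ζ => g ζ * (z - ζ)⁻¹ := by
  obtain ⟨R, hR0, hR⟩ : ∃ R, 0 ≤ R ∧ tsupport g ⊆ Metric.ball z R := by
    obtain ⟨R, hR⟩ := hgc.isCompact.isBounded.subset_ball z
    exact ⟨max R 0, le_max_right _ _, hR.trans (Metric.ball_subset_ball (le_max_left _ _))⟩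
  obtain ⟨M, hM⟩ := hgc.exists_bound_of_continuous hg
  have h1 : IntegrableOn (fun ζ => g ζ * (z - ζ)⁻¹) (Metric.ball z R) := by
    refine ⟨(hg.measurable.mul (measurable_const.sub measurable_id).inv).aestronglyMeasurable, ?_⟩
    rw [hasFiniteIntegral_iff_enorm]
    refine (lintegral_mono (g := fun ζ => ENNReal.ofReal M * ENNReal.ofReal (‖ζ - z‖⁻¹))
      fun ζ => ?_).trans_lt ?_
    · beta_reduce
      rw [← ENNReal.ofReal_mul ((norm_nonneg _).trans (hM z)), ← ofReal_norm, norm_mul,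
        norm_inv, norm_sub_rev]
      gcongr
      exact hM ζ
    · rw [lintegral_const_mul' _ _ ENNReal.ofReal_ne_top, lintegral_ball_inv_norm hR0]
      exact ENNReal.mul_lt_top ENNReal.ofReal_lt_top ENNReal.ofReal_lt_top
  rw [← integrableOn_iff_integrable_of_support_subset]
  · exact h1
  · intro ζ hζ
    exact hR (subset_tsupport _ fun h => hζ (by simp [h]))

/-- The **Cauchy–Pompeiu formula** for a compactly supported `C¹` function. -/
theorem integral_dzb_mul_inv {g : ℂ → ℂ} (hg : ContDiff ℝ 1 g) (hgc : HasCompactSupport g)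
    (z : ℂ) : ∫ ζ, dzb g ζ * (z - ζ)⁻¹ = Real.pi * g z := by
  have hc : Continuous (dzb g) := (hg.dzb (m := 0) (by simp)).continuous
  have hcc : HasCompactSupport (dzb g) :=
    hgc.mono' ((subset_tsupport _).trans (tsupport_dzb_subset g))
  have h1 : ∀ δ : ℝ, 0 < δ → ∫ ζ, dzb g ζ * ck δ (z - ζ) = ∫ ζ, g ζ * pk δ (z - ζ) := by
    intro δ hδ
    have hk : ContDiff ℝ 1 fun ζ => ck δ (z - ζ) :=
      (contDiff_ck hδ).comp (contDiff_const.sub contDiff_id)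
    have := integral_mul_dzb_of_tsupport_subset isOpen_univ hk.contDiffOn hg hgc (subset_univ _)
    simp only [mul_comm (dzb g _)]
    rw [this, ← integral_neg]
    congr 1
    ext ζ
    rw [dzb_sub_left _ _ ((contDiff_ck hδ (n := 1)).differentiable one_ne_zero _), dzb_ck hδ]
    ring
  have h2 := tendsto_integral_mul_pk (hg.continuous.integrable_of_hasCompactSupport hgc)
    (hg.continuous.continuousAt (x := z))
  have h3 : Tendsto (fun δ : ℝ => ∫ ζ, dzb g ζ * ck δ (z - ζ)) (𝓝[>] 0)
      (𝓝 (∫ ζ, dzb g ζ * (z - ζ)⁻¹)) := by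
    refine tendsto_integral_filter_of_dominated_convergence
      (fun ζ => ‖dzb g ζ * (z - ζ)⁻¹‖) ?_ ?_ (integrable_inv_mul hc hcc z).norm ?_
    · filter_upwards [self_mem_nhdsWithin] with δ (hδ : 0 < δ)
      exact (hc.mul ((contDiff_ck hδ (n := 0)).continuous.comp
        (continuous_const.sub continuous_id))).aestronglyMeasurable
    · refine Eventually.of_forall fun δ => ae_of_all _ fun ζ => ?_
      rw [norm_mul, norm_mul, norm_inv]
      gcongr
      exact norm_ck_le_inv _ _
    · filter_upwards [compl_mem_ae_iff.2 (measure_singleton z)] with ζ hζ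
      exact (tendsto_ck (sub_ne_zero.2 (Ne.symm hζ))).const_mul _
  refine tendsto_nhds_unique h3 (h2.congr' ?_)
  filter_upwards [self_mem_nhdsWithin] with δ hδ using (h1 δ hδ).symm

end

section

variable {δ : ℝ}

/-! ### The `L²` bound for the regularized Beurling transform -/

/-- The regularized Beurling transform: convolution with `bk δ`. -/
noncomputable def bt (δ : ℝ) (f : ℂ → ℂ) (z : ℂ) : ℂ := ∫ w, f w * bk δ (z - w)

/-- The function `(|x|² + δ²)^(-1/2)`, in terms of which the decay of the kernels is measured. -/
noncomputable def km (δ : ℝ) (x : ℂ) : ℝ := (Real.sqrt (‖x‖ ^ 2 + δ ^ 2))⁻¹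

lemma km_nonneg (δ : ℝ) (x : ℂ) : 0 ≤ km δ x := inv_nonneg.2 (Real.sqrt_nonneg _)

lemma km_sq (δ : ℝ) (x : ℂ) : km δ x ^ 2 = (‖x‖ ^ 2 + δ ^ 2)⁻¹ := by
  rw [km, inv_pow, Real.sq_sqrt (by positivity)]

lemma km_le (hδ : 0 < δ) (x : ℂ) : km δ x ≤ δ⁻¹ := by
  rw [km]
  refine inv_anti₀ hδ (Real.le_sqrt_of_sq_le ?_)
  nlinarith [sq_nonneg ‖x‖]

lemma continuous_km (hδ : 0 < δ) : Continuous (km δ) := by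
  unfold km
  refine Continuous.inv₀ (by fun_prop) fun x => ?_
  positivity

lemma norm_ck_le_km (δ : ℝ) (x : ℂ) : ‖ck δ x‖ ≤ km δ x := by
  rw [norm_ck, ← km_sq, sq, ← mul_assoc]
  refine mul_le_of_le_one_left (km_nonneg _ _) ?_
  rw [km, ← div_eq_mul_inv]
  refine div_le_one_of_le₀ (Real.le_sqrt_of_sq_le ?_) (Real.sqrt_nonneg _)
  nlinarith [sq_nonneg δ]

lemma norm_bk_le_km (δ : ℝ) (x : ℂ) : ‖bk δ x‖ ≤ km δ x ^ 2 := by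
  rw [norm_bk]
  exact pow_le_pow_left₀ (norm_nonneg _) (norm_ck_le_km δ x) 2

lemma norm_pk_le_km (hδ : 0 < δ) (x : ℂ) : ‖pk δ x‖ ≤ km δ x ^ 2 := by
  rw [norm_pk, km_sq, sq (_⁻¹), ← mul_assoc]
  refine mul_le_of_le_one_left (by positivity) ?_
  rw [← div_eq_mul_inv]
  exact div_le_one_of_le₀ (by nlinarith [sq_nonneg ‖x‖]) (by positivity)

lemma integrable_km_pow (hδ : 0 < δ) {n : ℕ} (hn : 2 < n) : Integrable fun x => km δ x ^ n := by
  have h := integrable_rpow_neg_one_add_norm_sq (E := ℂ) (μ := volume) (r := n)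
    (by rw [Complex.finrank_real_complex]; exact_mod_cast hn)
  have hc : Continuous fun x => km δ x ^ n := (continuous_km hδ).pow n
  set c := min 1 (δ ^ 2) with hcdef
  have hc0 : 0 < c := lt_min one_pos (by positivity)
  refine (h.const_mul (c ^ (-(n : ℝ) / 2))).mono' hc.aestronglyMeasurable (ae_of_all _ fun x => ?_)
  have e : km δ x = (‖x‖ ^ 2 + δ ^ 2) ^ (-1 / 2 : ℝ) := by
    rw [km, Real.sqrt_eq_rpow, ← Real.rpow_neg (by positivity)]
    norm_num
  have hb : c * (1 + ‖x‖ ^ 2) ≤ ‖x‖ ^ 2 + δ ^ 2 := by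
    nlinarith [min_le_left 1 (δ ^ 2), min_le_right 1 (δ ^ 2), sq_nonneg ‖x‖]
  rw [Real.norm_of_nonneg (pow_nonneg (km_nonneg _ _) _), e, ← Real.rpow_natCast,
    ← Real.rpow_mul (by positivity), ← Real.mul_rpow hc0.le (by positivity),
    show (-1 / 2 : ℝ) * n = -(n : ℝ) / 2 by ring]
  exact Real.rpow_le_rpow_of_nonpos (by positivity) hb (by
    have : (0 : ℝ) ≤ n := n.cast_nonneg
    linarith)

lemma fderiv_apply_eq {u : ℂ → ℂ} (z v : ℂ) :
    fderiv ℝ u z v = dz u z * v + dzb u z * starRingEnd ℂ v := by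
  have hv : v = v.re • (1 : ℂ) + v.im • Complex.I := by simp
  conv_lhs => rw [hv, map_add, map_smul, map_smul]
  conv_rhs => rw [hv]
  simp only [dz, dzb, Complex.real_smul, map_add, map_mul, Complex.conj_ofReal, map_one,
    Complex.conj_I]
  ring_nf
  rw [Complex.I_sq]
  ring

lemma norm_fderiv_apply_le {u : ℂ → ℂ} (z v : ℂ) :
    ‖fderiv ℝ u z v‖ ≤ (‖dz u z‖ + ‖dzb u z‖) * ‖v‖ := by
  rw [fderiv_apply_eq, add_mul]
  refine (norm_add_le _ _).trans (le_of_eq ?_)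
  rw [norm_mul, norm_mul, Complex.norm_conj]

lemma dz_conj_comp {u : ℂ → ℂ} {z : ℂ} (hu : DifferentiableAt ℝ u z) :
    dz (fun x => starRingEnd ℂ (u x)) z = starRingEnd ℂ (dzb u z) := by
  rw [(show HasFDerivAt (fun x => starRingEnd ℂ (u x)) _ z from
    (Complex.conjCLE.hasFDerivAt (x := u z)).comp z hu.hasFDerivAt).dz_eq, dzb]
  simp
  rw [show (starRingEnd ℂ) 2 = 2 from map_ofNat _ 2]
  ring

lemma dzb_conj_comp {u : ℂ → ℂ} {z : ℂ} (hu : DifferentiableAt ℝ u z) :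
    dzb (fun x => starRingEnd ℂ (u x)) z = starRingEnd ℂ (dz u z) := by
  rw [(show HasFDerivAt (fun x => starRingEnd ℂ (u x)) _ z from
    (Complex.conjCLE.hasFDerivAt (x := u z)).comp z hu.hasFDerivAt).dzb_eq, dz]
  simp
  rw [show (starRingEnd ℂ) 2 = 2 from map_ofNat _ 2]

lemma dz_sub_right {g : ℂ → ℂ} (z w : ℂ) (hg : DifferentiableAt ℝ g (z - w)) :
    dz (fun z => g (z - w)) z = dz g (z - w) := by
  rw [(show HasFDerivAt (fun z => g (z - w)) _ z from
    hg.hasFDerivAt.comp z ((hasFDerivAt_id z).sub_const w)).dz_eq, dz]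
  simp

lemma dzb_sub_right {g : ℂ → ℂ} (z w : ℂ) (hg : DifferentiableAt ℝ g (z - w)) :
    dzb (fun z => g (z - w)) z = dzb g (z - w) := by
  rw [(show HasFDerivAt (fun z => g (z - w)) _ z from
    hg.hasFDerivAt.comp z ((hasFDerivAt_id z).sub_const w)).dzb_eq, dzb]
  simp

lemma sq_mul_le_add_cube {a b : ℝ} (ha : 0 ≤ a) (hb : 0 ≤ b) : a ^ 2 * b ≤ a ^ 3 + b ^ 3 := by
  rcases le_total a b with h | h
  · nlinarith [pow_nonneg ha 3, mul_le_mul_of_nonneg_right (pow_le_pow_left₀ ha h 2) hb]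
  · nlinarith [pow_nonneg hb 3, mul_le_mul_of_nonneg_left h (sq_nonneg a)]

lemma integrable_of_norm_le_km (hδ : 0 < δ) {F : ℂ → ℂ} (hF : Continuous F) (C : ℝ) (w w' : ℂ)
    (h : ∀ z, ‖F z‖ ≤ C * (km δ (z - w') ^ 2 * km δ (z - w))) : Integrable F := by
  have i1 := (integrable_km_pow hδ (n := 3) (by norm_num)).comp_sub_right w'
  have i2 := (integrable_km_pow hδ (n := 3) (by norm_num)).comp_sub_right w
  refine ((i1.add i2).const_mul |C|).mono' hF.aestronglyMeasurable (ae_of_all _ fun z => ?_)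
  refine (h z).trans ?_
  have := sq_mul_le_add_cube (km_nonneg δ (z - w')) (km_nonneg δ (z - w))
  have h0 := mul_nonneg (sq_nonneg (km δ (z - w'))) (km_nonneg δ (z - w))
  calc _ ≤ |C| * (km δ (z - w') ^ 2 * km δ (z - w)) :=
        mul_le_mul_of_nonneg_right (le_abs_self C) h0
    _ ≤ _ := mul_le_mul_of_nonneg_left this (abs_nonneg C)

/-- The polarized form of `∫ |∂_z G|² = ∫ |∂_{z̄} G|²` for the two kernels `bk δ = ∂_z (ck δ)` and
`pk δ = ∂_{z̄} (ck δ)`. -/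
lemma integral_bk_mul_conj (hδ : 0 < δ) (w w' : ℂ) :
    ∫ z, bk δ (z - w) * starRingEnd ℂ (bk δ (z - w')) =
      ∫ z, pk δ (z - w) * starRingEnd ℂ (pk δ (z - w')) := by
  have dck : Differentiable ℝ (ck δ) := (contDiff_ck hδ (n := 1)).differentiable one_ne_zero
  have dbk : Differentiable ℝ (bk δ) := (contDiff_bk hδ (n := 1)).differentiable one_ne_zero
  have dpk : Differentiable ℝ (pk δ) := (contDiff_pk hδ (n := 1)).differentiable one_ne_zero
  have hsub : ∀ {n : WithTop ℕ∞} (a : ℂ), ContDiff ℝ n fun z : ℂ => z - a :=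
    fun a => contDiff_id.sub contDiff_const
  have cck : ∀ a, ContDiff ℝ 1 fun z => ck δ (z - a) := fun a => (contDiff_ck hδ).comp (hsub a)
  have cbk : ∀ a, ContDiff ℝ 1 fun z => starRingEnd ℂ (bk δ (z - a)) :=
    fun a => contDiff_conj.comp ((contDiff_bk hδ).comp (hsub a))
  have cpk : ∀ a, ContDiff ℝ 1 fun z => starRingEnd ℂ (pk δ (z - a)) :=
    fun a => contDiff_conj.comp ((contDiff_pk hδ).comp (hsub a))
  -- the derivatives of the three kernels
  have e1 : ∀ z, dz (fun z => ck δ (z - w)) z = bk δ (z - w) := fun z => by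
    rw [dz_sub_right _ _ (dck _), dz_ck hδ]
  have e2 : ∀ z, dzb (fun z => ck δ (z - w)) z = pk δ (z - w) := fun z => by
    rw [dzb_sub_right _ _ (dck _), dzb_ck hδ]
  have e3 : ∀ z, dz (fun z => starRingEnd ℂ (bk δ (z - w'))) z =
      starRingEnd ℂ (-2 * ck δ (z - w') * pk δ (z - w')) := fun z => by
    rw [dz_conj_comp (u := fun z => bk δ (z - w')) ((dbk _).comp z
      (differentiableAt_id.sub_const w')), dzb_sub_right _ _ (dbk _), dzb_bk hδ]
  have e4 : ∀ z, dzb (fun z => starRingEnd ℂ (pk δ (z - w'))) z =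
      starRingEnd ℂ (-2 * ck δ (z - w') * pk δ (z - w')) := fun z => by
    rw [dzb_conj_comp (u := fun z => pk δ (z - w')) ((dpk _).comp z
      (differentiableAt_id.sub_const w')), dz_sub_right _ _ (dpk _), dz_pk hδ]
  have e5 : ∀ z, dzb (fun z => starRingEnd ℂ (bk δ (z - w'))) z =
      starRingEnd ℂ (-2 * ck δ (z - w') * bk δ (z - w')) := fun z => by
    rw [dzb_conj_comp (u := fun z => bk δ (z - w')) ((dbk _).comp z
      (differentiableAt_id.sub_const w')), dz_sub_right _ _ (dbk _)]
    unfold bk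
    rw [dz_comp (f := fun y => -y ^ 2) (hasDerivAt_pow 2 _).neg (dck _), dz_ck hδ, bk]
    norm_num
  have e6 : ∀ z, dz (fun z => starRingEnd ℂ (pk δ (z - w'))) z =
      starRingEnd ℂ (dzb (pk δ) (z - w')) := fun z => by
    rw [dz_conj_comp (u := fun z => pk δ (z - w')) ((dpk _).comp z
      (differentiableAt_id.sub_const w')), dzb_sub_right _ _ (dpk _)]
  have e7 : ∀ z, ‖dzb (pk δ) z‖ = ‖-2 * ck δ z * pk δ z‖ := fun z => by
    have : pk δ = fun z => starRingEnd ℂ (pk δ z) := by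
      ext z; rw [pk_eq, Complex.conj_ofReal]
    rw [this, dzb_conj_comp (dpk z), Complex.norm_conj, dz_pk hδ]
    simp only [← congrFun this z]
  have b0 : ∀ a, km δ a ≤ δ⁻¹ := km_le hδ
  have p0 : ∀ a, 0 ≤ km δ a := km_nonneg δ
  have hδ' : 0 ≤ δ⁻¹ := (inv_pos.2 hδ).le
  -- bounds for the factors
  have n1 : ∀ z, ‖-2 * ck δ z * pk δ z‖ ≤ 2 * δ⁻¹ * km δ z ^ 2 := fun z => by
    rw [norm_mul, norm_mul, norm_neg, RCLike.norm_ofNat]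
    exact mul_le_mul (mul_le_mul_of_nonneg_left ((norm_ck_le_km _ _).trans (b0 _)) (by norm_num))
      (norm_pk_le_km hδ _) (norm_nonneg _) (by positivity)
  have n2 : ∀ z, ‖-2 * ck δ z * bk δ z‖ ≤ 2 * δ⁻¹ * km δ z ^ 2 := fun z => by
    rw [norm_mul, norm_mul, norm_neg, RCLike.norm_ofNat]
    exact mul_le_mul (mul_le_mul_of_nonneg_left ((norm_ck_le_km _ _).trans (b0 _)) (by norm_num))
      (norm_bk_le_km _ _) (norm_nonneg _) (by positivity)
  have n3 : ∀ z v, ‖fderiv ℝ (fun z => ck δ (z - w)) z v‖ ≤ 2 * δ⁻¹ * ‖v‖ * km δ (z - w) := by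
    intro z v
    refine (norm_fderiv_apply_le z v).trans ?_
    rw [e1, e2]
    have h1 := norm_bk_le_km δ (z - w)
    have h2 := norm_pk_le_km hδ (z - w)
    have h3 : km δ (z - w) ^ 2 ≤ δ⁻¹ * km δ (z - w) := by
      rw [sq]; exact mul_le_mul_of_nonneg_right (b0 _) (p0 _)
    calc _ ≤ (2 * (δ⁻¹ * km δ (z - w))) * ‖v‖ := by gcongr; linarith
      _ = _ := by ring
  have n4 : ∀ z v, ‖fderiv ℝ (fun z => starRingEnd ℂ (bk δ (z - w'))) z v‖ ≤
      4 * δ⁻¹ * ‖v‖ * km δ (z - w') ^ 2 := by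
    intro z v
    refine (norm_fderiv_apply_le z v).trans ?_
    rw [e3, e5, Complex.norm_conj, Complex.norm_conj]
    calc _ ≤ (2 * δ⁻¹ * km δ (z - w') ^ 2 + 2 * δ⁻¹ * km δ (z - w') ^ 2) * ‖v‖ := by
          gcongr
          · exact n1 _
          · exact n2 _
      _ = _ := by ring
  have n5 : ∀ z v, ‖fderiv ℝ (fun z => starRingEnd ℂ (pk δ (z - w'))) z v‖ ≤
      4 * δ⁻¹ * ‖v‖ * km δ (z - w') ^ 2 := by
    intro z v
    refine (norm_fderiv_apply_le z v).trans ?_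
    rw [e4, e6, Complex.norm_conj, Complex.norm_conj, e7]
    calc _ ≤ (2 * δ⁻¹ * km δ (z - w') ^ 2 + 2 * δ⁻¹ * km δ (z - w') ^ 2) * ‖v‖ := by
          gcongr
          · exact n1 _
          · exact n1 _
      _ = _ := by ring
  have cont1 : ∀ {g : ℂ → ℂ} (_ : ContDiff ℝ 1 g) (v : ℂ), Continuous fun z => fderiv ℝ g z v :=
    fun hg v => (hg.continuous_fderiv one_ne_zero).clm_apply continuous_const
  have key1 := integral_mul_dz (f := fun z => starRingEnd ℂ (bk δ (z - w')))
    (g := fun z => ck δ (z - w))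
    (fun v => integrable_of_norm_le_km hδ ((cont1 (cbk w') v).mul (cck w).continuous)
      (4 * δ⁻¹ * ‖v‖) w w' fun z => by
        rw [norm_mul, ← mul_assoc]
        exact mul_le_mul (n4 z v) (norm_ck_le_km _ _) (norm_nonneg _) (by positivity))
    (fun v => integrable_of_norm_le_km hδ ((cbk w').continuous.mul (cont1 (cck w) v))
      (2 * δ⁻¹ * ‖v‖) w w' fun z => by
        rw [norm_mul, Complex.norm_conj, mul_left_comm]
        exact mul_le_mul (norm_bk_le_km _ _) (n3 z v) (norm_nonneg _) (by positivity))
    (integrable_of_norm_le_km hδ ((cbk w').continuous.mul (cck w).continuous) 1 w w' fun z => by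
        rw [norm_mul, Complex.norm_conj, one_mul]
        exact mul_le_mul (norm_bk_le_km _ _) (norm_ck_le_km _ _) (norm_nonneg _) (by positivity))
    (fun x _ => (cbk w').differentiable one_ne_zero x)
    (fun x _ => (cck w).differentiable one_ne_zero x)
  have key2 := integral_mul_dzb (f := fun z => starRingEnd ℂ (pk δ (z - w')))
    (g := fun z => ck δ (z - w))
    (fun v => integrable_of_norm_le_km hδ ((cont1 (cpk w') v).mul (cck w).continuous)
      (4 * δ⁻¹ * ‖v‖) w w' fun z => by
        rw [norm_mul, ← mul_assoc]
        exact mul_le_mul (n5 z v) (norm_ck_le_km _ _) (norm_nonneg _) (by positivity))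
    (fun v => integrable_of_norm_le_km hδ ((cpk w').continuous.mul (cont1 (cck w) v))
      (2 * δ⁻¹ * ‖v‖) w w' fun z => by
        rw [norm_mul, Complex.norm_conj, mul_left_comm]
        exact mul_le_mul (norm_pk_le_km hδ _) (n3 z v) (norm_nonneg _) (by positivity))
    (integrable_of_norm_le_km hδ ((cpk w').continuous.mul (cck w).continuous) 1 w w' fun z => by
        rw [norm_mul, Complex.norm_conj, one_mul]
        exact mul_le_mul (norm_pk_le_km hδ _) (norm_ck_le_km _ _) (norm_nonneg _) (by positivity))
    (fun x _ => (cpk w').differentiable one_ne_zero x)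
    (fun x _ => (cck w).differentiable one_ne_zero x)
  simp only [e1, e3] at key1
  simp only [e2, e4] at key2
  simp only [mul_comm (bk δ _), mul_comm (pk δ (_ - w))]
  rw [key1, key2]

/-- The square of the `L²` norm of a convolution, as a quadratic form in the density. -/
lemma integral_mul_conj_convolution (hδ : 0 < δ) {κ f : ℂ → ℂ} (hκ : Continuous κ)
    (hκm : ∀ x, ‖κ x‖ ≤ km δ x ^ 2) (hf : Integrable f) :
    Integrable (fun z => (∫ w, f w * κ (z - w)) * starRingEnd ℂ (∫ w, f w * κ (z - w))) ∧
    ∫ z, (∫ w, f w * κ (z - w)) * starRingEnd ℂ (∫ w, f w * κ (z - w)) =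
      ∫ p : ℂ × ℂ, f p.1 * starRingEnd ℂ (f p.2) *
        ∫ z, κ (z - p.1) * starRingEnd ℂ (κ (z - p.2)) := by
  have hconj : Integrable fun w => starRingEnd ℂ (f w) :=
    (Complex.conjCLE : ℂ →L[ℝ] ℂ).integrable_comp hf
  have hff : Integrable (fun p : ℂ × ℂ => f p.1 * starRingEnd ℂ (f p.2)) := hf.mul_prod hconj
  have i4 := integrable_km_pow hδ (n := 4) (by norm_num)
  set M := ∫ x, km δ x ^ 4 with hM
  let G : ℂ × (ℂ × ℂ) → ℂ := fun q => f q.2.1 * starRingEnd ℂ (f q.2.2) *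
    (κ (q.1 - q.2.1) * starRingEnd ℂ (κ (q.1 - q.2.2)))
  have hκκ : ∀ p : ℂ × ℂ, Integrable fun z => κ (z - p.1) * starRingEnd ℂ (κ (z - p.2)) := by
    intro p
    refine ((i4.comp_sub_right p.1).add (i4.comp_sub_right p.2)).mono' (by fun_prop)
      (ae_of_all _ fun z => ?_)
    rw [norm_mul, Complex.norm_conj]
    have h1 := hκm (z - p.1)
    have h2 := hκm (z - p.2)
    have := mul_le_mul h1 h2 (norm_nonneg _) (by positivity)
    simp only [Pi.add_apply]
    nlinarith [sq_nonneg (km δ (z - p.1) ^ 2 - km δ (z - p.2) ^ 2),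
      sq_nonneg (km δ (z - p.1) ^ 2), sq_nonneg (km δ (z - p.2) ^ 2)]
  have hGm : AEStronglyMeasurable G ((volume : Measure ℂ).prod (volume : Measure (ℂ × ℂ))) := by
    refine AEStronglyMeasurable.mul hff.aestronglyMeasurable.comp_snd ?_
    exact Continuous.aestronglyMeasurable (by fun_prop)
  have hG : Integrable G ((volume : Measure ℂ).prod (volume : Measure (ℂ × ℂ))) := by
    rw [integrable_prod_iff' hGm]
    refine ⟨ae_of_all _ fun p =>
      (hκκ p).const_mul (f p.1 * starRingEnd ℂ (f p.2)), ?_⟩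
    refine (hff.norm.mul_const (M + M)).mono' hGm.prod_swap.norm.integral_prod_right' (ae_of_all _ fun p => ?_)
    rw [Real.norm_of_nonneg (integral_nonneg fun _ => norm_nonneg _)]
    simp only [G, norm_mul (f p.1 * _)]
    rw [integral_const_mul]
    refine mul_le_mul_of_nonneg_left ?_ (norm_nonneg _)
    have := integral_mono (hκκ p).norm ((i4.comp_sub_right p.1).add (i4.comp_sub_right p.2))
      fun z => by
        simp only [Pi.add_apply]
        rw [norm_mul, Complex.norm_conj]
        have h1 := hκm (z - p.1)
        have h2 := hκm (z - p.2)
        have := mul_le_mul h1 h2 (norm_nonneg _) (by positivity)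
        nlinarith [sq_nonneg (km δ (z - p.1) ^ 2 - km δ (z - p.2) ^ 2),
          sq_nonneg (km δ (z - p.1) ^ 2), sq_nonneg (km δ (z - p.2) ^ 2)]
    refine this.trans (le_of_eq ?_)
    rw [integral_add' (i4.comp_sub_right p.1) (i4.comp_sub_right p.2)]
    rw [integral_sub_right_eq_self (fun x => km δ x ^ 4), integral_sub_right_eq_self
      (fun x => km δ x ^ 4)]
  have hz : ∀ z, (∫ w, f w * κ (z - w)) * starRingEnd ℂ (∫ w, f w * κ (z - w)) =
      ∫ p : ℂ × ℂ, G (z, p) := by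
    intro z
    rw [← integral_conj, ← integral_prod_mul]
    congr 1
    ext p
    simp only [G, map_mul]
    ring
  simp only [hz]
  refine ⟨hG.integral_prod_left, ?_⟩
  rw [integral_integral_swap (f := fun z p => G (z, p)) hG]
  congr 1
  ext p
  rw [← integral_const_mul]

lemma lintegral_enorm_sq_eq {F : ℂ → ℂ} (h : Integrable fun z => F z * starRingEnd ℂ (F z)) :
    ∫⁻ z, ‖F z‖ₑ ^ 2 = ENNReal.ofReal (∫ z, F z * starRingEnd ℂ (F z)).re := by
  have e : ∀ z, F z * starRingEnd ℂ (F z) = ((‖F z‖ ^ 2 : ℝ) : ℂ) := fun z => by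
    rw [Complex.mul_conj, Complex.normSq_eq_norm_sq]
  simp only [e] at h ⊢
  have h' : Integrable fun z => ‖F z‖ ^ 2 := by
    have := Complex.reCLM.integrable_comp h
    simpa only [Complex.reCLM_apply, Complex.ofReal_re] using this
  rw [integral_complex_ofReal, Complex.ofReal_re, ofReal_integral_eq_lintegral_ofReal h'
    (ae_of_all _ fun z => by positivity)]
  congr 1
  ext z
  rw [ENNReal.ofReal_pow (norm_nonneg _), ofReal_norm]

/-- Young's inequality for convolution with `pk δ`, whose integral is `π`. -/
lemma lintegral_convolution_pk_le (hδ : 0 < δ) {f : ℂ → ℂ} (hf : AEStronglyMeasurable f) :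
    ∫⁻ z, ‖∫ w, f w * pk δ (z - w)‖ₑ ^ 2 ≤ ENNReal.ofReal Real.pi ^ 2 * ∫⁻ w, ‖f w‖ₑ ^ 2 := by
  have cpk : Continuous (pk δ) := (contDiff_pk hδ (n := 0)).continuous
  have hpi : ∫⁻ x, ‖pk δ x‖ₑ = ENNReal.ofReal Real.pi := by
    rw [← integral_norm_pk hδ, ofReal_integral_eq_lintegral_ofReal (integrable_norm_pk hδ)
      (ae_of_all _ fun z => by positivity)]
    congr 1
    ext x
    rw [← norm_pk, ofReal_norm]
  have h1 : ∀ z, ‖∫ w, f w * pk δ (z - w)‖ₑ ^ 2 ≤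
      ENNReal.ofReal Real.pi * ∫⁻ w, ‖f w‖ₑ ^ 2 * ‖pk δ (z - w)‖ₑ := by
    intro z
    have hm2 : Measurable fun w => ‖pk δ (z - w)‖ₑ :=
      (cpk.measurable.comp (measurable_const.sub measurable_id)).enorm
    have h2 := ENNReal.lintegral_mul_le_Lp_mul_Lq (volume : Measure ℂ) Real.HolderConjugate.two_two
      (f := fun w => ‖f w‖ₑ * ‖pk δ (z - w)‖ₑ ^ (1 / 2 : ℝ)) (g := fun w => ‖pk δ (z - w)‖ₑ ^ (1 / 2 : ℝ))
      (hf.enorm.mul (hm2.pow_const _).aemeasurable) (hm2.pow_const _).aemeasurable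
    have h3 : ∀ w, (‖pk δ (z - w)‖ₑ ^ (1 / 2 : ℝ)) ^ (2 : ℝ) = ‖pk δ (z - w)‖ₑ := fun w => by
      rw [← ENNReal.rpow_mul]; norm_num
    have h4 : ∀ w, ‖pk δ (z - w)‖ₑ ^ (1 / 2 : ℝ) * ‖pk δ (z - w)‖ₑ ^ (1 / 2 : ℝ) =
        ‖pk δ (z - w)‖ₑ := fun w => by
      rw [← sq, ← ENNReal.rpow_natCast]; exact h3 w
    simp only [Pi.mul_apply, ENNReal.mul_rpow_of_nonneg _ _ (zero_le_two (α := ℝ)), h3,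
      mul_assoc, h4] at h2
    rw [lintegral_sub_left_eq_self (fun x => ‖pk δ x‖ₑ) z, hpi] at h2
    have h5 : ‖∫ w, f w * pk δ (z - w)‖ₑ ≤ ∫⁻ w, ‖f w‖ₑ * ‖pk δ (z - w)‖ₑ := by
      refine (enorm_integral_le_lintegral_enorm _).trans (le_of_eq ?_)
      simp only [enorm_mul]
    refine (pow_le_pow_left' (h5.trans h2) 2).trans (le_of_eq ?_)
    rw [mul_pow, ← ENNReal.rpow_natCast, ← ENNReal.rpow_mul, ← ENNReal.rpow_natCast,
      ← ENNReal.rpow_mul]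
    norm_num
    rw [mul_comm]
  refine (lintegral_mono h1).trans ?_
  rw [lintegral_const_mul' _ _ ENNReal.ofReal_ne_top, sq, mul_assoc]
  gcongr
  rw [lintegral_lintegral_swap]
  · refine le_of_eq ?_
    rw [← hpi, ← lintegral_const_mul'' _ (hf.enorm.pow_const 2)]
    congr 1
    ext w
    have hm3 : Measurable fun x => ‖pk δ (x - w)‖ₑ :=
      (cpk.measurable.comp (measurable_id.sub_const w)).enorm
    rw [lintegral_const_mul _ hm3,
      lintegral_sub_right_eq_self (fun x => ‖pk δ x‖ₑ) w,
      mul_comm]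
  · refine AEMeasurable.mul (hf.comp_snd.enorm.pow_const 2) ?_
    exact (Continuous.measurable (by fun_prop)).enorm.aemeasurable

/-- The `L²` bound for the regularized Beurling transform, uniform in `δ`. Writing both sides as
quadratic forms in `f`, it follows from `∫ |∂_z G|² = ∫ |∂_{z̄} G|²` and Young's inequality. -/
theorem lintegral_bt_sq_le (hδ : 0 < δ) {f : ℂ → ℂ} (hf : Integrable f) :
    ∫⁻ z, ‖bt δ f z‖ₑ ^ 2 ≤ ENNReal.ofReal Real.pi ^ 2 * ∫⁻ w, ‖f w‖ₑ ^ 2 := by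
  have h1 := integral_mul_conj_convolution hδ (contDiff_bk hδ (n := 0)).continuous
    (norm_bk_le_km δ) hf
  have h2 := integral_mul_conj_convolution hδ (contDiff_pk hδ (n := 0)).continuous
    (norm_pk_le_km hδ) hf
  refine le_trans (le_of_eq ?_) (lintegral_convolution_pk_le hδ hf.aestronglyMeasurable)
  unfold bt
  rw [lintegral_enorm_sq_eq h1.1, lintegral_enorm_sq_eq h2.1, h1.2, h2.2]
  simp only [integral_bk_mul_conj hδ]

end

/-! ### The John–Nirenberg inequality -/

/-- The half-open square with lower left corner `x + iy` and side `l`. -/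
def sq (x y l : ℝ) : Set ℂ := Ioc x (x + l) ×ℂ Ioc y (y + l)

/-- The average of `F` over a square. -/
noncomputable def sqAvg (F : ℂ → ℂ) (x y l : ℝ) : ℂ := ((l ^ 2)⁻¹ : ℝ) • ∫ z in sq x y l, F z

lemma mem_sq {x y l : ℝ} {z : ℂ} :
    z ∈ sq x y l ↔ (x < z.re ∧ z.re ≤ x + l) ∧ y < z.im ∧ z.im ≤ y + l := by
  simp [sq, Complex.mem_reProdIm]

lemma measurableSet_sq (x y l : ℝ) : MeasurableSet (sq x y l) :=
  (Complex.measurable_re measurableSet_Ioc).inter (Complex.measurable_im measurableSet_Ioc)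

lemma volume_sq {x y l : ℝ} (hl : 0 ≤ l) : volume (sq x y l) = ENNReal.ofReal (l ^ 2) := by
  have h : sq x y l = Complex.measurableEquivRealProd ⁻¹' (Ioc x (x + l) ×ˢ Ioc y (y + l)) := by
    ext z; simp [mem_sq]
  rw [h, Complex.volume_preserving_equiv_real_prod.measure_preimage
    (measurableSet_Ioc.prod measurableSet_Ioc).nullMeasurableSet, Measure.volume_eq_prod,
    Measure.prod_prod, Real.volume_Ioc, Real.volume_Ioc, pow_two, ENNReal.ofReal_mul hl]
  simp

lemma measureReal_sq {x y l : ℝ} (hl : 0 ≤ l) : volume.real (sq x y l) = l ^ 2 := by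
  rw [measureReal_def, volume_sq hl, ENNReal.toReal_ofReal (by positivity)]

lemma norm_sub_le_of_mem_sq {x y l : ℝ} {z w : ℂ} (hz : z ∈ sq x y l) (hw : w ∈ sq x y l) :
    ‖z - w‖ ≤ 2 * l := by
  rw [mem_sq] at hz hw
  refine (Complex.norm_le_abs_re_add_abs_im _).trans ?_
  rw [Complex.sub_re, Complex.sub_im]
  have h1 : |z.re - w.re| ≤ l := abs_le.2 ⟨by linarith [hz.1.1, hw.1.2], by linarith [hz.1.2, hw.1.1]⟩
  have h2 : |z.im - w.im| ≤ l := abs_le.2 ⟨by linarith [hz.2.1, hw.2.2], by linarith [hz.2.2, hw.2.1]⟩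
  linarith

lemma integrableOn_sq {E : Type*} [NormedAddCommGroup E] {F : ℂ → E} (hF : Continuous F)
    (x y l : ℝ) : IntegrableOn F (sq x y l) := by
  refine (hF.locallyIntegrable.integrableOn_isCompact
    (isCompact_Icc (a := x) (b := x + l) |>.reProdIm (isCompact_Icc (a := y) (b := y + l)))).mono_set ?_
  intro z hz
  rw [mem_sq] at hz
  rw [Complex.mem_reProdIm]
  exact ⟨⟨hz.1.1.le, hz.1.2⟩, hz.2.1.le, hz.2.2⟩

/-- A square splits into four squares of half the side. -/
lemma integral_sq_split {E : Type*} [NormedAddCommGroup E] [NormedSpace ℝ E] {F : ℂ → E}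
    {x y l : ℝ} (hl : 0 < l) (hF : IntegrableOn F (sq x y l)) :
    ∫ z in sq x y l, F z =
      (∫ z in sq x y (l / 2), F z) + (∫ z in sq (x + l / 2) y (l / 2), F z) +
      ((∫ z in sq x (y + l / 2) (l / 2), F z) +
        ∫ z in sq (x + l / 2) (y + l / 2) (l / 2), F z) := by
  have hU : sq x y l = (sq x y (l / 2) ∪ sq (x + l / 2) y (l / 2)) ∪
      (sq x (y + l / 2) (l / 2) ∪ sq (x + l / 2) (y + l / 2) (l / 2)) := by
    ext z
    simp only [mem_union, mem_sq]
    grind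
  have hd1 : Disjoint (sq x y (l / 2)) (sq (x + l / 2) y (l / 2)) := by
    rw [Set.disjoint_left]; intro z h1 h2; rw [mem_sq] at h1 h2; linarith [h1.1.2, h2.1.1]
  have hd2 : Disjoint (sq x (y + l / 2) (l / 2)) (sq (x + l / 2) (y + l / 2) (l / 2)) := by
    rw [Set.disjoint_left]; intro z h1 h2; rw [mem_sq] at h1 h2; linarith [h1.1.2, h2.1.1]
  have hd3 : Disjoint (sq x y (l / 2) ∪ sq (x + l / 2) y (l / 2))
      (sq x (y + l / 2) (l / 2) ∪ sq (x + l / 2) (y + l / 2) (l / 2)) := by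
    rw [Set.disjoint_left]
    intro z h1 h2
    simp only [mem_union, mem_sq] at h1 h2
    grind
  rw [hU] at hF ⊢
  have h1 := hF.left_of_union
  have h2 := hF.right_of_union
  rw [setIntegral_union hd3 ((measurableSet_sq _ _ _).union (measurableSet_sq _ _ _)) h1 h2,
    setIntegral_union hd1 (measurableSet_sq _ _ _) h1.left_of_union h1.right_of_union,
    setIntegral_union hd2 (measurableSet_sq _ _ _) h2.left_of_union h2.right_of_union]

lemma sq_half_subset {x y l a b : ℝ} (hl : 0 < l) (ha : a = x ∨ a = x + l / 2)
    (hb : b = y ∨ b = y + l / 2) : sq a b (l / 2) ⊆ sq x y l := by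
  intro z hz
  rw [mem_sq] at hz ⊢
  rcases ha with rfl | rfl <;> rcases hb with rfl | rfl <;> grind

lemma norm_sqAvg_sub_le {F : ℂ → ℂ} (hF : Continuous F) {x y l : ℝ} (hl : 0 < l) (c : ℂ) :
    ‖sqAvg F x y l - c‖ ≤ (l ^ 2)⁻¹ * ∫ z in sq x y l, ‖F z - c‖ := by
  have h : sqAvg F x y l - c = ((l ^ 2)⁻¹ : ℝ) • ∫ z in sq x y l, (F z - c) := by
    have hi : IntegrableOn (fun _ : ℂ => c) (sq x y l) := integrableOn_sq continuous_const _ _ _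
    rw [integral_sub (integrableOn_sq hF x y l) hi,
      setIntegral_const, measureReal_sq hl.le, smul_sub, smul_smul,
      inv_mul_cancel₀ (by positivity), one_smul, sqAvg]
  rw [h, norm_smul, Real.norm_of_nonneg (by positivity)]
  gcongr
  exact norm_integral_le_integral_norm _

/-- A stopping-time argument carried out by induction on the number of halvings. A square is
stopped as soon as the average of `F` over it is at distance more than `s₀` from `c`; the stopped
squares have total area at most `s₀⁻¹ ∫ ‖F - c‖`, and `F` is within `2 s₀` of `c` elsewhere. -/
lemma integral_sq_pow_le_of_stopping {F : ℂ → ℂ} (hF : Continuous F) (q : ℕ) {s₀ d L r : ℝ}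
    (hs₀ : 0 < s₀) (hL : 0 ≤ L) (hr : ∀ z w, ‖z - w‖ ≤ r → ‖F z - F w‖ ≤ s₀)
    (hjump : ∀ x y l a b : ℝ, 0 < l → (a = x ∨ a = x + l / 2) → (b = y ∨ b = y + l / 2) →
      ‖sqAvg F a b (l / 2) - sqAvg F x y l‖ ≤ d)
    (hsel : ∀ x y l : ℝ, 0 < l → ∀ c, ‖sqAvg F x y l - c‖ ≤ s₀ + d →
      ∫ z in sq x y l, ‖F z - c‖ ^ q ≤ L * l ^ 2) (n : ℕ) :
    ∀ x y l : ℝ, 0 < l → 2 * l ≤ 2 ^ n * r → ∀ c, ‖sqAvg F x y l - c‖ ≤ s₀ →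
      ∫ z in sq x y l, ‖F z - c‖ ^ q ≤
        (2 * s₀) ^ q * l ^ 2 + L / s₀ * ∫ z in sq x y l, ‖F z - c‖ := by
  have hcont : ∀ c (q : ℕ), Continuous fun z => ‖F z - c‖ ^ q := fun c q => by fun_prop
  have hcont1 : ∀ c, Continuous fun z => ‖F z - c‖ := fun c => by fun_prop
  induction n with
  -- the side is so small that `F` varies by at most `s₀` over the square
  | zero =>
    intro x y l hl hlr c hc
    have hle : ∀ z ∈ sq x y l, ‖F z - c‖ ^ q ≤ (2 * s₀) ^ q := by
      intro z hz
      have h1 : ‖sqAvg F x y l - F z‖ ≤ s₀ := by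
        refine (norm_sqAvg_sub_le hF hl (F z)).trans ?_
        have : ∫ w in sq x y l, ‖F w - F z‖ ≤ ∫ _ in sq x y l, s₀ :=
          setIntegral_mono_on (integrableOn_sq (hcont1 _) _ _ _)
            (integrableOn_sq continuous_const _ _ _) (measurableSet_sq _ _ _) fun w hw =>
            hr _ _ ((norm_sub_le_of_mem_sq hw hz).trans (by simpa using hlr))
        rw [setIntegral_const, measureReal_sq hl.le, smul_eq_mul] at this
        rw [inv_mul_le_iff₀ (by positivity)]
        exact this
      refine pow_le_pow_left₀ (norm_nonneg _) ?_ q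
      calc ‖F z - c‖ = ‖(sqAvg F x y l - c) - (sqAvg F x y l - F z)‖ := by congr 1; ring
        _ ≤ s₀ + s₀ := (norm_sub_le _ _).trans (add_le_add hc h1)
        _ = 2 * s₀ := by ring
    have h2 := setIntegral_mono_on (integrableOn_sq (hcont c q) x y l)
      (integrableOn_sq (continuous_const (y := (2 * s₀) ^ q)) x y l) (measurableSet_sq _ _ _) hle
    rw [setIntegral_const, measureReal_sq hl.le, smul_eq_mul, mul_comm] at h2
    have h3 : 0 ≤ L / s₀ * ∫ z in sq x y l, ‖F z - c‖ :=
      mul_nonneg (by positivity) (integral_nonneg fun _ => norm_nonneg _)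
    linarith
  | succ n ih =>
    intro x y l hl hlr c hc
    -- a quarter is either stopped, in which case `‖F - c‖` has average more than `s₀` over it, or
    -- is covered by the induction hypothesis
    have hchild : ∀ a b, (a = x ∨ a = x + l / 2) → (b = y ∨ b = y + l / 2) →
        ∫ z in sq a b (l / 2), ‖F z - c‖ ^ q ≤
          (2 * s₀) ^ q * (l / 2) ^ 2 + L / s₀ * ∫ z in sq a b (l / 2), ‖F z - c‖ := by
      intro a b ha hb
      rcases le_or_gt ‖sqAvg F a b (l / 2) - c‖ s₀ with h | h
      · refine ih a b (l / 2) (by positivity) ?_ c h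
        rw [pow_succ] at hlr
        linarith
      · have h1 := hsel a b (l / 2) (by positivity) c (by
          calc _ = ‖(sqAvg F a b (l / 2) - sqAvg F x y l) + (sqAvg F x y l - c)‖ := by
                congr 1; ring
            _ ≤ d + s₀ := (norm_add_le _ _).trans (add_le_add (hjump x y l a b hl ha hb) hc)
            _ = s₀ + d := add_comm _ _)
        have h2 := h.le.trans (norm_sqAvg_sub_le hF (x := a) (y := b) (half_pos hl) c)
        rw [le_inv_mul_iff₀ (by positivity)] at h2
        have h3 : L * (l / 2) ^ 2 ≤ L / s₀ * ∫ z in sq a b (l / 2), ‖F z - c‖ := by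
          rw [div_mul_eq_mul_div, le_div_iff₀ hs₀, mul_assoc]
          exact mul_le_mul_of_nonneg_left h2 hL
        have h4 : 0 ≤ (2 * s₀) ^ q * (l / 2) ^ 2 := by positivity
        linarith
    rw [integral_sq_split hl (integrableOn_sq (hcont c q) x y l),
      integral_sq_split hl (integrableOn_sq (hcont1 c) x y l)]
    have h1 := hchild x y (Or.inl rfl) (Or.inl rfl)
    have h2 := hchild (x + l / 2) y (Or.inr rfl) (Or.inl rfl)
    have h3 := hchild x (y + l / 2) (Or.inl rfl) (Or.inr rfl)
    have h4 := hchild (x + l / 2) (y + l / 2) (Or.inr rfl) (Or.inr rfl)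
    have h5 : (2 * s₀) ^ q * l ^ 2 = 4 * ((2 * s₀) ^ q * (l / 2) ^ 2) := by ring
    rw [h5]
    linarith

lemma add_pow_le_two_pow_mul {a b : ℝ} (ha : 0 ≤ a) (hb : 0 ≤ b) (q : ℕ) :
    (a + b) ^ q ≤ 2 ^ q * (a ^ q + b ^ q) := by
  rcases le_total a b with h | h
  · calc (a + b) ^ q ≤ (2 * b) ^ q := pow_le_pow_left₀ (by positivity) (by linarith) q
      _ = 2 ^ q * b ^ q := mul_pow _ _ _
      _ ≤ _ := by gcongr; linarith [pow_nonneg ha q]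
  · calc (a + b) ^ q ≤ (2 * a) ^ q := pow_le_pow_left₀ (by positivity) (by linarith) q
      _ = 2 ^ q * a ^ q := mul_pow _ _ _
      _ ≤ _ := by gcongr; linarith [pow_nonneg hb q]

/-- The constant in the John–Nirenberg inequality `integral_sq_sub_avg_pow_le`. -/
noncomputable def jnConst (q : ℕ) : ℝ :=
  2 * (2 * (2 ^ (q + 1) * 2)) ^ q + (2 ^ (q + 1) * 2 + 4 * 2) ^ q

/-- The **John–Nirenberg inequality** in `L^q` form, for a bounded uniformly continuous function.
Boundedness makes the best constant finite a priori, and the stopping-time argument bounds it by a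
fixed constant plus half of itself. -/
theorem integral_sq_sub_avg_pow_le {F : ℂ → ℂ} (hF : UniformContinuous F) {B : ℝ}
    (hB : ∀ z, ‖F z‖ ≤ B) {A : ℝ} (hA : 0 < A)
    (hosc : ∀ x y l : ℝ, 0 < l → ∃ c, ∫ z in sq x y l, ‖F z - c‖ ≤ A * l ^ 2) (q : ℕ)
    {x y l : ℝ} (hl : 0 < l) :
    ∫ z in sq x y l, ‖F z - sqAvg F x y l‖ ^ q ≤ jnConst q * A ^ q * l ^ 2 := by
  have hFc := hF.continuous
  have hcont : ∀ c (q : ℕ), Continuous fun z => ‖F z - c‖ ^ q := fun c q => by fun_prop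
  have hcont1 : ∀ c, Continuous fun z => ‖F z - c‖ := fun c => by fun_prop
  have hosc' : ∀ x y l : ℝ, 0 < l → ∫ z in sq x y l, ‖F z - sqAvg F x y l‖ ≤ 2 * A * l ^ 2 := by
    intro x y l hl
    obtain ⟨c, hc⟩ := hosc x y l hl
    have h1 := norm_sqAvg_sub_le hFc (x := x) (y := y) hl c
    have h2 : ∫ z in sq x y l, ‖F z - sqAvg F x y l‖ ≤
        ∫ z in sq x y l, (‖F z - c‖ + ‖sqAvg F x y l - c‖) := by
      refine setIntegral_mono_on (integrableOn_sq (hcont1 _) _ _ _)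
        (integrableOn_sq (by fun_prop) _ _ _) (measurableSet_sq _ _ _) fun z _ => ?_
      calc _ = ‖(F z - c) - (sqAvg F x y l - c)‖ := by congr 1; ring
        _ ≤ _ := norm_sub_le _ _
    rw [integral_add (integrableOn_sq (hcont1 _) _ _ _) (integrableOn_sq continuous_const _ _ _),
      setIntegral_const, measureReal_sq hl.le, smul_eq_mul] at h2
    rw [le_inv_mul_iff₀ (by positivity)] at h1
    linarith
  -- the best constant `Φ`, finite because `F` is bounded
  let S : Set ℝ := {t | ∃ x y l : ℝ, 0 < l ∧
    t = (l ^ 2)⁻¹ * ∫ z in sq x y l, ‖F z - sqAvg F x y l‖ ^ q}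
  have hB0 : 0 ≤ B := (norm_nonneg _).trans (hB 0)
  have hS : BddAbove S := by
    refine ⟨(2 * B) ^ q, ?_⟩
    rintro t ⟨x, y, l, hl, rfl⟩
    rw [inv_mul_le_iff₀ (by positivity)]
    have havg : ‖sqAvg F x y l‖ ≤ B := by
      have h := norm_sqAvg_sub_le hFc (x := x) (y := y) hl 0
      simp only [sub_zero] at h
      refine h.trans ?_
      rw [inv_mul_le_iff₀ (by positivity)]
      have := setIntegral_mono_on (integrableOn_sq hFc.norm x y l)
        (integrableOn_sq (continuous_const (y := B)) x y l) (measurableSet_sq _ _ _)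
        fun z _ => hB z
      rwa [setIntegral_const, measureReal_sq hl.le, smul_eq_mul] at this
    have := setIntegral_mono_on (integrableOn_sq (hcont (sqAvg F x y l) q) x y l)
        (integrableOn_sq (continuous_const (y := (2 * B) ^ q)) x y l) (measurableSet_sq _ _ _)
        fun z _ => pow_le_pow_left₀ (norm_nonneg _)
          ((norm_sub_le _ _).trans (by linarith [hB z])) q
    rwa [setIntegral_const, measureReal_sq hl.le, smul_eq_mul] at this
  set Φ := sSup S with hΦ
  have hmem : ∀ x y l : ℝ, 0 < l → ∫ z in sq x y l, ‖F z - sqAvg F x y l‖ ^ q ≤ Φ * l ^ 2 := by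
    intro x y l hl
    have := le_csSup hS ⟨x, y, l, hl, rfl⟩
    rwa [inv_mul_le_iff₀ (by positivity), mul_comm] at this
  have hΦ0 : 0 ≤ Φ := Real.sSup_nonneg (by
    rintro t ⟨x, y, l, hl, rfl⟩
    exact mul_nonneg (by positivity) (integral_nonneg fun _ => by positivity))
  -- the level `s₀` is so large that the stopped squares contribute at most `Φ / 2` to the new
  -- bound
  set s₀ := 2 ^ (q + 1) * (2 * A) with hs₀
  set d := 4 * (2 * A) with hd
  have hs₀0 : 0 < s₀ := by positivity
  set L := 2 ^ q * ((s₀ + d) ^ q + Φ) with hL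
  have hL0 : 0 ≤ L := by positivity
  obtain ⟨r, hr0, hr⟩ : ∃ r > 0, ∀ z w, ‖z - w‖ ≤ r → ‖F z - F w‖ ≤ s₀ := by
    obtain ⟨r, hr0, hr⟩ := Metric.uniformContinuous_iff.1 hF s₀ hs₀0
    refine ⟨r / 2, by positivity, fun z w h => ?_⟩
    have := hr (a := z) (b := w) (by rw [dist_eq_norm]; linarith)
    rw [dist_eq_norm] at this
    exact this.le
  have hjump : ∀ x y l a b : ℝ, 0 < l → (a = x ∨ a = x + l / 2) → (b = y ∨ b = y + l / 2) →
      ‖sqAvg F a b (l / 2) - sqAvg F x y l‖ ≤ d := by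
    intro x y l a b hl ha hb
    refine (norm_sqAvg_sub_le hFc (half_pos hl) _).trans ?_
    rw [inv_mul_le_iff₀ (by positivity)]
    have h1 := setIntegral_mono_set (integrableOn_sq (hcont1 (sqAvg F x y l)) x y l)
      (ae_of_all _ fun _ => norm_nonneg _) (sq_half_subset hl ha hb).eventuallyLE
    have h2 := hosc' x y l hl
    rw [hd]
    linarith
  have hsel : ∀ x y l : ℝ, 0 < l → ∀ c, ‖sqAvg F x y l - c‖ ≤ s₀ + d →
      ∫ z in sq x y l, ‖F z - c‖ ^ q ≤ L * l ^ 2 := by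
    intro x y l hl c hc
    have h1 := setIntegral_mono_on (integrableOn_sq (hcont c q) x y l)
      (integrableOn_sq (F := fun z => 2 ^ q * ((s₀ + d) ^ q + ‖F z - sqAvg F x y l‖ ^ q))
        (by fun_prop) x y l) (measurableSet_sq _ _ _) fun z _ => by
        refine le_trans (pow_le_pow_left₀ (norm_nonneg _) ?_ q)
          (add_pow_le_two_pow_mul (by positivity) (norm_nonneg _) q)
        calc ‖F z - c‖ = ‖(sqAvg F x y l - c) + (F z - sqAvg F x y l)‖ := by congr 1; ring
          _ ≤ _ := (norm_add_le _ _).trans (add_le_add_left hc _)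
    rw [integral_const_mul, integral_add (integrableOn_sq continuous_const _ _ _)
      (integrableOn_sq (hcont _ _) _ _ _), setIntegral_const, measureReal_sq hl.le,
      smul_eq_mul] at h1
    refine h1.trans ?_
    rw [hL, mul_assoc, add_mul, mul_comm (l ^ 2)]
    gcongr
    exact hmem x y l hl
  have hΦle : Φ ≤ (2 * s₀) ^ q + L / s₀ * (2 * A) := by
    refine csSup_le ⟨_, 0, 0, 1, one_pos, rfl⟩ ?_
    rintro t ⟨x, y, l, hl, rfl⟩
    rw [inv_mul_le_iff₀ (by positivity)]
    obtain ⟨n, hn⟩ : ∃ n : ℕ, 2 * l / r < 2 ^ n := pow_unbounded_of_one_lt _ one_lt_two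
    rw [div_lt_iff₀ hr0] at hn
    refine (integral_sq_pow_le_of_stopping hFc q hs₀0 hL0 hr hjump hsel n x y l hl hn.le _
      (by simpa using hs₀0.le)).trans ?_
    have h1 := mul_le_mul_of_nonneg_left (hosc' x y l hl) (show 0 ≤ L / s₀ by positivity)
    linarith
  have hLs : L / s₀ * (2 * A) = ((s₀ + d) ^ q + Φ) / 2 := by
    rw [hL, hs₀, pow_succ]
    field_simp
  rw [hLs] at hΦle
  have hfin : Φ ≤ jnConst q * A ^ q := by
    have : jnConst q * A ^ q = 2 * (2 * s₀) ^ q + (s₀ + d) ^ q := by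
      rw [jnConst, add_mul, mul_assoc, ← mul_pow, ← mul_pow, hs₀, hd]
      ring_nf
    rw [this]
    linarith
  refine (hmem x y l hl).trans ?_
  gcongr

section

variable {δ : ℝ}

/-! ### The regularized Beurling transform on bounded functions -/

lemma integrable_mul_bk (hδ : 0 < δ) {f : ℂ → ℂ} (hf : Integrable f) (z : ℂ) :
    Integrable fun w => f w * bk δ (z - w) := by
  have hc : Continuous fun w => bk δ (z - w) :=
    (contDiff_bk hδ (n := 0)).continuous.comp (continuous_const.sub continuous_id)
  exact hf.mul_bdd (c := δ⁻¹ ^ 2) hc.aestronglyMeasurable (ae_of_all _ fun w => norm_bk_le hδ _)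

lemma norm_bt_le (hδ : 0 < δ) {f : ℂ → ℂ} (hf : Integrable f) (z : ℂ) :
    ‖bt δ f z‖ ≤ (∫ w, ‖f w‖) * δ⁻¹ ^ 2 := by
  rw [← integral_mul_const]
  refine (norm_integral_le_integral_norm _).trans
    (integral_mono (integrable_mul_bk hδ hf z).norm (hf.norm.mul_const _) fun w => ?_)
  simp only [norm_mul]
  gcongr
  exact norm_bk_le hδ _

lemma norm_bt_sub_bt_le (hδ : 0 < δ) {f : ℂ → ℂ} (hf : Integrable f) (z z' : ℂ) :
    ‖bt δ f z - bt δ f z'‖ ≤ (∫ w, ‖f w‖) * ((δ ^ 2)⁻¹ * (2 * δ⁻¹)) * ‖z - z'‖ := by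
  rw [bt, bt, ← integral_sub (integrable_mul_bk hδ hf z) (integrable_mul_bk hδ hf z'), mul_assoc,
    ← integral_mul_const]
  refine (norm_integral_le_integral_norm _).trans (integral_mono
    ((integrable_mul_bk hδ hf z).sub (integrable_mul_bk hδ hf z')).norm (hf.norm.mul_const _)
    fun w => ?_)
  simp only [← mul_sub, norm_mul]
  gcongr
  refine (norm_bk_sub_bk_le_const hδ _ _).trans (le_of_eq ?_)
  rw [sub_sub_sub_cancel_right]
  ring

lemma uniformContinuous_bt (hδ : 0 < δ) {f : ℂ → ℂ} (hf : Integrable f) :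
    UniformContinuous (bt δ f) := by
  have h0 : 0 ≤ (∫ w, ‖f w‖) * ((δ ^ 2)⁻¹ * (2 * δ⁻¹)) :=
    mul_nonneg (integral_nonneg fun _ => norm_nonneg _) (by positivity)
  exact (LipschitzWith.of_dist_le_mul (K := ⟨_, h0⟩) fun z z' => by
    rw [dist_eq_norm, dist_eq_norm]; exact norm_bt_sub_bt_le hδ hf z z').uniformContinuous

lemma bt_add (hδ : 0 < δ) {f g : ℂ → ℂ} (hf : Integrable f) (hg : Integrable g) (z : ℂ) :
    bt δ (fun w => f w + g w) z = bt δ f z + bt δ g z := by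
  simp only [bt, add_mul]
  exact integral_add (integrable_mul_bk hδ hf z) (integrable_mul_bk hδ hg z)

lemma bt_const_mul (c : ℂ) (f : ℂ → ℂ) (z : ℂ) :
    bt δ (fun w => c * f w) z = c * bt δ f z := by
  simp only [bt, mul_assoc]
  exact integral_const_mul _ _

lemma integrable_of_bdd_ball {f : ℂ → ℂ} (hf : AEStronglyMeasurable f) {M : ℝ}
    (hM : ∀ z, ‖f z‖ ≤ M) {c : ℂ} {R : ℝ} (h0 : ∀ z ∉ Metric.closedBall c R, f z = 0) :
    Integrable f := by
  rw [← integrableOn_iff_integrable_of_support_subset (s := Metric.closedBall c R)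
    fun z hz => by_contra fun h => hz (h0 z h)]
  exact Measure.integrableOn_of_bounded Metric.isBounded_closedBall.measure_lt_top.ne hf
    (ae_of_all _ hM)

lemma lintegral_enorm_sq_le_of_bdd {f : ℂ → ℂ} {M : ℝ}
    (hM : ∀ z, ‖f z‖ ≤ M) {c : ℂ} {R : ℝ} (hR : 0 ≤ R) (h0 : ∀ z ∉ Metric.closedBall c R, f z = 0) :
    ∫⁻ z, ‖f z‖ₑ ^ 2 ≤ ENNReal.ofReal (M ^ 2 * (Real.pi * R ^ 2)) := by
  have hM0 := (norm_nonneg _).trans (hM 0)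
  have h1 : ∀ z, ‖f z‖ₑ ^ 2 ≤
      (Metric.closedBall c R).indicator (fun _ => ENNReal.ofReal (M ^ 2)) z := by
    intro z
    by_cases hz : z ∈ Metric.closedBall c R
    · rw [indicator_of_mem hz, ← ofReal_norm, ← ENNReal.ofReal_pow (norm_nonneg _)]
      exact ENNReal.ofReal_le_ofReal (pow_le_pow_left₀ (norm_nonneg _) (hM z) 2)
    · simp [h0 z hz]
  refine (lintegral_mono h1).trans (le_of_eq ?_)
  rw [lintegral_indicator Metric.isClosed_closedBall.measurableSet, setLIntegral_const,
    Complex.volume_closedBall, ENNReal.ofReal_mul (by positivity), mul_comm Real.pi,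
    ENNReal.ofReal_mul (by positivity), ENNReal.ofReal_pow hR, ENNReal.ofReal_coe_nnreal.symm]
  rfl

/-- The `L²` bound in terms of real integrals over a measurable set. -/
lemma setIntegral_bt_sq_le (hδ : 0 < δ) {f : ℂ → ℂ} (hf : AEStronglyMeasurable f) {M : ℝ}
    (hM : ∀ z, ‖f z‖ ≤ M) {c : ℂ} {R : ℝ} (hR : 0 ≤ R) (h0 : ∀ z ∉ Metric.closedBall c R, f z = 0)
    (s : Set ℂ) : ∫ z in s, ‖bt δ f z‖ ^ 2 ≤ Real.pi ^ 2 * (M ^ 2 * (Real.pi * R ^ 2)) := by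
  have hi := integrable_of_bdd_ball hf hM h0
  have hc := (uniformContinuous_bt hδ hi).continuous
  rw [integral_eq_lintegral_of_nonneg_ae (ae_of_all _ fun z => by positivity)
    (Continuous.aestronglyMeasurable (by fun_prop))]
  refine ENNReal.toReal_le_of_le_ofReal (by positivity) ?_
  rw [ENNReal.ofReal_mul (by positivity), ENNReal.ofReal_pow Real.pi_pos.le]
  refine (setLIntegral_le_lintegral _ _).trans ?_
  refine le_trans (le_of_eq ?_) ((lintegral_bt_sq_le hδ hi).trans
    (mul_le_mul_right (lintegral_enorm_sq_le_of_bdd hM hR h0) _))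
  congr 1
  ext z
  rw [ENNReal.ofReal_pow (norm_nonneg _), ofReal_norm]

lemma setIntegral_sq_norm_le (hδ : 0 < δ) {f : ℂ → ℂ} (hf : AEStronglyMeasurable f) {M : ℝ}
    (hM0 : 0 < M) (hM : ∀ z, ‖f z‖ ≤ M) {c : ℂ} {R : ℝ} (hR : 0 ≤ R)
    (h0 : ∀ z ∉ Metric.closedBall c R, f z = 0) {x y l : ℝ} (hl : 0 ≤ l) :
    ∫ z in sq x y l, ‖bt δ f z‖ ≤ M * (Real.pi ^ 3 * R ^ 2 + l ^ 2) := by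
  have hi := integrable_of_bdd_ball hf hM h0
  have hc := (uniformContinuous_bt hδ hi).continuous
  have h1 := setIntegral_bt_sq_le hδ hf hM hR h0 (sq x y l)
  have h2 := setIntegral_mono_on (integrableOn_sq hc.norm x y l)
    (integrableOn_sq (F := fun z => M⁻¹ * ‖bt δ f z‖ ^ 2 + M) (by fun_prop) x y l)
    (measurableSet_sq _ _ _) fun z _ => by
      have : 0 ≤ (‖bt δ f z‖ - M) ^ 2 := sq_nonneg _
      have h3 : 0 ≤ ‖bt δ f z‖ := norm_nonneg _
      rw [← sub_nonneg]
      have : M⁻¹ * ‖bt δ f z‖ ^ 2 + M - ‖bt δ f z‖ =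
          M⁻¹ * ((‖bt δ f z‖ - M) ^ 2 + M * ‖bt δ f z‖) := by
        field_simp; ring
      rw [this]
      positivity
  rw [integral_add (integrableOn_sq (by fun_prop) _ _ _) (integrableOn_sq continuous_const _ _ _),
    integral_const_mul, setIntegral_const, measureReal_sq hl, smul_eq_mul] at h2
  refine h2.trans ?_
  have h4 := mul_le_mul_of_nonneg_left h1 (inv_pos.2 hM0).le
  have h5 : M⁻¹ * (Real.pi ^ 2 * (M ^ 2 * (Real.pi * R ^ 2))) = M * (Real.pi ^ 3 * R ^ 2) := by
    field_simp
  rw [h5] at h4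
  linarith

/-- The constant in the `L^∞ → BMO` bound. -/
noncomputable def bmoConst : ℝ := 16 * Real.pi ^ 3 + 1 + 6 * Real.pi

lemma bmoConst_pos : 0 < bmoConst := by unfold bmoConst; positivity

/-- The regularized Beurling transform maps bounded functions to functions of bounded mean
oscillation: the part of `f` near the square is handled by the `L²` bound, the part far from it by
the smoothness of the kernel. -/
lemma exists_setIntegral_bt_sub_le (hδ : 0 < δ) {f : ℂ → ℂ} (hf : AEStronglyMeasurable f) {M : ℝ}
    (hM0 : 0 < M) (hM : ∀ z, ‖f z‖ ≤ M) (hfi : Integrable f) {x y l : ℝ} (hl : 0 < l) :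
    ∃ c, ∫ z in sq x y l, ‖bt δ f z - c‖ ≤ bmoConst * M * l ^ 2 := by
  set c₀ : ℂ := ⟨x, y⟩ with hc₀
  set B := Metric.closedBall c₀ (4 * l) with hB
  have hBm : MeasurableSet B := Metric.isClosed_closedBall.measurableSet
  set f₁ := B.indicator f with hf₁
  set f₂ := Bᶜ.indicator f with hf₂
  have i1 : Integrable f₁ := hfi.indicator hBm
  have i2 : Integrable f₂ := hfi.indicator hBm.compl
  have hsplit : f = fun w => f₁ w + f₂ w := by
    ext w; exact (congrFun (indicator_self_add_compl B f) w).symm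
  have hbt : ∀ z, bt δ f z = bt δ f₁ z + bt δ f₂ z := fun z => by
    conv_lhs => rw [hsplit]
    exact bt_add hδ i1 i2 z
  have m1 : ∀ z, ‖f₁ z‖ ≤ M := fun z => (norm_indicator_le_norm_self f z).trans (hM z)
  have hnear := setIntegral_sq_norm_le hδ (hf.indicator hBm) hM0 m1 (c := c₀) (R := 4 * l)
    (by positivity) (fun z hz => indicator_of_notMem hz f) (x := x) (y := y) hl.le
  -- the far part varies by a bounded amount over the square, by the smoothness of the kernel
  have hfar : ∀ z ∈ sq x y l, ‖bt δ f₂ z - bt δ f₂ c₀‖ ≤ 6 * Real.pi * M := by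
    intro z hz
    have hz' : ‖z - c₀‖ ≤ 2 * l := by
      rw [mem_sq] at hz
      refine (Complex.norm_le_abs_re_add_abs_im _).trans ?_
      rw [Complex.sub_re, Complex.sub_im, hc₀, abs_of_nonneg (by simp; linarith [hz.1.1]),
        abs_of_nonneg (by simp; linarith [hz.2.1])]
      simp only
      linarith [hz.1.2, hz.2.2]
    rw [bt, bt, ← integral_sub (integrable_mul_bk hδ i2 z) (integrable_mul_bk hδ i2 c₀)]
    have hkey : ∫⁻ w, ‖f₂ w * bk δ (z - w) - f₂ w * bk δ (c₀ - w)‖ₑ ≤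
        ENNReal.ofReal (6 * Real.pi * M) := by
      have h3 := lintegral_compl_ball_rpow (s := -3) (R := 4 * l) (by norm_num) (by positivity)
      have h4 : ∀ w, ‖f₂ w * bk δ (z - w) - f₂ w * bk δ (c₀ - w)‖ₑ ≤
          ENNReal.ofReal (M * (12 * l)) * (Metric.closedBall (0 : ℂ) (4 * l))ᶜ.indicator
            (fun x => ENNReal.ofReal (‖x‖ ^ (-3 : ℝ))) (w - c₀) := by
        intro w
        by_cases hw : w ∈ B
        · simp [hf₂, hw]
        have hw' : 4 * l < ‖w - c₀‖ := by simpa [hB, dist_eq_norm] using hw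
        have hw0 : 0 < ‖w - c₀‖ := by linarith
        rw [indicator_of_mem (by simpa using hw'), ← ENNReal.ofReal_mul (by positivity),
          ← ofReal_norm, ← mul_sub, norm_mul]
        refine ENNReal.ofReal_le_ofReal ?_
        have e1 : f₂ w = f w := indicator_of_mem (by simpa using hw) f
        have e2 : ‖w - c₀‖ / 2 ≤ ‖z - w‖ := by
          have : ‖w - c₀‖ ≤ ‖z - w‖ + ‖z - c₀‖ := by
            calc ‖w - c₀‖ = ‖(z - c₀) - (z - w)‖ := by congr 1; ring
              _ ≤ _ := by rw [add_comm]; exact norm_sub_le _ _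
          linarith
        have e3 : 0 < ‖z - w‖ := by linarith
        have h5 := norm_bk_sub_bk_le_div hδ (norm_pos_iff.1 e3)
          (norm_pos_iff.1 (show 0 < ‖c₀ - w‖ by rwa [norm_sub_rev]))
        have e4 : ‖z - w‖⁻¹ ≤ 2 * ‖w - c₀‖⁻¹ := by
          rw [inv_le_comm₀ e3 (by positivity), mul_inv, inv_inv]; linarith
        rw [e1, Real.rpow_neg hw0.le, mul_assoc]
        refine mul_le_mul (hM w) (h5.trans ?_) (norm_nonneg _) hM0.le
        rw [sub_sub_sub_cancel_right, norm_sub_rev c₀ w]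
        calc ‖z - c₀‖ * (‖z - w‖⁻¹ * ‖w - c₀‖⁻¹) * (‖z - w‖⁻¹ + ‖w - c₀‖⁻¹)
            ≤ (2 * l) * ((2 * ‖w - c₀‖⁻¹) * ‖w - c₀‖⁻¹) *
              (2 * ‖w - c₀‖⁻¹ + ‖w - c₀‖⁻¹) := by gcongr
          _ = 12 * l * (‖w - c₀‖ ^ (3 : ℝ))⁻¹ := by
            rw [show (3 : ℝ) = ((3 : ℕ) : ℝ) by norm_num, Real.rpow_natCast]
            field_simp
            norm_num
      refine (lintegral_mono h4).trans ?_
      rw [lintegral_const_mul' _ _ ENNReal.ofReal_ne_top, lintegral_sub_right_eq_self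
        ((Metric.closedBall (0 : ℂ) (4 * l))ᶜ.indicator (fun x => ENNReal.ofReal (‖x‖ ^ (-3 : ℝ)))),
        lintegral_indicator Metric.isClosed_closedBall.measurableSet.compl, h3,
        ← ENNReal.ofReal_mul (by positivity)]
      refine ENNReal.ofReal_le_ofReal (le_of_eq ?_)
      norm_num
      rw [Real.rpow_neg_one]
      field_simp
      norm_num
    rw [← ENNReal.ofReal_le_ofReal_iff (by positivity), ofReal_norm]
    exact (enorm_integral_le_lintegral_enorm _).trans hkey
  have c1 := (uniformContinuous_bt hδ i1).continuous
  have c2 := (uniformContinuous_bt hδ i2).continuous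
  refine ⟨bt δ f₂ c₀, ?_⟩
  have h := setIntegral_mono_on
    (integrableOn_sq (F := fun z => ‖bt δ f z - bt δ f₂ c₀‖)
      (((uniformContinuous_bt hδ hfi).continuous.sub continuous_const).norm) x y l)
    (integrableOn_sq (F := fun z => ‖bt δ f₁ z‖ + 6 * Real.pi * M) (by fun_prop) x y l)
    (measurableSet_sq _ _ _) fun z hz => by
      rw [hbt z, add_sub_assoc]
      exact (norm_add_le _ _).trans (add_le_add_right (hfar z hz) _)
  rw [integral_add (integrableOn_sq c1.norm _ _ _) (integrableOn_sq continuous_const _ _ _),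
    setIntegral_const, measureReal_sq hl.le, smul_eq_mul] at h
  refine h.trans ?_
  unfold bmoConst
  nlinarith

/-- The constant in the `L^∞ → L^q` bound. -/
noncomputable def bddConst (q : ℕ) : ℝ :=
  2 ^ q * (jnConst q * bmoConst ^ q * 4 + 4 * ((Real.pi ^ 3 + 4) / 4) ^ q)

/-- The regularized Beurling transform maps `L^∞` of the unit disk to `L^q` for every finite `q`,
uniformly in `δ`. -/
theorem lintegral_bt_pow_le_of_bdd (hδ : 0 < δ) {f : ℂ → ℂ} (hf : AEStronglyMeasurable f) {M : ℝ}
    (hM0 : 0 < M) (hM : ∀ z, ‖f z‖ ≤ M) (h0 : ∀ z ∉ Metric.ball (0 : ℂ) 1, f z = 0) (q : ℕ) :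
    ∫⁻ z in Metric.ball 0 1, ‖bt δ f z‖ₑ ^ q ≤ ENNReal.ofReal (bddConst q * M ^ q) := by
  have h0' : ∀ z ∉ Metric.closedBall (0 : ℂ) 1, f z = 0 := fun z hz =>
    h0 z fun h => hz (Metric.ball_subset_closedBall h)
  have hi := integrable_of_bdd_ball hf hM h0'
  have hu := uniformContinuous_bt hδ hi
  have hc := hu.continuous
  -- John–Nirenberg on a square that contains the disk; its average is bounded through `L²`
  have hjn := integral_sq_sub_avg_pow_le hu (norm_bt_le hδ hi) (mul_pos bmoConst_pos hM0)
    (fun x y l hl => exists_setIntegral_bt_sub_le hδ hf hM0 hM hi hl) q (x := -1) (y := -1)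
    (l := 2) two_pos
  have havg := norm_sqAvg_sub_le hc (x := -1) (y := -1) (l := 2) two_pos 0
  have h1 := setIntegral_sq_norm_le hδ hf hM0 hM zero_le_one h0' (x := -1) (y := -1) (l := 2)
    zero_le_two
  simp only [sub_zero] at havg
  have havg' : ‖sqAvg (bt δ f) (-1) (-1) 2‖ ≤ M * ((Real.pi ^ 3 + 4) / 4) := by
    rw [inv_mul_eq_div, le_div_iff₀ (by norm_num)] at havg
    linarith
  set a := sqAvg (bt δ f) (-1) (-1) 2
  have hball : Metric.ball (0 : ℂ) 1 ⊆ sq (-1) (-1) 2 := by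
    intro z hz
    have hz' : ‖z‖ < 1 := by simpa using hz
    have h1 := abs_le.1 ((Complex.abs_re_le_norm z).trans hz'.le)
    have h2 := abs_le.1 ((Complex.abs_im_le_norm z).trans hz'.le)
    have h3 := abs_lt.1 ((Complex.abs_re_le_norm z).trans_lt hz')
    have h4 := abs_lt.1 ((Complex.abs_im_le_norm z).trans_lt hz')
    rw [mem_sq]
    exact ⟨⟨h3.1, by linarith⟩, h4.1, by linarith⟩
  have h2 := setIntegral_mono_on (integrableOn_sq (hc.norm.pow q) (-1) (-1) 2)
    (integrableOn_sq (F := fun z => 2 ^ q * (‖bt δ f z - a‖ ^ q + ‖a‖ ^ q)) (by fun_prop) _ _ _)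
    (measurableSet_sq _ _ _) fun z _ => by
      refine le_trans (pow_le_pow_left₀ (norm_nonneg _) ?_ q)
        (add_pow_le_two_pow_mul (norm_nonneg _) (norm_nonneg _) q)
      simpa using norm_add_le (bt δ f z - a) a
  rw [integral_const_mul, integral_add (integrableOn_sq (by fun_prop) _ _ _)
    (integrableOn_sq continuous_const _ _ _), setIntegral_const, measureReal_sq zero_le_two,
    smul_eq_mul] at h2
  have h3 : ∫ z in sq (-1) (-1) 2, ‖bt δ f z‖ ^ q ≤ bddConst q * M ^ q := by
    refine h2.trans ?_
    have h4 := pow_le_pow_left₀ (norm_nonneg _) havg' q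
    rw [mul_pow] at h4 hjn
    rw [bddConst, mul_assoc]
    refine mul_le_mul_of_nonneg_left ?_ (by positivity)
    nlinarith
  refine (lintegral_mono_set hball).trans ?_
  refine le_trans (le_of_eq ?_) (ENNReal.ofReal_le_ofReal h3)
  rw [ofReal_integral_eq_lintegral_ofReal (integrableOn_sq (by fun_prop) (-1) (-1) 2)
    (ae_of_all _ fun z => by positivity)]
  congr 1
  ext z
  rw [ENNReal.ofReal_pow (norm_nonneg _), ofReal_norm]

/-! ### Interpolation -/

/-- A weak-type estimate with a small loss in the exponent: truncate `f` at height `t ^ (1 - κ)`,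
and use the `L^∞ → L^n` bound for a large `n` on the bounded part and the `L²` bound on the rest. -/
lemma measure_bt_gt_le (hδ : 0 < δ) {f : ℂ → ℂ} (hf : AEStronglyMeasurable f) (hfi : Integrable f)
    (h0 : ∀ z ∉ Metric.ball (0 : ℂ) 1, f z = 0) {p κ : ℝ} (hp : 2 ≤ p)
    (hfp : ∫⁻ z, ‖f z‖ₑ ^ p ≤ 1) (n : ℕ) {t : ℝ} (ht : 1 ≤ t) :
    volume.restrict (Metric.ball 0 1) {z | t < ‖bt δ f z‖} ≤
      ENNReal.ofReal (2 ^ n * bddConst n * t ^ (-(κ * n))) +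
        ENNReal.ofReal (4 * Real.pi ^ 2 * t ^ (-(p - κ * (p - 2)))) := by
  have ht0 : 0 < t := by linarith
  set lam := t ^ (1 - κ) with hlam
  have hlam0 : 0 < lam := Real.rpow_pos_of_pos ht0 _
  set S := {z | ‖f z‖ ≤ lam} with hS
  have hSm : NullMeasurableSet S volume := nullMeasurableSet_le hf.norm.aemeasurable aemeasurable_const
  set f₁ := S.indicator f with hf₁
  set f₂ := Sᶜ.indicator f with hf₂
  have i1 : Integrable f₁ := hfi.indicator₀ hSm
  have i2 : Integrable f₂ := hfi.indicator₀ hSm.compl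
  have hbt : ∀ z, bt δ f z = bt δ f₁ z + bt δ f₂ z := fun z => by
    have hsplit : f = fun w => f₁ w + f₂ w := by
      ext w; exact (congrFun (indicator_self_add_compl S f) w).symm
    conv_lhs => rw [hsplit]
    exact bt_add hδ i1 i2 z
  have c1 := (uniformContinuous_bt hδ i1).continuous
  have c2 := (uniformContinuous_bt hδ i2).continuous
  have ht2 : 0 < t / 2 := by positivity
  have hsub : {z | t < ‖bt δ f z‖} ⊆
      {z | ENNReal.ofReal (t / 2) ^ n ≤ ‖bt δ f₁ z‖ₑ ^ n} ∪
        {z | ENNReal.ofReal (t / 2) ^ 2 ≤ ‖bt δ f₂ z‖ₑ ^ 2} := by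
    intro z (hz : t < _)
    rw [hbt] at hz
    have h1 := hz.trans_le (norm_add_le _ _)
    rcases le_or_gt (t / 2) ‖bt δ f₁ z‖ with h | h
    · left
      rw [mem_ofPred_eq, ← ofReal_norm]
      exact pow_le_pow_left' (ENNReal.ofReal_le_ofReal h) n
    · right
      rw [mem_ofPred_eq, ← ofReal_norm]
      exact pow_le_pow_left' (ENNReal.ofReal_le_ofReal (by linarith)) 2
  have hne : ∀ m : ℕ, ENNReal.ofReal (t / 2) ^ m ≠ 0 := fun m => by
    simpa using fun h => absurd h (not_le.2 ht2)
  have hnt : ∀ m : ℕ, ENNReal.ofReal (t / 2) ^ m ≠ ⊤ := fun m => ENNReal.pow_ne_top ENNReal.ofReal_ne_top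
  -- Chebyshev with exponent `n` for the bounded part, and with exponent `2` for the rest
  refine (measure_mono hsub).trans ((measure_union_le _ _).trans (add_le_add ?_ ?_))
  · refine (meas_ge_le_lintegral_div (c1.measurable.enorm.pow_const n).aemeasurable (hne n)
      (hnt n)).trans ?_
    have hb : ∀ z, ‖f₁ z‖ ≤ lam := fun z => by
      by_cases hz : z ∈ S
      · rw [hf₁, indicator_of_mem hz]; exact hz
      · rw [hf₁, indicator_of_notMem hz, norm_zero]; exact hlam0.le
    have h1 := lintegral_bt_pow_le_of_bdd hδ i1.aestronglyMeasurable hlam0 hb (fun z hz => by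
      by_cases hzS : z ∈ S
      · rw [hf₁, indicator_of_mem hzS, h0 z hz]
      · exact indicator_of_notMem hzS f) n
    refine (ENNReal.div_le_div_right h1 _).trans (le_of_eq ?_)
    rw [← ENNReal.ofReal_pow ht2.le, ← ENNReal.ofReal_div_of_pos (by positivity)]
    congr 1
    have e : t ^ (-(κ * n)) = lam ^ n / t ^ n := by
      rw [hlam, ← Real.rpow_natCast, ← Real.rpow_natCast, ← Real.rpow_mul ht0.le,
        ← Real.rpow_sub ht0]
      congr 1; ring
    rw [e, div_pow]
    field_simp
  · refine (meas_ge_le_lintegral_div (c2.measurable.enorm.pow_const 2).aemeasurable (hne 2)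
      (hnt 2)).trans ?_
    have h1 : ∫⁻ z, ‖f₂ z‖ₑ ^ 2 ≤ ENNReal.ofReal (lam ^ (2 - p)) := by
      have h2 : ∀ z, ‖f₂ z‖ₑ ^ 2 ≤ ENNReal.ofReal (lam ^ (2 - p)) * ‖f z‖ₑ ^ p := by
        intro z
        by_cases hz : z ∈ S
        · simp [hf₂, hz]
        · have hz' : lam < ‖f z‖ := by simpa [hS] using hz
          have hz0 : 0 < ‖f z‖ := hlam0.trans hz'
          rw [hf₂, indicator_of_mem (by simpa using hz), ← ofReal_norm,
            ← ENNReal.ofReal_pow hz0.le, ENNReal.ofReal_rpow_of_pos hz0,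
            ← ENNReal.ofReal_mul (by positivity)]
          refine ENNReal.ofReal_le_ofReal ?_
          have e : ‖f z‖ ^ 2 = ‖f z‖ ^ (2 - p) * ‖f z‖ ^ p := by
            rw [← Real.rpow_add hz0]; norm_num
          rw [e]
          gcongr ?_ * _
          exact Real.rpow_le_rpow_of_nonpos hlam0 hz'.le (by linarith)
      refine (lintegral_mono h2).trans ?_
      rw [lintegral_const_mul' _ _ ENNReal.ofReal_ne_top]
      exact mul_le_of_le_one_right' hfp
    have h3 : ∫⁻ z in Metric.ball 0 1, ‖bt δ f₂ z‖ₑ ^ 2 ≤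
        ENNReal.ofReal (Real.pi ^ 2 * lam ^ (2 - p)) := by
      refine (setLIntegral_le_lintegral _ _).trans ((lintegral_bt_sq_le hδ i2).trans ?_)
      rw [ENNReal.ofReal_mul (by positivity), ENNReal.ofReal_pow Real.pi_pos.le]
      gcongr
    refine (ENNReal.div_le_div_right h3 _).trans (le_of_eq ?_)
    rw [← ENNReal.ofReal_pow ht2.le, ← ENNReal.ofReal_div_of_pos (by positivity)]
    congr 1
    have e : t ^ (-(p - κ * (p - 2))) = lam ^ (2 - p) / t ^ 2 := by
      rw [hlam, ← Real.rpow_natCast, ← Real.rpow_mul ht0.le, ← Real.rpow_sub ht0]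
      congr 1; push_cast; ring
    rw [e, div_pow]
    field_simp
    norm_num

lemma jnConst_nonneg (q : ℕ) : 0 ≤ jnConst q := by unfold jnConst; positivity

lemma bddConst_nonneg (q : ℕ) : 0 ≤ bddConst q := by
  have := jnConst_nonneg q
  have := bmoConst_pos
  unfold bddConst
  positivity

lemma exists_lintegral_bt_rpow_le_of_le_one {p q : ℝ} (hp : 2 ≤ p) (hq : 1 ≤ q) (hqp : q < p) :
    ∃ C : ℝ, 0 ≤ C ∧ ∀ δ : ℝ, 0 < δ → ∀ f : ℂ → ℂ, Integrable f →
      (∀ z ∉ Metric.ball (0 : ℂ) 1, f z = 0) → ∫⁻ z, ‖f z‖ₑ ^ p ≤ 1 →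
      ∫⁻ z in Metric.ball 0 1, ‖bt δ f z‖ₑ ^ q ≤ ENNReal.ofReal C := by
  -- with this `κ` and `n` both terms of the weak-type estimate decay at least like `t ^ (-r)`,
  -- where `q < r < p`
  set κ := (p - q) / (2 * p) with hκ
  set r := (p + q) / 2 with hr
  have hp0 : 0 < p := by linarith
  have hκ0 : 0 < κ := div_pos (by linarith) (by linarith)
  set n := ⌈r / κ⌉₊ with hn
  have hκn : r ≤ κ * n := by
    have := Nat.le_ceil (r / κ)
    rwa [div_le_iff₀' hκ0] at this
  have hκp : r ≤ p - κ * (p - 2) := by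
    have : κ * p = (p - q) / 2 := by rw [hκ]; field_simp
    nlinarith
  set C₁ := 2 ^ n * bddConst n + 4 * Real.pi ^ 2 with hC₁
  have hb := bddConst_nonneg n
  have hC₁0 : 0 ≤ C₁ := by positivity
  have hrq : 0 < r - q := by rw [hr]; linarith
  have hpi := Real.pi_pos
  refine ⟨q * (Real.pi + C₁ * (1 / (r - q))), by positivity, fun δ hδ f hfi h0 hfp => ?_⟩
  have hc := (uniformContinuous_bt hδ hfi).continuous
  have e1 : ∀ z, ‖bt δ f z‖ₑ ^ q = ENNReal.ofReal (‖bt δ f z‖ ^ q) := fun z => by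
    rw [← ofReal_norm, ENNReal.ofReal_rpow_of_nonneg (norm_nonneg _) (by linarith)]
  simp only [e1]
  rw [lintegral_rpow_eq_lintegral_meas_lt_mul _ (ae_of_all _ fun z => norm_nonneg _)
    hc.norm.measurable.aemeasurable (by linarith), ENNReal.ofReal_mul (by linarith)]
  gcongr
  rw [← Ioc_union_Ioi_eq_Ioi zero_le_one, ENNReal.ofReal_add hpi.le (by positivity)]
  refine (lintegral_union_le _ _ _).trans (add_le_add ?_ ?_)
  · have h1 : ∀ t ∈ Ioc (0 : ℝ) 1, volume.restrict (Metric.ball 0 1) {z | t < ‖bt δ f z‖} *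
        ENNReal.ofReal (t ^ (q - 1)) ≤ ENNReal.ofReal Real.pi := by
      intro t ht
      have h2 : volume.restrict (Metric.ball 0 1) {z | t < ‖bt δ f z‖} ≤ ENNReal.ofReal Real.pi := by
        refine (measure_mono (subset_univ _)).trans ?_
        rw [Measure.restrict_apply_univ, Complex.volume_ball]
        simp only [ENNReal.ofReal_one, one_pow, one_mul]
        rw [← NNReal.coe_real_pi, ENNReal.ofReal_coe_nnreal]
      have h3 : ENNReal.ofReal (t ^ (q - 1)) ≤ 1 := by
        rw [← ENNReal.ofReal_one]
        exact ENNReal.ofReal_le_ofReal (Real.rpow_le_one ht.1.le ht.2 (by linarith))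
      exact (mul_le_mul' h2 h3).trans (by rw [mul_one])
    refine (setLIntegral_mono measurable_const h1).trans ?_
    simp
  · have h1 : ∀ t ∈ Ioi (1 : ℝ), volume.restrict (Metric.ball 0 1) {z | t < ‖bt δ f z‖} *
        ENNReal.ofReal (t ^ (q - 1)) ≤ ENNReal.ofReal (C₁ * t ^ (q - r - 1)) := by
      intro t (ht : 1 < t)
      have ht0 : 0 < t := by linarith
      have h2 := measure_bt_gt_le hδ hfi.aestronglyMeasurable hfi h0 hp hfp n (κ := κ) ht.le
      have h3 : volume.restrict (Metric.ball 0 1) {z | t < ‖bt δ f z‖} ≤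
          ENNReal.ofReal (C₁ * t ^ (-r)) := by
        refine h2.trans ?_
        rw [← ENNReal.ofReal_add (by positivity) (by positivity), hC₁, add_mul]
        gcongr
        · exact ht.le
        · exact ht.le
      refine (mul_le_mul_left h3 _).trans (le_of_eq ?_)
      rw [← ENNReal.ofReal_mul (by positivity), mul_assoc, ← Real.rpow_add ht0]
      congr 3; ring
    refine (setLIntegral_mono (by fun_prop) h1).trans ?_
    have hlt : q - r - 1 < -1 := by linarith
    rw [← ofReal_integral_eq_lintegral_ofReal
      ((integrableOn_Ioi_rpow_of_lt hlt one_pos).const_mul C₁)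
      ((ae_restrict_mem measurableSet_Ioi).mono fun t (ht : 1 < t) => by
        have : 0 < t := by linarith
        positivity), integral_const_mul,
      integral_Ioi_rpow_of_lt hlt one_pos, Real.one_rpow]
    refine ENNReal.ofReal_le_ofReal (le_of_eq ?_)
    congr 1
    rw [show q - r - 1 + 1 = -(r - q) by ring, div_neg, neg_div, neg_neg]

/-- The Calderón–Zygmund estimate on the unit disk, with an arbitrarily small loss in the exponent
and uniformly in the regularization parameter. -/
theorem exists_lintegral_bt_rpow_le {p q : ℝ} (hp : 2 ≤ p) (hq : 1 ≤ q) (hqp : q < p) :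
    ∃ C : ℝ, 0 ≤ C ∧ ∀ δ : ℝ, 0 < δ → ∀ f : ℂ → ℂ, Integrable f →
      (∀ z ∉ Metric.ball (0 : ℂ) 1, f z = 0) → ∀ K : ℝ, 0 ≤ K →
      ∫⁻ z, ‖f z‖ₑ ^ p ≤ ENNReal.ofReal K ^ p →
      ∫⁻ z in Metric.ball 0 1, ‖bt δ f z‖ₑ ^ q ≤ ENNReal.ofReal C * ENNReal.ofReal K ^ q := by
  obtain ⟨C, hC, h⟩ := exists_lintegral_bt_rpow_le_of_le_one hp hq hqp
  refine ⟨C, hC, fun δ hδ f hfi h0 K hK hfK => ?_⟩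
  have hp0 : 0 < p := by linarith
  have hq0 : 0 < q := by linarith
  rcases hK.eq_or_lt with rfl | hK0
  · rw [ENNReal.ofReal_zero, ENNReal.zero_rpow_of_pos hp0, nonpos_iff_eq_zero,
      lintegral_eq_zero_iff' (hfi.aestronglyMeasurable.enorm.pow_const p)] at hfK
    have hf0 : f =ᵐ[volume] 0 := by
      filter_upwards [hfK] with z hz
      simpa [hp0, hp0.le] using hz
    have hb : ∀ z, bt δ f z = 0 := fun z => by
      rw [bt, integral_eq_zero_of_ae]
      filter_upwards [hf0] with w hw
      simp [hw]
    simp [hb, hq0]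
  · have hKne : (K : ℂ) ≠ 0 := by exact_mod_cast hK0.ne'
    have hEK : ENNReal.ofReal K ≠ 0 := by simpa using hK0
    set g : ℂ → ℂ := fun z => (K : ℂ)⁻¹ * f z with hg
    have hfg : f = fun z => (K : ℂ) * g z := by ext z; rw [hg]; field_simp
    have hen : ‖(K : ℂ)‖ₑ = ENNReal.ofReal K := by
      rw [← ofReal_norm, Complex.norm_real, Real.norm_of_nonneg hK]
    have hgp : ∫⁻ z, ‖g z‖ₑ ^ p ≤ 1 := by
      have e : ∀ z, ‖f z‖ₑ ^ p = ENNReal.ofReal K ^ p * ‖g z‖ₑ ^ p := fun z => by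
        rw [hfg]; beta_reduce; rw [enorm_mul, ENNReal.mul_rpow_of_nonneg _ _ hp0.le, hen]
      simp only [e] at hfK
      have hT : ENNReal.ofReal K ^ p ≠ ⊤ := ENNReal.rpow_ne_top_of_nonneg hp0.le ENNReal.ofReal_ne_top
      have hZ : ENNReal.ofReal K ^ p ≠ 0 := by
        rw [ne_eq, ENNReal.rpow_eq_zero_iff_of_pos hp0]; exact hEK
      rw [lintegral_const_mul' _ _ hT] at hfK
      rw [← ENNReal.mul_le_mul_iff_right hZ hT, mul_one]
      exact hfK
    have h1 := h δ hδ g (hfi.const_mul _) (fun z hz => by simp [hg, h0 z hz]) hgp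
    have e2 : ∀ z, ‖bt δ f z‖ₑ ^ q = ENNReal.ofReal K ^ q * ‖bt δ g z‖ₑ ^ q := fun z => by
      rw [hfg, bt_const_mul, enorm_mul, ENNReal.mul_rpow_of_nonneg _ _ hq0.le, hen]
    simp only [e2]
    rw [lintegral_const_mul' _ _ (ENNReal.rpow_ne_top_of_nonneg hq0.le ENNReal.ofReal_ne_top),
      mul_comm]
    gcongr

end

section

variable {δ : ℝ}

/-! ### The Beurling transform recovers `∂_z` -/

lemma norm_dz_pk_le (hδ : 0 < δ) {r : ℝ} (hr : 0 < r) {x : ℂ} (hx : r ≤ ‖x‖) :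
    ‖dz (pk δ) x‖ ≤ 2 * r⁻¹ ^ 5 * δ ^ 2 := by
  have hx0 : 0 < ‖x‖ := hr.trans_le hx
  rw [dz_pk hδ, norm_mul, norm_mul, norm_neg, RCLike.norm_ofNat, norm_pk]
  have h1 : ‖ck δ x‖ ≤ r⁻¹ := (norm_ck_le_inv δ x).trans (inv_anti₀ hr hx)
  have h2 : (‖x‖ ^ 2 + δ ^ 2)⁻¹ ≤ r⁻¹ ^ 2 := by
    rw [inv_pow]
    refine inv_anti₀ (by positivity) ?_
    nlinarith [sq_nonneg δ]
  calc 2 * ‖ck δ x‖ * (δ ^ 2 * (‖x‖ ^ 2 + δ ^ 2)⁻¹ ^ 2)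
      ≤ 2 * r⁻¹ * (δ ^ 2 * (r⁻¹ ^ 2) ^ 2) := by gcongr
    _ = _ := by ring

/-- Convolution with `∂_z (pk δ)` tends to `π ∂_z`, at any point near which the function is `C¹`. -/
lemma tendsto_integral_mul_dz_pk {k : ℂ → ℂ} (hk : Integrable k) {U : Set ℂ} (hU : IsOpen U)
    (hkU : ContDiffOn ℝ 1 k U) {z : ℂ} (hz : z ∈ U) :
    Tendsto (fun δ : ℝ => ∫ ζ, k ζ * dz (pk δ) (z - ζ)) (𝓝[>] 0) (𝓝 (Real.pi * dz k z)) := by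
  obtain ⟨r, hr0, hr⟩ := Metric.isOpen_iff.1 hU z hz
  let θ : ContDiffBump z := ⟨r / 4, r / 2, by positivity, by linarith⟩
  have hθ : ContDiff ℝ 1 fun ζ => ((θ ζ : ℝ) : ℂ) := Complex.ofRealCLM.contDiff.comp θ.contDiff
  have htm : tsupport (fun ζ => ((θ ζ : ℝ) : ℂ)) ⊆ Metric.closedBall z (r / 2) := by
    rw [← show tsupport θ = _ from θ.tsupport_eq]
    exact closure_mono fun ζ hζ => by simpa using hζ
  have hts : tsupport (fun ζ => ((θ ζ : ℝ) : ℂ)) ⊆ U :=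
    htm.trans ((Metric.closedBall_subset_ball (by linarith)).trans hr)
  have hcs : HasCompactSupport fun ζ => ((θ ζ : ℝ) : ℂ) :=
    HasCompactSupport.of_support_subset_isCompact (isCompact_closedBall z (r / 2))
      ((subset_tsupport _).trans htm)
  set k₁ : ℂ → ℂ := fun ζ => k ζ * ((θ ζ : ℝ) : ℂ) with hk₁
  have c1 : ContDiff ℝ 1 k₁ := contDiff_mul_of_tsupport_subset hU hkU hθ hts
  have cs1 : HasCompactSupport k₁ := hcs.mul_left
  have i1 : Integrable k₁ := c1.continuous.integrable_of_hasCompactSupport cs1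
  have hone : k₁ =ᶠ[𝓝 z] k := by
    filter_upwards [θ.eventuallyEq_one] with ζ hζ
    simp only [hk₁, hζ, Pi.one_apply, Complex.ofReal_one, mul_one]
  have hdk : dz k₁ z = dz k z := dz_congr hone
  -- the part of `k` near `z`
  have h1 : Tendsto (fun δ : ℝ => ∫ ζ, k₁ ζ * dz (pk δ) (z - ζ)) (𝓝[>] 0)
      (𝓝 (Real.pi * dz k z)) := by
    have cd : Continuous (dz k₁) := (c1.dz (m := 0) (by simp)).continuous
    have csd : HasCompactSupport (dz k₁) := by
      refine cs1.mono' fun ζ hζ => ?_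
      by_contra h
      refine hζ ?_
      rw [dz_congr (notMem_tsupport_iff_eventuallyEq.1 h)]
      simp [dz]
    have h2 := tendsto_integral_mul_pk (cd.integrable_of_hasCompactSupport csd)
      (cd.continuousAt (x := z))
    rw [hdk] at h2
    refine h2.congr' ?_
    filter_upwards [self_mem_nhdsWithin] with δ (hδ : 0 < δ)
    have hp : ContDiff ℝ 1 fun ζ => pk δ (z - ζ) :=
      (contDiff_pk hδ).comp (contDiff_const.sub contDiff_id)
    have := integral_mul_dz_of_tsupport_subset isOpen_univ hp.contDiffOn c1 cs1 (subset_univ _)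
    simp only [mul_comm (dz k₁ _)]
    rw [this, ← integral_neg]
    congr 1
    ext ζ
    rw [dz_sub_left _ _ ((contDiff_pk hδ (n := 1)).differentiable one_ne_zero _)]
    ring
  -- the part away from `z`
  have h2 : Tendsto (fun δ : ℝ => ∫ ζ, (k ζ - k₁ ζ) * dz (pk δ) (z - ζ)) (𝓝[>] 0) (𝓝 0) := by
    have hlim : Tendsto (fun δ : ℝ => (∫ ζ, ‖k ζ - k₁ ζ‖) * (2 * (r / 4)⁻¹ ^ 5 * δ ^ 2)) (𝓝[>] 0)
        (𝓝 0) := by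
      have : ContinuousAt (fun δ : ℝ => (∫ ζ, ‖k ζ - k₁ ζ‖) * (2 * (r / 4)⁻¹ ^ 5 * δ ^ 2)) 0 := by
        fun_prop
      have h := this.tendsto.mono_left (nhdsWithin_le_nhds (s := Ioi 0))
      simpa using h
    refine squeeze_zero_norm' ?_ hlim
    filter_upwards [self_mem_nhdsWithin] with δ (hδ : 0 < δ)
    rw [← integral_mul_const]
    refine norm_integral_le_of_norm_le ((hk.sub i1).norm.mul_const _) (ae_of_all _ fun ζ => ?_)
    rw [norm_mul]
    by_cases hζ : r / 4 ≤ ‖z - ζ‖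
    · exact mul_le_mul_of_nonneg_left (norm_dz_pk_le hδ (by positivity) hζ) (norm_nonneg _)
    · have : θ ζ = 1 := θ.one_of_mem_closedBall (by
        rw [Metric.mem_closedBall, dist_comm, dist_eq_norm]; exact (not_le.1 hζ).le)
      simp [hk₁, this]
  have h3 := h1.add h2
  rw [add_zero] at h3
  refine h3.congr' ?_
  filter_upwards [self_mem_nhdsWithin] with δ (hδ : 0 < δ)
  have hbd : ∀ x, ‖dz (pk δ) x‖ ≤ 2 * δ⁻¹ * δ⁻¹ ^ 2 := fun x => by
    rw [dz_pk hδ, norm_mul, norm_mul, norm_neg, RCLike.norm_ofNat]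
    have := (norm_pk_le_km hδ x).trans (pow_le_pow_left₀ (km_nonneg _ _) (km_le hδ x) 2)
    gcongr
    exact norm_ck_le hδ x
  have hcd : Continuous fun ζ => dz (pk δ) (z - ζ) :=
    ((contDiff_pk hδ (n := 1)).dz (m := 0) (by simp)).continuous.comp
      (continuous_const.sub continuous_id)
  have hint : ∀ {h : ℂ → ℂ}, Integrable h → Integrable fun ζ => h ζ * dz (pk δ) (z - ζ) :=
    fun hh => hh.mul_bdd (c := 2 * δ⁻¹ * δ⁻¹ ^ 2) hcd.aestronglyMeasurable
      (ae_of_all _ fun w => hbd _)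
  have i2 : Integrable fun ζ => k ζ - k₁ ζ := hk.sub i1
  rw [← integral_add (hint i1) (hint i2)]
  congr 1
  ext ζ
  ring

lemma lintegral_enorm_mul_inv_le {g : ℂ → ℂ} {M R : ℝ} (hR : 0 ≤ R) (hM : ∀ z, ‖g z‖ ≤ M) (w : ℂ)
    (h0 : ∀ z ∉ Metric.ball w R, g z = 0) :
    ∫⁻ ζ, ‖g ζ * (w - ζ)⁻¹‖ₑ ≤ ENNReal.ofReal (M * (2 * Real.pi * R)) := by
  have hM0 := (norm_nonneg _).trans (hM 0)
  have h1 : ∀ ζ, ‖g ζ * (w - ζ)⁻¹‖ₑ ≤ (Metric.ball w R).indicator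
      (fun ζ => ENNReal.ofReal M * ENNReal.ofReal (‖ζ - w‖⁻¹)) ζ := by
    intro ζ
    by_cases hζ : ζ ∈ Metric.ball w R
    · rw [indicator_of_mem hζ, ← ENNReal.ofReal_mul hM0, ← ofReal_norm, norm_mul, norm_inv,
        norm_sub_rev]
      exact ENNReal.ofReal_le_ofReal (mul_le_mul_of_nonneg_right (hM ζ) (by positivity))
    · simp [h0 ζ hζ]
  refine (lintegral_mono h1).trans (le_of_eq ?_)
  rw [lintegral_indicator Metric.isOpen_ball.measurableSet,
    lintegral_const_mul' _ _ ENNReal.ofReal_ne_top, lintegral_ball_inv_norm hR,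
    ENNReal.ofReal_mul hM0]

/-- If `k` is the Cauchy transform of `f`, then the regularized Beurling transform of `f` is the
convolution of `k` with `∂_z (pk δ)`. The function `k` need not be differentiable: the derivative
falls on the kernel, by Fubini and the Cauchy–Pompeiu formula for the kernel. -/
lemma bt_eq_integral_mul_dz_pk (hδ : 0 < δ) {f k : ℂ → ℂ} (hf : Integrable f)
    (hf0 : ∀ z ∉ Metric.ball (0 : ℂ) 1, f z = 0) (hk0 : ∀ z ∉ Metric.ball (0 : ℂ) 1, k z = 0)
    (hk : ∀ᵐ z, Real.pi * k z = ∫ ζ, f ζ * (z - ζ)⁻¹) (z : ℂ) :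
    bt δ f z = ∫ ζ, k ζ * dz (pk δ) (z - ζ) := by
  let θ : ContDiffBump (0 : ℂ) := ⟨2, 3, by norm_num, by norm_num⟩
  have hθ : ContDiff ℝ 2 fun ζ => ((θ ζ : ℝ) : ℂ) := Complex.ofRealCLM.contDiff.comp θ.contDiff
  have hcs : HasCompactSupport fun ζ => ((θ ζ : ℝ) : ℂ) :=
    θ.hasCompactSupport.comp_left (g := fun x : ℝ => (x : ℂ)) Complex.ofReal_zero
  have hone : ∀ ζ ∈ Metric.ball (0 : ℂ) 1, (fun ζ => ((θ ζ : ℝ) : ℂ)) =ᶠ[𝓝 ζ] fun _ => 1 := by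
    intro ζ hζ
    filter_upwards [Metric.isOpen_ball.mem_nhds hζ] with w hw
    rw [θ.one_of_mem_closedBall (by
      rw [Metric.mem_closedBall]; exact (Metric.mem_ball.1 hw).le.trans (by norm_num))]
    simp
  have hb : ContDiff ℝ 2 fun ζ => bk δ (z - ζ) :=
    (contDiff_bk hδ).comp (contDiff_const.sub contDiff_id)
  set φ : ℂ → ℂ := fun ζ => bk δ (z - ζ) * ((θ ζ : ℝ) : ℂ) with hφ
  have cφ : ContDiff ℝ 2 φ := hb.mul hθ
  have csφ : HasCompactSupport φ := hcs.mul_left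
  have cd : Continuous (dzb φ) := (cφ.dzb (m := 1) (by norm_num)).continuous
  have csd : HasCompactSupport (dzb φ) :=
    csφ.mono' ((subset_tsupport _).trans (tsupport_dzb_subset φ))
  obtain ⟨M, hM⟩ := csd.exists_bound_of_continuous cd
  obtain ⟨R, hR0, hR⟩ : ∃ R, 0 ≤ R ∧ ∀ ζ ∉ Metric.ball (0 : ℂ) R, dzb φ ζ = 0 := by
    obtain ⟨R, hR⟩ := csd.isCompact.isBounded.subset_ball (0 : ℂ)
    refine ⟨max R 0, le_max_right _ _, fun ζ hζ => ?_⟩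
    by_contra h
    exact hζ (Metric.ball_subset_ball (le_max_left _ _) (hR (subset_tsupport _ h)))
  have hM0 := (norm_nonneg _).trans (hM 0)
  -- the double integral converges absolutely
  have hprod : Integrable (fun q : ℂ × ℂ => f q.1 * (dzb φ q.2 * (q.1 - q.2)⁻¹))
      ((volume : Measure ℂ).prod volume) := by
    have hm : AEStronglyMeasurable (fun q : ℂ × ℂ => f q.1 * (dzb φ q.2 * (q.1 - q.2)⁻¹))
        ((volume : Measure ℂ).prod volume) := by
      refine hf.aestronglyMeasurable.comp_fst.mul (AEStronglyMeasurable.mul ?_ ?_)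
      · exact (cd.comp continuous_snd).aestronglyMeasurable
      · exact (measurable_fst.sub measurable_snd).inv.aestronglyMeasurable
    refine ⟨hm, ?_⟩
    rw [hasFiniteIntegral_iff_enorm, lintegral_prod _ hm.enorm]
    have h1 : ∀ w, ∫⁻ ζ, ‖f w * (dzb φ ζ * (w - ζ)⁻¹)‖ₑ ≤
        ‖f w‖ₑ * ENNReal.ofReal (M * (2 * Real.pi * (R + 1))) := by
      intro w
      simp only [enorm_mul (f w)]
      rw [lintegral_const_mul' _ _ enorm_ne_top]
      by_cases hw : w ∈ Metric.ball (0 : ℂ) 1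
      · gcongr
        refine lintegral_enorm_mul_inv_le (by linarith) hM w fun ζ hζ => hR ζ fun h => hζ ?_
        rw [Metric.mem_ball] at *
        calc dist ζ w ≤ dist ζ 0 + dist w 0 := dist_triangle_right _ _ _
          _ < R + 1 := add_lt_add h hw
      · simp [hf0 w hw]
    refine (lintegral_mono h1).trans_lt ?_
    rw [lintegral_mul_const' _ _ ENNReal.ofReal_ne_top]
    exact ENNReal.mul_lt_top hf.hasFiniteIntegral ENNReal.ofReal_lt_top
  have e1 : bt δ f z = ∫ w, f w * ((Real.pi : ℂ)⁻¹ * ∫ ζ, dzb φ ζ * (w - ζ)⁻¹) := by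
    have hpi : (Real.pi : ℂ) ≠ 0 := by exact_mod_cast Real.pi_ne_zero
    rw [bt]
    congr 1
    ext w
    by_cases hw : w ∈ Metric.ball (0 : ℂ) 1
    · rw [integral_dzb_mul_inv (cφ.of_le (by norm_num)) csφ w, ← mul_assoc (Real.pi : ℂ)⁻¹,
        inv_mul_cancel₀ hpi, one_mul, hφ]
      simp only [(hone w hw).eq_of_nhds, mul_one]
    · simp [hf0 w hw]
  have e2 : bt δ f z = (Real.pi : ℂ)⁻¹ * ∫ w, ∫ ζ, f w * (dzb φ ζ * (w - ζ)⁻¹) := by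
    rw [e1, ← integral_const_mul]
    congr 1
    ext w
    rw [integral_const_mul]
    ring
  rw [e2, integral_integral_swap hprod, ← integral_const_mul]
  refine integral_congr_ae ?_
  filter_upwards [hk] with ζ hζ
  have e3 : ∫ w, f w * (dzb φ ζ * (w - ζ)⁻¹) = -dzb φ ζ * ∫ w, f w * (ζ - w)⁻¹ := by
    rw [← integral_const_mul]
    congr 1
    ext w
    rw [← neg_sub ζ w, inv_neg]
    ring
  rw [e3]
  by_cases hζ1 : ζ ∈ Metric.ball (0 : ℂ) 1
  · have e4 : dzb φ ζ = -dz (pk δ) (z - ζ) := by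
      have : φ =ᶠ[𝓝 ζ] fun ζ => bk δ (z - ζ) := by
        filter_upwards [hone ζ hζ1] with w hw
        simp only [hφ, hw, mul_one]
      rw [dzb_congr this, dzb_sub_left _ _ ((contDiff_bk hδ (n := 1)).differentiable one_ne_zero _),
        dzb_bk hδ, dz_pk hδ]
    have hpi : (Real.pi : ℂ) ≠ 0 := by exact_mod_cast Real.pi_ne_zero
    rw [← hζ, e4]
    field_simp
  · rw [← hζ, hk0 ζ hζ1]
    simp

end

/-! ### The representation formula across the puncture -/

/-- The open unit disk without its centre. -/
abbrev pdisk : Set ℂ := Metric.ball (0 : ℂ) 1 \ {0}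

lemma isOpen_pdisk : IsOpen pdisk := Metric.isOpen_ball.sdiff isClosed_singleton

lemma setIntegral_ball_eq {g : ℂ → ℂ} (h : ∀ z ∉ Metric.ball (0 : ℂ) 1, g z = 0) :
    ∫ z in Metric.ball (0 : ℂ) 1, g z = ∫ z, g z :=
  setIntegral_eq_integral_of_forall_compl_eq_zero h

section

variable {u F : ℂ → ℂ}

lemma integrable_mul_of_integrableOn {g φ : ℂ → ℂ} {s : Set ℂ} (hg : IntegrableOn g s)
    (hφ : Continuous φ) (hc : HasCompactSupport φ) (ht : tsupport φ ⊆ s) :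
    Integrable fun z => g z * φ z := by
  obtain ⟨C, hC⟩ := hφ.bounded_above_of_compact_support hc
  have h : IntegrableOn (fun z => g z * φ z) s :=
    Integrable.mul_bdd hg hφ.aestronglyMeasurable (Eventually.of_forall hC)
  refine (integrableOn_iff_integrable_of_support_subset fun z hz => ht ?_).1 h
  exact subset_tsupport _ (right_ne_zero_of_mul hz)

/-- The equation tested with `φ`. Where `∂_{z̄} φ` vanishes near the origin, `Δ φ = 4 ∂_z ∂_{z̄} φ`
can be integrated by parts against `u`, although `u` may be singular at the origin. -/
lemma integral_dz_mul_dzb_of_isDistribSolution (hd : IsDistribSolution u F) {φ : ℂ → ℂ}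
    (hφ : ContDiff ℝ ∞ φ) (hc : HasCompactSupport φ) (hs : tsupport φ ⊆ Metric.ball 0 1)
    (hu : ContDiffOn ℝ 2 u pdisk) (hs' : tsupport (dzb φ) ⊆ pdisk) :
    ∫ z, dz u z * dzb φ z = -(1 / 4) * ∫ z, F z * φ z := by
  have h1 := hd.2.2 φ hφ hc hs
  have hφ0 : ∀ z ∉ Metric.ball (0 : ℂ) 1, φ z = 0 := fun z hz => by
    by_contra h
    exact hz (hs (subset_tsupport _ h))
  have hL : ∀ z, Laplacian.laplacian φ z = 4 * dz (dzb φ) z :=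
    laplacian_eq_four_mul_dz_dzb (mod_cast contDiff_infty.1 hφ 2)
  have hdz0 : ∀ z ∉ Metric.ball (0 : ℂ) 1, dz (dzb φ) z = 0 := fun z hz => by
    have : dzb φ =ᶠ[𝓝 z] fun _ => 0 :=
      notMem_tsupport_iff_eventuallyEq.1 fun h => hz (hs' h).1
    rw [dz_congr this]
    simp [dz]
  rw [setIntegral_ball_eq (fun z hz => by rw [hL, hdz0 z hz]; simp),
    setIntegral_ball_eq (fun z hz => by rw [hφ0 z hz]; simp)] at h1
  have cd : ContDiff ℝ 1 (dzb φ) := (show ContDiff ℝ 2 φ from mod_cast contDiff_infty.1 hφ 2).dzb (by norm_num)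
  have csd : HasCompactSupport (dzb φ) :=
    hc.mono' ((subset_tsupport _).trans (tsupport_dzb_subset φ))
  have h2 := integral_mul_dz_of_tsupport_subset isOpen_pdisk (hu.of_le (by norm_num)) cd csd hs'
  simp only [hL, mul_left_comm _ (4 : ℂ)] at h1
  rw [integral_const_mul] at h1
  rw [← h1, h2]
  ring

/-- Off the origin the equation holds classically. -/
lemma ae_dzb_dz_eq (hd : IsDistribSolution u F) (hu : ContDiffOn ℝ 2 u pdisk)
    (hF : IntegrableOn F (Metric.ball 0 1)) :
    ∀ᵐ z, z ∈ pdisk → 4 * dzb (dz u) z = F z := by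
  have hv : ContDiffOn ℝ 1 (dz u) pdisk := hu.dz isOpen_pdisk (by norm_num)
  have hw : ContDiffOn ℝ 0 (dzb (dz u)) pdisk := hv.dzb isOpen_pdisk (by norm_num)
  have hloc : LocallyIntegrableOn (fun z => 4 * dzb (dz u) z - F z) pdisk := by
    refine LocallyIntegrableOn.sub ?_ (hd.2.1.mono_set sdiff_subset)
    exact (continuousOn_const.mul hw.continuousOn).locallyIntegrableOn isOpen_pdisk.measurableSet
  have h := isOpen_pdisk.ae_eq_zero_of_integral_contDiff_smul_eq_zero hloc ?_
  · filter_upwards [h] with z hz hzp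
    exact sub_eq_zero.1 (hz hzp)
  intro g hg hgc hgs
  set φ : ℂ → ℂ := fun z => ((g z : ℝ) : ℂ) with hφ
  have cφ : ContDiff ℝ ∞ φ := Complex.ofRealCLM.contDiff.comp hg
  have csφ : HasCompactSupport φ := hgc.comp_left (g := fun x : ℝ => (x : ℂ)) Complex.ofReal_zero
  have hts : tsupport φ ⊆ pdisk := by
    refine Subset.trans (closure_mono fun ζ hζ => ?_) hgs
    simpa [hφ] using hζ
  have h1 := integral_dz_mul_dzb_of_isDistribSolution hd cφ csφ (hts.trans sdiff_subset) hu
    ((tsupport_dzb_subset φ).trans hts)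
  have h2 := integral_mul_dzb_of_tsupport_subset isOpen_pdisk hv (cφ.of_le (mod_cast le_top))
    csφ hts
  rw [h2] at h1
  have i1 : Integrable fun z => dzb (dz u) z * φ z :=
    integrable_mul_of_tsupport_subset isOpen_pdisk hw.continuousOn cφ.continuous csφ hts
  have i2 : Integrable fun z => F z * φ z :=
    integrable_mul_of_integrableOn hF cφ.continuous csφ (hts.trans sdiff_subset)
  have e : ∀ z, g z • (4 * dzb (dz u) z - F z) = 4 * (dzb (dz u) z * φ z) - F z * φ z := fun z => by
    rw [Complex.real_smul]; simp only [hφ]; ring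
  simp only [e]
  rw [integral_sub (i1.const_mul 4) i2, integral_const_mul]
  linear_combination (-4) * h1

/-- The Cauchy–Pompeiu formula for `z ^ m ψ u_z`, across the origin. The cutoff `ψ` has to be
constant near the origin. The classical formula applies outside a small disk about the origin, and
the contribution of that disk is computed by testing the equation with
`ζ ↦ η(ζ) ζ ^ m / (z - ζ)`, where `η` is a cutoff. -/
theorem integral_representation (hd : IsDistribSolution u F) (hu : ContDiffOn ℝ 2 u pdisk)
    (hF : IntegrableOn F (Metric.ball 0 1)) (m : ℕ) {ψ : ℂ → ℂ} (hψ : ContDiff ℝ 1 ψ)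
    (hψc : HasCompactSupport ψ) (hψs : tsupport ψ ⊆ Metric.ball 0 1) {c : ℂ}
    (hψ0 : ∀ᶠ ζ in 𝓝 0, ψ ζ = c) {z : ℂ} (hz : z ≠ 0) :
    Integrable (fun ζ => ζ ^ m * (ψ ζ * (F ζ / 4) + dzb ψ ζ * dz u ζ) * (z - ζ)⁻¹) ∧
    ∫ ζ, ζ ^ m * (ψ ζ * (F ζ / 4) + dzb ψ ζ * dz u ζ) * (z - ζ)⁻¹ =
      Real.pi * (z ^ m * (ψ z * dz u z)) := by
  have hv : ContDiffOn ℝ 1 (dz u) pdisk := hu.dz isOpen_pdisk (by norm_num)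
  have hw : ContDiffOn ℝ 0 (dzb (dz u)) pdisk := hv.dzb isOpen_pdisk (by norm_num)
  -- a small disk on which `ψ` is constant, and the cutoff `η`
  obtain ⟨t, ht0, ht⟩ : ∃ t > 0, Metric.ball (0 : ℂ) t ⊆ {ζ | ψ ζ = c} :=
    Metric.mem_nhds_iff.1 hψ0
  set s := min (min t ‖z‖) 1 with hs
  have hs0 : 0 < s := lt_min (lt_min ht0 (norm_pos_iff.2 hz)) one_pos
  have hst : s ≤ t := (min_le_left _ _).trans (min_le_left _ _)
  have hsz : s ≤ ‖z‖ := (min_le_left _ _).trans (min_le_right _ _)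
  have hs1 : s ≤ 1 := min_le_right _ _
  let θ : ContDiffBump (0 : ℂ) := ⟨s / 4, s / 2, by positivity, by linarith⟩
  set η : ℂ → ℂ := fun ζ => ((θ ζ : ℝ) : ℂ) with hη
  have cη : ContDiff ℝ ∞ η := Complex.ofRealCLM.contDiff.comp θ.contDiff
  have csη : HasCompactSupport η :=
    θ.hasCompactSupport.comp_left (g := fun x : ℝ => (x : ℂ)) Complex.ofReal_zero
  have htsη : tsupport η ⊆ Metric.closedBall 0 (s / 2) := by
    rw [← show tsupport θ = _ from θ.tsupport_eq]
    exact closure_mono fun ζ hζ => by simpa [hη] using hζ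
  have hball : Metric.closedBall (0 : ℂ) (s / 2) ⊆ Metric.ball 0 s :=
    Metric.closedBall_subset_ball (by linarith)
  have hη1 : ∀ ζ ∈ Metric.ball (0 : ℂ) (s / 4), η ζ = 1 := fun ζ hζ => by
    simp only [hη]
    rw [θ.one_of_mem_closedBall (Metric.ball_subset_closedBall hζ)]
    simp
  have hηz : η z = 0 := by
    have : z ∉ tsupport η := fun h => by
      have := hball (htsη h)
      rw [Metric.mem_ball, dist_zero_right] at this
      linarith
    exact image_eq_zero_of_notMem_tsupport this
  have hdη1 : ∀ ζ ∈ Metric.ball (0 : ℂ) (s / 4), dzb η ζ = 0 := fun ζ hζ => by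
    have : η =ᶠ[𝓝 ζ] fun _ => 1 := by
      filter_upwards [Metric.isOpen_ball.mem_nhds hζ] with w hw using hη1 w hw
    rw [dzb_congr this]
    simp [dzb]
  have hdηs : tsupport (dzb η) ⊆ pdisk := by
    intro ζ hζ
    have h1 := hball (htsη (tsupport_dzb_subset η hζ))
    refine ⟨Metric.ball_subset_ball hs1 h1, ?_⟩
    rintro (rfl : ζ = 0)
    have : dzb η =ᶠ[𝓝 0] fun _ => 0 := by
      filter_upwards [Metric.ball_mem_nhds (0 : ℂ) (show 0 < s / 4 by positivity)] with w hw
        using hdη1 w hw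
    exact notMem_tsupport_iff_eventuallyEq.2 this hζ
  -- the holomorphic factor
  set κ : ℂ → ℂ := fun ζ => ζ ^ m * (z - ζ)⁻¹ with hκ
  have hzo : IsOpen ({z}ᶜ : Set ℂ) := isOpen_compl_singleton
  have cκ : ContDiffOn ℝ ∞ κ {z}ᶜ := by
    refine (contDiff_id.pow m).contDiffOn.mul ((contDiff_const.sub contDiff_id).contDiffOn.inv ?_)
    intro ζ hζ h
    exact hζ (sub_eq_zero.1 h).symm
  have htsz : tsupport η ⊆ {z}ᶜ := fun ζ hζ (h : ζ = z) => by
    have := hball (htsη hζ)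
    rw [Metric.mem_ball, dist_zero_right, h] at this
    linarith
  set φ : ℂ → ℂ := fun ζ => κ ζ * η ζ with hφ
  have cφ : ContDiff ℝ ∞ φ := contDiff_mul_of_tsupport_subset hzo cκ cη htsz
  have csφ : HasCompactSupport φ := csη.mul_left
  have htsφ : tsupport φ ⊆ tsupport η := closure_mono fun ζ hζ h => hζ (by simp [hφ, h])
  have hdφ : ∀ ζ, dzb φ ζ = κ ζ * dzb η ζ := by
    intro ζ
    by_cases hζ : ζ ∈ tsupport η
    · have hζz : z - ζ ≠ 0 := sub_ne_zero.2 (Ne.symm (htsz hζ))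
      have hd1 : HasDerivAt κ _ ζ :=
        (hasDerivAt_pow m ζ).mul (((hasDerivAt_id ζ).const_sub z).inv hζz)
      rw [hφ, dzb_mul ((cκ.contDiffAt (hzo.mem_nhds (htsz hζ))).differentiableAt (by simp))
        (cη.differentiable (by simp) ζ), hd1.dzb_eq]
      ring
    · rw [dzb_eq_zero_of_notMem_tsupport fun h => hζ (htsφ h),
        dzb_eq_zero_of_notMem_tsupport hζ, mul_zero]
  have hdφs : tsupport (dzb φ) ⊆ pdisk := by
    refine Subset.trans (closure_mono (show Function.support (dzb φ) ⊆ Function.support (dzb η)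
      from fun ζ hζ h => hζ ?_)) hdηs
    rw [hdφ, h, mul_zero]
  have hballη : tsupport η ⊆ Metric.ball 0 1 :=
    htsη.trans (hball.trans (Metric.ball_subset_ball hs1))
  have htest := integral_dz_mul_dzb_of_isDistribSolution hd cφ csφ (htsφ.trans hballη) hu hdφs
  -- the Cauchy–Pompeiu formula away from the origin
  set G : ℂ → ℂ := fun ζ => ζ ^ m * (ψ ζ * (1 - η ζ)) with hG
  have cη1 : ContDiff ℝ 1 η := cη.of_le (mod_cast le_top)
  have cG : ContDiff ℝ 1 G := (contDiff_id.pow m).mul (hψ.mul (contDiff_const.sub cη1))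
  have hGψ : tsupport G ⊆ tsupport ψ := closure_mono fun ζ hζ h => hζ (by simp [hG, h])
  have csG : HasCompactSupport G := hψc.mono' ((subset_tsupport _).trans hGψ)
  have htsG : tsupport G ⊆ pdisk := by
    intro ζ hζ
    refine ⟨hψs (hGψ hζ), ?_⟩
    rintro (rfl : ζ = 0)
    have : G =ᶠ[𝓝 0] fun _ => 0 := by
      filter_upwards [Metric.ball_mem_nhds (0 : ℂ) (show 0 < s / 4 by positivity)] with w hw
      simp [hG, hη1 w hw]
    exact notMem_tsupport_iff_eventuallyEq.2 this hζ
  set g : ℂ → ℂ := fun ζ => dz u ζ * G ζ with hg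
  have cg : ContDiff ℝ 1 g := contDiff_mul_of_tsupport_subset isOpen_pdisk hv cG htsG
  have csg : HasCompactSupport g := csG.mul_left
  have hCP := integral_dzb_mul_inv cg csg z
  have iCP : Integrable fun ζ => dzb g ζ * (z - ζ)⁻¹ := by
    refine integrable_inv_mul (cg.dzb (m := 0) (by norm_num)).continuous ?_ z
    exact csg.mono' ((subset_tsupport _).trans (tsupport_dzb_subset g))
  have i2 : Integrable fun ζ => F ζ * φ ζ :=
    integrable_mul_of_integrableOn hF cφ.continuous csφ (htsφ.trans hballη)
  have i3 : Integrable fun ζ => dz u ζ * dzb φ ζ :=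
    integrable_mul_of_tsupport_subset isOpen_pdisk hv.continuousOn
      (cφ.dzb (m := 0) (by simp)).continuous
      (csφ.mono' ((subset_tsupport _).trans (tsupport_dzb_subset φ))) hdφs
  have hae : ∀ᵐ ζ, ζ ^ m * (ψ ζ * (F ζ / 4) + dzb ψ ζ * dz u ζ) * (z - ζ)⁻¹ =
      dzb g ζ * (z - ζ)⁻¹ + (c / 4 * (F ζ * φ ζ) + c * (dz u ζ * dzb φ ζ)) := by
    filter_upwards [ae_dzb_dz_eq hd hu hF, compl_mem_ae_iff.2 (measure_singleton (0 : ℂ))] with ζ hF hζ0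
    have hηball : ζ ∉ Metric.ball (0 : ℂ) s → η ζ = 0 ∧ dzb η ζ = 0 := fun h => by
      have h' : ζ ∉ tsupport η := fun h' => h (hball (htsη h'))
      exact ⟨image_eq_zero_of_notMem_tsupport h', dzb_eq_zero_of_notMem_tsupport h'⟩
    have hψη : ψ ζ * η ζ = c * η ζ ∧ ψ ζ * dzb η ζ = c * dzb η ζ ∧ dzb ψ ζ * η ζ = 0 := by
      by_cases h : ζ ∈ Metric.ball (0 : ℂ) s
      · have h1 : ψ ζ = c := ht (Metric.ball_subset_ball hst h)
        have h2 : ψ =ᶠ[𝓝 ζ] fun _ => c := by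
          filter_upwards [Metric.isOpen_ball.mem_nhds h] with w hw
            using ht (Metric.ball_subset_ball hst hw)
        refine ⟨by rw [h1], by rw [h1], ?_⟩
        rw [dzb_congr h2]
        simp [dzb]
      · obtain ⟨h1, h2⟩ := hηball h
        simp [h1, h2]
    by_cases hζ : ζ ∈ Metric.ball (0 : ℂ) 1
    · have hζp : ζ ∈ pdisk := ⟨hζ, hζ0⟩
      have dv : DifferentiableAt ℝ (dz u) ζ :=
        (hv.contDiffAt (isOpen_pdisk.mem_nhds hζp)).differentiableAt one_ne_zero
      have dψ := hψ.differentiable one_ne_zero ζ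
      have dη := cη1.differentiable one_ne_zero ζ
      have dη' : DifferentiableAt ℝ (fun ζ => 1 - η ζ) ζ := dη.const_sub 1
      have e1 : dzb (fun ζ => 1 - η ζ) ζ = -dzb η ζ := by
        rw [dzb_sub (differentiableAt_const _) dη]
        simp [dzb]
      have e2 : dzb g ζ = dzb (dz u) ζ * G ζ +
          dz u ζ * (ζ ^ m * (dzb ψ ζ * (1 - η ζ) - ψ ζ * dzb η ζ)) := by
        rw [hg, dzb_mul dv (cG.differentiable one_ne_zero ζ), hG,
          dzb_mul (u := fun ζ => ζ ^ m) (w := fun ζ => ψ ζ * (1 - η ζ))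
            (differentiableAt_pow m) (dψ.mul dη'), dzb_mul dψ dη', e1,
          (hasDerivAt_pow m ζ).dzb_eq]
        ring
      rw [e2, hdφ, ← hF hζp]
      simp only [hG, hφ, hκ]
      obtain ⟨h1, h2, h3⟩ := hψη
      linear_combination (ζ ^ m * (z - ζ)⁻¹ * dzb (dz u) ζ) * h1 +
        (ζ ^ m * (z - ζ)⁻¹ * dz u ζ) * h2 + (ζ ^ m * (z - ζ)⁻¹ * dz u ζ) * h3
    · have h1 : ψ ζ = 0 := image_eq_zero_of_notMem_tsupport fun h => hζ (hψs h)
      have h2 : dzb ψ ζ = 0 := dzb_eq_zero_of_notMem_tsupport fun h => hζ (hψs h)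
      have h3 : dzb g ζ = 0 := dzb_eq_zero_of_notMem_tsupport fun h => by
        have : tsupport g ⊆ tsupport G := closure_mono fun ζ hζ h => hζ (by simp [hg, h])
        exact hζ (htsG (this h)).1
      obtain ⟨h4, h5⟩ := hηball fun h => hζ (Metric.ball_subset_ball hs1 h)
      rw [h1, h2, h3, hdφ, h5]
      simp [hφ, h4]
  have i4 : Integrable fun ζ => c / 4 * (F ζ * φ ζ) + c * (dz u ζ * dzb φ ζ) :=
    (i2.const_mul (c / 4)).add (i3.const_mul c)
  have iR := iCP.add i4
  refine ⟨iR.congr ?_, ?_⟩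
  · filter_upwards [hae] with ζ hζ using hζ.symm
  · rw [integral_congr_ae hae, integral_add iCP i4,
      integral_add (i2.const_mul _) (i3.const_mul _), integral_const_mul, integral_const_mul,
      htest, hCP]
    simp only [hg, hG, hηz]
    ring

end

/-! ### Weighted estimates of the Cauchy kernel -/

lemma chi_pos {ε : ℝ} (hε : 0 < ε) (z : ℂ) : 0 < chi ε z :=
  Real.sqrt_pos.2 (by positivity)

lemma le_chi (ε : ℝ) (z : ℂ) : ε ≤ chi ε z :=
  Real.le_sqrt_of_sq_le (by nlinarith [sq_nonneg ‖z‖])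

lemma norm_le_chi (ε : ℝ) (z : ℂ) : ‖z‖ ≤ chi ε z :=
  Real.le_sqrt_of_sq_le (by nlinarith [sq_nonneg ε])

lemma chi_sq (ε : ℝ) (z : ℂ) : chi ε z ^ 2 = ε ^ 2 + ‖z‖ ^ 2 :=
  Real.sq_sqrt (by positivity)

lemma chi_le_add {ε : ℝ} (hε : 0 < ε) (z : ℂ) : chi ε z ≤ ε + ‖z‖ := by
  refine Real.sqrt_le_iff.2 ⟨by positivity, ?_⟩
  nlinarith [norm_nonneg z]

lemma chi_le_chi_add {ε : ℝ} (hε : 0 < ε) (z w : ℂ) : chi ε w ≤ chi ε z + ‖z - w‖ := by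
  have h1 := norm_le_chi ε z
  have h2 : ‖w‖ ≤ ‖z‖ + ‖z - w‖ := by
    have := norm_sub_le z (z - w)
    rwa [sub_sub_cancel] at this
  have h3 := chi_sq ε z
  have h4 := chi_pos hε z
  refine Real.sqrt_le_iff.2 ⟨by positivity, ?_⟩
  nlinarith [norm_nonneg w, norm_nonneg (z - w), norm_nonneg z,
    mul_le_mul_of_nonneg_right h1 (norm_nonneg (z - w))]

lemma contDiff_chi {ε : ℝ} (hε : 0 < ε) {n : ℕ∞} : ContDiff ℝ n (chi ε) := by
  refine ContDiff.sqrt (contDiff_const.add (contDiff_norm_sq ℝ)) fun z => ?_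
  positivity

lemma continuous_chi {ε : ℝ} (hε : 0 < ε) : Continuous (chi ε) :=
  (contDiff_chi hε (n := 0)).continuous

lemma contDiff_chi_rpow {ε : ℝ} (hε : 0 < ε) (a : ℝ) {n : ℕ∞} :
    ContDiff ℝ n fun z => chi ε z ^ a :=
  (contDiff_chi hε).rpow_const_of_ne fun z => (chi_pos hε z).ne'

lemma measurable_chi_rpow {ε : ℝ} (hε : 0 < ε) (a : ℝ) : Measurable fun z => chi ε z ^ a :=
  (contDiff_chi_rpow hε a (n := 0)).continuous.measurable

lemma two_div_toReal_mem {p : ℝ≥0∞} (hp : 2 ≤ p) : 2 / p.toReal ∈ Icc (0 : ℝ) 1 := by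
  refine ⟨by positivity, ?_⟩
  rcases eq_or_ne p ∞ with rfl | h
  · simp
  · have : (2 : ℝ) ≤ p.toReal := by
      simpa using ENNReal.toReal_mono h hp
    rw [div_le_one (by linarith)]
    exact this

lemma two_div_toReal_lt {p : ℝ≥0∞} (hp : 2 < p) : 2 / p.toReal < 1 := by
  rcases eq_or_ne p ∞ with rfl | h
  · simp
  · have : (2 : ℝ) < p.toReal := by
      simpa using (ENNReal.toReal_lt_toReal (by simp) h).2 hp
    rw [div_lt_one (by linarith)]
    exact this

/-- Hölder's inequality, with the conjugate exponent of `p` written as `2 / (2 - 2 / p)`. -/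
lemma lintegral_enorm_mul_le {p : ℝ≥0∞} (hp : 2 ≤ p) {f : ℂ → ℂ} (hf : AEStronglyMeasurable f)
    {g : ℂ → ℝ≥0∞} (hg : AEMeasurable g) {r : ℝ} (hr : r = 2 / (2 - 2 / p.toReal)) :
    ∫⁻ z, ‖f z‖ₑ * g z ≤ eLpNorm f p volume * (∫⁻ z, g z ^ r) ^ (1 / r) := by
  rcases eq_or_ne p ∞ with rfl | h
  · have : r = 1 := by rw [hr]; norm_num
    simp only [this, ENNReal.rpow_one, div_one, eLpNorm_exponent_top]
    rw [← lintegral_const_mul'' _ hg]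
    refine lintegral_mono_ae ?_
    filter_upwards [enorm_ae_le_eLpNormEssSup f volume] with z hz
    gcongr
  · have hP : (2 : ℝ) ≤ p.toReal := by
      simpa using ENNReal.toReal_mono h hp
    have hr' : r = p.toReal / (p.toReal - 1) := by
      have h1 : p.toReal - 1 ≠ 0 := by linarith
      have h2 : p.toReal ≠ 0 := by linarith
      have h3 : 2 - 2 / p.toReal = 2 * (p.toReal - 1) / p.toReal := by field_simp
      rw [hr, h3]
      field_simp
    have hc : p.toReal.HolderConjugate r := by
      rw [Real.holderConjugate_iff, hr']
      refine ⟨by linarith, ?_⟩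
      have h1 : p.toReal - 1 ≠ 0 := by linarith
      have h2 : p.toReal ≠ 0 := by linarith
      field_simp
      ring
    have hp0 : p ≠ 0 := by
      rintro rfl
      simp at hp
    rw [eLpNorm_eq_lintegral_rpow_enorm_toReal hp0 h]
    exact ENNReal.lintegral_mul_le_Lp_mul_Lq volume hc hf.enorm hg

lemma eq_indicator_ball {f : ℂ → ℂ} (h0 : ∀ z ∉ Metric.ball (0 : ℂ) 1, f z = 0) (z : ℂ)
    (g : ℝ≥0∞) : ‖f z‖ₑ * g = ‖f z‖ₑ * (Metric.ball (0 : ℂ) 1).indicator (fun _ => g) z := by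
  by_cases h : z ∈ Metric.ball (0 : ℂ) 1
  · rw [indicator_of_mem h]
  · simp [h0 z h]

/-- The weights integrable against `L ^ p`: `χ ^ (2 / p - 2 + υ)` lies in the dual space,
uniformly in `ε`. -/
lemma exists_lintegral_mul_chi_rpow_le {p : ℝ≥0∞} (hp : 2 ≤ p) {υ : ℝ} (h0 : 0 < υ)
    (h2 : υ ≤ 2 - 2 / p.toReal) :
    ∃ C, 0 ≤ C ∧ ∀ ε > 0, ∀ f : ℂ → ℂ, AEStronglyMeasurable f →
      (∀ z ∉ Metric.ball (0 : ℂ) 1, f z = 0) →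
      ∫⁻ z, ‖f z‖ₑ * ENNReal.ofReal (chi ε z ^ (2 / p.toReal - 2 + υ)) ≤
        ENNReal.ofReal C * eLpNorm f p volume := by
  obtain ⟨hb0, hb1⟩ := two_div_toReal_mem hp
  set b := 2 / p.toReal with hb
  set r := 2 / (2 - b) with hr
  have hr0 : 0 < r := by rw [hr]; apply div_pos <;> linarith
  have e1 : (b - 2 + υ) * r = -2 + υ * r := by
    rw [hr]
    have : 2 - b ≠ 0 := by linarith
    field_simp
    ring
  refine ⟨(2 * Real.pi * (1 / (υ * r))) ^ (1 / r), by positivity, fun ε hε f hf hf0 => ?_⟩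
  have hm : Measurable fun z => ENNReal.ofReal (chi ε z ^ (b - 2 + υ)) :=
    (measurable_chi_rpow hε _).ennreal_ofReal
  have hind : ∀ z, ‖f z‖ₑ * ENNReal.ofReal (chi ε z ^ (b - 2 + υ)) = ‖f z‖ₑ *
      (Metric.ball (0 : ℂ) 1).indicator (fun z => ENNReal.ofReal (chi ε z ^ (b - 2 + υ))) z := by
    intro z
    rw [eq_indicator_ball hf0]
    rfl
  simp only [hind]
  refine (lintegral_enorm_mul_le hp hf
    (hm.indicator Metric.isOpen_ball.measurableSet).aemeasurable hr).trans ?_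
  rw [mul_comm]
  gcongr
  rw [← ENNReal.ofReal_rpow_of_nonneg (by positivity) (by positivity)]
  gcongr
  have e2 := lintegral_ball_rpow (s := -2 + υ * r) (R := 1) (by nlinarith [mul_pos h0 hr0])
    zero_le_one
  rw [Real.one_rpow, show -2 + υ * r + 2 = υ * r by ring] at e2
  rw [← e2, ← lintegral_indicator Metric.isOpen_ball.measurableSet]
  refine lintegral_mono_ae ?_
  filter_upwards [compl_mem_ae_iff.2 (measure_singleton (0 : ℂ))] with z hz
  have hz0 : 0 < ‖z‖ := norm_pos_iff.2 hz
  by_cases h : z ∈ Metric.ball (0 : ℂ) 1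
  · rw [indicator_of_mem h, indicator_of_mem h,
      ENNReal.ofReal_rpow_of_nonneg (Real.rpow_nonneg (chi_pos hε z).le _) hr0.le,
      ← Real.rpow_mul (chi_pos hε z).le, e1]
    refine ENNReal.ofReal_le_ofReal (Real.rpow_le_rpow_of_nonpos hz0 (norm_le_chi ε z) ?_)
    rw [← e1]
    exact mul_nonpos_of_nonpos_of_nonneg (by linarith) hr0.le
  · rw [indicator_of_notMem h, indicator_of_notMem h, ENNReal.zero_rpow_of_pos hr0]

/-- The weighted Cauchy potential `∫ χ ^ β |f| / |z - ζ|`. -/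
noncomputable def cpot (ε β : ℝ) (f : ℂ → ℂ) (z : ℂ) : ℝ≥0∞ :=
  ∫⁻ ζ, ‖f ζ‖ₑ * ENNReal.ofReal (chi ε ζ ^ β) * ENNReal.ofReal (‖z - ζ‖⁻¹)

/-- The mean of `1 / |z - ζ|` over a disk of radius `T` about the origin. -/
lemma lintegral_ball_inv_norm_sub_le {ε T : ℝ} (hε : 0 < ε) (hT : ε ≤ T) (ζ : ℂ) :
    ∫⁻ z in Metric.closedBall (0 : ℂ) T, ENNReal.ofReal (‖z - ζ‖⁻¹) ≤
      ENNReal.ofReal (24 * Real.pi * T ^ 2 / max T (chi ε ζ)) := by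
  have hT0 := hε.trans_le hT
  have hχ := chi_le_add hε ζ
  have hπ := Real.pi_pos
  rcases le_or_gt ‖ζ‖ (2 * T) with h | h
  · have hsub : Metric.closedBall (0 : ℂ) T ⊆ Metric.ball ζ (4 * T) := fun z hz => by
      rw [mem_closedBall_zero_iff] at hz
      rw [Metric.mem_ball, dist_eq_norm]
      linarith [norm_sub_le z ζ]
    refine (lintegral_mono_set hsub).trans ?_
    rw [lintegral_ball_inv_norm (by positivity)]
    refine ENNReal.ofReal_le_ofReal ?_
    rw [le_div_iff₀ (by positivity)]
    have : max T (chi ε ζ) ≤ 3 * T := max_le (by linarith) (by linarith)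
    nlinarith [mul_le_mul_of_nonneg_left this (show 0 ≤ Real.pi * T by positivity)]
  · have hb : ∀ z ∈ Metric.closedBall (0 : ℂ) T,
        ENNReal.ofReal (‖z - ζ‖⁻¹) ≤ ENNReal.ofReal (2 / ‖ζ‖) := fun z hz => by
      rw [mem_closedBall_zero_iff] at hz
      refine ENNReal.ofReal_le_ofReal ?_
      have h1 : ‖ζ‖ ≤ 2 * ‖z - ζ‖ := by
        have := norm_sub_norm_le ζ z
        rw [norm_sub_rev] at this
        linarith
      rw [inv_eq_one_div, div_le_div_iff₀ (by linarith) (by linarith)]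
      linarith
    refine (setLIntegral_mono measurable_const hb).trans ?_
    rw [setLIntegral_const, Complex.volume_closedBall, ← ENNReal.ofReal_pow hT0.le,
      ← ENNReal.ofReal_coe_nnreal, ← ENNReal.ofReal_mul (by positivity),
      ← ENNReal.ofReal_mul (by positivity)]
    refine ENNReal.ofReal_le_ofReal ?_
    have : max T (chi ε ζ) ≤ 2 * ‖ζ‖ := max_le (by linarith) (by linarith)
    rw [NNReal.coe_real_pi, div_mul_eq_mul_div, div_le_div_iff₀ (by linarith) (by positivity)]
    nlinarith [mul_le_mul_of_nonneg_left this (show 0 ≤ Real.pi * T ^ 2 by positivity),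
      mul_pos (mul_pos hπ (pow_pos hT0 2)) (show 0 < ‖ζ‖ by linarith)]

lemma rpow_div_max_le {x y β τ : ℝ} (hx : 0 < x) (hy : 0 < y) (h0 : 0 ≤ τ) (h1 : τ ≤ 1) :
    x ^ β / max y x ≤ y ^ (τ - 1) * x ^ (β - τ) := by
  have hm : 0 < max y x := lt_max_of_lt_left hy
  have e : max y x = max y x ^ τ * max y x ^ (1 - τ) := by
    rw [← Real.rpow_add hm]; norm_num
  have h2 : x ^ τ * y ^ (1 - τ) ≤ max y x := by
    rw [e]
    have h3 : 0 ≤ 1 - τ := by linarith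
    gcongr
    · exact le_max_right _ _
    · exact le_max_left _ _
  rw [div_le_iff₀ hm]
  calc x ^ β = y ^ (τ - 1) * x ^ (β - τ) * (x ^ τ * y ^ (1 - τ)) := by
        rw [show y ^ (τ - 1) * x ^ (β - τ) * (x ^ τ * y ^ (1 - τ)) =
          (y ^ (τ - 1) * y ^ (1 - τ)) * (x ^ (β - τ) * x ^ τ) by ring, ← Real.rpow_add hy,
          ← Real.rpow_add hx]
        simp
    _ ≤ _ := by gcongr

/-- The integral of the potential over `{|z| ≤ T}`. -/
lemma exists_setLIntegral_cpot_le {p : ℝ≥0∞} (hp : 2 ≤ p) {β : ℝ}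
    (h2 : β - 2 / p.toReal ≤ -1) {υ : ℝ} (h0 : 0 < υ) (hυ : υ ≤ β - 2 / p.toReal + 2) :
    ∃ C, 0 ≤ C ∧ ∀ ε > 0, ∀ T, ε ≤ T → ∀ f : ℂ → ℂ, AEStronglyMeasurable f →
      (∀ z ∉ Metric.ball (0 : ℂ) 1, f z = 0) →
      ∫⁻ z in Metric.closedBall 0 T, cpot ε β f z ≤
        ENNReal.ofReal (C * T ^ (β + 3 - 2 / p.toReal - υ)) * eLpNorm f p volume := by
  obtain ⟨hb0, hb1⟩ := two_div_toReal_mem hp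
  obtain ⟨C, hC0, hC⟩ := exists_lintegral_mul_chi_rpow_le hp h0 (by linarith)
  set b := 2 / p.toReal with hb
  refine ⟨24 * Real.pi * C, by positivity, fun ε hε T hT f hf hf0 => ?_⟩
  have hT0 := hε.trans_le hT
  have hπ := Real.pi_pos
  -- the share of the decay of the kernel that is taken up by `T`, the rest going to `χ(ζ)`
  set τ := β - b + 2 - υ with hτ
  have hm1 : AEMeasurable (fun ζ => ‖f ζ‖ₑ * ENNReal.ofReal (chi ε ζ ^ β)) :=
    hf.enorm.mul (measurable_chi_rpow hε _).ennreal_ofReal.aemeasurable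
  have hmk : Measurable fun q : ℂ × ℂ => ENNReal.ofReal (‖q.1 - q.2‖⁻¹) :=
    (measurable_fst.sub measurable_snd).norm.inv.ennreal_ofReal
  simp only [cpot]
  rw [lintegral_lintegral_swap ((hm1.comp_snd).mul hmk.aemeasurable)]
  calc ∫⁻ ζ, ∫⁻ z in Metric.closedBall 0 T,
        ‖f ζ‖ₑ * ENNReal.ofReal (chi ε ζ ^ β) * ENNReal.ofReal (‖z - ζ‖⁻¹)
      ≤ ∫⁻ ζ, ENNReal.ofReal (24 * Real.pi * T ^ 2 * T ^ (τ - 1)) *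
          (‖f ζ‖ₑ * ENNReal.ofReal (chi ε ζ ^ (b - 2 + υ))) := by
        refine lintegral_mono fun ζ => ?_
        rw [lintegral_const_mul _ (by fun_prop)]
        refine (mul_le_mul_right (lintegral_ball_inv_norm_sub_le hε hT ζ) _).trans ?_
        rw [mul_assoc, mul_left_comm (ENNReal.ofReal (24 * _ * _ * _))]
        refine mul_le_mul_right ?_ _
        have hχ := chi_pos hε ζ
        rw [← ENNReal.ofReal_mul (by positivity), ← ENNReal.ofReal_mul (by positivity)]
        refine ENNReal.ofReal_le_ofReal ?_
        have := rpow_div_max_le (β := β) hχ hT0 (τ := τ) (by linarith) (by linarith)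
        rw [show β - τ = b - 2 + υ by rw [hτ]; ring] at this
        calc _ = 24 * Real.pi * T ^ 2 * (chi ε ζ ^ β / max T (chi ε ζ)) := by ring
          _ ≤ 24 * Real.pi * T ^ 2 * (T ^ (τ - 1) * chi ε ζ ^ (b - 2 + υ)) := by gcongr
          _ = _ := by ring
    _ ≤ ENNReal.ofReal (24 * Real.pi * T ^ 2 * T ^ (τ - 1)) *
          (ENNReal.ofReal C * eLpNorm f p volume) := by
        rw [lintegral_const_mul' _ _ ENNReal.ofReal_ne_top]
        gcongr
        exact hC ε hε f hf hf0
    _ = _ := by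
        rw [← mul_assoc, ← ENNReal.ofReal_mul (by positivity)]
        congr 2
        rw [show β + 3 - b - υ = 2 + (τ - 1) by rw [hτ]; ring, Real.rpow_add hT0, Real.rpow_two]
        ring

/-- The pointwise bound of the potential for `p > 2`: the part near `z` is estimated by Hölder's
inequality on a disk where `χ` is comparable with `χ(z)`. -/
lemma exists_cpot_le {p : ℝ≥0∞} (hp : 2 < p) {β : ℝ}
    (h2 : β - 2 / p.toReal ≤ -1) {υ : ℝ} (h0 : 0 < υ) (hυ : υ ≤ β - 2 / p.toReal + 2) {X : ℝ}
    (hX : 0 ≤ X) :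
    ∃ C, 0 ≤ C ∧ ∀ ε > 0, ∀ f : ℂ → ℂ, AEStronglyMeasurable f →
      (∀ z ∉ Metric.ball (0 : ℂ) 1, f z = 0) → ∀ z, chi ε z ≤ X →
      cpot ε β f z ≤
        ENNReal.ofReal (C * chi ε z ^ (β + 1 - 2 / p.toReal - υ)) * eLpNorm f p volume := by
  obtain ⟨hb0, hb1⟩ := two_div_toReal_mem hp.le
  have hb1' := two_div_toReal_lt hp
  obtain ⟨C, hC0, hC⟩ := exists_lintegral_mul_chi_rpow_le hp.le h0 (by linarith)
  set b := 2 / p.toReal with hb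
  -- `r` is the exponent conjugate to `p`; as `p > 2`, `1 / |ζ|` is locally in `L ^ r`
  set r := 2 / (2 - b) with hr
  have hr0 : 0 < r := by rw [hr]; apply div_pos <;> linarith
  have hr2 : 0 < 2 - r := by
    rw [hr, sub_pos, div_lt_iff₀ (by linarith)]; linarith
  have hrb : 1 / r = 1 - b / 2 := by
    rw [hr, one_div_div]; ring
  set τ := β - b + 2 - υ with hτ
  set C1 := (2 * Real.pi * ((1 / 4 : ℝ) ^ (2 - r) / (2 - r))) ^ (1 / r) with hC1d
  have hC1 : 0 ≤ C1 := by positivity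
  refine ⟨(3 / 4) ^ β * C1 * X ^ υ + 5 * C, by positivity, fun ε hε f hf hf0 z hzX => ?_⟩
  have hχ := chi_pos hε z
  set R := chi ε z / 4 with hR
  have hR0 : 0 < R := by positivity
  set B := Metric.ball z R with hB
  have hmk : Measurable fun ζ : ℂ => B.indicator (fun ζ => ENNReal.ofReal (‖z - ζ‖⁻¹)) ζ :=
    Measurable.indicator (by fun_prop) Metric.isOpen_ball.measurableSet
  have hmχ : Measurable fun ζ => ENNReal.ofReal (chi ε ζ ^ (b - 2 + υ)) :=
    (measurable_chi_rpow hε _).ennreal_ofReal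
  -- inside `B` the weight is comparable with `χ(z) ^ β`, and outside the distance `|z - ζ|` is at
  -- least a fifth of `max (χ z) (χ ζ)`
  have hpt : ∀ ζ, ‖f ζ‖ₑ * ENNReal.ofReal (chi ε ζ ^ β) * ENNReal.ofReal (‖z - ζ‖⁻¹) ≤
      ENNReal.ofReal ((3 / 4) ^ β * chi ε z ^ β) *
        (‖f ζ‖ₑ * B.indicator (fun ζ => ENNReal.ofReal (‖z - ζ‖⁻¹)) ζ) +
      ENNReal.ofReal (5 * chi ε z ^ (τ - 1)) *
        (‖f ζ‖ₑ * ENNReal.ofReal (chi ε ζ ^ (b - 2 + υ))) := by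
    intro ζ
    have hχζ := chi_pos hε ζ
    by_cases h : ζ ∈ B
    · refine le_add_right ?_
      rw [indicator_of_mem h, mul_assoc, mul_left_comm (ENNReal.ofReal ((3 / 4) ^ β * _))]
      refine mul_le_mul_right (mul_le_mul_left (ENNReal.ofReal_le_ofReal ?_) _) _
      rw [← Real.mul_rpow (by norm_num) hχ.le]
      refine Real.rpow_le_rpow_of_nonpos (by positivity) ?_ (by linarith)
      rw [hB, Metric.mem_ball, dist_eq_norm] at h
      have := chi_le_chi_add hε ζ z
      linarith
    · refine le_add_left ?_
      rw [mul_assoc, mul_left_comm (ENNReal.ofReal (5 * _))]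
      refine mul_le_mul_right ?_ _
      rw [← ENNReal.ofReal_mul (by positivity), ← ENNReal.ofReal_mul (by positivity)]
      refine ENNReal.ofReal_le_ofReal ?_
      rw [hB, Metric.mem_ball, dist_eq_norm, not_lt, norm_sub_rev] at h
      have h3 := chi_le_chi_add hε z ζ
      have h4 : max (chi ε z) (chi ε ζ) ≤ 5 * ‖z - ζ‖ := max_le (by linarith) (by linarith)
      have h5 := rpow_div_max_le (β := β) hχζ hχ (τ := τ) (by linarith) (by linarith)
      rw [show β - τ = b - 2 + υ by rw [hτ]; ring] at h5
      have h6 : ‖z - ζ‖⁻¹ ≤ 5 / max (chi ε z) (chi ε ζ) := by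
        rw [inv_eq_one_div, div_le_div_iff₀ (by linarith) (lt_max_of_lt_left hχ)]
        linarith
      calc chi ε ζ ^ β * ‖z - ζ‖⁻¹ ≤ chi ε ζ ^ β * (5 / max (chi ε z) (chi ε ζ)) := by gcongr
        _ = 5 * (chi ε ζ ^ β / max (chi ε z) (chi ε ζ)) := by ring
        _ ≤ 5 * (chi ε z ^ (τ - 1) * chi ε ζ ^ (b - 2 + υ)) := by gcongr
        _ = _ := by ring
  have hnear : ∫⁻ ζ, (B.indicator (fun ζ => ENNReal.ofReal (‖z - ζ‖⁻¹)) ζ) ^ r =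
      ENNReal.ofReal (2 * Real.pi * (R ^ (2 - r) / (2 - r))) := by
    have e := lintegral_ball_rpow (s := -r) (by linarith) hR0.le
    rw [show -r + 2 = 2 - r by ring] at e
    rw [← e, ← lintegral_indicator Metric.isOpen_ball.measurableSet,
      ← lintegral_sub_left_eq_self _ z]
    refine lintegral_congr_ae ?_
    filter_upwards [compl_mem_ae_iff.2 (measure_singleton (0 : ℂ))] with ζ hζ
    have hmem : z - ζ ∈ B ↔ ζ ∈ Metric.ball (0 : ℂ) R := by
      simp [hB, dist_eq_norm]
    by_cases h : ζ ∈ Metric.ball (0 : ℂ) R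
    · rw [indicator_of_mem h, indicator_of_mem (hmem.2 h), sub_sub_cancel,
        ENNReal.ofReal_rpow_of_nonneg (by positivity) hr0.le, Real.inv_rpow (norm_nonneg _),
        Real.rpow_neg (norm_nonneg _)]
    · rw [indicator_of_notMem h, indicator_of_notMem (fun h' => h (hmem.1 h')),
        ENNReal.zero_rpow_of_pos hr0]
  have hnear' : (∫⁻ ζ, (B.indicator (fun ζ => ENNReal.ofReal (‖z - ζ‖⁻¹)) ζ) ^ r) ^ (1 / r) =
      ENNReal.ofReal (C1 * chi ε z ^ (1 - b)) := by
    rw [hnear, ENNReal.ofReal_rpow_of_nonneg (by positivity) (by positivity), hC1d]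
    congr 1
    have e1 : chi ε z ^ (1 - b) = (chi ε z ^ (2 - r)) ^ (1 / r) := by
      rw [← Real.rpow_mul hχ.le, sub_mul, mul_one_div_cancel hr0.ne', hrb]
      congr 1
      ring
    have e2 : R ^ (2 - r) = (1 / 4) ^ (2 - r) * chi ε z ^ (2 - r) := by
      rw [← Real.mul_rpow (by norm_num) hχ.le, hR]
      congr 1
      ring
    rw [e1, ← Real.mul_rpow (by positivity) (by positivity), e2]
    congr 1
    ring
  have hpow : chi ε z ^ β * chi ε z ^ (1 - b) ≤ X ^ υ * chi ε z ^ (τ - 1) := by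
    rw [← Real.rpow_add hχ, show β + (1 - b) = υ + (τ - 1) by rw [hτ]; ring, Real.rpow_add hχ]
    gcongr
  calc cpot ε β f z
      ≤ ENNReal.ofReal ((3 / 4) ^ β * chi ε z ^ β) *
          (eLpNorm f p volume * ENNReal.ofReal (C1 * chi ε z ^ (1 - b))) +
        ENNReal.ofReal (5 * chi ε z ^ (τ - 1)) * (ENNReal.ofReal C * eLpNorm f p volume) := by
        refine (lintegral_mono hpt).trans ?_
        have hm2 : AEMeasurable fun ζ => ENNReal.ofReal (5 * chi ε z ^ (τ - 1)) *
            (‖f ζ‖ₑ * ENNReal.ofReal (chi ε ζ ^ (b - 2 + υ))) :=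
          (hf.enorm.mul hmχ.aemeasurable).const_mul _
        rw [lintegral_add_right' _ hm2, lintegral_const_mul' _ _ ENNReal.ofReal_ne_top,
          lintegral_const_mul' _ _ ENNReal.ofReal_ne_top]
        gcongr
        · rw [← hnear']
          exact lintegral_enorm_mul_le hp.le hf hmk.aemeasurable hr
        · exact hC ε hε f hf hf0
    _ = ENNReal.ofReal ((3 / 4) ^ β * C1 * (chi ε z ^ β * chi ε z ^ (1 - b)) +
          5 * C * chi ε z ^ (τ - 1)) * eLpNorm f p volume := by
        rw [ENNReal.ofReal_add (by positivity) (by positivity), add_mul,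
          mul_comm (eLpNorm f p volume), ← mul_assoc, ← mul_assoc,
          ← ENNReal.ofReal_mul (by positivity), ← ENNReal.ofReal_mul (by positivity)]
        ring_nf
    _ ≤ _ := by
        refine mul_le_mul_left (ENNReal.ofReal_le_ofReal ?_) _
        rw [show β + 1 - b - υ = τ - 1 by rw [hτ]; ring]
        calc _ ≤ (3 / 4) ^ β * C1 * (X ^ υ * chi ε z ^ (τ - 1)) + 5 * C * chi ε z ^ (τ - 1) := by
              gcongr
          _ = _ := by ring

/-! ### Radial cutoffs -/

/-- The smooth cutoff that grows from `0` to `1` while `‖z‖ ^ 2` goes from `A` to `B`. -/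
noncomputable def rst (A B : ℝ) (z : ℂ) : ℂ :=
  ((Real.smoothTransition ((‖z‖ ^ 2 - A) / (B - A)) : ℝ) : ℂ)

lemma contDiff_rst (A B : ℝ) {n : ℕ∞} : ContDiff ℝ n (rst A B) :=
  Complex.ofRealCLM.contDiff.comp (Real.smoothTransition.contDiff.comp
    (((contDiff_norm_sq ℝ).sub contDiff_const).div_const _))

lemma rst_eq_zero {A B : ℝ} (hAB : A < B) {z : ℂ} (h : ‖z‖ ^ 2 ≤ A) : rst A B z = 0 := by
  rw [rst, Real.smoothTransition.zero_of_nonpos, Complex.ofReal_zero]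
  exact div_nonpos_of_nonpos_of_nonneg (by linarith) (by linarith)

lemma rst_eq_one {A B : ℝ} (hAB : A < B) {z : ℂ} (h : B ≤ ‖z‖ ^ 2) : rst A B z = 1 := by
  rw [rst, Real.smoothTransition.one_of_one_le, Complex.ofReal_one]
  rw [le_div_iff₀ (by linarith)]
  linarith

lemma norm_rst_le (A B : ℝ) (z : ℂ) : ‖rst A B z‖ ≤ 1 := by
  rw [rst, Complex.norm_real, Real.norm_of_nonneg (Real.smoothTransition.nonneg _)]
  exact Real.smoothTransition.le_one _

lemma norm_one_sub_rst_le (A B : ℝ) (z : ℂ) : ‖1 - rst A B z‖ ≤ 1 := by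
  rw [rst, ← Complex.ofReal_one, ← Complex.ofReal_sub, Complex.norm_real,
    Real.norm_of_nonneg (by linarith [Real.smoothTransition.le_one ((‖z‖ ^ 2 - A) / (B - A))])]
  linarith [Real.smoothTransition.nonneg ((‖z‖ ^ 2 - A) / (B - A))]

lemma dzb_const (c z : ℂ) : dzb (fun _ => c) z = 0 := by
  simp [dzb]

lemma dzb_rst_eq_zero {A B : ℝ} (hAB : A < B) {z : ℂ} (h : ‖z‖ ^ 2 < A ∨ B < ‖z‖ ^ 2) :
    dzb (rst A B) z = 0 := by
  have hc : Continuous fun w : ℂ => ‖w‖ ^ 2 := by fun_prop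
  rcases h with h | h
  · have : rst A B =ᶠ[𝓝 z] fun _ => 0 := by
      filter_upwards [(isOpen_lt hc continuous_const).mem_nhds h] with w hw
        using rst_eq_zero hAB (le_of_lt hw)
    rw [dzb_congr this, dzb_const]
  · have : rst A B =ᶠ[𝓝 z] fun _ => 1 := by
      filter_upwards [(isOpen_lt continuous_const hc).mem_nhds h] with w hw
        using rst_eq_one hAB (le_of_lt hw)
    rw [dzb_congr this, dzb_const]

lemma norm_dzb_le (u : ℂ → ℂ) (z : ℂ) : ‖dzb u z‖ ≤ ‖fderiv ℝ u z‖ := by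
  have h1 := (fderiv ℝ u z).le_opNorm 1
  have h2 := (fderiv ℝ u z).le_opNorm Complex.I
  rw [norm_one, mul_one] at h1
  rw [Complex.norm_I, mul_one] at h2
  rw [dzb, norm_div, Complex.norm_ofNat, div_le_iff₀ two_pos]
  calc _ ≤ _ := norm_add_le _ _
    _ ≤ _ := by
      rw [norm_mul, Complex.norm_I, one_mul]
      linarith

lemma exists_deriv_smoothTransition_le : ∃ M, 0 ≤ M ∧ ∀ x, |deriv Real.smoothTransition x| ≤ M := by
  have hc : Continuous (deriv Real.smoothTransition) :=
    (Real.smoothTransition.contDiff (n := 1)).continuous_deriv le_rfl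
  have hs : HasCompactSupport (deriv Real.smoothTransition) := by
    refine HasCompactSupport.intro (isCompact_Icc (a := (0 : ℝ)) (b := 1)) fun x hx => ?_
    rw [mem_Icc, not_and_or, not_le, not_le] at hx
    rcases hx with h | h
    · have : Real.smoothTransition =ᶠ[𝓝 x] fun _ => 0 := by
        filter_upwards [Iio_mem_nhds h] with y hy using Real.smoothTransition.zero_of_nonpos hy.le
      rw [this.deriv_eq, deriv_const]
    · have : Real.smoothTransition =ᶠ[𝓝 x] fun _ => 1 := by
        filter_upwards [Ioi_mem_nhds h] with y hy using Real.smoothTransition.one_of_one_le hy.le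
      rw [this.deriv_eq, deriv_const]
  obtain ⟨M, hM⟩ := hc.bounded_above_of_compact_support hs
  exact ⟨M, (norm_nonneg _).trans (hM 0), hM⟩

lemma exists_norm_dzb_rst_le :
    ∃ M, 0 ≤ M ∧ ∀ A B : ℝ, A < B → ∀ z, ‖dzb (rst A B) z‖ ≤ M * ‖z‖ / (B - A) := by
  obtain ⟨M, hM0, hM⟩ := exists_deriv_smoothTransition_le
  refine ⟨M * 2, by positivity, fun A B hAB z => ?_⟩
  have hBA : 0 < B - A := by linarith
  have h1 : HasFDerivAt (fun w : ℂ => ‖w‖ ^ 2) (2 • innerSL ℝ z) z :=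
    (hasStrictFDerivAt_norm_sq z).hasFDerivAt
  have h2 : HasFDerivAt (fun w : ℂ => (‖w‖ ^ 2 - A) / (B - A))
      ((B - A)⁻¹ • (2 • innerSL ℝ z)) z := by
    simpa only [div_eq_inv_mul, smul_eq_mul] using! (h1.sub_const A).const_mul (B - A)⁻¹
  have h3 := ((Real.smoothTransition.contDiff (n := 1)).differentiable one_ne_zero
    ((‖z‖ ^ 2 - A) / (B - A))).hasDerivAt.comp_hasFDerivAt z h2
  have h4 : HasFDerivAt (rst A B) _ z := Complex.ofRealCLM.hasFDerivAt.comp z h3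
  refine (norm_dzb_le _ _).trans ?_
  rw [h4.fderiv]
  refine (ContinuousLinearMap.opNorm_comp_le _ _).trans ?_
  have h5 : ‖2 • innerSL ℝ z‖ ≤ 2 * ‖z‖ := by
    rw [two_nsmul, two_mul]
    refine (norm_add_le _ _).trans ?_
    rw [innerSL_apply_norm]
  rw [Complex.ofRealCLM_norm, one_mul, norm_smul, norm_smul, Real.norm_eq_abs,
    Real.norm_of_nonneg (inv_nonneg.2 hBA.le)]
  calc _ ≤ M * ((B - A)⁻¹ * (2 * ‖z‖)) := by
        gcongr
        exact hM _
    _ = _ := by field_simp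

/-! ### The holomorphic part of `u_z` -/

lemma boundaryC1Norm_nonneg (u : ℂ → ℂ) : 0 ≤ boundaryC1Norm u :=
  add_nonneg (Real.iSup_nonneg fun _ => norm_nonneg _) (Real.iSup_nonneg fun _ => norm_nonneg _)

/-- Near the unit circle `u_z` is almost bounded by the boundary norm of `u`. -/
lemma exists_norm_dz_le_boundaryC1Norm {u : ℂ → ℂ}
    (hu : ContDiffOn ℝ 1 u (Metric.closedBall 0 1 \ {0})) {δ : ℝ} (hδ : 0 < δ) :
    ∃ R, 1 / 2 ≤ R ∧ R < 1 ∧ ∀ z ∈ Metric.ball (0 : ℂ) 1, R ≤ ‖z‖ →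
      ‖dz u z‖ ≤ boundaryC1Norm u + δ := by
  set S : Set ℂ := Metric.closedBall 0 1 with hS
  set g : ℂ → ℂ →L[ℝ] ℂ := fun z => fderivWithin ℝ u S z with hg
  have hud : UniqueDiffOn ℝ (S \ {0}) := by
    refine (uniqueDiffOn_convex (convex_closedBall _ _) ?_).inter isOpen_compl_singleton
    rw [interior_closedBall _ one_ne_zero]
    exact ⟨0, by simp⟩
  have hgc : ContinuousOn g (S \ {0}) := by
    refine (hu.continuousOn_fderivWithin hud le_rfl).congr fun z hz => ?_
    refine fderivWithin_congr_set ?_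
    filter_upwards [isOpen_compl_singleton.mem_nhds hz.2] with w hw
    simp only [eq_iff_iff]
    exact ⟨fun h => ⟨h, hw⟩, fun h => h.1⟩
  -- a compact annulus on which the gradient is uniformly continuous
  set K : Set ℂ := S \ Metric.ball 0 (1 / 2) with hK
  have hKc : IsCompact K := (isCompact_closedBall _ _).diff Metric.isOpen_ball
  have hKS : K ⊆ S \ {0} := fun z hz => ⟨hz.1, fun h => hz.2 (by
    rw [mem_singleton_iff.1 h]; exact Metric.mem_ball_self (by norm_num))⟩
  have huc := Metric.uniformContinuousOn_iff.1
    (hKc.uniformContinuousOn_of_continuous (hgc.mono hKS)) δ hδ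
  obtain ⟨η, hη, h⟩ := huc
  have hsub : Metric.sphere (0 : ℂ) 1 ⊆ K := fun z hz => by
    rw [mem_sphere_zero_iff_norm] at hz
    refine ⟨by rw [hS, mem_closedBall_zero_iff, hz], ?_⟩
    rw [mem_ball_zero_iff, hz]
    norm_num
  have hbdd : BddAbove (range fun z : Metric.sphere (0 : ℂ) 1 => ‖g z‖) := by
    have := (isCompact_sphere (0 : ℂ) 1).bddAbove_image ((hgc.mono (hsub.trans hKS)).norm)
    rwa [image_eq_range] at this
  refine ⟨max (1 / 2) (1 - η / 2), le_max_left _ _, max_lt (by norm_num) (by linarith),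
    fun z hz hRz => ?_⟩
  have hz1 : ‖z‖ < 1 := by simpa using hz
  have hz2 : 1 / 2 ≤ ‖z‖ := (le_max_left _ _).trans hRz
  have hz3 : 1 - η / 2 ≤ ‖z‖ := (le_max_right _ _).trans hRz
  have hz0 : (‖z‖ : ℂ) ≠ 0 := by
    rw [Complex.ofReal_ne_zero]; linarith
  -- the nearest boundary point
  set w : ℂ := z / ‖z‖ with hw
  have hw1 : ‖w‖ = 1 := by
    rw [hw, norm_div, Complex.norm_real, norm_norm, div_self (by linarith)]
  have hwm : w ∈ Metric.sphere (0 : ℂ) 1 := by simpa using hw1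
  have hzK : z ∈ K := ⟨by rw [hS, mem_closedBall_zero_iff]; exact hz1.le, by
    rw [mem_ball_zero_iff]; linarith⟩
  have hdist : dist z w < η := by
    have : z - w = w * (‖z‖ - 1 : ℝ) := by
      rw [hw]; push_cast; field_simp
    rw [dist_eq_norm, this, norm_mul, hw1, Complex.norm_real, Real.norm_eq_abs, abs_sub_comm,
      abs_of_nonneg (by linarith)]
    linarith
  have h1 := h z hzK w (hsub hwm) hdist
  have h2 : fderiv ℝ u z = g z :=
    (fderivWithin_of_mem_nhds (mem_of_superset (Metric.isOpen_ball.mem_nhds hz)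
      Metric.ball_subset_closedBall)).symm
  have h3 : ‖g w‖ ≤ boundaryC1Norm u := by
    refine (le_ciSup hbdd ⟨w, hwm⟩).trans ?_
    rw [boundaryC1Norm]
    exact le_add_of_nonneg_left (Real.iSup_nonneg fun _ => norm_nonneg _)
  calc ‖dz u z‖ ≤ ‖g z‖ := (norm_dz_le).trans_eq (by rw [h2])
    _ ≤ ‖g w‖ + ‖g z - g w‖ := by
      have := norm_add_le (g w) (g z - g w)
      rwa [add_sub_cancel] at this
    _ ≤ _ := by rw [← dist_eq_norm]; linarith

/-- Cauchy potentials of integrable functions are holomorphic off the support. -/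
lemma cauchy_potential_of_eq_zero {W : ℂ → ℂ} (hW : Integrable W) {R : ℝ}
    (h0 : ∀ ζ ∈ Metric.ball (0 : ℂ) R, W ζ = 0) :
    (∀ z ∈ Metric.ball (0 : ℂ) R, Integrable fun ζ => W ζ * (z - ζ)⁻¹) ∧
    (∀ z ∈ Metric.ball (0 : ℂ) R, ‖∫ ζ, W ζ * (z - ζ)⁻¹‖ ≤ (∫ ζ, ‖W ζ‖) / (R - ‖z‖)) ∧
    DifferentiableOn ℂ (fun z => ∫ ζ, W ζ * (z - ζ)⁻¹) (Metric.ball 0 R) := by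
  have hb : ∀ d > 0, ∀ z, ‖z‖ + d ≤ R → ∀ ζ, ‖W ζ * (z - ζ)⁻¹‖ ≤ ‖W ζ‖ * d⁻¹ := by
    intro d hd z hz ζ
    by_cases hζ : ζ ∈ Metric.ball (0 : ℂ) R
    · simp [h0 ζ hζ]
    · rw [mem_ball_zero_iff, not_lt] at hζ
      rw [norm_mul, norm_inv]
      have := norm_sub_norm_le ζ z
      rw [norm_sub_rev] at this
      gcongr
      linarith
  have hm : ∀ z, AEStronglyMeasurable fun ζ => W ζ * (z - ζ)⁻¹ := fun z =>
    hW.aestronglyMeasurable.mul (by fun_prop : Measurable fun ζ : ℂ => (z - ζ)⁻¹).aestronglyMeasurable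
  have hi : ∀ z ∈ Metric.ball (0 : ℂ) R, Integrable fun ζ => W ζ * (z - ζ)⁻¹ := fun z hz => by
    rw [mem_ball_zero_iff] at hz
    exact (hW.norm.mul_const (R - ‖z‖)⁻¹).mono' (hm z)
      (Eventually.of_forall (hb _ (by linarith) z (by linarith)))
  refine ⟨hi, fun z hz => ?_, fun z hz => ?_⟩
  · have hz' := hz
    rw [mem_ball_zero_iff] at hz'
    rw [div_eq_mul_inv, ← integral_mul_const]
    exact norm_integral_le_of_norm_le (hW.norm.mul_const _)
      (Eventually.of_forall (hb _ (by linarith) z (by linarith)))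
  · have hz' := hz
    rw [mem_ball_zero_iff] at hz'
    set d := (R - ‖z‖) / 2 with hd
    have hd0 : 0 < d := by rw [hd]; linarith
    have hnz : ∀ x ∈ Metric.ball z d, ∀ ζ, W ζ ≠ 0 → x - ζ ≠ 0 ∧ ‖(x - ζ)⁻¹‖ ≤ d⁻¹ := by
      intro x hx ζ hζ
      have hζR : R ≤ ‖ζ‖ := by
        by_contra! h
        exact hζ (h0 ζ (by simpa using h))
      rw [Metric.mem_ball, dist_eq_norm] at hx
      have h1 := norm_sub_norm_le ζ x
      rw [norm_sub_rev] at h1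
      have h2 := norm_sub_norm_le x z
      have h3 : d ≤ ‖x - ζ‖ := by linarith
      refine ⟨norm_pos_iff.1 (hd0.trans_le h3), ?_⟩
      rw [norm_inv]
      gcongr
    have := hasDerivAt_integral_of_dominated_loc_of_deriv_le (𝕜 := ℂ) (μ := volume)
      (F := fun x ζ => W ζ * (x - ζ)⁻¹) (F' := fun x ζ => W ζ * (-((x - ζ)⁻¹ ^ 2)))
      (x₀ := z) (s := Metric.ball z d) (bound := fun ζ => ‖W ζ‖ * d⁻¹ ^ 2)
      (Metric.ball_mem_nhds z hd0) (Eventually.of_forall hm) (hi z hz)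
      (hW.aestronglyMeasurable.mul
        (by fun_prop : Measurable fun ζ : ℂ => -((z - ζ)⁻¹ ^ 2)).aestronglyMeasurable)
      (Eventually.of_forall fun ζ x hx => ?_) (hW.norm.mul_const _)
      (Eventually.of_forall fun ζ x hx => ?_)
    · exact this.2.differentiableAt.differentiableWithinAt
    · by_cases hζ : W ζ = 0
      · simp [hζ]
      · rw [norm_mul, norm_neg, norm_pow]
        gcongr
        exact (hnz x hx ζ hζ).2
    · by_cases hζ : W ζ = 0
      · simpa [hζ] using hasDerivAt_const x (0 : ℂ)
      · have h1 := (((hasDerivAt_id x).sub_const ζ).inv (hnz x hx ζ hζ).1).const_mul (W ζ)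
        refine h1.congr_deriv ?_
        simp [div_eq_mul_inv]

/-- The Cauchy potential of `ζ ^ m F / 4`. -/
noncomputable def cauchyPart (m : ℕ) (F : ℂ → ℂ) (z : ℂ) : ℂ :=
  (Real.pi : ℂ)⁻¹ * ∫ ζ, ζ ^ m * (F ζ / 4) * (z - ζ)⁻¹

lemma volume_real_annulus {R S : ℝ} (hR : 0 ≤ R) (hRS : R ≤ S) :
    volume.real (Metric.closedBall (0 : ℂ) S \ Metric.ball 0 R) = Real.pi * (S ^ 2 - R ^ 2) := by
  have h1 : volume.real (Metric.closedBall (0 : ℂ) S) = Real.pi * S ^ 2 := by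
    rw [Measure.real, Complex.volume_closedBall, ENNReal.toReal_mul, ENNReal.toReal_pow,
      ENNReal.toReal_ofReal (hR.trans hRS), ENNReal.coe_toReal, NNReal.coe_real_pi, mul_comm]
  have h2 : volume.real (Metric.ball (0 : ℂ) R) = Real.pi * R ^ 2 := by
    rw [Measure.real, Complex.volume_ball, ENNReal.toReal_mul, ENNReal.toReal_pow,
      ENNReal.toReal_ofReal hR, ENNReal.coe_toReal, NNReal.coe_real_pi, mul_comm]
  rw [measureReal_sdiff (Metric.ball_subset_closedBall.trans
    (Metric.closedBall_subset_closedBall hRS)) Metric.isOpen_ball.measurableSet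
    (isCompact_closedBall _ _).measure_lt_top.ne, h1, h2]
  ring

section

variable {u F : ℂ → ℂ}

/-- On the disk of radius `R` the difference of `z ^ m u_z` and the Cauchy potential is holomorphic,
and bounded by the values of `u_z` and `F` outside the disk. -/
lemma exists_holomorphic_part_ball : ∃ M, 0 ≤ M ∧ ∀ u F : ℂ → ℂ, IsDistribSolution u F →
    ContDiffOn ℝ 2 u pdisk → Integrable F → (∀ z ∉ Metric.ball (0 : ℂ) 1, F z = 0) →
    ∀ (m : ℕ) (R : ℝ), 1 / 2 ≤ R → R < 1 → ∃ H : ℂ → ℂ,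
      DifferentiableOn ℂ H (Metric.ball 0 R) ∧
      (∀ z ∈ Metric.ball (0 : ℂ) R, z ≠ 0 →
        Integrable (fun ζ => ζ ^ m * (F ζ / 4) * (z - ζ)⁻¹) ∧
        z ^ m * dz u z = H z + cauchyPart m F z) ∧
      ∀ K, (∀ ζ ∈ Metric.ball (0 : ℂ) 1, R ≤ ‖ζ‖ → ‖dz u ζ‖ ≤ K) → ∀ z ∈ Metric.ball (0 : ℂ) R,
        ‖H z‖ ≤ (M * K + ∫ ζ in (Metric.ball 0 R)ᶜ, ‖F ζ‖) / (R - ‖z‖) := by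
  obtain ⟨M, hM0, hM⟩ := exists_norm_dzb_rst_le
  refine ⟨M, hM0, fun u F hd hu hF hF0 m R hR hR1 => ?_⟩
  have hv : ContDiffOn ℝ 1 (dz u) pdisk := hu.dz isOpen_pdisk (by norm_num)
  have hπ := Real.pi_pos
  -- a cutoff that is `1` on the disk of radius `R` and vanishes outside that of radius `S`
  set S := (1 + R) / 2 with hS
  have hRS : R < S := by rw [hS]; linarith
  have hS1 : S < 1 := by rw [hS]; linarith
  have hRS2 : R ^ 2 < S ^ 2 := by nlinarith
  set ψ : ℂ → ℂ := fun z => 1 - rst (R ^ 2) (S ^ 2) z with hψ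
  have cψ : ContDiff ℝ 1 ψ := contDiff_const.sub (contDiff_rst _ _)
  have hdψ : ∀ ζ, dzb ψ ζ = -dzb (rst (R ^ 2) (S ^ 2)) ζ := fun ζ => by
    rw [hψ, dzb_sub (differentiableAt_const _)
      ((contDiff_rst _ _ (n := 1)).differentiable (by simp) ζ), dzb_const, zero_sub]
  have hψ1 : ∀ ζ, ‖ζ‖ ≤ R → ψ ζ = 1 := fun ζ h => by
    rw [hψ]; simp only; rw [rst_eq_zero hRS2 (by gcongr), sub_zero]
  have hsupp : Function.support ψ ⊆ Metric.closedBall 0 S := fun ζ hζ => by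
    by_contra h
    rw [mem_closedBall_zero_iff, not_le] at h
    refine hζ ?_
    rw [hψ]; simp only; rw [rst_eq_one hRS2 (by gcongr), sub_self]
  have htψ : tsupport ψ ⊆ Metric.closedBall 0 S := closure_minimal hsupp Metric.isClosed_closedBall
  have hcψ : HasCompactSupport ψ := HasCompactSupport.of_support_subset_isCompact
    (isCompact_closedBall _ _) hsupp
  have htψ1 : tsupport ψ ⊆ Metric.ball 0 1 :=
    htψ.trans (Metric.closedBall_subset_ball hS1)
  have hdψ0 : ∀ ζ, ‖ζ‖ < R → dzb ψ ζ = 0 := fun ζ h => by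
    rw [hdψ, dzb_rst_eq_zero hRS2 (Or.inl (by gcongr)), neg_zero]
  have hdψ1 : ∀ ζ, S < ‖ζ‖ → dzb ψ ζ = 0 := fun ζ h => by
    rw [hdψ, dzb_rst_eq_zero hRS2 (Or.inr (by gcongr)), neg_zero]
  have hR0 : 0 < R := by linarith
  have htdψ : tsupport (dzb ψ) ⊆ pdisk := fun ζ hζ => by
    refine ⟨htψ1 (tsupport_dzb_subset ψ hζ), ?_⟩
    rintro (rfl : ζ = 0)
    refine notMem_tsupport_iff_eventuallyEq.2 ?_ hζ
    filter_upwards [Metric.ball_mem_nhds (0 : ℂ) hR0] with w hw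
    exact hdψ0 w (by simpa using hw)
  -- the difference of the densities in the representation formula and in `cauchyPart`; it vanishes
  -- on the disk of radius `R`, so that its Cauchy potential is holomorphic there
  set W₁ : ℂ → ℂ := fun ζ => (ψ ζ - 1) * (F ζ / 4) with hW₁
  set W₂ : ℂ → ℂ := fun ζ => dzb ψ ζ * dz u ζ with hW₂
  set W : ℂ → ℂ := fun ζ => ζ ^ m * (W₁ ζ + W₂ ζ) with hW
  have hψn : ∀ ζ, ‖ψ ζ - 1‖ ≤ 1 := fun ζ => by
    rw [hψ]; simp only
    rw [sub_sub_cancel_left, norm_neg]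
    exact norm_rst_le _ _ _
  have iW₁ : Integrable W₁ :=
    (hF.div_const 4).bdd_mul (cψ.continuous.sub continuous_const).aestronglyMeasurable
      (Eventually.of_forall hψn)
  have iW₂ : Integrable W₂ := by
    have := integrable_mul_of_tsupport_subset isOpen_pdisk hv.continuousOn
      (cψ.dzb (m := 0) (by norm_num)).continuous
      (hcψ.mono' ((subset_tsupport _).trans (tsupport_dzb_subset ψ))) htdψ
    simpa only [hW₂, mul_comm] using this
  have hWn : ∀ ζ, ‖W ζ‖ ≤ ‖W₁ ζ + W₂ ζ‖ := fun ζ => by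
    by_cases h : ζ ∈ Metric.ball (0 : ℂ) 1
    · rw [mem_ball_zero_iff] at h
      rw [hW]; simp only
      rw [norm_mul, norm_pow]
      exact mul_le_of_le_one_left (norm_nonneg _) (pow_le_one₀ (norm_nonneg _) h.le)
    · have h1 : F ζ = 0 := hF0 ζ h
      have h2 : dzb ψ ζ = 0 := dzb_eq_zero_of_notMem_tsupport fun h' => h (htψ1 h')
      simp [hW, hW₁, hW₂, h1, h2]
  have iW : Integrable W := by
    refine (iW₁.add iW₂).mono ?_ (Eventually.of_forall hWn)
    exact ((continuous_pow m).aestronglyMeasurable).mul (iW₁.add iW₂).aestronglyMeasurable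
  have hW0 : ∀ ζ ∈ Metric.ball (0 : ℂ) R, W ζ = 0 := fun ζ hζ => by
    rw [mem_ball_zero_iff] at hζ
    simp [hW, hW₁, hW₂, hψ1 ζ hζ.le, hdψ0 ζ hζ]
  obtain ⟨hWi, hWb, hWd⟩ := cauchy_potential_of_eq_zero iW hW0
  refine ⟨fun z => (Real.pi : ℂ)⁻¹ * ∫ ζ, W ζ * (z - ζ)⁻¹, hWd.const_mul _, fun z hz hz0 => ?_,
    fun K hK z hz => ?_⟩
  · have hψ0 : ∀ᶠ ζ in 𝓝 0, ψ ζ = 1 := by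
      filter_upwards [Metric.ball_mem_nhds (0 : ℂ) hR0] with w hw
      exact hψ1 w (by simpa using (mem_ball_zero_iff.1 hw).le)
    obtain ⟨h1, h2⟩ := integral_representation hd hu hF.integrableOn m cψ hcψ htψ1 hψ0 hz0
    have e : ∀ ζ, ζ ^ m * (F ζ / 4) * (z - ζ)⁻¹ =
        ζ ^ m * (ψ ζ * (F ζ / 4) + dzb ψ ζ * dz u ζ) * (z - ζ)⁻¹ - W ζ * (z - ζ)⁻¹ := fun ζ => by
      simp only [hW, hW₁, hW₂]; ring
    have h3 : Integrable (fun ζ => ζ ^ m * (F ζ / 4) * (z - ζ)⁻¹) := by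
      simp only [e]
      exact h1.sub (hWi z hz)
    refine ⟨h3, ?_⟩
    rw [cauchyPart]
    simp only [e]
    rw [integral_sub h1 (hWi z hz), h2, hψ1 z (mem_ball_zero_iff.1 hz).le]
    have : (Real.pi : ℂ) ≠ 0 := Complex.ofReal_ne_zero.2 hπ.ne'
    field_simp
    ring
  · have hz' := mem_ball_zero_iff.1 hz
    have hRz : 0 < R - ‖z‖ := by linarith
    have hK0 : 0 ≤ K := by
      have h1 : (R : ℂ) ∈ Metric.ball (0 : ℂ) 1 := by
        rw [mem_ball_zero_iff, Complex.norm_real, Real.norm_of_nonneg hR0.le]; exact hR1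
      refine (norm_nonneg _).trans (hK R h1 ?_)
      rw [Complex.norm_real, Real.norm_of_nonneg hR0.le]
    set A : Set ℂ := Metric.closedBall (0 : ℂ) S \ Metric.ball 0 R with hA
    have hAm : MeasurableSet A :=
      measurableSet_closedBall.diff measurableSet_ball
    have hAf : volume A ≠ ⊤ :=
      ((measure_mono sdiff_subset).trans_lt (isCompact_closedBall _ _).measure_lt_top).ne
    set c := M * S / (S ^ 2 - R ^ 2) * K with hc
    have hS0 : 0 < S := by linarith
    have hc0 : 0 ≤ c := by
      have : 0 < S ^ 2 - R ^ 2 := by linarith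
      positivity
    -- `∂_{z̄} ψ` is of size `1 / (S - R)` on an annulus of width `S - R`: its integral does not
    -- depend on `R`
    have hpt : ∀ ζ, ‖W ζ‖ ≤ (Metric.ball 0 R)ᶜ.indicator (fun ζ => ‖F ζ‖) ζ +
        A.indicator (fun _ => c) ζ := by
      intro ζ
      by_cases hζ : ζ ∈ Metric.ball (0 : ℂ) R
      · rw [hW0 ζ hζ, norm_zero]
        exact add_nonneg (indicator_nonneg (fun _ _ => norm_nonneg _) _)
          (indicator_nonneg (fun _ _ => hc0) _)
      · rw [indicator_of_mem (show ζ ∈ (Metric.ball (0 : ℂ) R)ᶜ from hζ)]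
        refine (hWn ζ).trans ((norm_add_le _ _).trans (add_le_add ?_ ?_))
        · simp only [hW₁]
          rw [norm_mul, norm_div, Complex.norm_ofNat]
          have := hψn ζ
          nlinarith [norm_nonneg (F ζ), norm_nonneg (ψ ζ - 1)]
        · by_cases hζA : ζ ∈ A
          · rw [indicator_of_mem hζA]
            have hζS : ‖ζ‖ ≤ S := mem_closedBall_zero_iff.1 hζA.1
            have hζ1 : ζ ∈ Metric.ball (0 : ℂ) 1 := by
              rw [mem_ball_zero_iff]; linarith
            have h1 := hK ζ hζ1 (by rw [mem_ball_zero_iff, not_lt] at hζ; exact hζ)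
            have h2 := hM _ _ hRS2 ζ
            simp only [hW₂]
            rw [norm_mul, hdψ, norm_neg, hc]
            have h4 : 0 ≤ S ^ 2 - R ^ 2 := by linarith
            refine mul_le_mul (h2.trans ?_) h1 (norm_nonneg _) (by positivity)
            gcongr
          · rw [indicator_of_notMem hζA]
            have : S < ‖ζ‖ := by
              by_contra! h
              exact hζA ⟨mem_closedBall_zero_iff.2 h, hζ⟩
            simp [hW₂, hdψ1 ζ this]
    have hint : ∫ ζ, ‖W ζ‖ ≤ (∫ ζ in (Metric.ball 0 R)ᶜ, ‖F ζ‖) + Real.pi * (M * K) := by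
      have i1 : Integrable ((Metric.ball (0 : ℂ) R)ᶜ.indicator (fun ζ => ‖F ζ‖)) :=
        hF.norm.indicator Metric.isOpen_ball.measurableSet.compl
      have i2 : Integrable (A.indicator (fun _ : ℂ => c)) :=
        (integrable_indicator_iff hAm).2 (integrableOn_const hAf)
      refine (integral_mono iW.norm (i1.add i2) hpt).trans ?_
      simp only [Pi.add_apply]
      rw [integral_add i1 i2, integral_indicator Metric.isOpen_ball.measurableSet.compl,
        integral_indicator hAm, setIntegral_const, volume_real_annulus hR0.le hRS.le, smul_eq_mul]
      refine add_le_add le_rfl ?_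
      have h4 : S ^ 2 - R ^ 2 ≠ 0 := by linarith
      have : Real.pi * (S ^ 2 - R ^ 2) * c = Real.pi * (M * K) * S := by
        rw [hc]; field_simp
      rw [this]
      exact mul_le_of_le_one_right (by positivity) hS1.le
    have h5 : 0 ≤ ∫ ζ in (Metric.ball 0 R)ᶜ, ‖F ζ‖ := integral_nonneg fun _ => norm_nonneg _
    rw [norm_mul, norm_inv, Complex.norm_real, Real.norm_of_nonneg hπ.le]
    calc _ ≤ Real.pi⁻¹ * (((∫ ζ in (Metric.ball 0 R)ᶜ, ‖F ζ‖) + Real.pi * (M * K)) / (R - ‖z‖)) := by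
          gcongr
          exact (hWb z hz).trans (by gcongr)
      _ = (Real.pi⁻¹ * (∫ ζ in (Metric.ball 0 R)ᶜ, ‖F ζ‖) + M * K) / (R - ‖z‖) := by
          field_simp
      _ ≤ _ := by
          rw [add_comm]
          gcongr
          refine mul_le_of_le_one_left h5 (inv_le_one_of_one_le₀ ?_)
          linarith [Real.pi_gt_three]

/-- The difference of `z ^ m u_z` and the Cauchy potential extends to a holomorphic function on the
whole disk. -/
lemma exists_holomorphic_part : ∃ M, 0 ≤ M ∧ ∀ u F : ℂ → ℂ, IsDistribSolution u F →
    ContDiffOn ℝ 2 u pdisk → Integrable F → (∀ z ∉ Metric.ball (0 : ℂ) 1, F z = 0) →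
    ∀ m : ℕ, ∃ H : ℂ → ℂ, DifferentiableOn ℂ H (Metric.ball 0 1) ∧
      (∀ z ∈ pdisk, Integrable (fun ζ => ζ ^ m * (F ζ / 4) * (z - ζ)⁻¹) ∧
        z ^ m * dz u z = H z + cauchyPart m F z) ∧
      ∀ R, 1 / 2 ≤ R → R < 1 → ∀ K,
        (∀ ζ ∈ Metric.ball (0 : ℂ) 1, R ≤ ‖ζ‖ → ‖dz u ζ‖ ≤ K) → ∀ z ∈ Metric.ball (0 : ℂ) R,
        ‖H z‖ ≤ (M * K + ∫ ζ in (Metric.ball 0 R)ᶜ, ‖F ζ‖) / (R - ‖z‖) := by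
  obtain ⟨M, hM0, hM⟩ := exists_holomorphic_part_ball
  refine ⟨M, hM0, fun u F hd hu hF hF0 m => ?_⟩
  choose! H hHd hHe hHb using hM u F hd hu hF hF0 m
  -- the holomorphic parts on different disks agree off the origin, hence everywhere
  have agree : ∀ R R', 1 / 2 ≤ R → R < 1 → 1 / 2 ≤ R' → R' < 1 → ∀ z ∈ Metric.ball (0 : ℂ) R,
      z ∈ Metric.ball (0 : ℂ) R' → H R z = H R' z := by
    intro R R' h1 h2 h3 h4
    have hne : ∀ z ∈ Metric.ball (0 : ℂ) R, z ∈ Metric.ball (0 : ℂ) R' → z ≠ 0 →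
        H R z = H R' z := fun z hz hz' hz0 => by
      have e1 := (hHe R h1 h2 z hz hz0).2
      have e2 := (hHe R' h3 h4 z hz' hz0).2
      rw [e1] at e2
      exact add_right_cancel e2
    intro z hz hz'
    by_cases hz0 : z = 0
    · subst hz0
      have n1 : Metric.ball (0 : ℂ) R ∈ 𝓝 0 := Metric.isOpen_ball.mem_nhds hz
      have n2 : Metric.ball (0 : ℂ) R' ∈ 𝓝 0 := Metric.isOpen_ball.mem_nhds hz'
      have c1 : ContinuousAt (H R) 0 := ((hHd R h1 h2).differentiableAt n1).continuousAt
      have c2 : ContinuousAt (H R') 0 := ((hHd R' h3 h4).differentiableAt n2).continuousAt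
      refine tendsto_nhds_unique_of_eventuallyEq (c1.tendsto.mono_left nhdsWithin_le_nhds)
        (c2.tendsto.mono_left nhdsWithin_le_nhds) (l := 𝓝[≠] (0 : ℂ)) ?_
      filter_upwards [nhdsWithin_le_nhds n1, nhdsWithin_le_nhds n2, self_mem_nhdsWithin]
        with w hw hw' hw0 using hne w hw hw' hw0
    · exact hne z hz hz' hz0
  set h : ℂ → ℂ := fun z => H ((1 + ‖z‖) / 2) z with hh
  have key : ∀ R, 1 / 2 ≤ R → R < 1 → ∀ z ∈ Metric.ball (0 : ℂ) R, h z = H R z := by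
    intro R h1 h2 z hz
    have hz' := mem_ball_zero_iff.1 hz
    refine agree _ R (by linarith [norm_nonneg z]) (by linarith) h1 h2 z ?_ hz
    rw [mem_ball_zero_iff]; linarith
  refine ⟨h, fun z hz => ?_, fun z hz => ?_, fun R h1 h2 K hK z hz => ?_⟩
  · have hz' := mem_ball_zero_iff.1 hz
    have hzR : z ∈ Metric.ball (0 : ℂ) ((1 + ‖z‖) / 2) := by
      rw [mem_ball_zero_iff]; linarith
    have g1 : 1 / 2 ≤ (1 + ‖z‖) / 2 := by linarith [norm_nonneg z]
    have g2 : (1 + ‖z‖) / 2 < 1 := by linarith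
    have nn := Metric.isOpen_ball.mem_nhds hzR
    refine (DifferentiableAt.congr_of_eventuallyEq ((hHd _ g1 g2).differentiableAt nn)
      ?_).differentiableWithinAt
    filter_upwards [nn] with w hw using key _ g1 g2 w hw
  · have hz' := mem_ball_zero_iff.1 hz.1
    exact hHe ((1 + ‖z‖) / 2) (by linarith [norm_nonneg z]) (by linarith) z
      (by rw [mem_ball_zero_iff]; linarith) hz.2
  · rw [key R h1 h2 z hz]
    exact hHb R h1 h2 K hK z hz

end

/-! ### A priori bounds -/

/-- The right-hand side `χ ^ a f` of the equation. -/
noncomputable def wF (a ε : ℝ) (f : ℂ → ℂ) (z : ℂ) : ℂ := ((chi ε z ^ a : ℝ) : ℂ) * f z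

/-- The hypotheses on `u` and `f`, where `f` is extended by zero outside the unit disk. -/
structure IsData (a : ℝ) (p : ℝ≥0∞) (ε : ℝ) (u f : ℂ → ℂ) : Prop where
  eps_pos : 0 < ε
  contDiffOn_two : ContDiffOn ℝ 2 u pdisk
  contDiffOn_one : ContDiffOn ℝ 1 u (Metric.closedBall 0 1 \ {0})
  memLp : MemLp f p
  eq_zero : ∀ z ∉ Metric.ball (0 : ℂ) 1, f z = 0
  distrib : IsDistribSolution u (wF a ε f)

/-- The size `‖f‖_{L^p} + ‖u‖_{C¹(∂D)}` of the data. -/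
noncomputable def dataNorm (p : ℝ≥0∞) (u f : ℂ → ℂ) : ℝ :=
  (eLpNorm f p volume).toReal + boundaryC1Norm u

lemma dataNorm_nonneg (p : ℝ≥0∞) (u f : ℂ → ℂ) : 0 ≤ dataNorm p u f :=
  add_nonneg ENNReal.toReal_nonneg (boundaryC1Norm_nonneg u)

lemma boundaryC1Norm_le_dataNorm (p : ℝ≥0∞) (u f : ℂ → ℂ) :
    boundaryC1Norm u ≤ dataNorm p u f :=
  le_add_of_nonneg_left ENNReal.toReal_nonneg

lemma chi_le_of_mem_ball {ε ε₀ : ℝ} (hε : 0 < ε) (h : ε ≤ ε₀) {z : ℂ}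
    (hz : z ∈ Metric.ball (0 : ℂ) 1) : chi ε z ≤ 1 + ε₀ := by
  have := chi_le_add hε z
  have := mem_ball_zero_iff.1 hz
  linarith

lemma norm_wF {a ε : ℝ} (hε : 0 < ε) (f : ℂ → ℂ) (z : ℂ) :
    ‖wF a ε f z‖ = chi ε z ^ a * ‖f z‖ := by
  rw [wF, norm_mul, Complex.norm_real, Real.norm_of_nonneg (Real.rpow_nonneg (chi_pos hε z).le _)]

section

variable {a : ℝ} {p : ℝ≥0∞} {ε : ℝ} {u f : ℂ → ℂ}

lemma IsData.ofReal_le (h : IsData a p ε u f) :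
    eLpNorm f p volume ≤ ENNReal.ofReal (dataNorm p u f) := by
  rw [← ENNReal.ofReal_toReal h.memLp.eLpNorm_ne_top]
  exact ENNReal.ofReal_le_ofReal (le_add_of_nonneg_right (boundaryC1Norm_nonneg u))

lemma exists_lintegral_enorm_le (hp : 2 ≤ p) :
    ∃ C, 0 ≤ C ∧ ∀ f : ℂ → ℂ, AEStronglyMeasurable f →
      (∀ z ∉ Metric.ball (0 : ℂ) 1, f z = 0) →
      ∫⁻ z, ‖f z‖ₑ ≤ ENNReal.ofReal C * eLpNorm f p volume := by
  have hb := two_div_toReal_mem hp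
  obtain ⟨C, hC0, hC⟩ := exists_lintegral_mul_chi_rpow_le hp (υ := 2 - 2 / p.toReal)
    (by linarith [hb.2]) le_rfl
  refine ⟨C, hC0, fun f hf hf0 => ?_⟩
  simpa using hC 1 one_pos f hf hf0

lemma IsData.integrable (h : IsData a p ε u f) (hp : 2 ≤ p) : Integrable f := by
  obtain ⟨C, -, hC⟩ := exists_lintegral_enorm_le hp
  refine ⟨h.memLp.1, (hC f h.memLp.1 h.eq_zero).trans_lt ?_⟩
  exact ENNReal.mul_lt_top ENNReal.ofReal_lt_top h.memLp.eLpNorm_lt_top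

lemma IsData.integrable_wF (h : IsData a p ε u f) (hp : 2 ≤ p) : Integrable (wF a ε f) := by
  have hc : Continuous fun z => ((chi ε z ^ a : ℝ) : ℂ) :=
    Complex.continuous_ofReal.comp (contDiff_chi_rpow h.eps_pos a (n := 0)).continuous
  obtain ⟨K, hK⟩ := (isCompact_closedBall (0 : ℂ) 1).exists_bound_of_continuousOn hc.continuousOn
  refine ((h.integrable hp).norm.const_mul K).mono'
    (hc.aestronglyMeasurable.mul h.memLp.1) (Eventually.of_forall fun z => ?_)
  by_cases hz : z ∈ Metric.ball (0 : ℂ) 1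
  · rw [wF, norm_mul]
    gcongr
    exact hK z (Metric.ball_subset_closedBall hz)
  · simp [wF, h.eq_zero z hz]

lemma IsData.wF_eq_zero (h : IsData a p ε u f) : ∀ z ∉ Metric.ball (0 : ℂ) 1, wF a ε f z = 0 :=
  fun z hz => by rw [wF, h.eq_zero z hz, mul_zero]

end

lemma le_of_forall_pos_le_add_mul {x y c : ℝ} (hc : 0 ≤ c) (h : ∀ δ > 0, x ≤ y + δ * c) :
    x ≤ y := by
  refine le_of_forall_pos_le_add fun δ hδ => (h (δ / (c + 1)) (by positivity)).trans ?_
  gcongr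
  rw [div_mul_eq_mul_div, div_le_iff₀ (by positivity)]
  nlinarith

/-- The holomorphic part of `z ^ m u_z` with bounds by the data: inside the disk from the values
near the circle, and up to the boundary by the maximum principle if the potential is bounded. -/
lemma exists_holomorphic_part_bounds (a : ℝ) {p : ℝ≥0∞} (hp : 2 ≤ p) {ε₀ : ℝ} :
    ∃ C, 1 ≤ C ∧ ∀ ε ≤ ε₀, ∀ u f : ℂ → ℂ, IsData a p ε u f → ∀ m : ℕ, ∃ H : ℂ → ℂ,
      DifferentiableOn ℂ H (Metric.ball 0 1) ∧
      (∀ z ∈ pdisk, Integrable (fun ζ => ζ ^ m * (wF a ε f ζ / 4) * (z - ζ)⁻¹) ∧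
        z ^ m * dz u z = H z + cauchyPart m (wF a ε f) z) ∧
      (∀ z ∈ Metric.ball (0 : ℂ) 1, ‖H z‖ ≤ C * dataNorm p u f / (1 - ‖z‖)) ∧
      ∀ A, (∀ z ∈ Metric.ball (0 : ℂ) 1, 1 / 2 ≤ ‖z‖ → ‖cauchyPart m (wF a ε f) z‖ ≤ A) →
        ∀ z ∈ Metric.ball (0 : ℂ) 1, ‖H z‖ ≤ dataNorm p u f + A := by
  obtain ⟨M, hM0, hM⟩ := exists_holomorphic_part
  obtain ⟨C₁, hC₁0, hC₁⟩ := exists_lintegral_enorm_le hp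
  set c := |1 + ε₀| ^ a + (1 / 2) ^ a with hc
  have hc0 : 0 ≤ c := by positivity
  refine ⟨2 * (M + c * C₁) + 1, by nlinarith [mul_nonneg hc0 hC₁0], fun ε hε u f hD m => ?_⟩
  have hε0 := hD.eps_pos
  set N := dataNorm p u f with hN
  have hN0 : 0 ≤ N := dataNorm_nonneg p u f
  obtain ⟨H, hH, hHe, hHb⟩ := hM u (wF a ε f) hD.distrib hD.contDiffOn_two (hD.integrable_wF hp)
    hD.wF_eq_zero m
  -- away from the origin the weight is bounded above
  have hL : ∀ R, 1 / 2 ≤ R → ∫ ζ in (Metric.ball 0 R)ᶜ, ‖wF a ε f ζ‖ ≤ c * C₁ * N := by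
    intro R hR
    have h1 : ∀ ζ ∈ (Metric.ball (0 : ℂ) R)ᶜ, ‖wF a ε f ζ‖ ≤ c * ‖f ζ‖ := by
      intro ζ hζ
      by_cases h1 : ζ ∈ Metric.ball (0 : ℂ) 1
      · rw [norm_wF hε0]
        gcongr
        rw [mem_compl_iff, mem_ball_zero_iff, not_lt] at hζ
        have h2 : 1 / 2 ≤ chi ε ζ := (hR.trans hζ).trans (norm_le_chi ε ζ)
        have h3 := chi_le_of_mem_ball hε0 hε h1
        have h4 := chi_pos hε0 ζ
        rcases le_total 0 a with ha | ha
        · refine le_add_of_le_of_nonneg ?_ (by positivity)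
          exact Real.rpow_le_rpow h4.le (h3.trans (le_abs_self _)) ha
        · refine le_add_of_nonneg_of_le (by positivity) ?_
          exact Real.rpow_le_rpow_of_nonpos (by norm_num) h2 ha
      · rw [hD.wF_eq_zero ζ h1, norm_zero]
        positivity
    have iF := (hD.integrable hp).norm.const_mul c
    calc ∫ ζ in (Metric.ball 0 R)ᶜ, ‖wF a ε f ζ‖ ≤ ∫ ζ in (Metric.ball 0 R)ᶜ, c * ‖f ζ‖ :=
          setIntegral_mono_on (hD.integrable_wF hp).norm.integrableOn iF.integrableOn
            measurableSet_ball.compl h1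
      _ ≤ ∫ ζ, c * ‖f ζ‖ := setIntegral_le_integral iF (Eventually.of_forall fun _ => by positivity)
      _ = c * (∫ ζ, ‖f ζ‖) := integral_const_mul _ _
      _ ≤ c * (C₁ * N) := by
          gcongr
          rw [integral_norm_eq_lintegral_enorm hD.memLp.1]
          refine ENNReal.toReal_le_of_le_ofReal (by positivity) ?_
          rw [ENNReal.ofReal_mul hC₁0]
          exact (hC₁ f hD.memLp.1 hD.eq_zero).trans (by gcongr; exact hD.ofReal_le)
      _ = _ := by ring
  have hbN : boundaryC1Norm u ≤ N := boundaryC1Norm_le_dataNorm p u f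
  refine ⟨H, hH, hHe, fun z hz => ?_, fun A hA z hz => ?_⟩
  -- let the radius `S` of the disk tend to `1`, with the boundary norm controlling `u_z` near the
  -- circle
  · have hz' := mem_ball_zero_iff.1 hz
    have hz1 : 0 < 1 - ‖z‖ := by linarith
    refine le_of_forall_pos_le_add_mul (c := M * (2 / (1 - ‖z‖))) (by positivity) fun δ hδ => ?_
    obtain ⟨R, hR, hR1, hRb⟩ := exists_norm_dz_le_boundaryC1Norm hD.contDiffOn_one hδ
    set S := max R ((1 + ‖z‖) / 2) with hS
    have hS1 : S < 1 := max_lt hR1 (by linarith)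
    have hSz : (1 + ‖z‖) / 2 ≤ S := le_max_right _ _
    have hRS : R ≤ S := le_max_left _ _
    have h1 := hHb S (hR.trans hRS) hS1 (N + δ)
      (fun ζ hζ hSζ => (hRb ζ hζ (hRS.trans hSζ)).trans (by linarith)) z
      (by rw [mem_ball_zero_iff]; linarith)
    refine h1.trans ?_
    have h2 : 0 < S - ‖z‖ := by linarith
    calc _ ≤ (M * (N + δ) + c * C₁ * N) / ((1 - ‖z‖) / 2) := by
          have : 0 ≤ ∫ ζ in (Metric.ball 0 S)ᶜ, ‖wF a ε f ζ‖ := integral_nonneg fun _ => norm_nonneg _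
          gcongr
          · exact hL S (hR.trans hRS)
          · linarith
      _ = 2 * (M + c * C₁) * N / (1 - ‖z‖) + δ * (M * (2 / (1 - ‖z‖))) := by
          field_simp; ring
      _ ≤ _ := by
          gcongr
          linarith
  -- the maximum principle on the disk of radius `S`
  · have hz' := mem_ball_zero_iff.1 hz
    refine le_of_forall_pos_le_add_mul zero_le_one fun δ hδ => ?_
    obtain ⟨R, hR, hR1, hRb⟩ := exists_norm_dz_le_boundaryC1Norm hD.contDiffOn_one hδ
    set S := max R ((1 + ‖z‖) / 2) with hS
    have hS1 : S < 1 := max_lt hR1 (by linarith)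
    have hSz : (1 + ‖z‖) / 2 ≤ S := le_max_right _ _
    have hRS : R ≤ S := le_max_left _ _
    have hS0 : S ≠ 0 := by linarith
    have hcl : closure (Metric.ball (0 : ℂ) S) ⊆ Metric.ball 0 1 := by
      rw [closure_ball _ hS0]
      exact Metric.closedBall_subset_ball hS1
    have hdc : DiffContOnCl ℂ H (Metric.ball 0 S) :=
      (hH.mono hcl).diffContOnCl
    refine Complex.norm_le_of_forall_mem_frontier_norm_le Metric.isBounded_ball hdc
      (fun ζ hζ => ?_) (subset_closure (by rw [mem_ball_zero_iff]; linarith))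
    rw [frontier_ball _ hS0, mem_sphere_zero_iff_norm] at hζ
    have hζ1 : ζ ∈ Metric.ball (0 : ℂ) 1 := by rw [mem_ball_zero_iff, hζ]; exact hS1
    have hζ0 : ζ ≠ 0 := fun h => hS0 (by rw [← hζ, h, norm_zero])
    have e := (hHe ζ ⟨hζ1, hζ0⟩).2
    have e' : H ζ = ζ ^ m * dz u ζ - cauchyPart m (wF a ε f) ζ := by rw [e]; ring
    rw [e']
    refine (norm_sub_le _ _).trans ?_
    have h1 := hRb ζ hζ1 (hζ ▸ hRS)
    have h2 := hA ζ hζ1 (hζ ▸ hR.trans hRS)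
    have h3 : ‖ζ ^ m * dz u ζ‖ ≤ ‖dz u ζ‖ := by
      rw [norm_mul, norm_pow]
      exact mul_le_of_le_one_left (norm_nonneg _)
        (pow_le_one₀ (norm_nonneg _) (mem_ball_zero_iff.1 hζ1).le)
    linarith

/-! ### Taylor polynomials with remainder bounds -/

/-- A Taylor expansion at the origin, by repeated division by `z`. -/
lemma exists_taylor (l : ℕ) : ∀ (H : ℂ → ℂ) (b : ℝ), DifferentiableOn ℂ H (Metric.ball 0 1) →
    (∀ z ∈ Metric.ball (0 : ℂ) 1, ‖H z‖ ≤ b / (1 - ‖z‖)) →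
    ∃ P : Polynomial ℂ, (∀ k, l ≤ k → P.coeff k = 0) ∧ (∀ k, ‖P.coeff k‖ ≤ 8 ^ l * b) ∧
      ∀ z ∈ Metric.ball (0 : ℂ) 1, ‖H z - P.eval z‖ ≤ ‖z‖ ^ l * (8 ^ l * b / (1 - ‖z‖)) := by
  induction l with
  | zero =>
    intro H b hH hb
    have hb0 : 0 ≤ b := by
      simpa using (norm_nonneg _).trans (hb 0 (by simp))
    refine ⟨0, by simp, by simpa using hb0, fun z hz => ?_⟩
    simpa using hb z hz
  | succ l ih =>
    intro H b hH hb
    have h0 : ‖H 0‖ ≤ b := by simpa using hb 0 (by simp)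
    have hb0 : 0 ≤ b := (norm_nonneg _).trans h0
    -- division by `z` costs a factor away from the origin, and near it by the maximum principle
    have hbig : ∀ z ∈ Metric.ball (0 : ℂ) 1, 1 / 2 ≤ ‖z‖ →
        ‖dslope H 0 z‖ ≤ 4 * b / (1 - ‖z‖) := by
      intro z hz hz2
      have hz1 := mem_ball_zero_iff.1 hz
      have hz0 : z ≠ 0 := norm_pos_iff.1 (by linarith)
      rw [dslope_of_ne _ hz0, slope_def_field, sub_zero, norm_div]
      have h1 : 0 < 1 - ‖z‖ := by linarith
      have h2 : ‖H z - H 0‖ ≤ 2 * b / (1 - ‖z‖) := by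
        refine (norm_sub_le _ _).trans ?_
        have : b ≤ b / (1 - ‖z‖) := by
          rw [le_div_iff₀ h1]; nlinarith [norm_nonneg z]
        have := hb z hz
        rw [mul_div_assoc]
        linarith
      rw [div_le_iff₀ (by linarith)]
      refine h2.trans ?_
      have : 0 ≤ b / (1 - ‖z‖) := by positivity
      rw [mul_div_assoc, mul_div_assoc]
      nlinarith
    have hd : DifferentiableOn ℂ (dslope H 0) (Metric.ball 0 1) :=
      (Complex.differentiableOn_dslope (Metric.ball_mem_nhds _ one_pos)).2 hH
    have hall : ∀ z ∈ Metric.ball (0 : ℂ) 1, ‖dslope H 0 z‖ ≤ 8 * b / (1 - ‖z‖) := by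
      intro z hz
      have hz1 := mem_ball_zero_iff.1 hz
      have h1 : 0 < 1 - ‖z‖ := by linarith
      rcases le_or_gt (1 / 2) ‖z‖ with h | h
      · exact (hbig z hz h).trans (by gcongr; norm_num)
      · have hcl : closure (Metric.ball (0 : ℂ) (1 / 2)) ⊆ Metric.ball 0 1 := by
          rw [closure_ball _ (by norm_num)]
          exact Metric.closedBall_subset_ball (by norm_num)
        have h2 : ‖dslope H 0 z‖ ≤ 8 * b := by
          refine Complex.norm_le_of_forall_mem_frontier_norm_le Metric.isBounded_ball
            (hd.mono hcl).diffContOnCl (fun ζ hζ => ?_)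
            (subset_closure (by rw [mem_ball_zero_iff]; exact h))
          rw [frontier_ball _ (by norm_num), mem_sphere_zero_iff_norm] at hζ
          refine (hbig ζ (by rw [mem_ball_zero_iff, hζ]; norm_num) hζ.ge).trans_eq ?_
          rw [hζ]; ring
        refine h2.trans ?_
        rw [le_div_iff₀ h1]
        nlinarith [norm_nonneg z]
    obtain ⟨P, hP1, hP2, hP3⟩ := ih _ _ hd hall
    refine ⟨Polynomial.C (H 0) + Polynomial.X * P, fun k hk => ?_, fun k => ?_, fun z hz => ?_⟩
    · obtain ⟨k, rfl⟩ : ∃ j, k = j + 1 := ⟨k - 1, by omega⟩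
      simp [Polynomial.coeff_X_mul, hP1 k (by omega)]
    · rcases k with _ | k
      · simp only [Polynomial.coeff_add, Polynomial.coeff_C_zero, Polynomial.mul_coeff_zero,
          Polynomial.coeff_X_zero, zero_mul, add_zero]
        exact h0.trans (le_mul_of_one_le_left hb0 (one_le_pow₀ (by norm_num)))
      · have : (8 : ℝ) ^ (l + 1) * b = 8 ^ l * (8 * b) := by ring
        rw [this]
        simpa [Polynomial.coeff_X_mul, Polynomial.coeff_C] using hP2 k
    · have e : H z - (Polynomial.C (H 0) + Polynomial.X * P).eval z =
          z * (dslope H 0 z - P.eval z) := by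
        have := sub_smul_dslope H 0 z
        rw [sub_zero, smul_eq_mul] at this
        simp only [Polynomial.eval_add, Polynomial.eval_C, Polynomial.eval_mul, Polynomial.eval_X]
        linear_combination (-1 : ℂ) * this
      rw [e, norm_mul]
      calc _ ≤ ‖z‖ * (‖z‖ ^ l * (8 ^ l * (8 * b) / (1 - ‖z‖))) := by
            gcongr
            exact hP3 z hz
        _ = _ := by ring

/-! ### The polynomial part of `u_z` -/

lemma chi_le_two_mul_of_le {ε : ℝ} (hε : 0 < ε) {z ζ : ℂ} (h : ‖ζ‖ ≤ ε) :
    chi ε ζ ≤ 2 * chi ε z := by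
  linarith [chi_le_add hε ζ, le_chi ε z]

lemma chi_le_two_mul_norm {ε : ℝ} (hε : 0 < ε) {ζ : ℂ} (h : ε ≤ ‖ζ‖) : chi ε ζ ≤ 2 * ‖ζ‖ := by
  linarith [chi_le_add hε ζ]

/-- A Cauchy type integral is bounded by the weighted potential if its kernel is. -/
lemma enorm_integral_wF_le {a β ε : ℝ} (hε : 0 < ε) {f : ℂ → ℂ} {z : ℂ} {k : ℂ → ℂ} {c : ℝ}
    (hc : 0 ≤ c) (hk : ∀ᵐ ζ, f ζ ≠ 0 → chi ε ζ ^ a * ‖k ζ‖ ≤ c * (chi ε ζ ^ β * ‖z - ζ‖⁻¹)) :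
    ‖(Real.pi : ℂ)⁻¹ * ∫ ζ, wF a ε f ζ / 4 * k ζ‖ₑ ≤ ENNReal.ofReal c * cpot ε β f z := by
  have h1 : ‖(Real.pi : ℂ)⁻¹‖ₑ ≤ 1 := by
    rw [← ofReal_norm, norm_inv, Complex.norm_real, Real.norm_of_nonneg Real.pi_pos.le]
    refine ENNReal.ofReal_le_one.2 (inv_le_one_of_one_le₀ ?_)
    linarith [Real.pi_gt_three]
  rw [enorm_mul]
  refine (mul_le_of_le_one_left zero_le h1).trans ((enorm_integral_le_lintegral_enorm _).trans ?_)
  rw [cpot, ← lintegral_const_mul' _ _ ENNReal.ofReal_ne_top]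
  refine lintegral_mono_ae ?_
  filter_upwards [hk] with ζ hζ
  by_cases hf : f ζ = 0
  · simp [wF, hf]
  · have hχ := (chi_pos hε ζ).le
    rw [← ofReal_norm, ← ofReal_norm (f ζ), ← ENNReal.ofReal_mul (norm_nonneg _),
      ← ENNReal.ofReal_mul (by positivity), ← ENNReal.ofReal_mul hc]
    refine ENNReal.ofReal_le_ofReal ?_
    rw [norm_mul, norm_div, norm_wF hε, Complex.norm_ofNat]
    calc _ = ‖f ζ‖ / 4 * (chi ε ζ ^ a * ‖k ζ‖) := by ring
      _ ≤ ‖f ζ‖ * (c * (chi ε ζ ^ β * ‖z - ζ‖⁻¹)) :=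
          mul_le_mul (by linarith [norm_nonneg (f ζ)]) (hζ hf) (by positivity) (norm_nonneg _)
      _ = _ := by ring

/-- The expansion of the Cauchy kernel for `|ζ|` large against `|z|`. -/
lemma inv_sub_add_sum {z ζ : ℂ} (hζ : ζ ≠ 0) (hz : z ≠ ζ) (l : ℕ) :
    (z - ζ)⁻¹ + ∑ k ∈ Finset.range l, z ^ k * (ζ ^ (k + 1))⁻¹ = (z / ζ) ^ l * (z - ζ)⁻¹ := by
  have h1 : z - ζ ≠ 0 := sub_ne_zero.2 hz
  induction l with
  | zero => simp
  | succ l ih =>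
    rw [Finset.sum_range_succ, ← add_assoc, ih, div_pow, div_pow]
    field_simp
    ring

section

variable {p : ℝ≥0∞} {ε₀ : ℝ}

/-- The estimate of `u_z - P` when `P` has degree less than `l`. The polynomial consists of the
Taylor polynomials of the holomorphic part and of the potential of `F` restricted to `|ζ| > ε`. -/
lemma exists_polynomial_of_nat (hp : 2 ≤ p) {β : ℝ} (hβ : -2 < β - 2 / p.toReal)
    (hβ' : β - 2 / p.toReal ≤ -1) (hε₀ : 0 ≤ ε₀) (l : ℕ) :
    ∃ C, 0 ≤ C ∧ ∀ ε ≤ ε₀, ∀ u f : ℂ → ℂ, IsData (β + l) p ε u f → ∃ P : Polynomial ℂ,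
      (∀ k, l ≤ k → P.coeff k = 0) ∧ (∀ k, ‖P.coeff k‖ ≤ C * dataNorm p u f) ∧
      ∀ z ∈ pdisk, ‖dz u z - P.eval z‖ₑ ≤ ENNReal.ofReal (C * chi ε z ^ l) *
        (cpot ε β f z + ENNReal.ofReal (dataNorm p u f / (1 - ‖z‖))) := by
  obtain ⟨M, hM1, hM⟩ := exists_holomorphic_part_bounds (β + l) hp (ε₀ := ε₀)
  obtain ⟨C₁, hC₁0, hC₁⟩ := exists_lintegral_mul_chi_rpow_le hp (υ := β - 2 / p.toReal + 2)
    (by linarith) (by linarith [(two_div_toReal_mem hp).2])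
  set X := 1 + ε₀ with hX
  have hX1 : 1 ≤ X := by linarith
  refine ⟨8 ^ l * M + (2 * X) ^ l * C₁ + 2 ^ l, by positivity, fun ε hε u f hD => ?_⟩
  have hε0 := hD.eps_pos
  set N := dataNorm p u f with hN
  have hN0 : 0 ≤ N := dataNorm_nonneg p u f
  set F := wF (β + l) ε f with hF
  have iF : Integrable F := hD.integrable_wF hp
  obtain ⟨H, hH, hHe, hHb, -⟩ := hM ε hε u f hD 0
  obtain ⟨P₀, hP₀1, hP₀2, hP₀3⟩ := exists_taylor l H (M * N) hH hHb
  have hpow : ∀ ζ, chi ε ζ ^ (β + l) = chi ε ζ ^ β * chi ε ζ ^ l := fun ζ => by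
    rw [Real.rpow_add (chi_pos hε0 ζ), Real.rpow_natCast]
  -- the Taylor coefficients of the potential of `F` outside the disk of radius `ε`
  set E : Set ℂ := (Metric.closedBall (0 : ℂ) ε)ᶜ with hE
  have hEm : MeasurableSet E := measurableSet_closedBall.compl
  set κ : ℕ → ℂ → ℂ := fun k ζ => E.indicator (fun ζ => (ζ ^ (k + 1))⁻¹) ζ with hκ
  have hκm : ∀ k, Measurable (κ k) := fun k => Measurable.indicator (by fun_prop) hEm
  have hEn : ∀ ζ ∈ E, ε < ‖ζ‖ := fun ζ hζ => by
    rw [hE, mem_compl_iff, mem_closedBall_zero_iff, not_le] at hζ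
    exact hζ
  have hκb : ∀ k ζ, ‖κ k ζ‖ ≤ (ε ^ (k + 1))⁻¹ := by
    intro k ζ
    by_cases h : ζ ∈ E
    · simp only [hκ]
      rw [indicator_of_mem h, norm_inv, norm_pow]
      have := hEn ζ h
      gcongr
    · simp only [hκ]
      rw [indicator_of_notMem h, norm_zero]
      positivity
  have iκ : ∀ k, Integrable fun ζ => F ζ / 4 * κ k ζ := fun k =>
    (iF.div_const 4).mul_bdd (hκm k).aestronglyMeasurable (Eventually.of_forall (hκb k))
  set c : ℕ → ℂ := fun k => -((Real.pi : ℂ)⁻¹ * ∫ ζ, F ζ / 4 * κ k ζ) with hcd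
  have hcb : ∀ k < l, ‖c k‖ ≤ (2 * X) ^ l * C₁ * N := by
    intro k hk
    have h1 : ‖(∫ ζ, F ζ / 4 * κ k ζ)‖ₑ ≤ ENNReal.ofReal ((2 * X) ^ l * C₁ * N) := by
      refine (enorm_integral_le_lintegral_enorm _).trans ?_
      calc ∫⁻ ζ, ‖F ζ / 4 * κ k ζ‖ₑ
          ≤ ∫⁻ ζ, ENNReal.ofReal ((2 * X) ^ l) * (‖f ζ‖ₑ * ENNReal.ofReal (chi ε ζ ^ β)) := by
            refine lintegral_mono fun ζ => ?_
            by_cases h : ζ ∈ E ∧ ζ ∈ Metric.ball (0 : ℂ) 1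
            · have hχ := chi_pos hε0 ζ
              rw [← ofReal_norm, ← ofReal_norm (f ζ), ← ENNReal.ofReal_mul (norm_nonneg _),
                ← ENNReal.ofReal_mul (by positivity)]
              refine ENNReal.ofReal_le_ofReal ?_
              have h2 := chi_le_two_mul_norm hε0 (hEn ζ h.1).le
              have h3 := chi_le_of_mem_ball hε0 hε h.2
              have h4 : 0 < ‖ζ‖ := hε0.trans (hEn ζ h.1)
              simp only [hκ]
              rw [indicator_of_mem h.1, norm_mul, norm_div, hF, norm_wF hε0, hpow, norm_inv,
                norm_pow, Complex.norm_ofNat]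
              have h5 : chi ε ζ ^ l * (‖ζ‖ ^ (k + 1))⁻¹ ≤ (2 * X) ^ l := by
                rw [mul_inv_le_iff₀ (by positivity)]
                obtain ⟨j, rfl⟩ : ∃ j, l = k + 1 + j := ⟨l - (k + 1), by omega⟩
                calc chi ε ζ ^ (k + 1 + j) = chi ε ζ ^ (k + 1) * chi ε ζ ^ j := pow_add _ _ _
                  _ ≤ (2 * ‖ζ‖) ^ (k + 1) * X ^ j := by gcongr
                  _ ≤ (2 * X * ‖ζ‖) ^ (k + 1) * (2 * X) ^ j := by
                      gcongr
                      · nlinarith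
                      · linarith
                  _ = _ := by rw [mul_pow (2 * X), pow_add]; ring
              calc _ = chi ε ζ ^ β * ‖f ζ‖ / 4 * (chi ε ζ ^ l * (‖ζ‖ ^ (k + 1))⁻¹) := by ring
                _ ≤ chi ε ζ ^ β * ‖f ζ‖ * (2 * X) ^ l := by
                    gcongr
                    have : 0 ≤ chi ε ζ ^ β * ‖f ζ‖ := by positivity
                    linarith
                _ = _ := by ring
            · rw [not_and_or] at h
              rcases h with h | h
              · simp [hκ, h]
              · simp [hF, hD.wF_eq_zero ζ h]
        _ ≤ ENNReal.ofReal ((2 * X) ^ l) * (ENNReal.ofReal C₁ * ENNReal.ofReal N) := by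
            rw [lintegral_const_mul' _ _ ENNReal.ofReal_ne_top]
            have := hC₁ ε hε0 f hD.memLp.1 hD.eq_zero
            rw [show 2 / p.toReal - 2 + (β - 2 / p.toReal + 2) = β by ring] at this
            gcongr
            exact this.trans (by gcongr; exact hD.ofReal_le)
        _ = _ := by
            rw [← ENNReal.ofReal_mul (by positivity), ← ENNReal.ofReal_mul (by positivity), mul_assoc]
    rw [← ofReal_norm, ENNReal.ofReal_le_ofReal_iff (by positivity)] at h1
    rw [hcd]; simp only
    rw [norm_neg, norm_mul, norm_inv, Complex.norm_real, Real.norm_of_nonneg Real.pi_pos.le]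
    refine (mul_le_of_le_one_left (norm_nonneg _) (inv_le_one_of_one_le₀ ?_)).trans h1
    linarith [Real.pi_gt_three]
  set P₁ : Polynomial ℂ := ∑ k ∈ Finset.range l, Polynomial.C (c k) * Polynomial.X ^ k with hP₁
  have hP₁c : ∀ k, P₁.coeff k = if k < l then c k else 0 := by
    intro k
    rw [hP₁, Polynomial.finsetSum_coeff]
    simp only [Polynomial.coeff_C_mul_X_pow]
    rw [Finset.sum_ite_eq]
    simp
  have hP₁e : ∀ z, P₁.eval z = ∑ k ∈ Finset.range l, c k * z ^ k := fun z => by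
    rw [hP₁, Polynomial.eval_finsetSum]
    simp
  refine ⟨P₀ + P₁, fun k hk => ?_, fun k => ?_, fun z hz => ?_⟩
  · rw [Polynomial.coeff_add, hP₀1 k hk, hP₁c, if_neg (by omega), add_zero]
  · rw [Polynomial.coeff_add, hP₁c]
    refine (norm_add_le _ _).trans ?_
    have h1 := hP₀2 k
    have h2 : ‖if k < l then c k else 0‖ ≤ (2 * X) ^ l * C₁ * N := by
      split_ifs with h
      · exact hcb k h
      · rw [norm_zero]; positivity
    have h3 : 0 ≤ 2 ^ l * N := by positivity
    nlinarith
  · have hz1 := mem_ball_zero_iff.1 hz.1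
    obtain ⟨i1, e1⟩ := hHe z hz
    simp only [pow_zero, one_mul] at i1 e1
    -- the kernel left after subtracting the Taylor polynomial
    set k : ℂ → ℂ := fun ζ => (z - ζ)⁻¹ + ∑ j ∈ Finset.range l, z ^ j * κ j ζ with hk
    have e2 : cauchyPart 0 F z - P₁.eval z = (Real.pi : ℂ)⁻¹ * ∫ ζ, F ζ / 4 * k ζ := by
      have i2 : ∀ j ∈ Finset.range l, Integrable fun ζ => z ^ j * (F ζ / 4 * κ j ζ) :=
        fun j _ => (iκ j).const_mul _
      have e3 : ∀ ζ, F ζ / 4 * k ζ = F ζ / 4 * (z - ζ)⁻¹ +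
          ∑ j ∈ Finset.range l, z ^ j * (F ζ / 4 * κ j ζ) := fun ζ => by
        simp only [hk]
        rw [mul_add, Finset.mul_sum]
        congr 1
        exact Finset.sum_congr rfl fun j _ => by ring
      simp only [e3]
      rw [integral_add i1 (integrable_finsetSum _ i2), integral_finsetSum _ i2, mul_add,
        Finset.mul_sum, hP₁e, cauchyPart, sub_eq_add_neg, ← Finset.sum_neg_distrib]
      congr 1
      · simp only [pow_zero, one_mul, hF]
      · refine Finset.sum_congr rfl fun j _ => ?_
        rw [integral_const_mul, hcd]
        ring
    have e4 : dz u z - (P₀ + P₁).eval z =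
        (H z - P₀.eval z) + (Real.pi : ℂ)⁻¹ * ∫ ζ, F ζ / 4 * k ζ := by
      rw [← e2, e1, Polynomial.eval_add]; ring
    have hχz := chi_pos hε0 z
    have hker : ∀ᵐ ζ, f ζ ≠ 0 → chi ε ζ ^ (β + l) * ‖k ζ‖ ≤
        2 ^ l * chi ε z ^ l * (chi ε ζ ^ β * ‖z - ζ‖⁻¹) := by
      filter_upwards [compl_mem_ae_iff.2 (measure_singleton z)] with ζ hζz _
      have hχ := chi_pos hε0 ζ
      rw [hpow]
      -- for `|ζ| > ε` the kernel is `(z / ζ) ^ l / (z - ζ)`, and `χ(ζ) ≤ 2 |ζ|`; for `|ζ| ≤ ε`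
      -- nothing was subtracted, and `χ(ζ) ≤ 2 χ(z)`
      by_cases h : ζ ∈ E
      · have h4 : 0 < ‖ζ‖ := hε0.trans (hEn ζ h)
        have h2 := chi_le_two_mul_norm hε0 (hEn ζ h).le
        have e5 : k ζ = (z / ζ) ^ l * (z - ζ)⁻¹ := by
          rw [← inv_sub_add_sum (norm_pos_iff.1 h4) (Ne.symm hζz)]
          simp [hk, hκ, h]
        rw [e5, norm_mul, norm_pow, norm_div, norm_inv]
        have h6 : chi ε ζ ^ l * (‖z‖ / ‖ζ‖) ^ l ≤ 2 ^ l * chi ε z ^ l := by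
          rw [← mul_pow, ← mul_pow]
          have h7 : chi ε ζ * (‖z‖ / ‖ζ‖) ≤ 2 * chi ε z := by
            rw [mul_div_assoc', div_le_iff₀ h4]
            nlinarith [norm_le_chi ε z, norm_nonneg z,
              mul_le_mul h2 (norm_le_chi ε z) (norm_nonneg z) (by positivity)]
          gcongr
        calc _ = chi ε ζ ^ l * (‖z‖ / ‖ζ‖) ^ l * (chi ε ζ ^ β * ‖z - ζ‖⁻¹) := by ring
          _ ≤ _ := by gcongr
      · have e5 : k ζ = (z - ζ)⁻¹ := by simp [hk, hκ, h]
        rw [e5, norm_inv]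
        have h6 : chi ε ζ ^ l ≤ 2 ^ l * chi ε z ^ l := by
          rw [← mul_pow]
          have := chi_le_two_mul_of_le hε0 (z := z) (ζ := ζ) (by
            rw [hE, notMem_compl_iff, mem_closedBall_zero_iff] at h
            exact h)
          gcongr
        calc _ = chi ε ζ ^ l * (chi ε ζ ^ β * ‖z - ζ‖⁻¹) := by ring
          _ ≤ _ := by gcongr
    have h1 := enorm_integral_wF_le hε0 (by positivity) hker
    have h2 : ‖H z - P₀.eval z‖ₑ ≤ ENNReal.ofReal (8 ^ l * M * chi ε z ^ l) *
        ENNReal.ofReal (N / (1 - ‖z‖)) := by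
      have h3 : 0 < 1 - ‖z‖ := by linarith
      rw [← ofReal_norm, ← ENNReal.ofReal_mul (by positivity)]
      refine ENNReal.ofReal_le_ofReal ((hP₀3 z hz.1).trans ?_)
      calc _ ≤ chi ε z ^ l * (8 ^ l * (M * N) / (1 - ‖z‖)) := by
            gcongr
            exact norm_le_chi ε z
        _ = _ := by ring
    have hle : (0 : ℝ) ≤ (2 * X) ^ l * C₁ := by positivity
    have hle2 : (0 : ℝ) ≤ 8 ^ l * M := by positivity
    have hle3 : (0 : ℝ) ≤ 2 ^ l := by positivity
    rw [e4, mul_add]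
    refine (enorm_add_le _ _).trans ?_
    rw [add_comm (ENNReal.ofReal _ * cpot ε β f z)]
    refine add_le_add (h2.trans ?_) (h1.trans ?_)
    · gcongr; linarith
    · gcongr; linarith

/-- The estimate of `u_z` for large negative `a`, where no polynomial is needed. If `|z| ≥ ε`, the
factor `ζ ^ m` in the representation of `z ^ m u_z` compensates the singularity of the weight; if
`|z| < ε`, the weight at `z` is the largest up to a constant, and `u_z` itself is represented. -/
lemma norm_dz_le_of_nat (hp : 2 ≤ p) (β : ℝ) (hε₀ : 0 ≤ ε₀) (m : ℕ) :
    ∃ C, 0 ≤ C ∧ ∀ ε ≤ ε₀, ∀ u f : ℂ → ℂ, IsData (β - m) p ε u f →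
      ∀ z ∈ pdisk, ‖dz u z‖ₑ ≤ ENNReal.ofReal (C * (chi ε z ^ m)⁻¹) *
        (cpot ε β f z + ENNReal.ofReal (dataNorm p u f / (1 - ‖z‖))) := by
  obtain ⟨M, hM1, hM⟩ := exists_holomorphic_part_bounds (β - m) hp (ε₀ := ε₀)
  set X := 1 + ε₀ with hX
  have hX1 : 1 ≤ X := by linarith
  refine ⟨(2 * X) ^ m * M, by positivity, fun ε hε u f hD z hz => ?_⟩
  have hε0 := hD.eps_pos
  set N := dataNorm p u f with hN
  have hN0 : 0 ≤ N := dataNorm_nonneg p u f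
  have hpow : ∀ ζ, chi ε ζ ^ (β - m) = chi ε ζ ^ β * (chi ε ζ ^ m)⁻¹ := fun ζ => by
    rw [Real.rpow_sub (chi_pos hε0 ζ), Real.rpow_natCast, div_eq_mul_inv]
  have hz1 : 0 < 1 - ‖z‖ := by linarith [mem_ball_zero_iff.1 hz.1]
  have hz0 : 0 < ‖z‖ := norm_pos_iff.2 hz.2
  have hχz := chi_pos hε0 z
  have hχX := chi_le_of_mem_ball hε0 hε hz.1
  have hB : (2 : ℝ) ^ m ≤ (2 * X) ^ m * M := by
    calc (2 : ℝ) ^ m ≤ (2 * X) ^ m := by gcongr; linarith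
      _ ≤ _ := le_mul_of_one_le_right (by positivity) hM1
  rcases le_or_gt ε ‖z‖ with h | h
  · obtain ⟨H, hH, hHe, hHb, -⟩ := hM ε hε u f hD m
    have e1 := (hHe z hz).2
    have h1 : ‖cauchyPart m (wF (β - m) ε f) z‖ₑ ≤ ENNReal.ofReal 1 * cpot ε β f z := by
      have := enorm_integral_wF_le (a := β - m) (β := β) hε0 (f := f) (z := z)
        (k := fun ζ => ζ ^ m * (z - ζ)⁻¹) zero_le_one (Eventually.of_forall fun ζ _ => by
          have hχ := chi_pos hε0 ζ
          rw [hpow, norm_mul, norm_pow, norm_inv, one_mul]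
          have : (chi ε ζ ^ m)⁻¹ * ‖ζ‖ ^ m ≤ 1 := by
            rw [inv_mul_le_iff₀ (by positivity), mul_one]
            gcongr
            exact norm_le_chi ε ζ
          calc _ = (chi ε ζ ^ m)⁻¹ * ‖ζ‖ ^ m * (chi ε ζ ^ β * ‖z - ζ‖⁻¹) := by ring
            _ ≤ 1 * (chi ε ζ ^ β * ‖z - ζ‖⁻¹) := by gcongr
            _ = _ := one_mul _)
      refine le_trans (le_of_eq ?_) this
      rw [cauchyPart]
      congr 2
      refine congrArg _ (funext fun ζ => ?_)
      ring
    have h2 : ‖H z‖ₑ ≤ ENNReal.ofReal M * ENNReal.ofReal (N / (1 - ‖z‖)) := by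
      rw [← ofReal_norm, ← ENNReal.ofReal_mul (by positivity)]
      exact ENNReal.ofReal_le_ofReal ((hHb z hz.1).trans_eq (by ring))
    have e2 : dz u z = (z ^ m)⁻¹ * (H z + cauchyPart m (wF (β - m) ε f) z) := by
      rw [← e1, inv_mul_cancel_left₀ (pow_ne_zero _ hz.2)]
    have h3 : ‖(z ^ m)⁻¹‖ₑ ≤ ENNReal.ofReal (2 ^ m * (chi ε z ^ m)⁻¹) := by
      rw [← ofReal_norm, norm_inv, norm_pow]
      refine ENNReal.ofReal_le_ofReal ?_
      rw [inv_le_iff_one_le_mul₀ (by positivity), mul_assoc, mul_left_comm,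
        le_inv_mul_iff₀ (by positivity), mul_one, ← mul_pow]
      gcongr
      exact chi_le_two_mul_norm hε0 h
    rw [e2, enorm_mul]
    have h4 : ‖H z + cauchyPart m (wF (β - m) ε f) z‖ₑ ≤ ENNReal.ofReal M *
        (cpot ε β f z + ENNReal.ofReal (N / (1 - ‖z‖))) := by
      rw [mul_add, add_comm (_ * _)]
      refine (enorm_add_le _ _).trans (add_le_add h2 (h1.trans ?_))
      gcongr
    refine (mul_le_mul' h3 h4).trans ?_
    rw [← mul_assoc, ← ENNReal.ofReal_mul (by positivity)]
    refine mul_le_mul' (ENNReal.ofReal_le_ofReal ?_) le_rfl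
    calc _ = 2 ^ m * (M * (chi ε z ^ m)⁻¹) := by ring
      _ ≤ (2 * X) ^ m * (M * (chi ε z ^ m)⁻¹) := by gcongr; linarith
      _ = _ := by ring
  · obtain ⟨H, hH, hHe, hHb, -⟩ := hM ε hε u f hD 0
    have e1 := (hHe z hz).2
    rw [pow_zero, one_mul] at e1
    have h1 : ‖cauchyPart 0 (wF (β - m) ε f) z‖ₑ ≤
        ENNReal.ofReal (2 ^ m * (chi ε z ^ m)⁻¹) * cpot ε β f z := by
      have := enorm_integral_wF_le (a := β - m) (β := β) hε0 (f := f) (z := z)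
        (k := fun ζ => (z - ζ)⁻¹) (c := 2 ^ m * (chi ε z ^ m)⁻¹) (by positivity)
        (Eventually.of_forall fun ζ _ => by
          have hχ := chi_pos hε0 ζ
          rw [hpow, norm_inv]
          have : (chi ε ζ ^ m)⁻¹ ≤ 2 ^ m * (chi ε z ^ m)⁻¹ := by
            rw [inv_le_iff_one_le_mul₀ (by positivity), mul_assoc, mul_left_comm,
              le_inv_mul_iff₀ (by positivity), mul_one, ← mul_pow]
            have := chi_le_two_mul_of_le hε0 (z := ζ) (ζ := z) h.le
            gcongr
          calc _ = (chi ε ζ ^ m)⁻¹ * (chi ε ζ ^ β * ‖z - ζ‖⁻¹) := by ring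
            _ ≤ _ := by gcongr)
      refine le_trans (le_of_eq ?_) this
      rw [cauchyPart]
      simp
    have h2 : ‖H z‖ₑ ≤ ENNReal.ofReal ((2 * X) ^ m * M * (chi ε z ^ m)⁻¹) *
        ENNReal.ofReal (N / (1 - ‖z‖)) := by
      rw [← ofReal_norm, ← ENNReal.ofReal_mul (by positivity)]
      refine ENNReal.ofReal_le_ofReal ((hHb z hz.1).trans ?_)
      have : 1 ≤ (2 * X) ^ m * (chi ε z ^ m)⁻¹ := by
        rw [mul_comm, le_inv_mul_iff₀ (by positivity), mul_one]
        gcongr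
        linarith
      calc _ = 1 * (M * (N / (1 - ‖z‖))) := by ring
        _ ≤ (2 * X) ^ m * (chi ε z ^ m)⁻¹ * (M * (N / (1 - ‖z‖))) := by gcongr
        _ = _ := by ring
    rw [e1, mul_add, add_comm (_ * _)]
    refine (enorm_add_le _ _).trans (add_le_add h2 (h1.trans ?_))
    gcongr

end

lemma rpow_le_add_of_mem {t X : ℝ} (h1 : 1 / 2 ≤ t) (h2 : t ≤ X) (e : ℝ) :
    t ^ e ≤ X ^ e + (1 / 2) ^ e := by
  have hX : 0 ≤ X := by linarith
  rcases le_total 0 e with he | he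
  · exact le_add_of_le_of_nonneg (Real.rpow_le_rpow (by linarith) h2 he) (by positivity)
  · exact le_add_of_nonneg_of_le (by positivity)
      (Real.rpow_le_rpow_of_nonpos (by norm_num) h1 he)

section

variable {p : ℝ≥0∞} {ε₀ : ℝ}

/-- For `p > 2` the derivative `u_z` is bounded away from the origin, up to the boundary. -/
lemma exists_norm_dz_le_of_half_le (hp : 2 < p) {a β : ℝ} (hβ : -2 < β - 2 / p.toReal)
    (hβ' : β - 2 / p.toReal ≤ -1) (hε₀ : 0 ≤ ε₀) (m : ℕ) {c : ℝ} (hc : 0 ≤ c)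
    (hm : ∀ ε > 0, ε ≤ ε₀ → ∀ ζ ∈ Metric.ball (0 : ℂ) 1,
      chi ε ζ ^ a * ‖ζ‖ ^ m ≤ c * chi ε ζ ^ β) :
    ∃ C, 0 ≤ C ∧ ∀ ε ≤ ε₀, ∀ u f : ℂ → ℂ, IsData a p ε u f →
      ∀ z ∈ pdisk, 1 / 2 ≤ ‖z‖ → ‖dz u z‖ ≤ C * dataNorm p u f := by
  obtain ⟨M, hM1, hM⟩ := exists_holomorphic_part_bounds a hp.le (ε₀ := ε₀)
  obtain ⟨C, hC0, hC⟩ := exists_cpot_le hp hβ' (υ := β - 2 / p.toReal + 2) (by linarith) le_rfl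
    (show 0 ≤ 1 + ε₀ by linarith)
  refine ⟨2 ^ m * (1 + 2 * (c * (C * 2))), by positivity, fun ε hε u f hD z hz hz2 => ?_⟩
  have hε0 := hD.eps_pos
  set N := dataNorm p u f with hN
  have hN0 : 0 ≤ N := dataNorm_nonneg p u f
  obtain ⟨H, -, hHe, -, hHb⟩ := hM ε hε u f hD m
  have hG : ∀ z ∈ Metric.ball (0 : ℂ) 1, 1 / 2 ≤ ‖z‖ →
      ‖cauchyPart m (wF a ε f) z‖ ≤ c * (C * 2) * N := by
    intro z hz hz2
    have h1 := enorm_integral_wF_le (a := a) (β := β) hε0 (f := f) (z := z)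
      (k := fun ζ => ζ ^ m * (z - ζ)⁻¹) hc (Eventually.of_forall fun ζ hfζ => by
        have hχ := chi_pos hε0 ζ
        have hζ : ζ ∈ Metric.ball (0 : ℂ) 1 := by
          by_contra h
          exact hfζ (hD.eq_zero ζ h)
        rw [norm_mul, norm_pow, norm_inv, ← mul_assoc, ← mul_assoc]
        exact mul_le_mul_of_nonneg_right (hm ε hε0 hε ζ hζ) (by positivity))
    have h2 := hC ε hε0 f hD.memLp.1 hD.eq_zero z (chi_le_of_mem_ball hε0 hε hz)
    rw [show β + 1 - 2 / p.toReal - (β - 2 / p.toReal + 2) = -1 by ring, Real.rpow_neg_one] at h2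
    have h3 : (chi ε z)⁻¹ ≤ 2 := by
      rw [inv_le_comm₀ (chi_pos hε0 z) two_pos]
      have := norm_le_chi ε z
      linarith
    have e : cauchyPart m (wF a ε f) z =
        (Real.pi : ℂ)⁻¹ * ∫ ζ, wF a ε f ζ / 4 * (ζ ^ m * (z - ζ)⁻¹) := by
      rw [cauchyPart]
      refine congrArg _ (congrArg _ (funext fun ζ => ?_))
      ring
    have h4 : ‖cauchyPart m (wF a ε f) z‖ₑ ≤ ENNReal.ofReal (c * (C * 2) * N) := by
      rw [e]
      refine h1.trans ?_
      rw [mul_assoc, ENNReal.ofReal_mul hc, ENNReal.ofReal_mul (by positivity)]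
      gcongr
      refine h2.trans ?_
      gcongr
      exact hD.ofReal_le
    rwa [← ofReal_norm, ENNReal.ofReal_le_ofReal_iff (by positivity)] at h4
  have h1 := hHb _ hG z hz.1
  have h2 := hG z hz.1 hz2
  have e := (hHe z hz).2
  have h3 : ‖z‖ ^ m * ‖dz u z‖ ≤ N + 2 * (c * (C * 2)) * N := by
    rw [← norm_pow, ← norm_mul, e]
    refine (norm_add_le _ _).trans ?_
    linarith
  calc ‖dz u z‖ = 1 * ‖dz u z‖ := (one_mul _).symm
    _ ≤ (2 * ‖z‖) ^ m * ‖dz u z‖ := by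
        gcongr
        exact one_le_pow₀ (by linarith)
    _ = 2 ^ m * (‖z‖ ^ m * ‖dz u z‖) := by rw [mul_pow]; ring
    _ ≤ 2 ^ m * (N + 2 * (c * (C * 2)) * N) := by gcongr
    _ = _ := by ring

lemma norm_eval_le {P : Polynomial ℂ} {l : ℕ} {c : ℝ} (hP : ∀ k, l ≤ k → P.coeff k = 0)
    (hc : ∀ k, ‖P.coeff k‖ ≤ c) {z : ℂ} (hz : ‖z‖ ≤ 1) : ‖P.eval z‖ ≤ (l + 1) * c := by
  have hd : P.natDegree < l + 1 :=
    Nat.lt_succ_of_le (Polynomial.natDegree_le_iff_coeff_eq_zero.2 fun k hk => hP k hk.le)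
  rw [Polynomial.eval_eq_sum_range' hd]
  refine (norm_sum_le _ _).trans ((Finset.sum_le_card_nsmul _ _ c fun k _ => ?_).trans_eq ?_)
  · rw [norm_mul, norm_pow]
    exact (mul_le_of_le_one_right (norm_nonneg _) (pow_le_one₀ (norm_nonneg _) hz)).trans (hc k)
  · simp

/-- The polynomial `P`, of degree at most `⌈a - 2 / p⌉`, and the basic estimate of `u_z - P`. -/
lemma exists_polynomial (a : ℝ) (hp : 2 ≤ p) (hε₀ : 0 ≤ ε₀) :
    ∃ β C : ℝ, -2 < β - 2 / p.toReal ∧ β - 2 / p.toReal ≤ -1 ∧ 0 ≤ C ∧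
      ∀ ε ≤ ε₀, ∀ u f : ℂ → ℂ, IsData a p ε u f → ∃ P : Polynomial ℂ,
        (∀ k : ℕ, ⌈a⌉ < (k : ℤ) → P.coeff k = 0) ∧
        (∀ z ∈ pdisk, ‖dz u z - P.eval z‖ₑ ≤ ENNReal.ofReal (C * chi ε z ^ (a - β)) *
          (cpot ε β f z + ENNReal.ofReal (dataNorm p u f / (1 - ‖z‖)))) ∧
        (2 < p → ∀ z ∈ pdisk, 1 / 2 ≤ ‖z‖ → ‖dz u z - P.eval z‖ ≤ C * dataNorm p u f) := by
  obtain ⟨hb0, hb1⟩ := two_div_toReal_mem hp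
  set b := 2 / p.toReal with hb
  -- with this `n` the exponent `β = a - n - 1` satisfies `-2 < β - 2 / p ≤ -1`
  set n := ⌈a - b⌉ with hn
  have hn1 : a - b ≤ n := Int.le_ceil _
  have hn2 : (n : ℝ) < a - b + 1 := Int.ceil_lt_add_one _
  have hna : n ≤ ⌈a⌉ := Int.ceil_mono (by linarith)
  rcases le_or_gt 0 (n + 1) with h | h
  · obtain ⟨l, hl⟩ := Int.eq_ofNat_of_zero_le h
    have hl' : (n : ℝ) + 1 = l := by exact_mod_cast hl
    obtain ⟨C, hC0, hC⟩ := exists_polynomial_of_nat hp (β := a - l) (by linarith) (by linarith)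
      hε₀ l
    have key : ∃ C', 0 ≤ C' ∧ (2 < p → ∀ ε ≤ ε₀, ∀ u f : ℂ → ℂ, IsData a p ε u f →
        ∀ z ∈ pdisk, 1 / 2 ≤ ‖z‖ → ‖dz u z‖ ≤ C' * dataNorm p u f) := by
      by_cases hp2 : 2 < p
      · obtain ⟨C', h0, h1⟩ := exists_norm_dz_le_of_half_le hp2 (a := a) (β := a - l) (ε₀ := ε₀)
          (by linarith) (by linarith) hε₀ 0 (c := (1 + ε₀) ^ l) (by positivity)
          (fun ε hε0 hε ζ hζ => by
            have hχ := chi_pos hε0 ζ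
            rw [pow_zero, mul_one, Real.rpow_sub hχ, Real.rpow_natCast, mul_div_assoc',
              le_div_iff₀ (by positivity), mul_comm]
            gcongr
            exact chi_le_of_mem_ball hε0 hε hζ)
        exact ⟨C', h0, fun _ => h1⟩
      · exact ⟨0, le_rfl, fun h => absurd h hp2⟩
    obtain ⟨C', hC'0, hC'⟩ := key
    refine ⟨a - l, C + (C' + (l + 1) * C), by linarith, by linarith, by positivity,
      fun ε hε u f hD => ?_⟩
    have hD' := hD
    rw [show a = a - l + l by ring] at hD'
    obtain ⟨P, hP1, hP2, hP3⟩ := hC ε hε u f hD'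
    have hN0 := dataNorm_nonneg p u f
    refine ⟨P, fun k hk => hP1 k (by omega), fun z hz => (hP3 z hz).trans ?_,
      fun hp2 z hz hz2 => ?_⟩
    · have := chi_pos hD.eps_pos z
      rw [sub_sub_cancel, Real.rpow_natCast]
      gcongr
      exact le_add_of_nonneg_right (by positivity)
    · refine (norm_sub_le _ _).trans ?_
      have h1 := hC' hp2 ε hε u f hD z hz hz2
      have h2 := norm_eval_le hP1 hP2 (mem_ball_zero_iff.1 hz.1).le
      nlinarith [mul_nonneg hC0 hN0]
  · obtain ⟨m, hm⟩ := Int.eq_ofNat_of_zero_le (show 0 ≤ -(n + 1) by omega)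
    have hm' : -((n : ℝ) + 1) = m := by exact_mod_cast hm
    obtain ⟨C, hC0, hC⟩ := norm_dz_le_of_nat hp (a + m) hε₀ m
    have key : ∃ C', 0 ≤ C' ∧ (2 < p → ∀ ε ≤ ε₀, ∀ u f : ℂ → ℂ, IsData a p ε u f →
        ∀ z ∈ pdisk, 1 / 2 ≤ ‖z‖ → ‖dz u z‖ ≤ C' * dataNorm p u f) := by
      by_cases hp2 : 2 < p
      · obtain ⟨C', h0, h1⟩ := exists_norm_dz_le_of_half_le hp2 (a := a) (β := a + m) (ε₀ := ε₀)
          (by linarith) (by linarith) hε₀ m zero_le_one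
          (fun ε hε0 hε ζ hζ => by
            have hχ := chi_pos hε0 ζ
            rw [one_mul, Real.rpow_add hχ, Real.rpow_natCast]
            gcongr
            exact norm_le_chi ε ζ)
        exact ⟨C', h0, fun _ => h1⟩
      · exact ⟨0, le_rfl, fun h => absurd h hp2⟩
    obtain ⟨C', hC'0, hC'⟩ := key
    refine ⟨a + m, C + C', by linarith, by linarith, by positivity, fun ε hε u f hD => ?_⟩
    have hD' := hD
    rw [show a = a + m - m by ring] at hD'
    have hN0 := dataNorm_nonneg p u f
    refine ⟨0, fun k _ => by simp, fun z hz => ?_, fun hp2 z hz hz2 => ?_⟩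
    · have := chi_pos hD.eps_pos z
      rw [Polynomial.eval_zero, sub_zero]
      refine (hC ε hε u f hD' z hz).trans ?_
      rw [sub_add_cancel_left, Real.rpow_neg this.le, Real.rpow_natCast]
      gcongr
      exact le_add_of_nonneg_right hC'0
    · rw [Polynomial.eval_zero, sub_zero]
      refine (hC' hp2 ε hε u f hD z hz hz2).trans ?_
      gcongr
      exact le_add_of_nonneg_left hC0

/-- The pointwise estimate of `u_z - P` for `p > 2`. -/
lemma exists_norm_sub_le (hp : 2 < p) {a β : ℝ} (hβ : -2 < β - 2 / p.toReal)
    (hβ' : β - 2 / p.toReal ≤ -1) (hε₀ : 0 ≤ ε₀) {C : ℝ} (hC : 0 ≤ C) {υ : ℝ} (hυ : 0 < υ) :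
    ∃ K, 0 ≤ K ∧ ∀ ε ≤ ε₀, ∀ u f : ℂ → ℂ, IsData a p ε u f → ∀ g : ℂ → ℂ,
      (∀ z ∈ pdisk, ‖g z‖ₑ ≤ ENNReal.ofReal (C * chi ε z ^ (a - β)) *
          (cpot ε β f z + ENNReal.ofReal (dataNorm p u f / (1 - ‖z‖)))) →
      (∀ z ∈ pdisk, 1 / 2 ≤ ‖z‖ → ‖g z‖ ≤ C * dataNorm p u f) →
      ∀ z ∈ pdisk, ‖g z‖ ≤ K * dataNorm p u f * chi ε z ^ (a + 1 - 2 / p.toReal - υ) := by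
  set b := 2 / p.toReal with hb
  set X := 1 + ε₀ with hX
  have hX0 : 0 < X := by linarith
  set υ' := min υ (β - b + 2) with hυ'
  have hυ0 : 0 < υ' := lt_min hυ (by linarith)
  obtain ⟨C₁, hC₁0, hC₁⟩ := exists_cpot_le hp hβ' hυ0 (min_le_right _ _) hX0.le
  set e := a + 1 - b - υ with he
  refine ⟨C * (C₁ * X ^ (υ - υ') + 2 * X ^ (a - β - e)) + C * (X ^ (-e) + (1 / 2) ^ (-e)),
    by positivity, fun ε hε u f hD g hg1 hg2 z hz => ?_⟩
  have hε0 := hD.eps_pos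
  have hχ := chi_pos hε0 z
  have hχX := chi_le_of_mem_ball hε0 hε hz.1
  set N := dataNorm p u f with hN
  have hN0 : 0 ≤ N := dataNorm_nonneg p u f
  have hA : 0 ≤ C * (C₁ * X ^ (υ - υ') + 2 * X ^ (a - β - e)) := by positivity
  have hB : 0 ≤ C * (X ^ (-e) + (1 / 2) ^ (-e)) := by positivity
  -- near the circle `χ` is bounded from above and below
  rcases le_or_gt (1 / 2) ‖z‖ with h | h
  · have h1 : 1 ≤ (X ^ (-e) + (1 / 2) ^ (-e)) * chi ε z ^ e := by
      have := rpow_le_add_of_mem (h.trans (norm_le_chi ε z)) hχX (-e)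
      calc (1 : ℝ) = chi ε z ^ (-e) * chi ε z ^ e := by rw [← Real.rpow_add hχ]; simp
        _ ≤ _ := by gcongr
    calc ‖g z‖ ≤ C * N * 1 := by rw [mul_one]; exact hg2 z hz h
      _ ≤ C * N * ((X ^ (-e) + (1 / 2) ^ (-e)) * chi ε z ^ e) := by gcongr
      _ = C * (X ^ (-e) + (1 / 2) ^ (-e)) * N * chi ε z ^ e := by ring
      _ ≤ _ := by
          gcongr
          exact le_add_of_nonneg_left hA
  · have h1 := hC₁ ε hε0 f hD.memLp.1 hD.eq_zero z hχX
    have h2 : N / (1 - ‖z‖) ≤ 2 * N := by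
      rw [div_le_iff₀ (by linarith)]
      nlinarith
    have h3 : ‖g z‖ₑ ≤ ENNReal.ofReal (C * chi ε z ^ (a - β) *
        (C₁ * chi ε z ^ (β + 1 - b - υ') * N + 2 * N)) := by
      refine (hg1 z hz).trans ?_
      rw [ENNReal.ofReal_mul (p := C * chi ε z ^ (a - β)) (by positivity),
        ENNReal.ofReal_add (by positivity) (by positivity), ENNReal.ofReal_mul (by positivity) (q := N)]
      gcongr
      refine h1.trans ?_
      gcongr
      exact hD.ofReal_le
    rw [← ofReal_norm, ENNReal.ofReal_le_ofReal_iff (by positivity)] at h3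
    have h4 : chi ε z ^ (a - β) * chi ε z ^ (β + 1 - b - υ') ≤ X ^ (υ - υ') * chi ε z ^ e := by
      rw [← Real.rpow_add hχ, show a - β + (β + 1 - b - υ') = (υ - υ') + e by rw [he]; ring,
        Real.rpow_add hχ]
      have : 0 ≤ υ - υ' := sub_nonneg.2 (min_le_left _ _)
      gcongr
    have h5 : chi ε z ^ (a - β) ≤ X ^ (a - β - e) * chi ε z ^ e := by
      have : chi ε z ^ (a - β) = chi ε z ^ (a - β - e) * chi ε z ^ e := by
        rw [← Real.rpow_add hχ]; simp
      rw [this]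
      have : 0 ≤ a - β - e := by rw [he]; linarith
      gcongr
    calc ‖g z‖ ≤ _ := h3
      _ = C * (C₁ * (chi ε z ^ (a - β) * chi ε z ^ (β + 1 - b - υ')) + 2 * chi ε z ^ (a - β)) * N := by
          ring
      _ ≤ C * (C₁ * (X ^ (υ - υ') * chi ε z ^ e) + 2 * (X ^ (a - β - e) * chi ε z ^ e)) * N := by
          gcongr
      _ = C * (C₁ * X ^ (υ - υ') + 2 * X ^ (a - β - e)) * N * chi ε z ^ e := by ring
      _ ≤ _ := by
          gcongr
          exact le_add_of_nonneg_right hB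

end

/-! ### Cutoffs to the rings where `χ` is comparable with `s` -/

lemma eventually_rst_eq_one {A B : ℝ} (hAB : A < B) {z : ℂ} (h : B < ‖z‖ ^ 2) :
    ∀ᶠ w in 𝓝 z, rst A B w = 1 := by
  have hc : Continuous fun w : ℂ => ‖w‖ ^ 2 := by fun_prop
  filter_upwards [(isOpen_lt continuous_const hc).mem_nhds h] with w hw
    using rst_eq_one hAB (le_of_lt hw)

lemma eventually_rst_eq_zero {A B : ℝ} (hAB : A < B) {z : ℂ} (h : ‖z‖ ^ 2 < A) :
    ∀ᶠ w in 𝓝 z, rst A B w = 0 := by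
  have hc : Continuous fun w : ℂ => ‖w‖ ^ 2 := by fun_prop
  filter_upwards [(isOpen_lt hc continuous_const).mem_nhds h] with w hw
    using rst_eq_zero hAB (le_of_lt hw)

lemma norm_sq_eq_chi_sq_sub (ε : ℝ) (z : ℂ) : ‖z‖ ^ 2 = chi ε z ^ 2 - ε ^ 2 := by
  rw [chi_sq]; ring

lemma dzb_one_sub_rst (A B : ℝ) (z : ℂ) : dzb (fun w => 1 - rst A B w) z = -dzb (rst A B) z := by
  rw [dzb_sub (differentiableAt_const _) ((contDiff_rst _ _ (n := 1)).differentiable (by simp) z),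
    dzb_const, zero_sub]

set_option maxHeartbeats 1000000 in
/-- A cutoff to the ring `{s ≤ χ ≤ 2 s}` inside the disk of radius `ρ`. If `s = ε` or `2 ε ≤ s`,
then the cutoff is constant near the origin. -/
lemma exists_ring_cutoff {ρ X : ℝ} (hρ0 : 0 < ρ) (hρ : ρ < 1) (hX : 1 ≤ X) :
    ∃ M c ρ', 0 ≤ M ∧ 0 < c ∧ ρ' < 1 ∧ ∀ ε s, 0 < ε → s ≤ X → (s = ε ∨ 2 * ε ≤ s) →
      ∃ ψ : ℂ → ℂ, ContDiff ℝ 1 ψ ∧ HasCompactSupport ψ ∧ tsupport ψ ⊆ Metric.ball 0 1 ∧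
        (∀ ζ, ‖ψ ζ‖ ≤ 1) ∧ (∃ c', ∀ᶠ ζ in 𝓝 0, ψ ζ = c') ∧
        (∀ z, ‖z‖ < ρ → s ≤ chi ε z → chi ε z ≤ 2 * s → ∀ᶠ w in 𝓝 z, ψ w = 1) ∧
        (∀ ζ ∈ tsupport ψ, s / 2 ≤ chi ε ζ ∧ chi ε ζ ≤ 3 * s ∧ ‖ζ‖ ≤ ρ') ∧
        (∀ ζ, ‖dzb ψ ζ‖ ≤ M / s) ∧
        ∀ ζ, dzb ψ ζ ≠ 0 → ∀ z, ‖z‖ < ρ → s ≤ chi ε z → chi ε z ≤ 2 * s → c * s ≤ ‖z - ζ‖ := by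
  obtain ⟨M, hM0, hM⟩ := exists_norm_dzb_rst_le
  set ρ₁ := (2 * ρ + 1) / 3 with hρ₁
  set ρ₂ := (ρ + 2) / 3 with hρ₂
  have h1 : ρ < ρ₁ := by rw [hρ₁]; linarith
  have h2 : ρ₁ < ρ₂ := by rw [hρ₁, hρ₂]; linarith
  have h3 : ρ₂ < 1 := by rw [hρ₂]; linarith
  have h12 : ρ₁ ^ 2 < ρ₂ ^ 2 := by nlinarith
  set D := ρ₂ ^ 2 - ρ₁ ^ 2 with hD
  have hD0 : 0 < D := by rw [hD]; linarith
  refine ⟨6 * M + 3 * M + M * X / D, min (1 / 4) ((ρ₁ - ρ) / X), ρ₂, by positivity,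
    lt_min (by norm_num) (div_pos (by linarith) (by linarith)), h3, fun ε s hε hsX hs => ?_⟩
  have hs0 : 0 < s := by rcases hs with h | h <;> linarith
  have hεs : ε ≤ s := by rcases hs with h | h <;> linarith
  -- `ψ₁` and `ψ₂` cut off to `s / √3 < χ < 3 s`, written in terms of `‖z‖² = χ² - ε²`, and `ψ₃` to
  -- the disk of radius `ρ₂`; at the origin, where `χ = ε`, `ψ₁` is `1` if `s = ε` and `0` if `2 ε
  -- ≤ s`
  set ψ₁ : ℂ → ℂ := rst (s ^ 2 / 3 - ε ^ 2) (s ^ 2 / 2 - ε ^ 2) with hψ₁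
  set ψ₂ : ℂ → ℂ := fun w => 1 - rst (8 * s ^ 2 - ε ^ 2) (9 * s ^ 2 - ε ^ 2) w with hψ₂
  set ψ₃ : ℂ → ℂ := fun w => 1 - rst (ρ₁ ^ 2) (ρ₂ ^ 2) w with hψ₃
  have hss : 0 < s ^ 2 := by positivity
  have hAB₁ : s ^ 2 / 3 - ε ^ 2 < s ^ 2 / 2 - ε ^ 2 := by linarith
  have hAB₂ : 8 * s ^ 2 - ε ^ 2 < 9 * s ^ 2 - ε ^ 2 := by linarith
  have c₁ : ContDiff ℝ 1 ψ₁ := contDiff_rst _ _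
  have c₂ : ContDiff ℝ 1 ψ₂ := contDiff_const.sub (contDiff_rst _ _)
  have c₃ : ContDiff ℝ 1 ψ₃ := contDiff_const.sub (contDiff_rst _ _)
  set ψ : ℂ → ℂ := fun w => ψ₁ w * (ψ₂ w * ψ₃ w) with hψ
  have n₁ : ∀ ζ, ‖ψ₁ ζ‖ ≤ 1 := norm_rst_le _ _
  have n₂ : ∀ ζ, ‖ψ₂ ζ‖ ≤ 1 := norm_one_sub_rst_le _ _
  have n₃ : ∀ ζ, ‖ψ₃ ζ‖ ≤ 1 := norm_one_sub_rst_le _ _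
  have hchi := continuous_chi hε
  have hclosed : IsClosed {ζ : ℂ | s / 2 ≤ chi ε ζ ∧ chi ε ζ ≤ 3 * s ∧ ‖ζ‖ ≤ ρ₂} :=
    (isClosed_le continuous_const hchi).inter
      ((isClosed_le hchi continuous_const).inter (isClosed_le continuous_norm continuous_const))
  have hsupp : Function.support ψ ⊆ {ζ : ℂ | s / 2 ≤ chi ε ζ ∧ chi ε ζ ≤ 3 * s ∧ ‖ζ‖ ≤ ρ₂} := by
    intro ζ hζ
    have hχ := chi_pos hε ζ
    refine ⟨?_, ?_, ?_⟩
    · by_contra! h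
      refine hζ ?_
      have : ψ₁ ζ = 0 := rst_eq_zero hAB₁ (by rw [norm_sq_eq_chi_sq_sub ε]; nlinarith)
      simp [hψ, this]
    · by_contra! h
      refine hζ ?_
      have : ψ₂ ζ = 0 := by
        rw [hψ₂]; simp only
        rw [rst_eq_one hAB₂ (by rw [norm_sq_eq_chi_sq_sub ε]; nlinarith), sub_self]
      simp [hψ, this]
    · by_contra! h
      refine hζ ?_
      have : ψ₃ ζ = 0 := by
        rw [hψ₃]; simp only
        rw [rst_eq_one h12 (by nlinarith), sub_self]
      simp [hψ, this]
  have htsupp := closure_minimal hsupp hclosed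
  have hcs : HasCompactSupport ψ :=
    HasCompactSupport.of_support_subset_isCompact (isCompact_closedBall (0 : ℂ) ρ₂)
      fun ζ hζ => mem_closedBall_zero_iff.2 (hsupp hζ).2.2
  have hdψ : ∀ ζ, dzb ψ ζ = dzb ψ₁ ζ * (ψ₂ ζ * ψ₃ ζ) +
      ψ₁ ζ * (dzb ψ₂ ζ * ψ₃ ζ + ψ₂ ζ * dzb ψ₃ ζ) := fun ζ => by
    have d₁ := c₁.differentiable one_ne_zero ζ
    have d₂ := c₂.differentiable one_ne_zero ζ
    have d₃ := c₃.differentiable one_ne_zero ζ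
    rw [hψ, dzb_mul (w := fun w => ψ₂ w * ψ₃ w) d₁ (d₂.mul d₃), dzb_mul d₂ d₃]
  have e₁ : ∀ ζ, dzb ψ₁ ζ ≠ 0 → chi ε ζ ^ 2 ≤ s ^ 2 / 2 := fun ζ h => by
    by_contra! h'
    exact h (dzb_rst_eq_zero hAB₁ (Or.inr (by rw [norm_sq_eq_chi_sq_sub ε]; linarith)))
  have e₂ : ∀ ζ, dzb ψ₂ ζ ≠ 0 → 8 * s ^ 2 ≤ chi ε ζ ^ 2 ∧ chi ε ζ ^ 2 ≤ 9 * s ^ 2 := by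
    intro ζ h
    by_contra h'
    rw [not_and_or, not_le, not_le] at h'
    refine h ?_
    rw [hψ₂, dzb_one_sub_rst, dzb_rst_eq_zero hAB₂, neg_zero]
    rw [norm_sq_eq_chi_sq_sub ε]
    exact h'.imp (fun h => by linarith) fun h => by linarith
  have e₃ : ∀ ζ, dzb ψ₃ ζ ≠ 0 → ρ₁ ≤ ‖ζ‖ ∧ ‖ζ‖ ≤ ρ₂ := by
    intro ζ h
    by_contra h'
    rw [not_and_or, not_le, not_le] at h'
    refine h ?_
    rw [hψ₃, dzb_one_sub_rst, dzb_rst_eq_zero h12, neg_zero]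
    exact h'.imp (fun h => by gcongr) fun h => by gcongr
  refine ⟨ψ, c₁.mul (c₂.mul c₃), hcs, fun ζ hζ => ?_, fun ζ => ?_, ?_, fun z hz hz1 hz2 => ?_,
    htsupp, fun ζ => ?_, fun ζ hζ z hz hz1 hz2 => ?_⟩
  · rw [mem_ball_zero_iff]
    exact (htsupp hζ).2.2.trans_lt h3
  · simp only [hψ, norm_mul]
    exact mul_le_one₀ (n₁ ζ) (by positivity)
      (mul_le_one₀ (n₂ ζ) (norm_nonneg _) (n₃ ζ))
  · have k₂ : ∀ᶠ ζ in 𝓝 (0 : ℂ), ψ₂ ζ = 1 := by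
      filter_upwards [eventually_rst_eq_zero (z := 0) hAB₂ (by rw [norm_zero]; nlinarith)] with w hw
      rw [hψ₂]; simp only; rw [hw, sub_zero]
    have k₃ : ∀ᶠ ζ in 𝓝 (0 : ℂ), ψ₃ ζ = 1 := by
      filter_upwards [eventually_rst_eq_zero (z := 0) h12 (by
        have : 0 < ρ₁ := by linarith
        rw [norm_zero, zero_pow two_ne_zero]
        positivity)] with w hw
      rw [hψ₃]; simp only; rw [hw, sub_zero]
    rcases hs with h | h
    · refine ⟨1, ?_⟩
      filter_upwards [eventually_rst_eq_one (z := 0) hAB₁ (by rw [norm_zero, h]; nlinarith), k₂, k₃]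
        with w w1 w2 w3
      simp only [hψ, hψ₁]
      rw [w1, w2, w3]; simp
    · refine ⟨0, ?_⟩
      filter_upwards [eventually_rst_eq_zero (z := 0) hAB₁ (by rw [norm_zero]; nlinarith)] with w w1
      simp only [hψ, hψ₁]
      rw [w1, zero_mul]
  · have hz3 := norm_nonneg z
    filter_upwards [eventually_rst_eq_one (z := z) hAB₁ (by rw [norm_sq_eq_chi_sq_sub ε]; nlinarith),
      eventually_rst_eq_zero (z := z) hAB₂ (by rw [norm_sq_eq_chi_sq_sub ε]; nlinarith),
      eventually_rst_eq_zero (z := z) h12 (by nlinarith)] with w w1 w2 w3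
    simp only [hψ, hψ₁, hψ₂, hψ₃]
    rw [w1, w2, w3]; simp
  · have b₁ : ‖dzb ψ₁ ζ‖ ≤ 6 * M / s := by
      by_cases h : dzb ψ₁ ζ = 0
      · rw [h, norm_zero]; positivity
      · refine (hM _ _ hAB₁ ζ).trans ?_
        have h4 : ‖ζ‖ ≤ s := (norm_le_chi ε ζ).trans (by nlinarith [e₁ ζ h, chi_pos hε ζ])
        rw [show s ^ 2 / 2 - ε ^ 2 - (s ^ 2 / 3 - ε ^ 2) = s ^ 2 / 6 by ring,
          div_le_div_iff₀ (by positivity) hs0]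
        nlinarith [mul_le_mul_of_nonneg_left h4 (show 0 ≤ M * s by positivity)]
    have b₂ : ‖dzb ψ₂ ζ‖ ≤ 3 * M / s := by
      by_cases h : dzb ψ₂ ζ = 0
      · rw [h, norm_zero]; positivity
      · have h4 : ‖ζ‖ ≤ 3 * s := (norm_le_chi ε ζ).trans (by nlinarith [(e₂ ζ h).2, chi_pos hε ζ])
        rw [hψ₂, dzb_one_sub_rst, norm_neg]
        refine (hM _ _ hAB₂ ζ).trans ?_
        rw [show 9 * s ^ 2 - ε ^ 2 - (8 * s ^ 2 - ε ^ 2) = s ^ 2 by ring,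
          div_le_div_iff₀ (by positivity) hs0]
        nlinarith [mul_le_mul_of_nonneg_left h4 (show 0 ≤ M * s by positivity)]
    have b₃ : ‖dzb ψ₃ ζ‖ ≤ M * X / D / s := by
      by_cases h : dzb ψ₃ ζ = 0
      · rw [h, norm_zero]; positivity
      · have h4 : ‖ζ‖ ≤ 1 := (e₃ ζ h).2.trans h3.le
        rw [hψ₃, dzb_one_sub_rst, norm_neg]
        refine (hM _ _ h12 ζ).trans ?_
        rw [← hD, div_div, div_le_div_iff₀ hD0 (by positivity)]
        nlinarith [mul_le_mul h4 hsX hs0.le zero_le_one, mul_nonneg hM0 hD0.le]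
    rw [hdψ]
    have t₁ : ‖dzb ψ₁ ζ * (ψ₂ ζ * ψ₃ ζ)‖ ≤ ‖dzb ψ₁ ζ‖ := by
      rw [norm_mul, norm_mul]
      exact mul_le_of_le_one_right (norm_nonneg _) (mul_le_one₀ (n₂ ζ) (norm_nonneg _) (n₃ ζ))
    have t₂ : ‖ψ₁ ζ * (dzb ψ₂ ζ * ψ₃ ζ + ψ₂ ζ * dzb ψ₃ ζ)‖ ≤ ‖dzb ψ₂ ζ‖ + ‖dzb ψ₃ ζ‖ := by
      rw [norm_mul]
      refine (mul_le_of_le_one_left (norm_nonneg _) (n₁ ζ)).trans ((norm_add_le _ _).trans ?_)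
      rw [norm_mul, norm_mul]
      exact add_le_add (mul_le_of_le_one_right (norm_nonneg _) (n₃ ζ))
        (mul_le_of_le_one_left (norm_nonneg _) (n₂ ζ))
    refine (norm_add_le _ _).trans ((add_le_add t₁ t₂).trans ?_)
    rw [add_div, add_div]
    linarith
  · have hor : dzb ψ₁ ζ ≠ 0 ∨ dzb ψ₂ ζ ≠ 0 ∨ dzb ψ₃ ζ ≠ 0 := by
      by_contra! h
      exact hζ (by rw [hdψ, h.1, h.2.1, h.2.2]; simp)
    have hm1 : min (1 / 4) ((ρ₁ - ρ) / X) * s ≤ 1 / 4 * s := by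
      gcongr
      exact min_le_left _ _
    have l1 := chi_le_chi_add hε z ζ
    have l2 := chi_le_chi_add hε ζ z
    rw [norm_sub_rev] at l2
    have hχζ := chi_pos hε ζ
    rcases hor with h | h | h
    · have := e₁ ζ h
      have : chi ε ζ ≤ 3 / 4 * s := by nlinarith
      linarith
    · have := (e₂ ζ h).1
      have : 9 / 4 * s ≤ chi ε ζ := by nlinarith
      linarith
    · have := (e₃ ζ h).1
      have h5 := norm_sub_norm_le ζ z
      rw [norm_sub_rev] at h5
      calc _ ≤ (ρ₁ - ρ) / X * s := by
            gcongr
            exact min_le_right _ _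
        _ ≤ (ρ₁ - ρ) / X * X := by
            have : 0 ≤ (ρ₁ - ρ) / X := div_nonneg (by linarith) (by linarith)
            gcongr
        _ = ρ₁ - ρ := div_mul_cancel₀ _ (by linarith)
        _ ≤ _ := by linarith

/-! ### The estimate of the second derivative -/

/-- Exponents `q < q₁ < p₁` with `p₁ ≤ p` finite. -/
lemma exists_exponents {p : ℝ≥0∞} (hp : 2 ≤ p) {q : ℝ} (hq : ENNReal.ofReal q < p) :
    ∃ q₁ p₁ C : ℝ, q < q₁ ∧ q₁ < p₁ ∧ 2 ≤ p₁ ∧ 0 ≤ C ∧ ∀ f : ℂ → ℂ,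
      (∀ z ∉ Metric.ball (0 : ℂ) 1, f z = 0) →
      ∫⁻ z, ‖f z‖ₑ ^ p₁ ≤ (ENNReal.ofReal C * eLpNorm f p volume) ^ p₁ := by
  rcases eq_or_ne p ∞ with rfl | h
  · refine ⟨|q| + 1, |q| + 2, Real.pi + 1, by linarith [le_abs_self q], by linarith,
      by linarith [abs_nonneg q], by positivity, fun f hf => ?_⟩
    have hp0 : 0 < |q| + 2 := by positivity
    have hp1 : 1 ≤ |q| + 2 := by linarith [abs_nonneg q]
    have hle : ∀ᵐ z, ‖f z‖ₑ ^ (|q| + 2) ≤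
        (Metric.ball (0 : ℂ) 1).indicator (fun _ => eLpNorm f ∞ volume ^ (|q| + 2)) z := by
      rw [eLpNorm_exponent_top]
      filter_upwards [enorm_ae_le_eLpNormEssSup f volume] with z hz
      by_cases h : z ∈ Metric.ball (0 : ℂ) 1
      · rw [indicator_of_mem h]
        gcongr
      · rw [hf z h, enorm_zero, ENNReal.zero_rpow_of_pos hp0]
        exact zero_le
    refine (lintegral_mono_ae hle).trans ?_
    rw [lintegral_indicator measurableSet_ball, setLIntegral_const, Complex.volume_ball,
      ENNReal.ofReal_one, one_pow, one_mul, mul_comm, ENNReal.mul_rpow_of_nonneg _ _ hp0.le]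
    gcongr
    rw [ENNReal.ofReal_rpow_of_nonneg (by positivity) hp0.le, ← ENNReal.ofReal_coe_nnreal,
      NNReal.coe_real_pi]
    refine ENNReal.ofReal_le_ofReal ?_
    calc Real.pi ≤ (Real.pi + 1) ^ (1 : ℝ) := by rw [Real.rpow_one]; linarith
      _ ≤ _ := Real.rpow_le_rpow_of_exponent_le (by linarith [Real.pi_pos]) hp1
  · have hp0 : p ≠ 0 := by
      rintro rfl
      simp at hp
    have hP : (2 : ℝ) ≤ p.toReal := by
      simpa using ENNReal.toReal_mono h hp
    have hqp : q < p.toReal := by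
      by_contra! h'
      refine absurd hq (not_lt.2 ?_)
      rw [← ENNReal.ofReal_toReal h]
      exact ENNReal.ofReal_le_ofReal h'
    refine ⟨(q + p.toReal) / 2, p.toReal, 1, by linarith, by linarith, hP, zero_le_one,
      fun f hf => le_of_eq ?_⟩
    rw [ENNReal.ofReal_one, one_mul, eLpNorm_eq_lintegral_rpow_enorm_toReal hp0 h, ← ENNReal.rpow_mul,
      one_div_mul_cancel (by linarith), ENNReal.rpow_one]

/-- The integral of `u_z - P` over a ring. -/
lemma exists_setLIntegral_ring_le {p : ℝ≥0∞} (hp : 2 ≤ p) {a β : ℝ}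
    (hβ' : β - 2 / p.toReal ≤ -1) {C : ℝ} (hC : 0 ≤ C) {υ : ℝ} (hυ : 0 < υ)
    (hυ' : υ ≤ β - 2 / p.toReal + 2) {ρ X : ℝ} (hρ : ρ < 1) (hX : 1 ≤ X) :
    ∃ K, 0 ≤ K ∧ ∀ ε, ∀ u f : ℂ → ℂ, IsData a p ε u f → ∀ g : ℂ → ℂ,
      (∀ z ∈ pdisk, ‖g z‖ₑ ≤ ENNReal.ofReal (C * chi ε z ^ (a - β)) *
          (cpot ε β f z + ENNReal.ofReal (dataNorm p u f / (1 - ‖z‖)))) →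
      ∀ s, ε ≤ s → s ≤ X →
      ∫⁻ z in {z | s / 2 ≤ chi ε z ∧ chi ε z ≤ 3 * s ∧ ‖z‖ ≤ ρ}, ‖g z‖ₑ ≤
        ENNReal.ofReal (K * dataNorm p u f * s ^ (a + 3 - 2 / p.toReal - υ)) := by
  obtain ⟨C₁, hC₁0, hC₁⟩ := exists_setLIntegral_cpot_le hp hβ' hυ hυ'
  set b := 2 / p.toReal with hb
  set c := (3 : ℝ) ^ (a - β) + (1 / 2) ^ (a - β) with hc
  set σ := β + 3 - b - υ with hσ
  have h1ρ : 0 < 1 - ρ := by linarith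
  refine ⟨C * c * (C₁ * 3 ^ σ + Real.pi * 9 / (1 - ρ) * X ^ (2 - σ)), by positivity,
    fun ε u f hD g hg s hs hsX => ?_⟩
  have hε0 := hD.eps_pos
  have hs0 := hε0.trans_le hs
  set N := dataNorm p u f with hN
  have hN0 : 0 ≤ N := dataNorm_nonneg p u f
  set A := {z | s / 2 ≤ chi ε z ∧ chi ε z ≤ 3 * s ∧ ‖z‖ ≤ ρ} with hA
  have hchi := continuous_chi hε0
  have hAm : MeasurableSet A := IsClosed.measurableSet ((isClosed_le continuous_const hchi).inter
    ((isClosed_le hchi continuous_const).inter (isClosed_le continuous_norm continuous_const)))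
  have hAsub : A ⊆ Metric.closedBall 0 (3 * s) := fun z hz => by
    rw [mem_closedBall_zero_iff]
    exact (norm_le_chi ε z).trans hz.2.1
  calc ∫⁻ z in A, ‖g z‖ₑ
      ≤ ∫⁻ z in A, ENNReal.ofReal (C * (c * s ^ (a - β))) *
          (cpot ε β f z + ENNReal.ofReal (N / (1 - ρ))) := by
        refine setLIntegral_mono_ae' hAm ?_
        filter_upwards [compl_mem_ae_iff.2 (measure_singleton (0 : ℂ))] with z hz0 hz
        have hχ := chi_pos hε0 z
        refine (hg z ⟨by rw [mem_ball_zero_iff]; exact hz.2.2.trans_lt hρ, hz0⟩).trans ?_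
        have h1 : chi ε z ^ (a - β) ≤ c * s ^ (a - β) := by
          have h2 := rpow_le_add_of_mem (t := chi ε z / s) (X := 3) (by
            rw [le_div_iff₀ hs0]; linarith [hz.1]) (by rw [div_le_iff₀ hs0]; exact hz.2.1) (a - β)
          rw [Real.div_rpow hχ.le hs0.le, div_le_iff₀ (by positivity)] at h2
          exact h2
        have := hz.2.2
        gcongr
    _ ≤ ENNReal.ofReal (C * (c * s ^ (a - β))) * (ENNReal.ofReal (C₁ * (3 * s) ^ σ) *
          ENNReal.ofReal N + ENNReal.ofReal (N / (1 - ρ)) * ENNReal.ofReal (Real.pi * (3 * s) ^ 2)) := by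
        rw [lintegral_const_mul' _ _ ENNReal.ofReal_ne_top, lintegral_add_right _ measurable_const,
          setLIntegral_const]
        gcongr
        · refine (lintegral_mono_set hAsub).trans ((hC₁ ε hε0 (3 * s) (by linarith) f hD.memLp.1
            hD.eq_zero).trans ?_)
          gcongr
          exact hD.ofReal_le
        · refine (measure_mono hAsub).trans_eq ?_
          rw [Complex.volume_closedBall, ← ENNReal.ofReal_pow (by positivity),
            ← ENNReal.ofReal_coe_nnreal, NNReal.coe_real_pi, ← ENNReal.ofReal_mul (by positivity),
            mul_comm]
    _ = ENNReal.ofReal (C * (c * s ^ (a - β)) *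
          (C₁ * (3 * s) ^ σ * N + N / (1 - ρ) * (Real.pi * (3 * s) ^ 2))) := by
        rw [← ENNReal.ofReal_mul (by positivity), ← ENNReal.ofReal_mul (by positivity),
          ← ENNReal.ofReal_add (by positivity) (by positivity), ← ENNReal.ofReal_mul (by positivity)]
    _ ≤ _ := by
        refine ENNReal.ofReal_le_ofReal ?_
        have e1 : s ^ 2 ≤ X ^ (2 - σ) * s ^ σ := by
          have : s ^ (2 : ℝ) = s ^ (2 - σ) * s ^ σ := by rw [← Real.rpow_add hs0]; simp
          rw [← Real.rpow_two, this]
          have : 0 ≤ 2 - σ := by rw [hσ]; linarith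
          gcongr
        have e2 : s ^ (a + 3 - b - υ) = s ^ (a - β) * s ^ σ := by
          rw [← Real.rpow_add hs0, hσ]; congr 1; ring
        rw [e2, Real.mul_rpow (by norm_num) hs0.le]
        calc _ = C * c * s ^ (a - β) * N * (C₁ * 3 ^ σ * s ^ σ + Real.pi * 9 / (1 - ρ) * s ^ 2) := by
              ring
          _ ≤ C * c * s ^ (a - β) * N *
              (C₁ * 3 ^ σ * s ^ σ + Real.pi * 9 / (1 - ρ) * (X ^ (2 - σ) * s ^ σ)) := by gcongr
          _ = _ := by ring

/-- Away from the origin, `∂(ψ (u_z - P))` is the limit of regularized Beurling transforms, for a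
cutoff `ψ` that is constant near the origin. -/
lemma tendsto_bt_cutoff {u F : ℂ → ℂ} (hd : IsDistribSolution u F) (hu : ContDiffOn ℝ 2 u pdisk)
    (hF : Integrable F) {ψ : ℂ → ℂ} (hψ : ContDiff ℝ 1 ψ) (hψc : HasCompactSupport ψ)
    (hψs : tsupport ψ ⊆ Metric.ball 0 1) (hψ1 : ∀ ζ, ‖ψ ζ‖ ≤ 1) {c : ℂ} (hψ0 : ∀ᶠ ζ in 𝓝 0, ψ ζ = c)
    (P : Polynomial ℂ) (hk : Integrable fun ζ => ψ ζ * (dz u ζ - P.eval ζ)) :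
    Integrable (fun ζ => ψ ζ * (F ζ / 4)) ∧
    Integrable (fun ζ => dzb ψ ζ * (dz u ζ - P.eval ζ)) ∧
    ∀ z ∈ pdisk, (∀ᶠ w in 𝓝 z, ψ w = 1) →
      Tendsto (fun δ => bt δ (fun ζ => ψ ζ * (F ζ / 4)) z +
        bt δ (fun ζ => dzb ψ ζ * (dz u ζ - P.eval ζ)) z) (𝓝[>] 0)
        (𝓝 (Real.pi * dz (fun w => dz u w - P.eval w) z)) := by
  have hv : ContDiffOn ℝ 1 (dz u) pdisk := hu.dz isOpen_pdisk (by norm_num)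
  have hP : ContDiff ℝ 1 fun ζ => P.eval ζ :=
    P.differentiable.contDiff.restrict_scalars ℝ
  have hg : ContDiffOn ℝ 1 (fun ζ => dz u ζ - P.eval ζ) pdisk := hv.sub hP.contDiffOn
  have htd : tsupport (dzb ψ) ⊆ pdisk := fun ζ hζ => by
    refine ⟨hψs (tsupport_dzb_subset ψ hζ), ?_⟩
    rintro (rfl : ζ = 0)
    refine notMem_tsupport_iff_eventuallyEq.2 ?_ hζ
    filter_upwards [hψ0.eventually_nhds] with w hw
    rw [dzb_congr (show ψ =ᶠ[𝓝 w] fun _ => c from hw), dzb_const]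
    rfl
  have cd : Continuous (dzb ψ) := (hψ.dzb (m := 0) (by norm_num)).continuous
  have cdc : HasCompactSupport (dzb ψ) :=
    hψc.mono' ((subset_tsupport _).trans (tsupport_dzb_subset ψ))
  have i1 : Integrable fun ζ => ψ ζ * (F ζ / 4) :=
    (hF.div_const 4).bdd_mul hψ.continuous.aestronglyMeasurable (Eventually.of_forall hψ1)
  have i2 : Integrable fun ζ => dzb ψ ζ * (dz u ζ - P.eval ζ) := by
    have := integrable_mul_of_tsupport_subset isOpen_pdisk hg.continuousOn cd cdc htd
    simpa only [mul_comm] using this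
  refine ⟨i1, i2, fun z hz hz1 => ?_⟩
  have hz1' : (fun ζ => ψ ζ * (dz u ζ - P.eval ζ)) =ᶠ[𝓝 z] fun ζ => dz u ζ - P.eval ζ := by
    filter_upwards [hz1] with w hw
    rw [hw, one_mul]
  have hlim := tendsto_integral_mul_dz_pk hk isOpen_pdisk (hψ.contDiffOn.mul hg) hz
  rw [dz_congr hz1'] at hlim
  refine hlim.congr' ?_
  filter_upwards [self_mem_nhdsWithin] with δ hδ
  have hψ0' : ∀ ζ ∉ Metric.ball (0 : ℂ) 1, ψ ζ = 0 := fun ζ h =>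
    image_eq_zero_of_notMem_tsupport fun h' => h (hψs h')
  rw [← bt_add hδ i1 i2]
  refine (bt_eq_integral_mul_dz_pk hδ (i1.add i2) (fun ζ hζ => ?_) (fun ζ hζ => ?_) ?_ z).symm
  · have h2 : dzb ψ ζ = 0 := dzb_eq_zero_of_notMem_tsupport fun h => hζ (hψs h)
    simp [hψ0' ζ hζ, h2]
  · simp [hψ0' ζ hζ]
  · filter_upwards [compl_mem_ae_iff.2 (measure_singleton (0 : ℂ))] with w hw
    obtain ⟨j1, j2⟩ := integral_representation hd hu hF.integrableOn 0 hψ hψc hψs hψ0 hw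
    have cP : ContDiff ℝ 1 fun ζ => ψ ζ * P.eval ζ := hψ.mul hP
    have csP : HasCompactSupport fun ζ => ψ ζ * P.eval ζ := hψc.mul_right
    have j3 := integral_dzb_mul_inv cP csP w
    have e1 : ∀ ζ, dzb (fun ζ => ψ ζ * P.eval ζ) ζ = dzb ψ ζ * P.eval ζ := fun ζ => by
      rw [dzb_mul (hψ.differentiable one_ne_zero ζ) (hP.differentiable one_ne_zero ζ),
        (P.hasDerivAt ζ).dzb_eq, mul_zero, add_zero]
    simp only [e1] at j3
    have j4 : Integrable fun ζ => dzb ψ ζ * P.eval ζ * (w - ζ)⁻¹ :=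
      integrable_inv_mul (cd.mul hP.continuous) cdc.mul_right w
    simp only [pow_zero, one_mul] at j1 j2
    have e2 : ∀ ζ, (ψ ζ * (F ζ / 4) + dzb ψ ζ * (dz u ζ - P.eval ζ)) * (w - ζ)⁻¹ =
        (ψ ζ * (F ζ / 4) + dzb ψ ζ * dz u ζ) * (w - ζ)⁻¹ - dzb ψ ζ * P.eval ζ * (w - ζ)⁻¹ :=
      fun ζ => by ring
    simp only [Pi.add_apply, e2]
    rw [integral_sub j1 j4, j2, j3]
    ring

/-- The part of the regularized transform that comes from the derivative of the cutoff. -/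
lemma enorm_bt_le_of_dist {h : ℂ → ℂ} {g : ℂ → ℂ} {A : Set ℂ} (hA : MeasurableSet A) {z : ℂ}
    {M d : ℝ} (hd : 0 < d) (hM : 0 ≤ M) (hh : ∀ ζ, ‖h ζ‖ ≤ M) (h0 : ∀ ζ ∉ A, h ζ = 0)
    (hdist : ∀ ζ, h ζ ≠ 0 → d ≤ ‖z - ζ‖) (δ : ℝ) :
    ‖bt δ (fun ζ => h ζ * g ζ) z‖ₑ ≤ ENNReal.ofReal (M * d⁻¹ ^ 2) * ∫⁻ ζ in A, ‖g ζ‖ₑ := by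
  rw [bt]
  refine (enorm_integral_le_lintegral_enorm _).trans ?_
  rw [← lintegral_const_mul' _ _ ENNReal.ofReal_ne_top, ← lintegral_indicator hA]
  refine lintegral_mono fun ζ => ?_
  by_cases hζ : h ζ = 0
  · simp [hζ]
  · have hζA : ζ ∈ A := by
      by_contra h'
      exact hζ (h0 ζ h')
    rw [indicator_of_mem hζA, enorm_mul, enorm_mul, mul_right_comm]
    gcongr
    rw [← ofReal_norm, ← ofReal_norm, ← ENNReal.ofReal_mul (norm_nonneg _)]
    refine ENNReal.ofReal_le_ofReal (mul_le_mul (hh ζ) ?_ (norm_nonneg _) hM)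
    refine (norm_bk_le_inv δ _).trans ?_
    have := hdist ζ hζ
    gcongr

/-- Hölder's inequality on a set of finite measure. -/
lemma lintegral_rpow_le_of_lt {E : Set ℂ} {q q₁ : ℝ} (hq : 0 < q) (hq₁ : q < q₁) {h : ℂ → ℝ≥0∞}
    (hh : Measurable h) :
    ∫⁻ z in E, h z ^ q ≤ (∫⁻ z in E, h z ^ q₁) ^ (q / q₁) * volume E ^ (1 - q / q₁) := by
  have hq10 : 0 < q₁ := hq.trans hq₁
  have hc : (q₁ / q).HolderConjugate (q₁ / (q₁ - q)) := by
    rw [Real.holderConjugate_iff]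
    refine ⟨(one_lt_div hq).2 hq₁, ?_⟩
    have : q₁ - q ≠ 0 := by linarith
    field_simp
    ring
  have h1 := ENNReal.lintegral_mul_le_Lp_mul_Lq (volume.restrict E) hc
    (f := fun z => h z ^ q) (g := fun _ => 1) (hh.pow_const q).aemeasurable aemeasurable_const
  simp only [Pi.mul_apply, mul_one, ENNReal.one_rpow, lintegral_one, Measure.restrict_apply_univ,
    ← ENNReal.rpow_mul] at h1
  have e1 : q * (q₁ / q) = q₁ := by field_simp
  have e2 : 1 / (q₁ / q) = q / q₁ := one_div_div _ _
  have e3 : 1 / (q₁ / (q₁ - q)) = 1 - q / q₁ := by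
    rw [one_div_div]; field_simp
  rwa [e1, e2, e3] at h1

lemma mul_two_div_toReal_lt {p : ℝ≥0∞} {q : ℝ} (hqp : ENNReal.ofReal q < p) :
    q * (2 / p.toReal) < 2 := by
  rcases eq_or_ne p ∞ with rfl | h
  · simp
  · have hp0 : 0 < p.toReal := ENNReal.toReal_pos (ne_bot_of_gt hqp) h
    have hlt : q < p.toReal := by
      by_contra! h'
      refine absurd hqp (not_lt.2 ?_)
      rw [← ENNReal.ofReal_toReal h]
      exact ENNReal.ofReal_le_ofReal h'
    rw [mul_div_assoc', div_lt_iff₀ hp0]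
    linarith

set_option maxHeartbeats 1000000 in
/-- The estimate of the second derivative on the ring `{s ≤ χ ≤ 2 s}`: there the weights are
constants up to bounded factors, and the `L ^ p` bounds of the Beurling transform apply. -/
lemma exists_ring_estimate {p : ℝ≥0∞} (hp : 2 ≤ p) {a β : ℝ} (hβ : -2 < β - 2 / p.toReal)
    (hβ' : β - 2 / p.toReal ≤ -1) {C : ℝ} (hC : 0 ≤ C) {q : ℝ} (hq : 1 ≤ q)
    (hqp : ENNReal.ofReal q < p) {ρ X : ℝ} (hρ0 : 0 < ρ) (hρ : ρ < 1) (hX : 1 ≤ X) :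
    ∃ K c₁ c₂ : ℝ, 0 ≤ K ∧ 0 < c₁ ∧ 0 < c₂ ∧ ∀ ε, ∀ u f : ℂ → ℂ, IsData a p ε u f →
      ∀ P : Polynomial ℂ,
      (∀ z ∈ pdisk, ‖dz u z - P.eval z‖ₑ ≤ ENNReal.ofReal (C * chi ε z ^ (a - β)) *
          (cpot ε β f z + ENNReal.ofReal (dataNorm p u f / (1 - ‖z‖)))) →
      ∀ s, (s = ε ∨ 2 * ε ≤ s) → s ≤ X →
      ∫⁻ z in {z | s ≤ chi ε z ∧ chi ε z ≤ 2 * s ∧ ‖z‖ < ρ},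
        ‖((chi ε z ^ (-a) : ℝ) : ℂ) * dz (fun w => dz u w - P.eval w) z‖ₑ ^ q ≤
        ENNReal.ofReal (K * (s ^ c₁ + s ^ c₂)) * ENNReal.ofReal (dataNorm p u f) ^ q := by
  have hqb := mul_two_div_toReal_lt hqp
  have hq0 : 0 < q := by linarith
  obtain ⟨q₁, p₁, C₁, hq₁, hp₁, hp₁2, hC₁0, hC₁⟩ := exists_exponents hp hqp
  obtain ⟨C₂, hC₂0, hC₂⟩ := exists_lintegral_bt_rpow_le hp₁2 (hq.trans hq₁.le) hp₁
  obtain ⟨M, c, ρ', hM0, hc0, hρ'1, hcut⟩ := exists_ring_cutoff hρ0 hρ hX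
  set b := 2 / p.toReal with hb
  -- a loss `υ` small enough for the exponent `2 - q (b + υ)` of `s` to be positive
  set υ := min (β - b + 2) ((2 / q - b) / 2) with hυ
  have h2q : b < 2 / q := by
    rw [lt_div_iff₀ hq0]; linarith
  have hυ0 : 0 < υ := lt_min (by linarith) (by linarith)
  obtain ⟨K₃, hK₃0, hK₃⟩ := exists_setLIntegral_ring_le (a := a) hp hβ' hC hυ0 (min_le_left _ _)
    hρ'1 hX
  have hq₁0 : 0 < q₁ := by linarith
  have hqq : q / q₁ < 1 := (div_lt_one hq₁0).2 hq₁
  have hc2 : 0 < 2 - q * (b + υ) := by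
    have h1 : υ ≤ (2 / q - b) / 2 := min_le_right _ _
    have h2 : q * (b + υ) ≤ q * (b + (2 / q - b) / 2) := by gcongr
    have h3 : q * (b + (2 / q - b) / 2) = 1 + q * b / 2 := by field_simp; ring
    linarith
  set A := (3 : ℝ) ^ a + (1 / 2) ^ a with hA
  set B := (2 : ℝ) ^ (-a) + (1 / 2) ^ (-a) with hB
  set K₄ := M * c⁻¹ ^ 2 * K₃ with hK₄
  set k₁ := C₂ ^ (q / q₁) * (A * C₁) ^ q * (4 * Real.pi) ^ (1 - q / q₁) with hk₁
  set k₂ := K₄ ^ q * (4 * Real.pi) with hk₂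
  have hk₁0 : 0 ≤ k₁ := by positivity
  have hk₂0 : 0 ≤ k₂ := by positivity
  refine ⟨B ^ q * 2 ^ (q - 1) * (k₁ + k₂), 2 * (1 - q / q₁), 2 - q * (b + υ), by positivity,
    by linarith, hc2, fun ε u f hD P hP s hs hsX => ?_⟩
  have hε0 := hD.eps_pos
  have hs0 : 0 < s := by rcases hs with h | h <;> linarith
  have hεs : ε ≤ s := by rcases hs with h | h <;> linarith
  set N := dataNorm p u f with hN
  have hN0 : 0 ≤ N := dataNorm_nonneg p u f
  obtain ⟨ψ, cψ, hψc, hψs, hψ1, ⟨c', hψ0⟩, hψE, hψsup, hdψ, hdist⟩ := hcut ε s hε0 hsX hs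
  set F := wF a ε f with hF
  have iF : Integrable F := hD.integrable_wF hp
  set g : ℂ → ℂ := fun ζ => dz u ζ - P.eval ζ with hg
  have hchi := continuous_chi hε0
  -- the integral of `g` over the support of the cutoff
  set S := {z | s / 2 ≤ chi ε z ∧ chi ε z ≤ 3 * s ∧ ‖z‖ ≤ ρ'} with hS
  have hSm : MeasurableSet S := IsClosed.measurableSet ((isClosed_le continuous_const hchi).inter
    ((isClosed_le hchi continuous_const).inter (isClosed_le continuous_norm continuous_const)))
  have hgS : ∫⁻ z in S, ‖g z‖ₑ ≤ ENNReal.ofReal (K₃ * N * s ^ (a + 3 - b - υ)) :=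
    hK₃ ε u f hD g hP s hεs hsX
  have hgc : ContinuousOn g pdisk :=
    (hD.contDiffOn_two.dz (m := 1) isOpen_pdisk (by norm_num)).continuousOn.sub
      P.continuous.continuousOn
  have ik : Integrable fun ζ => ψ ζ * g ζ := by
    refine ⟨?_, ?_⟩
    · have h1 : AEStronglyMeasurable (pdisk.indicator fun ζ => ψ ζ * g ζ) :=
        (aestronglyMeasurable_indicator_iff isOpen_pdisk.measurableSet).2
          ((cψ.continuous.continuousOn.mul hgc).aestronglyMeasurable isOpen_pdisk.measurableSet)
      refine h1.congr ?_
      filter_upwards [compl_mem_ae_iff.2 (measure_singleton (0 : ℂ))] with ζ hζ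
      by_cases h : ζ ∈ Metric.ball (0 : ℂ) 1
      · exact indicator_of_mem (show ζ ∈ pdisk from ⟨h, hζ⟩) _
      · rw [indicator_of_notMem (fun h' : ζ ∈ pdisk => h h'.1),
          image_eq_zero_of_notMem_tsupport (fun h' => h (hψs h')), zero_mul]
    · refine lt_of_le_of_lt ?_ (hgS.trans_lt ENNReal.ofReal_lt_top)
      rw [← lintegral_indicator hSm]
      refine lintegral_mono fun ζ => ?_
      show ‖ψ ζ * g ζ‖ₑ ≤ _
      by_cases h : ζ ∈ S
      · rw [indicator_of_mem h, enorm_mul]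
        refine mul_le_of_le_one_left zero_le ?_
        rw [← ofReal_norm]
        exact ENNReal.ofReal_le_one.2 (hψ1 ζ)
      · rw [image_eq_zero_of_notMem_tsupport (fun h' => h (hψsup ζ h')), zero_mul, enorm_zero]
        exact zero_le
  obtain ⟨i1, i2, hlim⟩ := tendsto_bt_cutoff hD.distrib hD.contDiffOn_two iF cψ hψc hψs hψ1 hψ0 P ik
  -- the density divided by `s ^ a`, which is comparable with `|f|`
  set f₁ : ℂ → ℂ := fun ζ => ((s ^ (-a) : ℝ) : ℂ) * (ψ ζ * (F ζ / 4)) with hf₁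
  have if₁ : Integrable f₁ := i1.const_mul _
  have hf₁b : ∀ ζ, ‖f₁ ζ‖ₑ ≤ ENNReal.ofReal A * ‖f ζ‖ₑ := by
    intro ζ
    rw [← ofReal_norm, ← ofReal_norm (f ζ), ← ENNReal.ofReal_mul (by positivity)]
    refine ENNReal.ofReal_le_ofReal ?_
    by_cases h : ζ ∈ tsupport ψ
    · have hχ := chi_pos hε0 ζ
      obtain ⟨h1, h2, -⟩ := hψsup ζ h
      have h3 := rpow_le_add_of_mem (t := chi ε ζ / s) (X := 3) (by
        rw [le_div_iff₀ hs0]; linarith) (by rw [div_le_iff₀ hs0]; exact h2) a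
      rw [Real.div_rpow hχ.le hs0.le, div_eq_mul_inv, ← Real.rpow_neg hs0.le] at h3
      simp only [hf₁]
      rw [norm_mul, norm_mul, norm_div, hF, norm_wF hε0, Complex.norm_ofNat, Complex.norm_real,
        Real.norm_of_nonneg (by positivity)]
      have h4 : ‖ψ ζ‖ * (chi ε ζ ^ a * ‖f ζ‖ / 4) ≤ 1 * (chi ε ζ ^ a * ‖f ζ‖) := by
        have : 0 ≤ chi ε ζ ^ a * ‖f ζ‖ := by positivity
        exact mul_le_mul (hψ1 ζ) (by linarith) (by positivity) zero_le_one
      calc _ ≤ s ^ (-a) * (1 * (chi ε ζ ^ a * ‖f ζ‖)) := by gcongr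
        _ = chi ε ζ ^ a * s ^ (-a) * ‖f ζ‖ := by ring
        _ ≤ _ := by gcongr
    · simp only [hf₁]
      rw [image_eq_zero_of_notMem_tsupport h, zero_mul, mul_zero, norm_zero]
      positivity
  have hf₁0 : ∀ z ∉ Metric.ball (0 : ℂ) 1, f₁ z = 0 := fun z hz => by
    simp only [hf₁]
    rw [image_eq_zero_of_notMem_tsupport (fun h => hz (hψs h)), zero_mul, mul_zero]
  have hf₁p : ∫⁻ z, ‖f₁ z‖ₑ ^ p₁ ≤ ENNReal.ofReal (A * C₁ * N) ^ p₁ := by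
    have hp₁0 : 0 ≤ p₁ := by linarith
    calc ∫⁻ z, ‖f₁ z‖ₑ ^ p₁ ≤ ∫⁻ z, ENNReal.ofReal A ^ p₁ * ‖f z‖ₑ ^ p₁ := by
          refine lintegral_mono fun z => ?_
          rw [← ENNReal.mul_rpow_of_nonneg _ _ hp₁0]
          exact ENNReal.rpow_le_rpow (hf₁b z) hp₁0
      _ ≤ ENNReal.ofReal A ^ p₁ * (ENNReal.ofReal C₁ * ENNReal.ofReal N) ^ p₁ := by
          rw [lintegral_const_mul' _ _ (ENNReal.rpow_ne_top_of_nonneg hp₁0 ENNReal.ofReal_ne_top)]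
          gcongr
          refine (hC₁ f hD.eq_zero).trans ?_
          gcongr
          exact hD.ofReal_le
      _ = _ := by
          rw [← ENNReal.mul_rpow_of_nonneg _ _ hp₁0, ← ENNReal.ofReal_mul hC₁0,
            ← ENNReal.ofReal_mul (by positivity), mul_assoc]
  -- the ring
  set E := {z | s ≤ chi ε z ∧ chi ε z ≤ 2 * s ∧ ‖z‖ < ρ} with hE
  have hEm : MeasurableSet E := (isClosed_le continuous_const hchi).measurableSet.inter
    ((isClosed_le hchi continuous_const).measurableSet.inter
      (isOpen_lt continuous_norm continuous_const).measurableSet)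
  have hE1 : E ⊆ Metric.ball 0 1 := fun z hz => mem_ball_zero_iff.2 (hz.2.2.trans hρ)
  have hEv : volume E ≤ ENNReal.ofReal (4 * Real.pi * s ^ 2) := by
    refine (measure_mono (t := Metric.closedBall 0 (2 * s)) fun z hz => ?_).trans_eq ?_
    · rw [mem_closedBall_zero_iff]
      exact (norm_le_chi ε z).trans hz.2.1
    · rw [Complex.volume_closedBall, ← ENNReal.ofReal_pow (by positivity),
        ← ENNReal.ofReal_coe_nnreal, NNReal.coe_real_pi, ← ENNReal.ofReal_mul (by positivity)]
      congr 1
      ring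
  -- the two parts of the regularized transform
  set D := K₄ * N * s ^ (-b - υ) with hDd
  have hD0 : 0 ≤ D := by positivity
  have hbt2 : ∀ δ, ∀ z ∈ E, ‖bt δ (fun ζ => dzb ψ ζ * g ζ) z‖ₑ ≤ ENNReal.ofReal (s ^ a * D) := by
    intro δ z hz
    have h1 := enorm_bt_le_of_dist hSm (h := dzb ψ) (g := g) (z := z) (M := M / s) (d := c * s)
      (by positivity) (by positivity) hdψ
      (fun ζ hζ => dzb_eq_zero_of_notMem_tsupport fun h => hζ (hψsup ζ h))
      (fun ζ hζ => hdist ζ hζ z hz.2.2 hz.1 hz.2.1) δ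
    refine (h1.trans (mul_le_mul' le_rfl hgS)).trans_eq ?_
    rw [← ENNReal.ofReal_mul (by positivity)]
    congr 1
    have e1 : s ^ (a + 3 - b - υ) = s ^ a * s ^ (-b - υ) * s ^ 3 := by
      rw [← Real.rpow_natCast, ← Real.rpow_add hs0, ← Real.rpow_add hs0]
      congr 1
      push_cast
      ring
    rw [e1, hDd, hK₄]
    field_simp
  have hbt1 : ∀ δ z, bt δ (fun ζ => ψ ζ * (F ζ / 4)) z = ((s ^ a : ℝ) : ℂ) * bt δ f₁ z := by
    intro δ z
    rw [← bt_const_mul]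
    congr 1
    funext ζ
    simp only [hf₁]
    rw [← mul_assoc, ← Complex.ofReal_mul, ← Real.rpow_add hs0, add_neg_cancel, Real.rpow_zero,
      Complex.ofReal_one, one_mul]
  have hsum : ∀ δ, ∀ z ∈ E, ‖((chi ε z ^ (-a) : ℝ) : ℂ) * ((Real.pi : ℂ)⁻¹ *
      (bt δ (fun ζ => ψ ζ * (F ζ / 4)) z + bt δ (fun ζ => dzb ψ ζ * g ζ) z))‖ₑ ^ q ≤
      ENNReal.ofReal B ^ q * (2 ^ (q - 1) * (‖bt δ f₁ z‖ₑ ^ q + ENNReal.ofReal D ^ q)) := by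
    intro δ z hz
    have hχ := chi_pos hε0 z
    have h1 : ‖bt δ (fun ζ => ψ ζ * (F ζ / 4)) z + bt δ (fun ζ => dzb ψ ζ * g ζ) z‖ₑ ≤
        ENNReal.ofReal (s ^ a) * (‖bt δ f₁ z‖ₑ + ENNReal.ofReal D) := by
      refine (enorm_add_le _ _).trans ?_
      rw [mul_add, ← ENNReal.ofReal_mul (by positivity), hbt1, enorm_mul]
      refine add_le_add (le_of_eq ?_) (hbt2 δ z hz)
      rw [← ofReal_norm (((s ^ a : ℝ) : ℂ)), Complex.norm_real, Real.norm_of_nonneg (by positivity)]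
    have h2 : ‖((chi ε z ^ (-a) : ℝ) : ℂ)‖ₑ ≤ ENNReal.ofReal (B * s ^ (-a)) := by
      rw [← ofReal_norm, Complex.norm_real, Real.norm_of_nonneg (by positivity)]
      refine ENNReal.ofReal_le_ofReal ?_
      have h3 := rpow_le_add_of_mem (t := chi ε z / s) (X := 2) (by
        rw [le_div_iff₀ hs0]; linarith [hz.1]) (by rw [div_le_iff₀ hs0]; exact hz.2.1) (-a)
      rwa [Real.div_rpow hχ.le hs0.le, div_le_iff₀ (by positivity)] at h3
    have h3 : ‖(Real.pi : ℂ)⁻¹‖ₑ ≤ 1 := by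
      rw [← ofReal_norm, norm_inv, Complex.norm_real, Real.norm_of_nonneg Real.pi_pos.le]
      refine ENNReal.ofReal_le_one.2 (inv_le_one_of_one_le₀ ?_)
      linarith [Real.pi_gt_three]
    have h4 : ‖((chi ε z ^ (-a) : ℝ) : ℂ) * ((Real.pi : ℂ)⁻¹ *
        (bt δ (fun ζ => ψ ζ * (F ζ / 4)) z + bt δ (fun ζ => dzb ψ ζ * g ζ) z))‖ₑ ≤
        ENNReal.ofReal B * (‖bt δ f₁ z‖ₑ + ENNReal.ofReal D) := by
      rw [enorm_mul, enorm_mul]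
      refine (mul_le_mul' h2 (mul_le_mul' h3 h1)).trans_eq ?_
      rw [one_mul, ← mul_assoc, ← ENNReal.ofReal_mul (by positivity), mul_assoc B,
        ← Real.rpow_add hs0, neg_add_cancel, Real.rpow_zero, mul_one]
    refine (ENNReal.rpow_le_rpow h4 hq0.le).trans ?_
    rw [ENNReal.mul_rpow_of_nonneg _ _ hq0.le]
    gcongr
    exact ENNReal.rpow_add_le_mul_rpow_add_rpow _ _ hq
  -- the integrals of the two parts
  have hI : ∀ δ > 0, ∫⁻ z in E, ENNReal.ofReal B ^ q *
      (2 ^ (q - 1) * (‖bt δ f₁ z‖ₑ ^ q + ENNReal.ofReal D ^ q)) ≤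
      ENNReal.ofReal (B ^ q * 2 ^ (q - 1) * (k₁ + k₂) *
        (s ^ (2 * (1 - q / q₁)) + s ^ (2 - q * (b + υ)))) * ENNReal.ofReal N ^ q := by
    intro δ hδ
    have hm : Measurable fun z => ‖bt δ f₁ z‖ₑ :=
      (uniformContinuous_bt hδ if₁).continuous.measurable.enorm
    have hBq : ENNReal.ofReal B ^ q ≠ ⊤ := ENNReal.rpow_ne_top_of_nonneg hq0.le ENNReal.ofReal_ne_top
    have h2q' : (2 : ℝ≥0∞) ^ (q - 1) = ENNReal.ofReal (2 ^ (q - 1)) := by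
      rw [← ENNReal.ofReal_rpow_of_pos two_pos, ENNReal.ofReal_ofNat]
    rw [lintegral_const_mul' _ _ hBq, h2q', lintegral_const_mul' _ _ ENNReal.ofReal_ne_top,
      lintegral_add_right _ measurable_const, setLIntegral_const,
      ENNReal.ofReal_rpow_of_nonneg (by positivity) hq0.le,
      ENNReal.ofReal_rpow_of_nonneg hD0 hq0.le, ENNReal.ofReal_rpow_of_nonneg hN0 hq0.le]
    have j1 : ∫⁻ z in E, ‖bt δ f₁ z‖ₑ ^ q ≤
        ENNReal.ofReal (k₁ * s ^ (2 * (1 - q / q₁)) * N ^ q) := by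
      have h1 := hC₂ δ hδ f₁ if₁ hf₁0 (A * C₁ * N) (by positivity) hf₁p
      refine (lintegral_rpow_le_of_lt hq0 hq₁ hm).trans ?_
      have h2 : (∫⁻ z in E, ‖bt δ f₁ z‖ₑ ^ q₁) ^ (q / q₁) ≤
          (ENNReal.ofReal C₂ * ENNReal.ofReal (A * C₁ * N) ^ q₁) ^ (q / q₁) := by
        gcongr
        exact (lintegral_mono_set hE1).trans h1
      have h3 : volume E ^ (1 - q / q₁) ≤
          ENNReal.ofReal (4 * Real.pi * s ^ 2) ^ (1 - q / q₁) := by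
        have : 0 ≤ 1 - q / q₁ := by linarith
        gcongr
      refine (mul_le_mul' h2 h3).trans_eq ?_
      have h4 : 0 ≤ q / q₁ := by positivity
      rw [ENNReal.mul_rpow_of_nonneg _ _ h4, ← ENNReal.rpow_mul,
        show q₁ * (q / q₁) = q by field_simp, ENNReal.ofReal_rpow_of_nonneg hC₂0 h4,
        ENNReal.ofReal_rpow_of_nonneg (by positivity) hq0.le,
        ENNReal.ofReal_rpow_of_nonneg (by positivity) (by linarith),
        ← ENNReal.ofReal_mul (by positivity), ← ENNReal.ofReal_mul (by positivity)]
      congr 1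
      have e1 : (A * C₁ * N) ^ q = (A * C₁) ^ q * N ^ q := Real.mul_rpow (by positivity) hN0
      have e2 : (4 * Real.pi * s ^ 2) ^ (1 - q / q₁) =
          (4 * Real.pi) ^ (1 - q / q₁) * s ^ (2 * (1 - q / q₁)) := by
        rw [Real.mul_rpow (by positivity) (by positivity), Real.rpow_mul hs0.le, Real.rpow_two]
      rw [e1, e2, hk₁]
      ring
    have j2 : ENNReal.ofReal (D ^ q) * volume E ≤
        ENNReal.ofReal (k₂ * s ^ (2 - q * (b + υ)) * N ^ q) := by
      refine (mul_le_mul' le_rfl hEv).trans_eq ?_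
      rw [← ENNReal.ofReal_mul (by positivity)]
      congr 1
      have e1 : s ^ (2 - q * (b + υ)) = (s ^ (-b - υ)) ^ q * s ^ 2 := by
        rw [← Real.rpow_mul hs0.le, ← Real.rpow_two, ← Real.rpow_add hs0]
        congr 1
        ring
      rw [e1, hDd, Real.mul_rpow (by positivity) (by positivity),
        Real.mul_rpow (by positivity) hN0, hk₂]
      ring
    refine (mul_le_mul' le_rfl (mul_le_mul' le_rfl (add_le_add j1 j2))).trans ?_
    rw [← ENNReal.ofReal_add (by positivity) (by positivity), ← ENNReal.ofReal_mul (by positivity),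
      ← ENNReal.ofReal_mul (by positivity), ← ENNReal.ofReal_mul (by positivity)]
    refine ENNReal.ofReal_le_ofReal ?_
    have h1 : k₁ * s ^ (2 * (1 - q / q₁)) * N ^ q + k₂ * s ^ (2 - q * (b + υ)) * N ^ q ≤
        (k₁ + k₂) * (s ^ (2 * (1 - q / q₁)) + s ^ (2 - q * (b + υ))) * N ^ q := by
      have h2 : 0 ≤ k₂ * s ^ (2 * (1 - q / q₁)) * N ^ q := by positivity
      have h3 : 0 ≤ k₁ * s ^ (2 - q * (b + υ)) * N ^ q := by positivity
      calc _ ≤ k₁ * s ^ (2 * (1 - q / q₁)) * N ^ q + k₂ * s ^ (2 - q * (b + υ)) * N ^ q +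
            (k₂ * s ^ (2 * (1 - q / q₁)) * N ^ q + k₁ * s ^ (2 - q * (b + υ)) * N ^ q) :=
            le_add_of_nonneg_right (add_nonneg h2 h3)
        _ = _ := by ring
    calc _ ≤ B ^ q * (2 ^ (q - 1) *
          ((k₁ + k₂) * (s ^ (2 * (1 - q / q₁)) + s ^ (2 - q * (b + υ))) * N ^ q)) := by gcongr
      _ = _ := by ring
  -- `∂(ψ g)`, which is `∂ g` on the ring, is the limit of the transforms: use Fatou
  obtain ⟨δ, -, hδ0, hδlim⟩ := exists_seq_strictAnti_tendsto (0 : ℝ)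
  have hδ' : Tendsto δ atTop (𝓝[>] 0) :=
    tendsto_nhdsWithin_iff.2 ⟨hδlim, Eventually.of_forall hδ0⟩
  have hpt : ∀ᵐ z, z ∈ E → ‖((chi ε z ^ (-a) : ℝ) : ℂ) * dz g z‖ₑ ^ q ≤
      liminf (fun j => ENNReal.ofReal B ^ q *
        (2 ^ (q - 1) * (‖bt (δ j) f₁ z‖ₑ ^ q + ENNReal.ofReal D ^ q))) atTop := by
    filter_upwards [compl_mem_ae_iff.2 (measure_singleton (0 : ℂ))] with z hz0 hz
    have h1 := (hlim z ⟨hE1 hz, hz0⟩ (hψE z hz.2.2 hz.1 hz.2.1)).comp hδ'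
    have h2 := (((h1.const_mul (Real.pi : ℂ)⁻¹).const_mul ((chi ε z ^ (-a) : ℝ) : ℂ)).enorm).ennrpow_const q
    have hπ : (Real.pi : ℂ) ≠ 0 := Complex.ofReal_ne_zero.2 Real.pi_ne_zero
    rw [inv_mul_cancel_left₀ hπ] at h2
    rw [← h2.liminf_eq]
    exact liminf_le_liminf (Eventually.of_forall fun j => hsum (δ j) z hz)
  refine (setLIntegral_mono_ae' hEm hpt).trans ((lintegral_liminf_le fun j => ?_).trans ?_)
  · have hm : Measurable fun z => ‖bt (δ j) f₁ z‖ₑ :=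
      (uniformContinuous_bt (hδ0 j) if₁).continuous.measurable.enorm
    exact (((hm.pow_const q).add_const _).const_mul _).const_mul _
  · exact liminf_le_of_frequently_le' (Frequently.of_forall fun j => hI (δ j) (hδ0 j))

lemma sum_range_mul_two_pow_rpow_le {ε c : ℝ} (hε : 0 < ε) (hc : 0 < c) (n : ℕ) :
    ∑ k ∈ Finset.range n, (ε * 2 ^ k) ^ c ≤ (ε * 2 ^ n) ^ c / (2 ^ c - 1) := by
  have h1 : (1 : ℝ) < 2 ^ c := Real.one_lt_rpow one_lt_two hc
  have h2 : ∀ k : ℕ, (ε * 2 ^ k) ^ c = ε ^ c * (2 ^ c) ^ k := fun k => by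
    rw [Real.mul_rpow hε.le (by positivity), ← Real.rpow_natCast, ← Real.rpow_natCast,
      ← Real.rpow_mul two_pos.le, ← Real.rpow_mul two_pos.le, mul_comm c]
  simp only [h2]
  rw [← Finset.mul_sum, geom_sum_eq h1.ne', mul_div_assoc]
  have : 0 < (2 : ℝ) ^ c - 1 := by linarith
  gcongr
  linarith

/-- The disk is covered by the rings `{ε 2 ^ k ≤ χ ≤ ε 2 ^ (k + 1)}`, and the ring estimates sum to
a bound that does not depend on `ε`, as the exponents of the radii are positive. -/
lemma exists_disk_estimate {p : ℝ≥0∞} (hp : 2 ≤ p) {a β : ℝ} (hβ : -2 < β - 2 / p.toReal)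
    (hβ' : β - 2 / p.toReal ≤ -1) {C : ℝ} (hC : 0 ≤ C) {q : ℝ} (hq : 1 ≤ q)
    (hqp : ENNReal.ofReal q < p) {ρ ε₀ : ℝ} (hρ0 : 0 < ρ) (hρ : ρ < 1) (hε₀ : 0 ≤ ε₀) :
    ∃ K : ℝ, 0 ≤ K ∧ ∀ ε ≤ ε₀, ∀ u f : ℂ → ℂ, IsData a p ε u f → ∀ P : Polynomial ℂ,
      (∀ z ∈ pdisk, ‖dz u z - P.eval z‖ₑ ≤ ENNReal.ofReal (C * chi ε z ^ (a - β)) *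
          (cpot ε β f z + ENNReal.ofReal (dataNorm p u f / (1 - ‖z‖)))) →
      ∫⁻ z in Metric.ball 0 ρ,
        ‖((chi ε z ^ (-a) : ℝ) : ℂ) * dz (fun w => dz u w - P.eval w) z‖ₑ ^ q ≤
        ENNReal.ofReal K * ENNReal.ofReal (dataNorm p u f) ^ q := by
  obtain ⟨K, c₁, c₂, hK, hc₁, hc₂, hring⟩ := exists_ring_estimate (a := a) hp hβ hβ' hC hq hqp hρ0 hρ
    (X := 1 + ε₀) (by linarith)
  have t₁ : (1 : ℝ) < 2 ^ c₁ := Real.one_lt_rpow one_lt_two hc₁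
  have t₂ : (1 : ℝ) < 2 ^ c₂ := Real.one_lt_rpow one_lt_two hc₂
  have t₁' : 0 < (2 : ℝ) ^ c₁ - 1 := by linarith
  have t₂' : 0 < (2 : ℝ) ^ c₂ - 1 := by linarith
  refine ⟨K * ((2 * (1 + ε₀)) ^ c₁ / (2 ^ c₁ - 1) + (2 * (1 + ε₀)) ^ c₂ / (2 ^ c₂ - 1)),
    by positivity, fun ε hεε₀ u f hD P hP => ?_⟩
  have hε := hD.eps_pos
  obtain ⟨n, hn, hn'⟩ := exists_nat_pow_near (x := (1 + ε₀) / ε) (y := 2)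
    (by rw [le_div_iff₀ hε]; linarith) one_lt_two
  rw [le_div_iff₀ hε] at hn
  rw [div_lt_iff₀ hε] at hn'
  set R : Fin (n + 1) → Set ℂ := fun k =>
    {z | ε * 2 ^ (k : ℕ) ≤ chi ε z ∧ chi ε z ≤ 2 * (ε * 2 ^ (k : ℕ)) ∧ ‖z‖ < ρ} with hR
  have hcov : Metric.ball (0 : ℂ) ρ ⊆ ⋃ k, R k := by
    intro z hz
    have hzρ : ‖z‖ < ρ := mem_ball_zero_iff.1 hz
    have hχ := chi_le_of_mem_ball hε hεε₀ (mem_ball_zero_iff.2 (hzρ.trans hρ))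
    obtain ⟨k, hk, hk'⟩ := exists_nat_pow_near (x := chi ε z / ε) (y := 2)
      (by rw [le_div_iff₀ hε]; linarith [le_chi ε z]) one_lt_two
    rw [le_div_iff₀ hε] at hk
    rw [div_lt_iff₀ hε, pow_succ] at hk'
    have hkn : k < n + 1 := by
      refine (pow_lt_pow_iff_right₀ (one_lt_two (α := ℝ))).1 ?_
      exact lt_of_mul_lt_mul_right ((hk.trans hχ).trans_lt hn') hε.le
    exact mem_iUnion.2 ⟨⟨k, hkn⟩, by linarith, by linarith, hzρ⟩
  have hs : ∀ k : Fin (n + 1), ∫⁻ z in R k,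
      ‖((chi ε z ^ (-a) : ℝ) : ℂ) * dz (fun w => dz u w - P.eval w) z‖ₑ ^ q ≤
      ENNReal.ofReal (K * ((ε * 2 ^ (k : ℕ)) ^ c₁ + (ε * 2 ^ (k : ℕ)) ^ c₂)) *
        ENNReal.ofReal (dataNorm p u f) ^ q := by
    intro k
    refine hring ε u f hD P hP _ ?_ ?_
    · rcases Nat.eq_zero_or_pos (k : ℕ) with h | h
      · left; rw [h]; ring
      · right
        have : (2 : ℝ) ^ 1 ≤ 2 ^ (k : ℕ) := pow_le_pow_right₀ one_le_two h
        nlinarith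
    · have : (2 : ℝ) ^ (k : ℕ) ≤ 2 ^ n := pow_le_pow_right₀ one_le_two (Nat.lt_succ_iff.1 k.2)
      nlinarith
  have hle : ε * 2 ^ (n + 1) ≤ 2 * (1 + ε₀) := by rw [pow_succ]; linarith
  have hS : ∀ c : ℝ, 0 < c → ∑ k ∈ Finset.range (n + 1), (ε * 2 ^ k) ^ c ≤
      (2 * (1 + ε₀)) ^ c / (2 ^ c - 1) := fun c hc => by
    have h1 : (1 : ℝ) < 2 ^ c := Real.one_lt_rpow one_lt_two hc
    refine (sum_range_mul_two_pow_rpow_le hε hc _).trans ?_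
    have : 0 ≤ (2 : ℝ) ^ c - 1 := by linarith
    gcongr
  refine (lintegral_mono_set hcov).trans ((lintegral_iUnion_le _ _).trans ?_)
  rw [tsum_fintype]
  refine (Finset.sum_le_sum fun k _ => hs k).trans ?_
  rw [← Finset.sum_mul, ← ENNReal.ofReal_sum_of_nonneg (fun k _ => by positivity)]
  gcongr
  rw [Fin.sum_univ_eq_sum_range (fun k => K * ((ε * 2 ^ k) ^ c₁ + (ε * 2 ^ k) ^ c₂)),
    ← Finset.mul_sum, Finset.sum_add_distrib]
  gcongr
  exacts [hS c₁ hc₁, hS c₂ hc₂]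

lemma contDiff_polynomial_eval (P : Polynomial ℂ) : ContDiff ℝ 1 fun z => P.eval z :=
  P.differentiable.contDiff.restrict_scalars ℝ

lemma exists_diskLpNorm_le {p : ℝ≥0∞} (hp : 2 ≤ p) {a β : ℝ} (hβ : -2 < β - 2 / p.toReal)
    (hβ' : β - 2 / p.toReal ≤ -1) {C : ℝ} (hC : 0 ≤ C) {p' : ℝ≥0∞} (hp'0 : 0 < p')
    (hp' : p' < p) {ρ ε₀ : ℝ}
    (hρ0 : 0 < ρ) (hρ : ρ < 1) (hε₀ : 0 ≤ ε₀) :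
    ∃ K : ℝ, ∀ ε ≤ ε₀, ∀ u f : ℂ → ℂ, IsData a p ε u f → ∀ P : Polynomial ℂ,
      (∀ z ∈ pdisk, ‖dz u z - P.eval z‖ₑ ≤ ENNReal.ofReal (C * chi ε z ^ (a - β)) *
          (cpot ε β f z + ENNReal.ofReal (dataNorm p u f / (1 - ‖z‖)))) →
      MemLp (fun z => ((chi ε z ^ (-a) : ℝ) : ℂ) * dz (fun w => dz u w - P.eval w) z) p'
          (volume.restrict (Metric.ball 0 ρ)) ∧
        diskLpNorm ρ p' (fun z => ((chi ε z ^ (-a) : ℝ) : ℂ) * dz (fun w => dz u w - P.eval w) z) ≤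
          K * dataNorm p u f := by
  obtain ⟨r, hr, hrp⟩ := exists_between (max_lt hp' (ENNReal.one_lt_two.trans_le hp))
  have hrt : r ≠ ⊤ := (lt_top_of_lt hrp).ne
  have h1r : 1 ≤ r.toReal := by
    rw [← ENNReal.toReal_one]
    exact ENNReal.toReal_mono hrt ((le_max_right _ _).trans hr.le)
  have hp'r : p' ≤ r := (le_max_left _ _).trans hr.le
  have hr0 : r ≠ 0 := ne_bot_of_gt hr
  set q := r.toReal with hq
  have hq0 : 0 < q := by linarith
  obtain ⟨K, hK, hest⟩ := exists_disk_estimate (a := a) hp hβ hβ' hC h1r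
    (by rwa [hq, ENNReal.ofReal_toReal hrt]) hρ0 hρ hε₀
  set V := volume.restrict (Metric.ball (0 : ℂ) ρ) univ ^ (1 / p'.toReal - 1 / r.toReal) with hV
  refine ⟨K ^ (1 / q) * V.toReal, fun ε hεε₀ u f hD P hP => ?_⟩
  set G : ℂ → ℂ := fun z => ((chi ε z ^ (-a) : ℝ) : ℂ) * dz (fun w => dz u w - P.eval w) z with hG
  have hε := hD.eps_pos
  have hGc : ContinuousOn G pdisk := by
    have h1 : ContDiffOn ℝ 1 (fun w => dz u w - P.eval w) pdisk :=
      (hD.contDiffOn_two.dz (m := 1) isOpen_pdisk (by norm_num)).sub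
        (contDiff_polynomial_eval P).contDiffOn
    have h2 := (h1.dz (m := 0) isOpen_pdisk (by norm_num)).continuousOn
    have h3 : Continuous fun z => ((chi ε z ^ (-a) : ℝ) : ℂ) :=
      Complex.continuous_ofReal.comp (contDiff_chi_rpow hε (-a) (n := 0)).continuous
    exact h3.continuousOn.mul h2
  have hGm : AEStronglyMeasurable G (volume.restrict (Metric.ball 0 ρ)) := by
    have h1 := hGc.aestronglyMeasurable (μ := volume) isOpen_pdisk.measurableSet
    have h2 : volume.restrict pdisk = volume.restrict (Metric.ball (0 : ℂ) 1) :=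
      Measure.restrict_congr_set (sdiff_null_ae_eq_self (measure_singleton 0))
    rw [h2] at h1
    exact h1.mono_set (Metric.ball_subset_ball hρ.le)
  have hN := dataNorm_nonneg p u f
  have hGr : eLpNorm G r (volume.restrict (Metric.ball 0 ρ)) ≤
      ENNReal.ofReal (K ^ (1 / q) * dataNorm p u f) := by
    rw [eLpNorm_eq_lintegral_rpow_enorm_toReal hr0 hrt]
    refine (ENNReal.rpow_le_rpow (hest ε hεε₀ u f hD P hP) (by positivity)).trans_eq ?_
    rw [ENNReal.mul_rpow_of_nonneg _ _ (by positivity), ← ENNReal.rpow_mul,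
      mul_one_div_cancel hq0.ne', ENNReal.rpow_one, ENNReal.ofReal_rpow_of_nonneg hK (by positivity),
      ← ENNReal.ofReal_mul (by positivity)]
  have : IsFiniteMeasure (volume.restrict (Metric.ball (0 : ℂ) ρ)) :=
    isFiniteMeasure_restrict.2 measure_ball_lt_top.ne
  have hGr' : MemLp G r (volume.restrict (Metric.ball 0 ρ)) :=
    ⟨hGm, hGr.trans_lt ENNReal.ofReal_lt_top⟩
  have hV' : V ≠ ⊤ := by
    refine ENNReal.rpow_ne_top_of_nonneg ?_ (measure_ne_top _ _)
    rw [sub_nonneg]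
    exact one_div_le_one_div_of_le (ENNReal.toReal_pos hp'0.ne' (hp'r.trans_lt hrt.lt_top).ne)
      (ENNReal.toReal_mono hrt hp'r)
  refine ⟨hGr'.mono_exponent hp'r, ?_⟩
  have h1 := (eLpNorm_le_eLpNorm_mul_rpow_measure_univ hp'r hGm).trans (mul_le_mul' hGr le_rfl)
  have h2 := ENNReal.toReal_mono (ENNReal.mul_ne_top ENNReal.ofReal_ne_top hV') h1
  rw [ENNReal.toReal_mul, ENNReal.toReal_ofReal (by positivity)] at h2
  exact h2.trans_eq (by ring)

/-- Extending the right-hand side by `0` outside the disk changes neither the equation nor the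
norm of the data. -/
lemma isData_indicator {a ε : ℝ} {p : ℝ≥0∞} (hε : 0 < ε) {u f : ℂ → ℂ}
    (hu2 : ContDiffOn ℝ 2 u (Metric.ball 0 1 \ {0}))
    (hu1 : ContDiffOn ℝ 1 u (Metric.closedBall 0 1 \ {0}))
    (hf : MemLp f p (volume.restrict (Metric.ball 0 1)))
    (hd : IsDistribSolution u (fun z => ((chi ε z ^ a : ℝ) : ℂ) * f z)) :
    IsData a p ε u ((Metric.ball (0 : ℂ) 1).indicator f) ∧
      dataNorm p u ((Metric.ball (0 : ℂ) 1).indicator f) =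
        diskLpNorm 1 p f + boundaryC1Norm u := by
  have heq : EqOn (wF a ε ((Metric.ball (0 : ℂ) 1).indicator f))
      (fun z => ((chi ε z ^ a : ℝ) : ℂ) * f z) (Metric.ball (0 : ℂ) 1) := fun z hz => by
    rw [wF, indicator_of_mem hz]
  refine ⟨⟨hε, hu2, hu1, (memLp_indicator_iff_restrict measurableSet_ball).2 hf,
    fun z hz => indicator_of_notMem hz f, hd.1, ?_, fun φ h1 h2 h3 => ?_⟩, ?_⟩
  · intro z hz
    obtain ⟨s, hs, hi⟩ := hd.2.1 z hz
    refine ⟨s ∩ Metric.ball 0 1, inter_mem hs self_mem_nhdsWithin, ?_⟩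
    have hm : ∀ᵐ x ∂volume.restrict (s ∩ Metric.ball (0 : ℂ) 1), x ∈ Metric.ball (0 : ℂ) 1 :=
      ae_restrict_of_ae_restrict_of_subset inter_subset_right (ae_restrict_mem measurableSet_ball)
    exact (hi.mono_set inter_subset_left).congr (hm.mono fun x hx => (heq hx).symm)
  · rw [hd.2.2 φ h1 h2 h3]
    exact setIntegral_congr_fun measurableSet_ball fun z hz => by simp only [heq hz]
  · rw [dataNorm, diskLpNorm, eLpNorm_indicator_eq_eLpNorm_restrict measurableSet_ball]

end Dbar

theorem mainTheorem9 (a : ℝ) (p : ℝ≥0∞) (hp : 2 ≤ p) (ε₀ : ℝ) :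
    ∃ (C : ℝ → ℝ) (C' : ℝ≥0∞ → ℝ → ℝ),
      ∀ (ε : ℝ), 0 < ε → ε ≤ ε₀ → ∀ (u f : ℂ → ℂ),
        ContDiffOn ℝ 2 u (Metric.ball 0 1 \ {0}) →
        ContDiffOn ℝ 1 u (Metric.closedBall 0 1 \ {0}) →
        MemLp f p (volume.restrict (Metric.ball 0 1)) →
        IsDistribSolution u (fun z => ((chi ε z ^ a : ℝ) : ℂ) * f z) →
        ∃ (P : Polynomial ℂ) (T Q : ℂ → ℂ),
          -- `P` has degree at most `⌈a⌉` (so `P = 0` if `⌈a⌉ < 0`)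
          (∀ n : ℕ, ⌈a⌉ < (n : ℤ) → P.coeff n = 0) ∧
          (∀ z ∈ Metric.ball (0 : ℂ) 1 \ {0},
            dz u z = P.eval z + ((chi ε z ^ a : ℝ) : ℂ) * T z) ∧
          -- for `p = ∞` the term `2 / p.toReal` is `0`, as it should be
          (2 < p → ∀ υ : ℝ, 0 < υ → ∀ z ∈ Metric.ball (0 : ℂ) 1 \ {0},
            ‖T z‖ / chi ε z ^ (1 - 2 / p.toReal - υ) ≤
              C υ * (diskLpNorm 1 p f + boundaryC1Norm u)) ∧
          (∀ z ∈ Metric.ball (0 : ℂ) 1 \ {0},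
            dz (dz u) z = P.derivative.eval z + ((chi ε z ^ a : ℝ) : ℂ) * Q z) ∧
          (∀ z ∈ Metric.ball (0 : ℂ) 1 \ {0},
            Q z = dz (fun w => ((chi ε w ^ a : ℝ) : ℂ) * T w) z / ((chi ε z ^ a : ℝ) : ℂ)) ∧
          (∀ p' : ℝ≥0∞, 0 < p' → p' < p → ∀ ρ : ℝ, 0 < ρ → ρ < 1 →
            MemLp Q p' (volume.restrict (Metric.ball 0 ρ)) ∧
            diskLpNorm ρ p' Q ≤ C' p' ρ * (diskLpNorm 1 p f + boundaryC1Norm u)) := by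
  rcases lt_or_ge ε₀ 0 with hε₀ | hε₀
  · exact ⟨0, 0, fun ε h h' => absurd (h.trans_le h') hε₀.le.not_gt⟩
  obtain ⟨β, C, hβ, hβ', hC, hP⟩ := Dbar.exists_polynomial a hp hε₀
  have hT : ∀ υ : ℝ, ∃ K : ℝ, 2 < p → 0 < υ → ∀ ε ≤ ε₀, ∀ u f : ℂ → ℂ, Dbar.IsData a p ε u f →
      ∀ g : ℂ → ℂ,
      (∀ z ∈ Dbar.pdisk, ‖g z‖ₑ ≤ ENNReal.ofReal (C * chi ε z ^ (a - β)) *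
          (Dbar.cpot ε β f z + ENNReal.ofReal (Dbar.dataNorm p u f / (1 - ‖z‖)))) →
      (∀ z ∈ Dbar.pdisk, 1 / 2 ≤ ‖z‖ → ‖g z‖ ≤ C * Dbar.dataNorm p u f) →
      ∀ z ∈ Dbar.pdisk,
        ‖g z‖ ≤ K * Dbar.dataNorm p u f * chi ε z ^ (a + 1 - 2 / p.toReal - υ) := by
    intro υ
    by_cases h : 2 < p ∧ 0 < υ
    · obtain ⟨K, -, hK⟩ := Dbar.exists_norm_sub_le (a := a) h.1 hβ hβ' hε₀ hC h.2
      exact ⟨K, fun _ _ => hK⟩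
    · exact ⟨0, fun h1 h2 => absurd ⟨h1, h2⟩ h⟩
  choose K hK using hT
  have hQ : ∀ (p' : ℝ≥0∞) (ρ : ℝ), ∃ K : ℝ, 0 < p' → p' < p → 0 < ρ → ρ < 1 →
      ∀ ε ≤ ε₀, ∀ u f : ℂ → ℂ, Dbar.IsData a p ε u f → ∀ P : Polynomial ℂ,
      (∀ z ∈ Dbar.pdisk, ‖dz u z - P.eval z‖ₑ ≤ ENNReal.ofReal (C * chi ε z ^ (a - β)) *
          (Dbar.cpot ε β f z + ENNReal.ofReal (Dbar.dataNorm p u f / (1 - ‖z‖)))) →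
      MemLp (fun z => ((chi ε z ^ (-a) : ℝ) : ℂ) * dz (fun w => dz u w - P.eval w) z) p'
          (volume.restrict (Metric.ball 0 ρ)) ∧
        diskLpNorm ρ p' (fun z => ((chi ε z ^ (-a) : ℝ) : ℂ) * dz (fun w => dz u w - P.eval w) z) ≤
          K * Dbar.dataNorm p u f := by
    intro p' ρ
    by_cases h : (0 < p' ∧ p' < p) ∧ 0 < ρ ∧ ρ < 1
    · obtain ⟨K, hK⟩ := Dbar.exists_diskLpNorm_le (a := a) hp hβ hβ' hC h.1.1 h.1.2 h.2.1 h.2.2 hε₀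
      exact ⟨K, fun _ _ _ _ => hK⟩
    · exact ⟨0, fun h1 h2 h3 h4 => absurd ⟨⟨h1, h2⟩, h3, h4⟩ h⟩
  choose K' hK' using hQ
  refine ⟨K, K', fun ε hε hεε₀ u f hu2 hu1 hf hd => ?_⟩
  -- only the values of `f` in the disk matter
  obtain ⟨hD, hN⟩ := Dbar.isData_indicator hε hu2 hu1 hf hd
  set f₀ := (Metric.ball (0 : ℂ) 1).indicator f
  obtain ⟨P, hPdeg, hPest, hPhalf⟩ := hP ε hεε₀ u f₀ hD
  have hχ : ∀ z, 0 < chi ε z := Dbar.chi_pos hε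
  have hmul : ∀ z, ((chi ε z ^ a : ℝ) : ℂ) * ((chi ε z ^ (-a) : ℝ) : ℂ) = 1 := fun z => by
    rw [← Complex.ofReal_mul, ← Real.rpow_add (hχ z), add_neg_cancel, Real.rpow_zero,
      Complex.ofReal_one]
  have hcancel : ∀ (z x : ℂ), ((chi ε z ^ a : ℝ) : ℂ) * (((chi ε z ^ (-a) : ℝ) : ℂ) * x) = x :=
    fun z x => by rw [← mul_assoc, hmul, one_mul]
  rw [← hN]
  refine ⟨P, fun z => ((chi ε z ^ (-a) : ℝ) : ℂ) * (dz u z - P.eval z),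
    fun z => ((chi ε z ^ (-a) : ℝ) : ℂ) * dz (fun w => dz u w - P.eval w) z, hPdeg,
    fun z _ => ?_, fun h2 υ hυ z hz => ?_, fun z hz => ?_, fun z _ => ?_,
    fun p' h1 h2 ρ h3 h4 => hK' p' ρ h1 h2 h3 h4 ε hεε₀ u f₀ hD P hPest⟩
  · rw [hcancel]
    ring
  · have h := hK υ h2 hυ ε hεε₀ u f₀ hD _ hPest (hPhalf h2) z hz
    have hz0 := hχ z
    rw [norm_mul, Complex.norm_real, Real.norm_of_nonneg (by positivity),
      div_le_iff₀ (by positivity)]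
    calc _ ≤ chi ε z ^ (-a) * (K υ * Dbar.dataNorm p u f₀ *
          chi ε z ^ (a + 1 - 2 / p.toReal - υ)) := by gcongr
      _ = K υ * Dbar.dataNorm p u f₀ *
          (chi ε z ^ (-a) * chi ε z ^ (a + 1 - 2 / p.toReal - υ)) := by ring
      _ = _ := by
        rw [← Real.rpow_add hz0]
        congr 2
        ring
  · have h1 : DifferentiableAt ℝ (dz u) z :=
      ((hD.contDiffOn_two.dz (m := 1) Dbar.isOpen_pdisk (by norm_num)).contDiffAt
        (Dbar.isOpen_pdisk.mem_nhds hz)).differentiableAt one_ne_zero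
    have h2 : DifferentiableAt ℝ (fun w => P.eval w) z :=
      (Dbar.contDiff_polynomial_eval P).differentiable one_ne_zero z
    rw [hcancel, Dbar.dz_sub h1 h2, (P.hasDerivAt z).dz_eq]
    ring
  · have h1 : (fun w => ((chi ε w ^ a : ℝ) : ℂ) * (((chi ε w ^ (-a) : ℝ) : ℂ) *
        (dz u w - P.eval w))) = fun w => dz u w - P.eval w := funext fun w => hcancel w _
    rw [h1, eq_div_iff (left_ne_zero_of_mul_eq_one (hmul z)), mul_comm, hcancel]
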